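/- Let $C$ be a differential graded algebra over $\mathbb{C}$ which is smooth (the diagonal bimodule $C$ is perfect over $C^e = C^{op}\otimes C$) and proper (its total cohomology is finite dimensional), and let $\mathcal{A} = \mathrm{Perf}(C)$ be the triangulated category of perfect right DG modules over $C$. Put $$\mathrm{HH}^k(\mathcal{A}) = \mathrm{Hom}_{D(C^e)}(C, C[k]), \qquad \mathrm{HH}_j(\mathcal{A}) = H^j(C\otimes^{\mathbf L}_{C^e} C)$$ (cohomological grading). Assume that $\mathcal{A}$ is Calabi–Yau of dimension $3$, i.e. that $[3]$ is a Serre functor at the DG level: $C[3]\cong \mathrm{Hom}_{\mathbb{C}}(C,\mathbb{C})$ in the derived category of $C$-bimodules. Assume moreover that $\mathcal{A}$ is connected, i.e. $\mathrm{HH}_{-3}(\mathcal{A})\cong\mathbb{C}$. For objects $F, G$ of $\mathcal{A}$ write $\mathrm{Hom}^\bullet(F,G)=\bigoplus_k \mathrm{Hom}(F,G[k])$. Let $\mathrm{rk}$ be a non-trivial (not identically zero) rank function on $\mathcal{A}$, i.e. a $\mathbb{Z}$-valued function on objects with $\mathrm{rk}(G)=\mathrm{rk}(F)+\mathrm{rk}(H)$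 for every exact triangle $F\to G\to H\to F[1]$ and $\mathrm{rk}(F[1])=-\mathrm{rk}(F)$. Let $\mathfrak{T}^\bullet$ be a homological unit for $\mathcal{A}$ with respect to $\mathrm{rk}$. This is a graded unital $\mathbb{C}$-algebra, maximal with respect to embeddings of graded algebras, with the following property: for every object $F$ of $\mathcal{A}$ there are a morphism of graded algebras $i_F:\mathfrak{T}^\bullet\to \mathrm{Hom}^\bullet(F,F)$ and a morphism of graded vector spaces $t_F:\mathrm{Hom}^\bullet(F,F)\to\mathfrak{T}^\bullet$ such that $t_F(i_F(a))=\mathrm{rk}(F)\,a$ for all $a$, and such that $i_F$ is functorial in $F$: for every $a\in\mathfrak{T}^k$ one has $i_G(a)\circ\psi=\psi[k]\circ i_F(a)$ for all $\psi:F\to G$, and $F\mapsto i_F(a)$ is a morphism $\mathrm{id}\to[k]$ of DG functors, i.e. it is $F\mapsto F\otimes^{\mathbf L}_C\zeta$ for some class $\zeta\in\mathrm{HH}^k(\mathcal{A})$. Assume that $\mathcal{A}$ contains a unitary object, i.e. an object $F$ with $\mathrm{Hom}^\bullet(F,F)\cong\mathfrak{T}^\bullet$ as graded rings. Define the Hodge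 numbers $h^{p,q}=h^{p,q}(\mathcal{A})$, $0\le p,q\le 3$, by - $h^{i,0}=\dim\mathfrak{T}^{3-i}$ for $0\le i\le 3$, - $h^{3,1}=\dim\mathrm{HH}_{-2}(\mathcal{A})-h^{2,0}$, - $h^{3,2}=h^{1,0}$ and $h^{2,1}=\dim\mathrm{HH}_{-1}(\mathcal{A})-h^{1,0}-h^{3,2}$, - $h^{3,3}=h^{0,0}$ and $h^{1,1}=h^{2,2}=\tfrac12\bigl(\dim\mathrm{HH}_0(\mathcal{A})-h^{0,0}-h^{3,3}\bigr)$, - $h^{p,q}=h^{q,p}$. Then: 1. all the spaces $\mathfrak{T}^k$, $\mathrm{HH}_j(\mathcal{A})$ and $\mathrm{HH}^k(\mathcal{A})$ are finite dimensional, and all $h^{p,q}$, except possibly $h^{2,1}=h^{1,2}$, are non-negative integers; 2. $h^{0,0}=h^{3,0}=1$; 3. there is a linear form $\mathrm{tr}:\mathrm{HH}^6(\mathcal{A})\to\mathbb{C}$ such that, for all $k$, the pairing $\mathrm{HH}^k(\mathcal{A})\times\mathrm{HH}^{6-k}(\mathcal{A})\to\mathbb{C}$, $(a,b)\mapsto\mathrm{tr}(ab)$,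 is perfect, and such that it is alternating for $k=3$; thus it makes $\mathrm{HH}^3(\mathcal{A})$ a symplectic vector space. Moreover $\dim\mathrm{HH}_0(\mathcal{A})$ is even. -/

import Mathlib

/-
DG algebras and DG bimodules over the complex numbers, perfect bimodules, Hochschild (co)homology,
rank functions, homological units and Hodge numbers.
-/

open scoped TensorProduct DirectSum

universe u v w

namespace HodgeCY

/-- The Koszul sign `(-1)ⁿ`, as a complex number. -/
noncomputable def sgn (n : ℤ) : ℂ := (-1) ^ n

lemma sgn_add (m n : ℤ) : sgn (m + n) = sgn m * sgn n := zpow_add₀ (by norm_num) m n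

lemma sgn_zero : sgn 0 = 1 := zpow_zero _

lemma sgn_one : sgn 1 = -1 := zpow_one _

lemma sgn_neg (n : ℤ) : sgn (-n) = sgn n := by
  unfold sgn; rw [zpow_neg, ← inv_zpow]; norm_num

lemma sgn_mul_self (n : ℤ) : sgn n * sgn n = 1 := by
  rw [← sgn_add]; exact Even.neg_one_zpow ⟨n, rfl⟩

/-- Cochain complexes of complex vector spaces, indexed by `ℤ`. -/
structure Cpx where
  X : ℤ → Type u
  [grp : ∀ i, AddCommGroup (X i)]
  [mod : ∀ i, Module ℂ (X i)]
  d : ∀ i j : ℤ, i + 1 = j → X i →ₗ[ℂ] X j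
  d_d : ∀ (i j k : ℤ) (h : i + 1 = j) (h' : j + 1 = k) (x : X i), d j k h' (d i j h x) = 0

attribute [instance] Cpx.grp Cpx.mod

namespace Cpx

/-- Cocycles of degree `k`. -/
def Z (K : Cpx.{u}) (k : ℤ) : Submodule ℂ (K.X k) := LinearMap.ker (K.d k (k + 1) rfl)

/-- Coboundaries of degree `k`, inside the cocycles. -/
def B (K : Cpx.{u}) (k : ℤ) : Submodule ℂ (K.Z k) :=
  (LinearMap.range (K.d (k - 1) k (sub_add_cancel k 1))).submoduleOf (K.Z k)

/-- The cohomology `Hᵏ(K)`. -/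
abbrev H (K : Cpx.{u}) (k : ℤ) : Type u := K.Z k ⧸ K.B k

def IsAcyclic (K : Cpx.{u}) : Prop := ∀ k, Subsingleton (K.H k)

end Cpx

/-- Differential graded (unital, associative, `ℤ`-graded) algebras over `ℂ`. The product of
elements of degrees `i` and `j` is available in every degree `k` with a proof of `i + j = k`. -/
structure DGAlg extends Cpx.{u} where
  mul : ∀ i j k : ℤ, i + j = k → X i →ₗ[ℂ] X j →ₗ[ℂ] X k
  one : X 0
  one_mul : ∀ (i : ℤ) (h : 0 + i = i) (a : X i), mul 0 i i h one a = a
  mul_one : ∀ (i : ℤ) (h : i + 0 = i) (a : X i), mul i 0 i h a one = a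
  mul_assoc : ∀ (i j k ij jk n : ℤ) (h₁ : i + j = ij) (h₂ : ij + k = n) (h₃ : j + k = jk)
    (h₄ : i + jk = n) (a : X i) (b : X j) (c : X k),
    mul ij k n h₂ (mul i j ij h₁ a b) c = mul i jk n h₄ a (mul j k jk h₃ b c)
  d_mul : ∀ (i j k i' j' k' : ℤ) (h : i + j = k) (hi : i + 1 = i') (hj : j + 1 = j')
    (hk : k + 1 = k') (a : X i) (b : X j),
    d k k' hk (mul i j k h a b) = mul i' j k' (by omega) (d i i' hi a) b
      + sgn i • mul i j' k' (by omega) a (d j j' hj b)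

/-- DG bimodules, with a left action of `A` and a right action of `B`. -/
structure DGBimod (A : DGAlg.{u}) (B : DGAlg.{v}) extends Cpx.{w} where
  lact : ∀ i j k : ℤ, i + j = k → A.X i →ₗ[ℂ] X j →ₗ[ℂ] X k
  ract : ∀ i j k : ℤ, i + j = k → X i →ₗ[ℂ] B.X j →ₗ[ℂ] X k
  one_lact : ∀ (i : ℤ) (h : 0 + i = i) (m : X i), lact 0 i i h A.one m = m
  ract_one : ∀ (i : ℤ) (h : i + 0 = i) (m : X i), ract i 0 i h m B.one = m
  mul_lact : ∀ (i j k ij jk n : ℤ) (h₁ : i + j = ij) (h₂ : ij + k = n) (h₃ : j + k = jk)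
    (h₄ : i + jk = n) (a : A.X i) (a' : A.X j) (m : X k),
    lact ij k n h₂ (A.mul i j ij h₁ a a') m = lact i jk n h₄ a (lact j k jk h₃ a' m)
  ract_mul : ∀ (i j k ij jk n : ℤ) (h₁ : i + j = ij) (h₂ : ij + k = n) (h₃ : j + k = jk)
    (h₄ : i + jk = n) (m : X i) (b : B.X j) (b' : B.X k),
    ract ij k n h₂ (ract i j ij h₁ m b) b' = ract i jk n h₄ m (B.mul j k jk h₃ b b')
  lact_ract : ∀ (i j k ij jk n : ℤ) (h₁ : i + j = ij) (h₂ : ij + k = n) (h₃ : j + k = jk)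
    (h₄ : i + jk = n) (a : A.X i) (m : X j) (b : B.X k),
    ract ij k n h₂ (lact i j ij h₁ a m) b = lact i jk n h₄ a (ract j k jk h₃ m b)
  d_lact : ∀ (i j k i' j' k' : ℤ) (h : i + j = k) (hi : i + 1 = i') (hj : j + 1 = j')
    (hk : k + 1 = k') (a : A.X i) (m : X j),
    d k k' hk (lact i j k h a m) = lact i' j k' (by omega) (A.d i i' hi a) m
      + sgn i • lact i j' k' (by omega) a (d j j' hj m)
  d_ract : ∀ (i j k i' j' k' : ℤ) (h : i + j = k) (hi : i + 1 = i') (hj : j + 1 = j')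
    (hk : k + 1 = k') (m : X i) (b : B.X j),
    d k k' hk (ract i j k h m b) = ract i' j k' (by omega) (d i i' hi m) b
      + sgn i • ract i j' k' (by omega) m (B.d j j' hj b)

/-- The component of degree `i` of `ℂ`, viewed as a complex in degree `0`. -/
def baseX (i : ℤ) : Submodule ℂ ℂ where
  carrier := {c : ℂ | i ≠ 0 → c = 0}
  add_mem' := by intro a b ha hb h; simp [ha h, hb h]
  zero_mem' := by intro _; rfl
  smul_mem' := by intro c a ha h; simp [ha h]

/-- The base field `ℂ` as a DG algebra in degree `0`, with zero differential. A DG bimodule over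
`base` and `C` is the same as a right DG module over `C`: the unit law forces the left action
of `base` to be scalar multiplication. -/
noncomputable abbrev base : DGAlg.{0} where
  X i := baseX i
  d _ _ _ := 0
  d_d := by intros; rfl
  mul i j k h := LinearMap.mk₂ ℂ
    (fun a b => ⟨a.1 * b.1, by
      intro hk
      by_cases hi : i = 0
      · rw [b.2 (by omega), mul_zero]
      · rw [a.2 hi, zero_mul]⟩)
    (fun _ _ _ => Subtype.ext (add_mul _ _ _))
    (fun _ _ _ => Subtype.ext (mul_assoc _ _ _))
    (fun _ _ _ => Subtype.ext (mul_add _ _ _))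
    (fun _ _ _ => Subtype.ext (mul_left_comm _ _ _))
  one := ⟨1, fun h => absurd rfl h⟩
  one_mul _ _ _ := Subtype.ext (one_mul _)
  mul_one _ _ _ := Subtype.ext (mul_one _)
  mul_assoc := by intros; exact Subtype.ext (mul_assoc _ _ _)
  d_mul := by intros; simp; rfl

namespace DGBimod

variable {A : DGAlg.{u}} {B : DGAlg.{v}}

/-- The diagonal bimodule. -/
abbrev diag (A : DGAlg.{u}) : DGBimod.{u, u, u} A A where
  toCpx := A.toCpx
  lact := A.mul
  ract := A.mul
  one_lact := A.one_mul
  ract_one := A.mul_one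
  mul_lact := A.mul_assoc
  ract_mul := A.mul_assoc
  lact_ract := A.mul_assoc
  d_lact := A.d_mul
  d_ract := A.d_mul

/-- The shift `M[n]`: `M[n]ⁱ = Mⁱ⁺ⁿ`, the differential is multiplied by `(-1)ⁿ`, and `a` acts on
the left through `(-1)^(n|a|) a`. -/
noncomputable abbrev shift (M : DGBimod.{u, v, w} A B) (n : ℤ) : DGBimod.{u, v, w} A B where
  X i := M.X (i + n)
  d i j h := sgn n • M.d (i + n) (j + n) (by omega)
  d_d := by intros; simp [M.d_d]
  lact i j k h := sgn (n * i) • M.lact i (j + n) (k + n) (by omega)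
  ract i j k h := M.ract (i + n) j (k + n) (by omega)
  one_lact i h m := by simpa [sgn_zero] using M.one_lact (i + n) (by omega) m
  ract_one i h m := M.ract_one (i + n) (by omega) m
  mul_lact := by
    intro i j k ij jk l h₁ h₂ h₃ h₄ a a' m
    subst h₁
    simp only [LinearMap.smul_apply, map_smul, smul_smul, mul_add, sgn_add]
    rw [M.mul_lact i j (k + n) (i + j) (jk + n) (l + n) rfl (by omega) (by omega) (by omega),
      mul_comm]
  ract_mul := by
    intro i j k ij jk l h₁ h₂ h₃ h₄ m b b'
    exact M.ract_mul _ _ _ _ _ _ _ _ _ _ m b b'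
  lact_ract := by
    intro i j k ij jk l h₁ h₂ h₃ h₄ a m b
    simp only [LinearMap.smul_apply, map_smul]
    rw [M.lact_ract i (j + n) k (ij + n) (jk + n) (l + n)]
  d_lact := by
    intro i j k i' j' k' h hi hj hk a m
    subst hi
    simp only [LinearMap.smul_apply, map_smul, smul_smul]
    rw [M.d_lact i (j + n) (k + n) (i + 1) (j' + n) (k' + n) (by omega) rfl (by omega) (by omega)]
    simp only [smul_add, smul_smul, mul_add, mul_one, sgn_add]
    congr 2; ring
  d_ract := by
    intro i j k i' j' k' h hi hj hk m b
    simp only [LinearMap.smul_apply, map_smul]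
    rw [M.d_ract (i + n) j (k + n) (i' + n) j' (k' + n) (by omega) (by omega) hj (by omega)]
    simp only [smul_add, smul_smul, sgn_add]
    congr 2
    rw [mul_comm (sgn i), ← mul_assoc, sgn_mul_self, one_mul]

/-- The dual bimodule `M* = Hom(M, ℂ)`: it has `(M*)ⁱ = Hom(M⁻ⁱ, ℂ)`, differential
`φ ↦ -(-1)^|φ| φ ∘ d`, and actions `(φ a)(m) = φ (a m)` and `(b φ)(m) = (-1)^|b| φ (m b)`. -/
noncomputable abbrev dual (M : DGBimod.{u, v, w} A B) : DGBimod.{v, u, w} B A where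
  X i := Module.Dual ℂ (M.X (-i))
  d i j h := -(sgn i) • LinearMap.lcomp ℂ ℂ (M.d (-j) (-i) (by omega))
  d_d := by
    intro i j k h h' x
    ext m
    simp [M.d_d]
  lact i j k h := LinearMap.mk₂ ℂ
    (fun b φ => sgn i • (φ ∘ₗ (M.ract (-k) i (-j) (by omega)).flip b))
    (by intros; ext; simp [mul_add]) (by intros; ext; simp; ring) (by intros; ext; simp; ring)
    (by intros; ext; simp; ring)
  ract i j k h := LinearMap.mk₂ ℂ
    (fun φ a => φ ∘ₗ M.lact j (-k) (-i) (by omega) a)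
    (by intros; ext; simp) (by intros; ext; simp) (by intros; ext; simp) (by intros; ext; simp)
  one_lact := by
    intro i h φ
    ext m
    simp [sgn_zero, M.ract_one]
  ract_one := by
    intro i h φ
    ext m
    simp [M.one_lact]
  mul_lact := by
    intro i j k ij jk l h₁ h₂ h₃ h₄ a a' φ
    ext m
    subst h₁
    simp only [LinearMap.mk₂_apply, LinearMap.smul_apply, LinearMap.comp_apply,
      LinearMap.flip_apply, sgn_add, smul_smul]
    rw [M.ract_mul (-l) i j (-jk) (i + j) (-k) (by omega) (by omega) rfl (by omega)]
  ract_mul := by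
    intro i j k ij jk l h₁ h₂ h₃ h₄ φ a a'
    ext m
    simp only [LinearMap.mk₂_apply, LinearMap.comp_apply]
    rw [M.mul_lact j k (-l) jk (-ij) (-i) (by omega) (by omega) (by omega) (by omega)]
  lact_ract := by
    intro i j k ij jk l h₁ h₂ h₃ h₄ b φ a
    ext m
    simp only [LinearMap.mk₂_apply, LinearMap.smul_apply, LinearMap.comp_apply,
      LinearMap.flip_apply]
    rw [M.lact_ract k (-l) i (-ij) (-jk) (-j) (by omega) (by omega) (by omega) (by omega)]
  d_lact := by
    intro i j k i' j' k' h hi hj hk b φ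
    ext m
    have e := M.d_ract (-k') i (-j') (-k) i' (-j) (by omega) (by omega) (by omega) (by omega) m b
    have e' := congrArg φ e
    simp only [map_add, map_smul, smul_eq_mul] at e'
    simp only [LinearMap.mk₂_apply, LinearMap.smul_apply, LinearMap.comp_apply,
      LinearMap.flip_apply, LinearMap.add_apply, LinearMap.lcomp_apply, smul_eq_mul]
    rw [e']
    subst hi hj hk h
    have h1 : sgn (-(i + j + 1)) = - (sgn i * sgn j) := by
      rw [sgn_neg, sgn_add, sgn_add, sgn_one]; ring
    have hi2 := sgn_mul_self i
    have hj2 := sgn_mul_self j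
    rw [h1]
    simp only [sgn_add, sgn_one]
    generalize φ (M.ract _ _ _ _ m (B.d _ _ _ b)) = y
    linear_combination (-y * sgn i * sgn j ^ 2) * hi2 - y * sgn i * hj2
  d_ract := by
    intro i j k i' j' k' h hi hj hk φ a
    ext m
    have e := M.d_lact j (-k') (-i') j' (-k) (-i) (by omega) (by omega) (by omega) (by omega) a m
    have e' := congrArg φ e
    simp only [map_add, map_smul, smul_eq_mul] at e'
    simp only [LinearMap.mk₂_apply, LinearMap.smul_apply, LinearMap.comp_apply,
      LinearMap.add_apply, LinearMap.lcomp_apply, smul_eq_mul]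
    rw [e']
    subst hi hj hk h
    have hj2 := sgn_mul_self j
    simp only [sgn_add]
    ring_nf

/-- `(A ⊗ B)ⁿ`, the direct sum of the `Aⁱ ⊗ Bʲ` with `i + j = n`. -/
abbrev FreeX (A : DGAlg.{u}) (B : DGAlg.{v}) (n : ℤ) : Type (max u v) :=
  ⨁ p : {p : ℤ × ℤ // p.1 + p.2 = n}, (A.X p.1.1 ⊗[ℂ] B.X p.1.2)

/-- The element `a ⊗ b` of `(A ⊗ B)ⁿ`, for `a` of degree `i` and `b` of degree `j`. -/
noncomputable def freeMk (A : DGAlg.{u}) (B : DGAlg.{v}) (i j n : ℤ) (h : i + j = n) :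
    A.X i →ₗ[ℂ] B.X j →ₗ[ℂ] FreeX A B n :=
  (TensorProduct.mk ℂ (A.X i) (B.X j)).compr₂
    (DirectSum.lof ℂ {p : ℤ × ℤ // p.1 + p.2 = n} (fun p => A.X p.1.1 ⊗[ℂ] B.X p.1.2)
      ⟨(i, j), h⟩)

/-- The linear map on `(A ⊗ B)ⁿ` with prescribed bilinear values on the `a ⊗ b`. -/
noncomputable def freeLift (A : DGAlg.{u}) (B : DGAlg.{v}) (n : ℤ) {V : Type w} [AddCommGroup V]
    [Module ℂ V] (f : ∀ i j : ℤ, i + j = n → A.X i →ₗ[ℂ] B.X j →ₗ[ℂ] V) :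
    FreeX A B n →ₗ[ℂ] V :=
  DirectSum.toModule ℂ _ _ (fun p => TensorProduct.lift (f p.1.1 p.1.2 p.2))

lemma freeLift_mk (A : DGAlg.{u}) (B : DGAlg.{v}) (n : ℤ) {V : Type w} [AddCommGroup V]
    [Module ℂ V] (f : ∀ i j : ℤ, i + j = n → A.X i →ₗ[ℂ] B.X j →ₗ[ℂ] V)
    (i j : ℤ) (h : i + j = n) (a : A.X i) (b : B.X j) :
    freeLift A B n f (freeMk A B i j n h a b) = f i j h a b := by
  simp [freeLift, freeMk]

lemma free_ext {A : DGAlg.{u}} {B : DGAlg.{v}} {n : ℤ} {V : Type w} [AddCommGroup V]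
    [Module ℂ V] {f g : FreeX A B n →ₗ[ℂ] V}
    (H : ∀ i j h a b, f (freeMk A B i j n h a b) = g (freeMk A B i j n h a b)) : f = g := by
  refine DirectSum.linearMap_ext _ fun p => TensorProduct.ext' fun a b => ?_
  exact H p.1.1 p.1.2 p.2 a b

lemma free_induction {A : DGAlg.{u}} {B : DGAlg.{v}} {n : ℤ} {P : FreeX A B n → Prop}
    (h0 : P 0) (hadd : ∀ x y, P x → P y → P (x + y))
    (H : ∀ i j h a b, P (freeMk A B i j n h a b)) (x : FreeX A B n) : P x := by
  induction x using DirectSum.induction_on with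
  | zero => exact h0
  | add x y hx hy => exact hadd x y hx hy
  | of p t =>
    induction t using TensorProduct.induction_on with
    | zero => rw [map_zero]; exact h0
    | add x y hx hy => rw [map_add]; exact hadd _ _ hx hy
    | tmul a b => exact H p.1.1 p.1.2 p.2 a b

lemma freeMk_left (A : DGAlg.{u}) (B : DGAlg.{v}) (l i i' j n : ℤ) (hi : l + i = i')
    (h : l + i + j = n) (a : A.X l) (x : A.X i) (b : B.X j) :
    freeMk A B (l + i) j n h (A.mul l i (l + i) rfl a x) b
      = freeMk A B i' j n (by omega) (A.mul l i i' hi a x) b := by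
  subst hi; rfl

lemma freeMk_right (A : DGAlg.{u}) (B : DGAlg.{v}) (i j l j' n : ℤ) (hj : j + l = j')
    (h : i + (j + l) = n) (a : A.X i) (x : B.X j) (b : B.X l) :
    freeMk A B i (j + l) n h a (B.mul j l (j + l) rfl x b)
      = freeMk A B i j' n (by omega) a (B.mul j l j' hj x b) := by
  subst hj; rfl

/-- The bimodule `A ⊗ B`, free on the generator `1 ⊗ 1`: `c (a ⊗ b) c' = c a ⊗ b c'` and
`d (a ⊗ b) = d a ⊗ b + (-1)^|a| a ⊗ d b`. -/
noncomputable abbrev free (A : DGAlg.{u}) (B : DGAlg.{v}) : DGBimod.{u, v, max u v} A B where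
  X n := FreeX A B n
  d n m hnm := freeLift A B n fun i j h =>
    freeMk A B (i + 1) j m (by omega) ∘ₗ A.d i (i + 1) rfl +
      sgn i • (freeMk A B i (j + 1) m (by omega)).compl₂ (B.d j (j + 1) rfl)
  d_d := by
    intro n m l hm hl x
    induction x using free_induction with
    | h0 => simp
    | hadd x y hx hy => simp only [map_add, hx, hy, add_zero]
    | H i j h a b => simp [freeLift_mk, A.d_d, B.d_d, sgn_add, sgn_one]
  lact l n m h :=
    { toFun := fun c => freeLift A B n fun i j hij =>
        freeMk A B (l + i) j m (by omega) ∘ₗ A.mul l i (l + i) rfl c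
      map_add' := fun c c' => free_ext fun i j h a b => by simp [freeLift_mk]
      map_smul' := fun r c => free_ext fun i j h a b => by simp [freeLift_mk] }
  ract n l m h := LinearMap.flip
    { toFun := fun c => freeLift A B n fun i j hij =>
        (freeMk A B i (j + l) m (by omega)).compl₂ ((B.mul j l (j + l) rfl).flip c)
      map_add' := fun c c' => free_ext fun i j h a b => by simp [freeLift_mk]
      map_smul' := fun r c => free_ext fun i j h a b => by simp [freeLift_mk] }
  one_lact := by
    intro n h x
    induction x using free_induction with
    | h0 => simp
    | hadd x y hx hy => simp only [map_add, hx, hy]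
    | H i j h a b =>
      simp only [LinearMap.coe_mk, AddHom.coe_mk, freeLift_mk, LinearMap.comp_apply]
      rw [freeMk_left A B 0 i i j n (by omega), A.one_mul]
  ract_one := by
    intro n h x
    induction x using free_induction with
    | h0 => simp
    | hadd x y hx hy => simp only [map_add, LinearMap.add_apply, hx, hy]
    | H i j h a b =>
      simp only [LinearMap.coe_mk, AddHom.coe_mk, freeLift_mk, LinearMap.flip_apply,
        LinearMap.compl₂_apply]
      rw [freeMk_right A B i j 0 j n (by omega), B.mul_one]
  mul_lact := by
    intro l l' n ll' n' m h₁ h₂ h₃ h₄ c c' x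
    induction x using free_induction with
    | h0 => simp
    | hadd x y hx hy => simp only [map_add, hx, hy]
    | H i j h a b =>
      simp only [LinearMap.coe_mk, AddHom.coe_mk, freeLift_mk, LinearMap.comp_apply]
      rw [freeMk_left A B ll' i (l + (l' + i)) j m (by omega),
        A.mul_assoc l l' i ll' (l' + i) (l + (l' + i)) h₁ (by omega) rfl rfl]
  ract_mul := by
    intro n l l' nl ll' m h₁ h₂ h₃ h₄ x c c'
    induction x using free_induction with
    | h0 => simp
    | hadd x y hx hy => simp only [map_add, LinearMap.add_apply, hx, hy]
    | H i j h a b =>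
      simp only [LinearMap.coe_mk, AddHom.coe_mk, freeLift_mk, LinearMap.flip_apply,
        LinearMap.compl₂_apply]
      rw [freeMk_right A B i j ll' (j + l + l') m (by omega),
        B.mul_assoc j l l' (j + l) ll' (j + l + l') rfl rfl h₃ (by omega)]
  lact_ract := by
    intro l n l' ln nl m h₁ h₂ h₃ h₄ c x c'
    induction x using free_induction with
    | h0 => simp
    | hadd x y hx hy => simp only [map_add, LinearMap.add_apply, hx, hy]
    | H i j h a b =>
      simp only [LinearMap.coe_mk, AddHom.coe_mk, freeLift_mk, LinearMap.flip_apply,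
        LinearMap.compl₂_apply, LinearMap.comp_apply]
  d_lact := by
    intro l n m l' n' m' h hl hn hm c x
    induction x using free_induction with
    | h0 => simp
    | hadd x y hx hy => simp only [map_add, smul_add, hx, hy]; abel
    | H i j h a b =>
      simp only [LinearMap.coe_mk, AddHom.coe_mk, freeLift_mk, LinearMap.comp_apply,
        LinearMap.add_apply, LinearMap.smul_apply, LinearMap.compl₂_apply, map_add, map_smul]
      rw [A.d_mul l i (l + i) l' (i + 1) (l + i + 1) rfl hl rfl rfl,
        freeMk_left A B l' i (l + i + 1) j m' (by omega),
        freeMk_left A B l (i + 1) (l + i + 1) j m' (by omega)]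
      simp only [map_add, map_smul, LinearMap.add_apply, LinearMap.smul_apply, sgn_add, smul_add,
        smul_smul]
      abel
  d_ract := by
    intro n l m n' l' m' h hn hl hm x c
    induction x using free_induction with
    | h0 => simp
    | hadd x y hx hy => simp only [map_add, LinearMap.add_apply, smul_add, hx, hy]; abel
    | H i j hij a b =>
      have hs : sgn n = sgn i * sgn j := by rw [← hij, sgn_add]
      rw [hs]
      simp only [LinearMap.coe_mk, AddHom.coe_mk, freeLift_mk, LinearMap.comp_apply,
        LinearMap.flip_apply,
        LinearMap.add_apply, LinearMap.smul_apply, LinearMap.compl₂_apply, map_add, map_smul]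
      rw [B.d_mul j l (j + l) (j + 1) l' (j + l + 1) rfl rfl hl rfl,
        freeMk_right A B i (j + 1) l (j + l + 1) m' (by omega),
        freeMk_right A B i j l' (j + l + 1) m' (by omega)]
      simp only [map_add, map_smul, LinearMap.add_apply, LinearMap.smul_apply, sgn_add, smul_add,
        smul_smul]
      abel

/-! ### Morphisms -/

/-- Morphisms of graded bimodules of degree `k`: families of linear maps `Mⁱ → Nⁱ⁺ᵏ` with
`f (a m) = (-1)^(k|a|) a f m` and `f (m b) = f m b`. -/
def homX (M N : DGBimod.{u, v, w} A B) (k : ℤ) :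
    Submodule ℂ (∀ t : CochainComplex.HomComplex.Triplet k, M.X t.p →ₗ[ℂ] N.X t.q) where
  carrier := {f |
    (∀ (l i j i' j' : ℤ) (h : l + i = j) (hi : i + k = i') (hj : j + k = j') (a : A.X l)
      (m : M.X i), f ⟨j, j', hj⟩ (M.lact l i j h a m)
        = sgn (k * l) • N.lact l i' j' (by omega) a (f ⟨i, i', hi⟩ m)) ∧
    (∀ (i l j i' j' : ℤ) (h : i + l = j) (hi : i + k = i') (hj : j + k = j') (m : M.X i)
      (b : B.X l), f ⟨j, j', hj⟩ (M.ract i l j h m b) = N.ract i' l j' (by omega) (f ⟨i, i', hi⟩ m) b)}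
  zero_mem' := by constructor <;> intros <;> simp
  add_mem' := by
    rintro f g ⟨hf, hf'⟩ ⟨hg, hg'⟩
    constructor
    · intro l i j i' j' h hi hj a m
      simp only [Pi.add_apply, LinearMap.add_apply, map_add, smul_add]
      rw [hf l i j i' j' h hi hj, hg l i j i' j' h hi hj]
    · intro i l j i' j' h hi hj m b
      simp only [Pi.add_apply, LinearMap.add_apply, map_add]
      rw [hf' i l j i' j' h hi hj, hg' i l j i' j' h hi hj]
  smul_mem' := by
    rintro c f ⟨hf, hf'⟩
    constructor
    · intro l i j i' j' h hi hj a m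
      simp only [Pi.smul_apply, LinearMap.smul_apply, map_smul]
      rw [hf l i j i' j' h hi hj, smul_comm]
    · intro i l j i' j' h hi hj m b
      simp only [Pi.smul_apply, LinearMap.smul_apply, map_smul]
      rw [hf' i l j i' j' h hi hj]

/-- The differential `f ↦ d f - (-1)^|f| f d` on morphisms of graded bimodules. -/
noncomputable def homD (M N : DGBimod.{u, v, w} A B) (k k' : ℤ) (hk : k + 1 = k') :
    homX M N k →ₗ[ℂ] homX M N k' where
  toFun f := ⟨fun t =>
    N.d (t.p + k) t.q (by have := t.hpq; omega) ∘ₗ f.1 ⟨t.p, t.p + k, rfl⟩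
      - sgn k • (f.1 ⟨t.p + 1, t.q, by have := t.hpq; omega⟩ ∘ₗ M.d t.p (t.p + 1) rfl), by
    obtain ⟨f, hf, hf'⟩ := f
    constructor
    · intro l i j i' j' h hi hj a m
      simp only [LinearMap.sub_apply, LinearMap.comp_apply, LinearMap.smul_apply]
      rw [hf l i j (i + k) (j + k) h rfl rfl, map_smul,
        N.d_lact l (i + k) (j + k) (l + 1) i' j' (by omega) rfl (by omega) (by omega),
        M.d_lact l i j (l + 1) (i + 1) (j + 1) h rfl rfl rfl, map_add, map_smul,
        hf (l + 1) i (j + 1) (i + k) j' (by omega) rfl (by omega),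
        hf l (i + 1) (j + 1) i' j' (by omega) (by omega) (by omega)]
      subst hk
      simp only [map_sub, map_smul, mul_add, add_mul, sgn_add, mul_one, one_mul]
      have hs := sgn_mul_self k
      match_scalars
      · linear_combination (-sgn (k * l)) * hs
      · ring
      · ring
    · intro i l j i' j' h hi hj m b
      simp only [LinearMap.sub_apply, LinearMap.comp_apply, LinearMap.smul_apply]
      rw [hf' i l j (i + k) (j + k) h rfl rfl,
        N.d_ract (i + k) l (j + k) i' (l + 1) j' (by omega) (by omega) rfl (by omega),
        M.d_ract i l j (i + 1) (l + 1) (j + 1) h rfl rfl rfl, map_add, map_smul,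
        hf' (i + 1) l (j + 1) i' j' (by omega) (by omega) (by omega),
        hf' i (l + 1) (j + 1) (i + k) j' (by omega) rfl (by omega)]
      simp only [map_sub, map_smul, LinearMap.sub_apply, LinearMap.smul_apply, sgn_add]
      module⟩
  map_add' := fun f g => Subtype.ext <| by
    funext t
    ext m
    simp
    module
  map_smul' := fun c f => Subtype.ext <| by
    funext t
    ext m
    simp
    module

lemma homD_apply (M N : DGBimod.{u, v, w} A B) (k k' : ℤ) (hk : k + 1 = k')
    (f : homX M N k) (i j i' q : ℤ) (h : i + k' = j) (hi : i + 1 = i') (hq : i + k = q)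
    (m : M.X i) :
    (homD M N k k' hk f).1 ⟨i, j, h⟩ m = N.d q j (by omega) (f.1 ⟨i, q, hq⟩ m)
      - sgn k • f.1 ⟨i', j, by omega⟩ (M.d i i' hi m) := by
  subst hi hq
  rfl

lemma homX_ext {M N : DGBimod.{u, v, w} A B} {k : ℤ} {f g : homX M N k}
    (h : ∀ (i j : ℤ) (hj : i + k = j) (m : M.X i), f.1 ⟨i, j, hj⟩ m = g.1 ⟨i, j, hj⟩ m) :
    f = g :=
  Subtype.ext (funext fun ⟨i, j, hj⟩ => LinearMap.ext (h i j hj))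

/-- The complex of morphisms from `M` to `N`. -/
noncomputable abbrev hom (M N : DGBimod.{u, v, w} A B) : Cpx.{w} where
  X k := homX M N k
  d := homD M N
  d_d := by
    intro k k' k'' h h' f
    refine homX_ext fun i j hj m => ?_
    rw [homD_apply M N k' k'' h' _ i j (i + 1) (i + k') hj rfl rfl,
      homD_apply M N k k' h f i (i + k') (i + 1) (i + k) rfl rfl rfl,
      homD_apply M N k k' h f (i + 1) j (i + 1 + 1) (i + k') (by omega) rfl (by omega)]
    subst h
    simp [sgn_add, sgn_one, M.d_d, N.d_d]

/-- The composition `g ∘ f` of graded morphisms. -/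
def homComp {M N K : DGBimod.{u, v, w} A B} {k l n : ℤ} (h : k + l = n)
    (g : homX N K l) (f : homX M N k) : homX M K n :=
  ⟨fun t => g.1 ⟨t.p + k, t.q, by have := t.hpq; omega⟩ ∘ₗ f.1 ⟨t.p, t.p + k, rfl⟩, by
    constructor
    · intro c i j i' j' h₁ hi hj a m
      simp only [LinearMap.comp_apply]
      rw [f.2.1 c i j (i + k) (j + k) h₁ rfl rfl, map_smul,
        g.2.1 c (i + k) (j + k) i' j' (by omega) (by omega) (by omega), smul_smul]
      congr 1
      rw [← h, add_mul, sgn_add]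
    · intro i c j i' j' h₁ hi hj m b
      simp only [LinearMap.comp_apply]
      rw [f.2.2 i c j (i + k) (j + k) h₁ rfl rfl,
        g.2.2 (i + k) c (j + k) i' j' (by omega) (by omega) (by omega)]⟩

lemma homComp_apply {M N K : DGBimod.{u, v, w} A B} {k l n : ℤ} (h : k + l = n)
    (g : homX N K l) (f : homX M N k) (i q j : ℤ) (hq : i + k = q) (hj : i + n = j) (m : M.X i) :
    (homComp h g f).1 ⟨i, j, hj⟩ m = g.1 ⟨q, j, by omega⟩ (f.1 ⟨i, q, hq⟩ m) := by
  subst hq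
  rfl

lemma homD_comp {M N K : DGBimod.{u, v, w} A B} {k l n k' l' n' : ℤ} (h : k + l = n)
    (hk : k + 1 = k') (hl : l + 1 = l') (hn : n + 1 = n') (g : homX N K l) (f : homX M N k) :
    homD M K n n' hn (homComp h g f) =
      homComp (by omega) (homD N K l l' hl g) f
        + sgn l • homComp (by omega) g (homD M N k k' hk f) := by
  refine homX_ext fun i j hj m => ?_
  rw [homD_apply M K n n' hn _ i j (i + 1) (i + n) hj rfl rfl]
  change _ = (homComp _ (homD N K l l' hl g) f).1 ⟨i, j, hj⟩ m
    + sgn l • (homComp _ g (homD M N k k' hk f)).1 ⟨i, j, hj⟩ m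
  rw [homComp_apply _ _ _ i (i + k) (i + n) rfl, homComp_apply _ _ _ (i + 1) (i + k') j (by omega),
    homComp_apply _ _ _ i (i + k) j rfl, homComp_apply _ _ _ i (i + k') j rfl,
    homD_apply N K l l' hl _ (i + k) j (i + k') (i + n) (by omega) (by omega) (by omega),
    homD_apply M N k k' hk _ i (i + k') (i + 1) (i + k) rfl rfl rfl]
  subst h
  simp only [map_sub, map_smul, sgn_add]
  module

lemma homComp_add_left {M N K : DGBimod.{u, v, w} A B} {k l n : ℤ} (h : k + l = n)
    (g g' : homX N K l) (f : homX M N k) :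
    homComp h (g + g') f = homComp h g f + homComp h g' f := rfl

lemma homComp_smul_left {M N K : DGBimod.{u, v, w} A B} {k l n : ℤ} (h : k + l = n) (c : ℂ)
    (g : homX N K l) (f : homX M N k) : homComp h (c • g) f = c • homComp h g f := rfl

lemma homComp_add_right {M N K : DGBimod.{u, v, w} A B} {k l n : ℤ} (h : k + l = n)
    (g : homX N K l) (f f' : homX M N k) :
    homComp h g (f + f') = homComp h g f + homComp h g f' :=
  homX_ext fun _ _ _ _ => by simp [homComp]

lemma homComp_smul_right {M N K : DGBimod.{u, v, w} A B} {k l n : ℤ} (h : k + l = n) (c : ℂ)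
    (g : homX N K l) (f : homX M N k) : homComp h g (c • f) = c • homComp h g f :=
  homX_ext fun _ _ _ _ => by simp [homComp]

lemma homComp_assoc {M N K L : DGBimod.{u, v, w} A B} {k l m kl lm n : ℤ} (h₁ : k + l = kl)
    (h₂ : kl + m = n) (h₃ : l + m = lm) (h₄ : k + lm = n) (e : homX K L m) (g : homX N K l)
    (f : homX M N k) :
    homComp h₂ e (homComp h₁ g f) = homComp h₄ (homComp h₃ e g) f := by
  refine homX_ext fun i j hj x => ?_
  rw [homComp_apply _ _ _ i (i + kl) j rfl, homComp_apply _ _ _ i (i + k) _ rfl,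
    homComp_apply _ _ _ i (i + k) j rfl, homComp_apply _ _ _ (i + k) (i + kl) j (by omega)]

/-- The identity of `M`. -/
def homId (M : DGBimod.{u, v, w} A B) : homX M M 0 :=
  ⟨fun t => { toFun := fun x => cast (congrArg M.X (by have := t.hpq; omega)) x
              map_add' := by
                obtain ⟨p, q, h⟩ := t
                obtain rfl : p = q := by omega
                intros; rfl
              map_smul' := by
                obtain ⟨p, q, h⟩ := t
                obtain rfl : p = q := by omega
                intros; rfl }, by
    constructor
    · intro l i j i' j' h hi hj a m
      obtain rfl : i = i' := by omega
      obtain rfl : j = j' := by omega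
      simp [sgn_zero]
    · intro i l j i' j' h hi hj m b
      obtain rfl : i = i' := by omega
      obtain rfl : j = j' := by omega
      rfl⟩

lemma homId_apply (M : DGBimod.{u, v, w} A B) (i : ℤ) (h : i + 0 = i) (m : M.X i) :
    (homId M).1 ⟨i, i, h⟩ m = m := rfl

lemma homD_id (M : DGBimod.{u, v, w} A B) : homD M M 0 1 rfl (homId M) = 0 := by
  refine homX_ext fun i j hj x => ?_
  subst hj
  rw [homD_apply M M 0 1 rfl _ i (i + 1) (i + 1) i rfl rfl (by omega)]
  change M.d i (i + 1) rfl x - sgn 0 • M.d i (i + 1) rfl x = 0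
  simp [sgn_zero]

lemma id_homComp {M N : DGBimod.{u, v, w} A B} {k : ℤ} (h : k + 0 = k) (f : homX M N k) :
    homComp h (homId N) f = f := by
  refine homX_ext fun i j hj x => ?_
  rw [homComp_apply h _ _ i j j hj, homId_apply]

lemma homComp_id {M N : DGBimod.{u, v, w} A B} {k : ℤ} (h : 0 + k = k) (f : homX M N k) :
    homComp h f (homId M) = f := by
  refine homX_ext fun i j hj x => ?_
  rw [homComp_apply h _ _ i i j (by omega), homId_apply]

/-- `Homᵏ(M, N)`, the cohomology of degree `k` of the complex of morphisms. For `M`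
K-projective, it is `Hom(M, N[k])` in the derived category of DG bimodules. -/
abbrev GHom (M N : DGBimod.{u, v, w} A B) (k : ℤ) : Type w := (hom M N).H k

lemma comp_mem_Z {M N K : DGBimod.{u, v, w} A B} {k l n : ℤ} (h : k + l = n)
    (g : (hom N K).Z l) (f : (hom M N).Z k) : homComp h g.1 f.1 ∈ (hom M K).Z n := by
  have hg : homD N K l (l + 1) rfl g.1 = 0 := g.2
  have hf : homD M N k (k + 1) rfl f.1 = 0 := f.2
  change homD M K n (n + 1) rfl _ = 0
  rw [homD_comp h rfl rfl rfl, hg, hf]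
  exact homX_ext fun i j hj m => by simp [homComp]

/-- Composition of cocycles. -/
noncomputable def compZ {M N K : DGBimod.{u, v, w} A B} {k l n : ℤ} (h : k + l = n) :
    (hom N K).Z l →ₗ[ℂ] (hom M N).Z k →ₗ[ℂ] (hom M K).Z n :=
  LinearMap.mk₂ ℂ (fun g f => ⟨homComp h g.1 f.1, comp_mem_Z h g f⟩)
    (fun _ _ _ => Subtype.ext (homComp_add_left h _ _ _))
    (fun _ _ _ => Subtype.ext (homComp_smul_left h _ _ _))
    (fun _ _ _ => Subtype.ext (homComp_add_right h _ _ _))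
    (fun _ _ _ => Subtype.ext (homComp_smul_right h _ _ _))

lemma compZ_mem_left {M N K : DGBimod.{u, v, w} A B} {k l n : ℤ} (h : k + l = n)
    (g : (hom N K).Z l) (hg : g ∈ (hom N K).B l) (f : (hom M N).Z k) :
    compZ h g f ∈ (hom M K).B n := by
  obtain ⟨y, hy⟩ := hg
  have hf : homD M N k (k + 1) rfl f.1 = 0 := f.2
  refine ⟨homComp (by omega) y f.1, ?_⟩
  change homD M K (n - 1) n (sub_add_cancel n 1) (homComp _ y f.1) = homComp h g.1 f.1
  rw [homD_comp (k' := k + 1) (l' := l) (by omega) rfl (by omega) (by omega), hf]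
  refine homX_ext fun i j hj m => ?_
  have : homD N K (l - 1) l (sub_add_cancel l 1) y = g.1 := hy
  simp [homComp, this]

lemma compZ_mem_right {M N K : DGBimod.{u, v, w} A B} {k l n : ℤ} (h : k + l = n)
    (g : (hom N K).Z l) (f : (hom M N).Z k) (hf : f ∈ (hom M N).B k) :
    compZ h g f ∈ (hom M K).B n := by
  obtain ⟨y, hy⟩ := hf
  have hg : homD N K l (l + 1) rfl g.1 = 0 := g.2
  have hy' : homD M N (k - 1) k (sub_add_cancel k 1) y = f.1 := hy
  refine ⟨sgn l • homComp (by omega) g.1 y, ?_⟩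
  change homD M K (n - 1) n (sub_add_cancel n 1) (sgn l • homComp _ g.1 y) = homComp h g.1 f.1
  rw [map_smul, homD_comp (k' := k) (l' := l + 1) (by omega) (by omega) rfl (by omega), hg, hy',
    smul_add, smul_smul, sgn_mul_self, one_smul]
  exact homX_ext fun i j hj m => by simp [homComp]

/-- Composition `Homˡ(N, K) × Homᵏ(M, N) → Homᵏ⁺ˡ(M, K)`. -/
noncomputable def comp {M N K : DGBimod.{u, v, w} A B} {k l n : ℤ} (h : k + l = n) :
    GHom N K l →ₗ[ℂ] GHom M N k →ₗ[ℂ] GHom M K n :=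
  Submodule.liftQ _ (LinearMap.flip (Submodule.liftQ _ (LinearMap.flip
    ((compZ h).compr₂ ((hom M K).B n).mkQ)) (by
      intro f hf
      ext g
      exact (Submodule.Quotient.mk_eq_zero _).2 (compZ_mem_right h g f hf)))) (by
    intro g hg
    ext f
    exact (Submodule.Quotient.mk_eq_zero _).2 (compZ_mem_left h g hg f))

lemma comp_mk {M N K : DGBimod.{u, v, w} A B} {k l n : ℤ} (h : k + l = n)
    (g : (hom N K).Z l) (f : (hom M N).Z k) :
    comp h (Submodule.Quotient.mk g) (Submodule.Quotient.mk f)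
      = Submodule.Quotient.mk (compZ h g f) := rfl

/-- The identity of `M` in `Hom⁰(M, M)`. -/
noncomputable def idE (M : DGBimod.{u, v, w} A B) : GHom M M 0 :=
  Submodule.Quotient.mk ⟨homId M, homD_id M⟩

lemma id_comp {M N : DGBimod.{u, v, w} A B} {k : ℤ} (h : k + 0 = k) (f : GHom M N k) :
    comp h (idE N) f = f := by
  obtain ⟨f, rfl⟩ := Submodule.Quotient.mk_surjective _ f
  exact congrArg Submodule.Quotient.mk (Subtype.ext (id_homComp h f.1))

lemma comp_id {M N : DGBimod.{u, v, w} A B} {k : ℤ} (h : 0 + k = k) (f : GHom M N k) :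
    comp h f (idE M) = f := by
  obtain ⟨f, rfl⟩ := Submodule.Quotient.mk_surjective _ f
  exact congrArg Submodule.Quotient.mk (Subtype.ext (homComp_id h f.1))

lemma comp_assoc {M N K L : DGBimod.{u, v, w} A B} {k l m kl lm n : ℤ} (h₁ : k + l = kl)
    (h₂ : kl + m = n) (h₃ : l + m = lm) (h₄ : k + lm = n) (e : GHom K L m) (g : GHom N K l)
    (f : GHom M N k) :
    comp h₂ e (comp h₁ g f) = comp h₄ (comp h₃ e g) f := by
  obtain ⟨e, rfl⟩ := Submodule.Quotient.mk_surjective _ e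
  obtain ⟨g, rfl⟩ := Submodule.Quotient.mk_surjective _ g
  obtain ⟨f, rfl⟩ := Submodule.Quotient.mk_surjective _ f
  exact congrArg Submodule.Quotient.mk (Subtype.ext (homComp_assoc h₁ h₂ h₃ h₄ e.1 g.1 f.1))

/-! ### Closed maps, quasi-isomorphisms and cones -/

/-- The component in degree `i` of a closed morphism of degree `0`. -/
def ap {M N : DGBimod.{u, v, w} A B} (f : (hom M N).Z 0) (i : ℤ) : M.X i →ₗ[ℂ] N.X i :=
  f.1.1 ⟨i, i, add_zero i⟩

lemma ap_d {M N : DGBimod.{u, v, w} A B} (f : (hom M N).Z 0) (i j : ℤ) (h : i + 1 = j)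
    (m : M.X i) : N.d i j h (ap f i m) = ap f j (M.d i j h m) := by
  have hf : homD M N 0 1 rfl f.1 = 0 := f.2
  have := homD_apply M N 0 1 rfl f.1 i j j i h h (add_zero i) m
  rw [hf, sgn_zero, one_smul] at this
  exact (sub_eq_zero.1 this.symm)

lemma ap_lact {M N : DGBimod.{u, v, w} A B} (f : (hom M N).Z 0) (i j k : ℤ) (h : i + j = k)
    (a : A.X i) (m : M.X j) : ap f k (M.lact i j k h a m) = N.lact i j k h a (ap f j m) := by
  have := f.1.2.1 i j k j k h (add_zero j) (add_zero k) a m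
  rw [zero_mul, sgn_zero, one_smul] at this
  exact this

lemma ap_ract {M N : DGBimod.{u, v, w} A B} (f : (hom M N).Z 0) (i j k : ℤ) (h : i + j = k)
    (m : M.X i) (b : B.X j) : ap f k (M.ract i j k h m b) = N.ract i j k h (ap f i m) b :=
  f.1.2.2 i j k i k h (add_zero i) (add_zero k) m b

/-- The map induced on cohomology by a closed morphism of degree `0`. -/
def mapH {M N : DGBimod.{u, v, w} A B} (f : (hom M N).Z 0) (k : ℤ) :
    M.H k →ₗ[ℂ] N.H k :=
  Submodule.mapQ (M.B k) (N.B k)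
    ((ap f k).restrict (p := M.Z k) (q := N.Z k) (fun m hm => by
      have hm' : M.d k (k + 1) rfl m = 0 := hm
      change N.d k (k + 1) rfl _ = 0
      rw [ap_d, hm', map_zero]))
    (by
      rintro m ⟨y, hy⟩
      refine ⟨ap f (k - 1) y, ?_⟩
      rw [ap_d, hy]
      rfl)

/-- Quasi-isomorphisms of DG bimodules. -/
def IsQuasiIso {M N : DGBimod.{u, v, w} A B} (f : (hom M N).Z 0) : Prop :=
  ∀ k, Function.Bijective (mapH f k)

/-- The cone of a closed morphism `f : M → N` of degree `0`: the bimodule `M[1] ⊕ N` with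
differential `(m, n) ↦ (-d m, f m + d n)`. -/
noncomputable abbrev cone {M N : DGBimod.{u, v, w} A B} (f : (hom M N).Z 0) :
    DGBimod.{u, v, w} A B where
  X i := M.X (i + 1) × N.X i
  d i j h := LinearMap.prod
    (-(M.d (i + 1) (j + 1) (by omega) ∘ₗ LinearMap.fst ℂ _ _))
    (f.1.1 ⟨i + 1, j, by omega⟩ ∘ₗ LinearMap.fst ℂ _ _ + N.d i j h ∘ₗ LinearMap.snd ℂ _ _)
  d_d := by
    intro i j k h h' x
    subst h h'
    have := ap_d f (i + 1) (i + 1 + 1) rfl x.1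
    have e := N.d_d i (i + 1) (i + 1 + 1) rfl rfl x.2
    simp only [ap] at this
    simp [M.d_d, this, e]
  lact i j k h := LinearMap.mk₂ ℂ
    (fun a x => (sgn i • M.lact i (j + 1) (k + 1) (by omega) a x.1, N.lact i j k h a x.2))
    (by intros; simp) (by intros; simp [smul_comm (sgn i)]) (by intros; simp)
    (by intros; simp [smul_comm (sgn i)])
  ract i j k h := LinearMap.mk₂ ℂ
    (fun x b => (M.ract (i + 1) j (k + 1) (by omega) x.1 b, N.ract i j k h x.2 b))
    (by intros; simp) (by intros; simp) (by intros; simp) (by intros; simp)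
  one_lact i h x := by simp [sgn_zero, M.one_lact, N.one_lact]
  ract_one i h x := by
    simp only [LinearMap.mk₂_apply, N.ract_one]
    rw [M.ract_one (i + 1) (by omega)]
  mul_lact := by
    intro i j k ij jk n h₁ h₂ h₃ h₄ a a' x
    simp only [LinearMap.mk₂_apply, map_smul, smul_smul]
    rw [M.mul_lact i j (k + 1) ij (jk + 1) (n + 1) h₁ (by omega) (by omega) (by omega),
      N.mul_lact i j k ij jk n h₁ h₂ h₃ h₄, ← sgn_add, h₁]
  ract_mul := by
    intro i j k ij jk n h₁ h₂ h₃ h₄ x b b'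
    simp only [LinearMap.mk₂_apply]
    rw [M.ract_mul (i + 1) j k (ij + 1) jk (n + 1) (by omega) (by omega) h₃ (by omega),
      N.ract_mul i j k ij jk n h₁ h₂ h₃ h₄]
  lact_ract := by
    intro i j k ij jk n h₁ h₂ h₃ h₄ a x b
    simp only [LinearMap.mk₂_apply, map_smul, LinearMap.smul_apply]
    rw [M.lact_ract i (j + 1) k (ij + 1) (jk + 1) (n + 1) (by omega) (by omega) (by omega)
      (by omega), N.lact_ract i j k ij jk n h₁ h₂ h₃ h₄]
  d_lact := by
    intro i j k i' j' k' h hi hj hk a x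
    subst hi hj hk
    have e := ap_lact f i (j + 1) (k + 1) (by omega) a x.1
    simp only [ap] at e
    refine Prod.ext ?_ ?_
    · simp only [LinearMap.mk₂_apply, LinearMap.prod_apply, Function.prod, LinearMap.neg_apply,
        LinearMap.comp_apply, LinearMap.fst_apply, Prod.fst_add, Prod.smul_fst, map_smul, map_neg]
      rw [M.d_lact i (j + 1) (k + 1) (i + 1) (j + 1 + 1) (k + 1 + 1) (by omega) rfl rfl rfl,
        sgn_add, sgn_one]
      module
    · simp only [LinearMap.mk₂_apply, LinearMap.prod_apply, Function.prod, LinearMap.add_apply,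
        LinearMap.comp_apply, LinearMap.fst_apply, LinearMap.snd_apply, Prod.snd_add,
        Prod.smul_snd, map_smul, map_add, e]
      rw [N.d_lact i j k (i + 1) (j + 1) (k + 1) h rfl rfl rfl]
      module
  d_ract := by
    intro i j k i' j' k' h hi hj hk x b
    subst hi hj hk
    have e := ap_ract f (i + 1) j (k + 1) (by omega) x.1 b
    simp only [ap] at e
    refine Prod.ext ?_ ?_
    · simp only [LinearMap.mk₂_apply, LinearMap.prod_apply, Function.prod, LinearMap.neg_apply,
        LinearMap.comp_apply, LinearMap.fst_apply, Prod.fst_add, Prod.smul_fst, map_neg]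
      rw [M.d_ract (i + 1) j (k + 1) (i + 1 + 1) (j + 1) (k + 1 + 1) (by omega) rfl rfl rfl,
        sgn_add, sgn_one]
      module
    · simp only [LinearMap.mk₂_apply, LinearMap.prod_apply, Function.prod, LinearMap.add_apply,
        LinearMap.comp_apply, LinearMap.fst_apply, LinearMap.snd_apply, Prod.snd_add,
        Prod.smul_snd, map_add, e]
      rw [N.d_ract i j k (i + 1) (j + 1) (k + 1) h rfl rfl rfl]
      module

/-! ### Perfect and K-projective bimodules -/

/-- Isomorphism in the homotopy category, i.e. homotopy equivalence. -/
def HtpyEquiv (M N : DGBimod.{u, v, w} A B) : Prop :=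
  ∃ (f : GHom M N 0) (g : GHom N M 0),
    comp (add_zero 0) g f = idE M ∧ comp (add_zero 0) f g = idE N

/-- The (K-projective models of) perfect DG bimodules: the smallest class that contains the free
bimodule `A ⊗ B` and is closed under shifts, cones, and retracts in the homotopy category (in
particular under homotopy equivalences and direct summands). All its members are K-projective, so
morphisms between them in the derived category are homotopy classes of morphisms. -/
inductive IsPerfect : DGBimod.{u, v, max u v} A B → Prop
  | free : IsPerfect (free A B)
  | shift (M : DGBimod.{u, v, max u v} A B) (n : ℤ) : IsPerfect M → IsPerfect (M.shift n)
  | cone {M N : DGBimod.{u, v, max u v} A B} (f : (hom M N).Z 0) :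
      IsPerfect M → IsPerfect N → IsPerfect (cone f)
  | retract {M N : DGBimod.{u, v, max u v} A B} (i : GHom M N 0) (r : GHom N M 0) :
      comp (add_zero 0) r i = idE M → IsPerfect N → IsPerfect M

/-- `P` is K-projective: every morphism complex from `P` to an acyclic bimodule is acyclic. -/
def IsKProjective (P : DGBimod.{u, v, w} A B) : Prop :=
  ∀ N : DGBimod.{u, v, w} A B, N.IsAcyclic → (hom P N).IsAcyclic

end DGBimod

open DGBimod DGAlg

/-! ### Smooth, proper and Calabi–Yau DG algebras -/

namespace DGAlg

/-- `C` is proper: its total cohomology is finite-dimensional. -/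
def IsProper (C : DGAlg.{u}) : Prop :=
  (∀ k, FiniteDimensional ℂ (C.H k)) ∧ {k : ℤ | Nontrivial (C.H k)}.Finite

/-- `C` is smooth: the diagonal bimodule is perfect, i.e. it has a perfect resolution. -/
def IsSmooth (C : DGAlg.{u}) : Prop :=
  ∃ (P : DGBimod.{u, u, u} C C) (ε : (hom P (diag C)).Z 0), P.IsPerfect ∧ IsQuasiIso ε

/-- `C` is Calabi–Yau of dimension `n`: the bimodules `C[n]` and `C* = Hom(C, ℂ)` are isomorphic
in the derived category of bimodules (they are related by a roof of quasi-isomorphisms). -/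
def IsCalabiYau (C : DGAlg.{u}) (n : ℤ) : Prop :=
  ∃ (P : DGBimod.{u, u, u} C C) (f : (hom P ((diag C).shift n)).Z 0)
    (g : (hom P (diag C).dual).Z 0), IsQuasiIso f ∧ IsQuasiIso g

/-- A K-projective resolution of the diagonal bimodule. -/
structure Resolution (C : DGAlg.{u}) where
  P : DGBimod.{u, u, u} C C
  ε : (hom P (diag C)).Z 0
  kproj : P.IsKProjective
  quasiIso : IsQuasiIso ε

/-- Hochschild cohomology `HHᵏ(C) = Hom(C, C[k])` in the derived category of bimodules. -/
abbrev HHcoh {C : DGAlg.{u}} (R : C.Resolution) (k : ℤ) : Type u := GHom R.P R.P k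

/-- The span of the graded commutators `a p - (-1)^(|a||p|) p a` in degree `i`. -/
def commutators {C : DGAlg.{u}} (P : DGBimod.{u, u, w} C C) (i : ℤ) : Submodule ℂ (P.X i) :=
  Submodule.span ℂ {x | ∃ (j k : ℤ) (h : j + k = i) (a : C.X j) (p : P.X k),
    x = P.lact j k i h a p - sgn (j * k) • P.ract k j i (by omega) p a}

lemma commutators_le {C : DGAlg.{u}} (P : DGBimod.{u, u, w} C C) (i j : ℤ) (h : i + 1 = j) :
    commutators P i ≤ (commutators P j).comap (P.d i j h) := by
  refine Submodule.span_le.2 ?_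
  rintro _ ⟨l, k, hlk, a, p, rfl⟩
  have h1 : P.lact (l + 1) k j (by omega) (C.d l (l + 1) rfl a) p
      - sgn ((l + 1) * k) • P.ract k (l + 1) j (by omega) p (C.d l (l + 1) rfl a)
      ∈ commutators P j := Submodule.subset_span ⟨_, _, _, _, _, rfl⟩
  have h2 : P.lact l (k + 1) j (by omega) a (P.d k (k + 1) rfl p)
      - sgn (l * (k + 1)) • P.ract (k + 1) l j (by omega) (P.d k (k + 1) rfl p) a
      ∈ commutators P j := Submodule.subset_span ⟨_, _, _, _, _, rfl⟩
  have h3 := Submodule.add_mem _ h1 (Submodule.smul_mem _ (sgn l) h2)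
  change P.d i j h _ ∈ commutators P j
  convert h3 using 1
  rw [map_sub, map_smul, P.d_lact l k i (l + 1) (k + 1) j hlk rfl rfl h,
    P.d_ract k l i (k + 1) (l + 1) j (by omega) rfl rfl h]
  have hl := sgn_mul_self l
  simp only [add_mul, mul_add, sgn_add, _root_.one_mul, _root_.mul_one]
  match_scalars
  · ring
  · ring
  · linear_combination sgn (l * k) * hl
  · ring

/-- The complex `C ⊗ P` over the enveloping algebra of `C`, i.e. the quotient of `P` by the graded
commutators. -/
def coinvariants {C : DGAlg.{u}} (P : DGBimod.{u, u, w} C C) : Cpx.{w} where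
  X i := P.X i ⧸ commutators P i
  d i j h := Submodule.mapQ (commutators P i) (commutators P j) (P.d i j h)
    (commutators_le P i j h)
  d_d := by
    intro i j k h h' x
    obtain ⟨x, rfl⟩ := Submodule.Quotient.mk_surjective _ x
    rw [Submodule.mapQ_apply, Submodule.mapQ_apply, P.d_d, Submodule.Quotient.mk_zero]

/-- Hochschild homology: `HHⱼ(C)` is the cohomology in (cohomological) degree `j` of the derived
tensor product of `C` with itself over its enveloping algebra. -/
abbrev HHhom {C : DGAlg.{u}} (R : C.Resolution) (j : ℤ) : Type u := (coinvariants R.P).H j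

end DGAlg

/-! ### Perfect complexes, rank functions and homological units -/

/-- The objects of the triangulated category `Perf C` of perfect right DG modules over `C`; its
morphisms `F → G[k]` are the elements of `GHom F.1 G.1 k`. -/
abbrev Perf (C : DGAlg.{u}) : Type (u + 1) := {F : DGBimod.{0, u, u} base C // F.IsPerfect}

/-- A rank function on `Perf C`: it is additive on exact triangles `F → G → H → F[1]` (those in
which `H` is isomorphic to the cone of a morphism `F → G`) and changes sign under the shift. -/
structure IsRankFunction {C : DGAlg.{u}} (rk : Perf C → ℤ) : Prop where
  additive : ∀ (F G H : Perf C) (f : (hom F.1 G.1).Z 0), HtpyEquiv H.1 (cone f) →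
    rk G = rk F + rk H
  shift : ∀ F : Perf C, rk ⟨F.1.shift 1, .shift F.1 1 F.2⟩ = -rk F

/-- Graded (unital, associative, `ℤ`-graded) algebras over `ℂ`. -/
structure GrAlg where
  X : ℤ → Type u
  [grp : ∀ i, AddCommGroup (X i)]
  [mod : ∀ i, Module ℂ (X i)]
  mul : ∀ i j k : ℤ, i + j = k → X i →ₗ[ℂ] X j →ₗ[ℂ] X k
  one : X 0
  one_mul : ∀ (i : ℤ) (h : 0 + i = i) (a : X i), mul 0 i i h one a = a
  mul_one : ∀ (i : ℤ) (h : i + 0 = i) (a : X i), mul i 0 i h a one = a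
  mul_assoc : ∀ (i j k ij jk n : ℤ) (h₁ : i + j = ij) (h₂ : ij + k = n) (h₃ : j + k = jk)
    (h₄ : i + jk = n) (a : X i) (b : X j) (c : X k),
    mul ij k n h₂ (mul i j ij h₁ a b) c = mul i jk n h₄ a (mul j k jk h₃ b c)

attribute [instance] GrAlg.grp GrAlg.mod

/-- Morphisms of graded algebras. -/
structure GrAlgHom (S : GrAlg.{u}) (T : GrAlg.{v}) where
  app : ∀ k, S.X k →ₗ[ℂ] T.X k
  map_one : app 0 S.one = T.one
  map_mul : ∀ (i j k : ℤ) (h : i + j = k) (a : S.X i) (b : S.X j),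
    app k (S.mul i j k h a b) = T.mul i j k h (app i a) (app j b)

/-- Isomorphism as graded rings. -/
def GrRingIso (S : GrAlg.{u}) (T : GrAlg.{v}) : Prop :=
  ∃ e : ∀ k, S.X k ≃+ T.X k, e 0 S.one = T.one ∧
    ∀ (i j k : ℤ) (h : i + j = k) (a : S.X i) (b : S.X j),
      e k (S.mul i j k h a b) = T.mul i j k h (e i a) (e j b)

/-- The graded endomorphism algebra `⨁ₖ Hom(F, F[k])`, with composition as its product. -/
noncomputable abbrev endAlg {A : DGAlg.{u}} {B : DGAlg.{v}} (F : DGBimod.{u, v, w} A B) :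
    GrAlg.{w} where
  X k := GHom F F k
  mul i j k h := comp (by omega)
  one := idE F
  one_mul _ h a := id_comp (by omega) a
  mul_one _ h a := comp_id (by omega) a
  mul_assoc i j k ij jk n h₁ h₂ h₃ h₄ a b c :=
    (comp_assoc (by omega) (by omega) (by omega) (by omega) a b c).symm

/-- `ActsAs R F ζ g` says that `g ∈ Hom(F, F[k])` is the value at `F` of the natural transformation
`id → [k]` given by the class `ζ ∈ HHᵏ(C)`, i.e. `g` is `F ⊗ ζ` under `F ⊗ C = F`. With `P → C`
the resolution, this means that `g ∘ (F ⊗ ε)` and `(F ⊗ ε) ∘ (F ⊗ ζ)` agree as homotopy classes of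
maps of right DG modules `F ⊗ P → F` of degree `k` (tensor product over `C`). Such maps are written
as balanced bilinear maps; in particular `s` below is the homotopy, of degree `k - 1`. -/
def ActsAs {C : DGAlg.{u}} (R : C.Resolution) (F : DGBimod.{0, u, u} base C) {k : ℤ}
    (ζ : HHcoh R k) (g : GHom F F k) : Prop :=
  ∃ (z : (hom R.P R.P).Z k) (γ : (hom F F).Z k)
    (s : ∀ i j l : ℤ, i + j + (k - 1) = l → F.X i →ₗ[ℂ] R.P.X j →ₗ[ℂ] F.X l),
    Submodule.Quotient.mk z = ζ ∧ Submodule.Quotient.mk γ = g ∧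
    (∀ (i c j ic cj l : ℤ) (h₁ : i + c = ic) (h₂ : c + j = cj) (h : i + c + j + (k - 1) = l)
      (x : F.X i) (a : C.X c) (p : R.P.X j),
      s ic j l (by omega) (F.ract i c ic h₁ x a) p
        = s i cj l (by omega) x (R.P.lact c j cj h₂ a p)) ∧
    (∀ (i j c jc l l' : ℤ) (h₁ : j + c = jc) (h : i + j + (k - 1) = l) (h' : l + c = l')
      (x : F.X i) (p : R.P.X j) (a : C.X c),
      s i jc l' (by omega) x (R.P.ract j c jc h₁ p a) = F.ract l c l' h' (s i j l h x p) a) ∧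
    (∀ (i j n l m : ℤ) (hn : i + j = n) (hm : j + k = m) (hl : n + k = l) (x : F.X i)
      (p : R.P.X j),
      γ.1.1 ⟨n, l, hl⟩ (F.ract i j n hn x (ap R.ε j p))
          - sgn (k * i) • F.ract i m l (by omega) x (ap R.ε m (z.1.1 ⟨j, m, hm⟩ p))
        = F.d (l - 1) l (by omega) (s i j (l - 1) (by omega) x p)
          + sgn k • (s (i + 1) j l (by omega) (F.d i (i + 1) rfl x) p
            + sgn i • s i (j + 1) l (by omega) x (R.P.d j (j + 1) rfl p)))

/-- The property of `T` in the definition of homological units: for every object `F` of `Perf C`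
there are a morphism `i F : T → Hom(F, F[•])` of graded algebras and a morphism
`t : Hom(F, F[•]) → T` of graded vector spaces with `t (i F a) = rk F · a`, where `i F a` is
functorial in `F`: it commutes with all morphisms `ψ : F → G`, and more precisely `F ↦ i F a` is
induced by a morphism `id → [k]` of DG functors, i.e. by a class in `HHᵏ(C)`. -/
def HasUnitProperty {C : DGAlg.{u}} (R : C.Resolution) (rk : Perf C → ℤ) (T : GrAlg.{v}) : Prop :=
  ∃ i : ∀ F : Perf C, GrAlgHom T (endAlg F.1),
    (∀ (k : ℤ) (a : T.X k) (F G : Perf C) (ψ : GHom F.1 G.1 0),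
      comp (zero_add k) ((i G).app k a) ψ = comp (add_zero k) ψ ((i F).app k a)) ∧
    (∀ (k : ℤ) (a : T.X k), ∃ ζ : HHcoh R k, ∀ F : Perf C, ActsAs R F.1 ζ ((i F).app k a)) ∧
    ∀ F : Perf C, ∃ t : ∀ k, GHom F.1 F.1 k →ₗ[ℂ] T.X k,
      ∀ (k : ℤ) (a : T.X k), t k ((i F).app k a) = rk F • a

/-- `T` is a homological unit for `Perf C` with respect to `rk`: it is maximal, with respect to
embeddings of graded algebras, among the graded algebras with the previous property. -/
def IsHomologicalUnit {C : DGAlg.{u}} (R : C.Resolution) (rk : Perf C → ℤ) (T : GrAlg.{v}) :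
    Prop :=
  HasUnitProperty R rk T ∧ ∀ T' : GrAlg.{v}, HasUnitProperty R rk T' → ∀ f : GrAlgHom T T',
    (∀ k, Function.Injective (f.app k)) → ∀ k, Function.Surjective (f.app k)

/-- The pairing `(a, b) ↦ tr (a ∘ b)` between `HHˡ(C)` and `HHᵏ(C)` given by a linear form `tr` on
`HHⁿ(C)`, for `k + l = n`. -/
noncomputable def tracePairing {C : DGAlg.{u}} (R : C.Resolution) {k l n : ℤ} (h : k + l = n)
    (tr : HHcoh R n →ₗ[ℂ] ℂ) : HHcoh R l →ₗ[ℂ] HHcoh R k →ₗ[ℂ] ℂ :=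
  (comp h).compr₂ tr

/-- The Hodge numbers `h^{p,q}`, for `0 ≤ p, q ≤ 3`. -/
noncomputable def hodgeNumber {C : DGAlg.{u}} (R : C.Resolution) (T : GrAlg.{v}) : ℕ → ℕ → ℚ
  | 0, 0 | 3, 3 => Module.finrank ℂ (T.X 3)
  | 1, 0 | 0, 1 | 3, 2 | 2, 3 => Module.finrank ℂ (T.X 2)
  | 2, 0 | 0, 2 => Module.finrank ℂ (T.X 1)
  | 3, 0 | 0, 3 => Module.finrank ℂ (T.X 0)
  | 3, 1 | 1, 3 => Module.finrank ℂ (HHhom R (-2)) - Module.finrank ℂ (T.X 1)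
  | 2, 1 | 1, 2 =>
    Module.finrank ℂ (HHhom R (-1)) - Module.finrank ℂ (T.X 2) - Module.finrank ℂ (T.X 2)
  | 1, 1 | 2, 2 =>
    (Module.finrank ℂ (HHhom R 0) - Module.finrank ℂ (T.X 3) - Module.finrank ℂ (T.X 3)) / 2
  | _, _ => 0

end HodgeCY

open HodgeCY

open HodgeCY

universe t t'

namespace HodgeCY

namespace Cpx

/-! ### Shortcut instances -/

scoped instance (K : Cpx.{u}) (i : ℤ) : AddCommMonoid (K.X i) := inferInstance

scoped instance {A : DGAlg.{u}} {B : DGAlg.{v}} (M N : DGBimod.{u, v, w} A B) (k : ℤ) :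
    AddCommGroup (DGBimod.homX M N k) := inferInstance

scoped instance {A : DGAlg.{u}} {B : DGAlg.{v}} (M N : DGBimod.{u, v, w} A B) (k : ℤ) :
    AddCommMonoid (DGBimod.homX M N k) := inferInstance

scoped instance {A : DGAlg.{u}} {B : DGAlg.{v}} (M N : DGBimod.{u, v, w} A B) (k : ℤ) :
    Module ℂ (DGBimod.homX M N k) := inferInstance

/-- Cocycles, as a predicate on homogeneous elements. -/
def IsCyc (K : Cpx.{u}) {i : ℤ} (x : K.X i) : Prop := K.d i (i + 1) rfl x = 0

/-- Coboundaries, as a predicate on homogeneous elements. -/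
def IsBd (K : Cpx.{u}) {i : ℤ} (x : K.X i) : Prop :=
  ∃ y, K.d (i - 1) i (sub_add_cancel i 1) y = x

variable {K : Cpx.{u}} {L : Cpx.{v}}

lemma IsCyc.d {i : ℤ} {x : K.X i} (hx : K.IsCyc x) (j : ℤ) (h : i + 1 = j) : K.d i j h x = 0 := by
  subst h; exact hx

lemma isCyc_of {i : ℤ} {x : K.X i} (j : ℤ) (h : i + 1 = j) (hx : K.d i j h x = 0) : K.IsCyc x := by
  subst h; exact hx

lemma isBd_d {i j : ℤ} (h : i + 1 = j) (x : K.X i) : K.IsBd (K.d i j h x) := by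
  obtain rfl : i = j - 1 := by omega
  exact ⟨x, rfl⟩

lemma IsBd.exists {i : ℤ} {x : K.X i} (hx : K.IsBd x) (j : ℤ) (h : j + 1 = i) :
    ∃ y, K.d j i h y = x := by
  obtain rfl : j = i - 1 := by omega
  exact hx

lemma IsBd.isCyc {i : ℤ} {x : K.X i} (hx : K.IsBd x) : K.IsCyc x := by
  obtain ⟨y, rfl⟩ := hx
  exact K.d_d _ _ _ _ _ y

/-- The submodule of coboundaries. -/
def bd (K : Cpx.{u}) (i : ℤ) : Submodule ℂ (K.X i) :=
  LinearMap.range (K.d (i - 1) i (sub_add_cancel i 1))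

lemma mem_bd {i : ℤ} {x : K.X i} : x ∈ K.bd i ↔ K.IsBd x := Iff.rfl

lemma IsBd.add {i : ℤ} {x y : K.X i} (hx : K.IsBd x) (hy : K.IsBd y) : K.IsBd (x + y) :=
  (K.bd i).add_mem hx hy

lemma IsBd.sub {i : ℤ} {x y : K.X i} (hx : K.IsBd x) (hy : K.IsBd y) : K.IsBd (x - y) :=
  (K.bd i).sub_mem hx hy

lemma IsBd.smul {i : ℤ} {x : K.X i} (c : ℂ) (hx : K.IsBd x) : K.IsBd (c • x) :=
  (K.bd i).smul_mem c hx

lemma IsBd.neg {i : ℤ} {x : K.X i} (hx : K.IsBd x) : K.IsBd (-x) := (K.bd i).neg_mem hx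

lemma isBd_zero {i : ℤ} : K.IsBd (0 : K.X i) := (K.bd i).zero_mem

lemma IsCyc.sub {i : ℤ} {x y : K.X i} (hx : K.IsCyc x) (hy : K.IsCyc y) : K.IsCyc (x - y) :=
  (K.Z i).sub_mem hx hy

lemma IsCyc.smul {i : ℤ} {x : K.X i} (c : ℂ) (hx : K.IsCyc x) : K.IsCyc (c • x) :=
  (K.Z i).smul_mem c hx

lemma mk_eq_zero {i : ℤ} (z : K.Z i) :
    (Submodule.Quotient.mk z : K.H i) = 0 ↔ K.IsBd z.1 := Submodule.Quotient.mk_eq_zero _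

lemma mk_eq_mk {i : ℤ} (z z' : K.Z i) :
    (Submodule.Quotient.mk z : K.H i) = Submodule.Quotient.mk z' ↔ K.IsBd (z.1 - z'.1) :=
  Submodule.Quotient.eq _

lemma subsingleton_H_iff {i : ℤ} :
    Subsingleton (K.H i) ↔ ∀ x : K.X i, K.IsCyc x → K.IsBd x := by
  constructor
  · intro h x hx
    exact (mk_eq_zero ⟨x, hx⟩).1 (Subsingleton.elim _ _)
  · intro h
    refine subsingleton_of_forall_eq 0 fun x => ?_
    obtain ⟨z, rfl⟩ := Submodule.Quotient.mk_surjective _ x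
    exact (mk_eq_zero z).2 (h z.1 z.2)

lemma isAcyclic_iff : K.IsAcyclic ↔ ∀ (i : ℤ) (x : K.X i), K.IsCyc x → K.IsBd x :=
  forall_congr' fun _ => subsingleton_H_iff

/-- Morphisms of complexes of degree `m`. -/
structure GMap (K : Cpx.{u}) (L : Cpx.{v}) (m : ℤ) where
  f : ∀ i j : ℤ, i + m = j → K.X i →ₗ[ℂ] L.X j
  comm : ∀ (i j i' j' : ℤ) (h : i + m = j) (hi : i + 1 = i') (hj : j + 1 = j') (x : K.X i),
    L.d j j' hj (f i j h x) = sgn m • f i' j' (by omega) (K.d i i' hi x)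

namespace GMap

variable {m : ℤ} (f : GMap K L m)

lemma isCyc {i j : ℤ} (h : i + m = j) {x : K.X i} (hx : K.IsCyc x) : L.IsCyc (f.f i j h x) := by
  refine isCyc_of (j + 1) rfl ?_
  rw [f.comm i j (i + 1) (j + 1) h rfl rfl, hx.d, map_zero, smul_zero]

lemma isBd {i j : ℤ} (h : i + m = j) {x : K.X i} (hx : K.IsBd x) : L.IsBd (f.f i j h x) := by
  obtain ⟨y, rfl⟩ := hx
  have := f.comm (i - 1) (j - 1) i j (by omega) (by omega) (by omega) y
  have h2 : f.f i j h (K.d (i - 1) i (by omega) y)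
      = sgn m • L.d (j - 1) j (by omega) (f.f (i - 1) (j - 1) (by omega) y) := by
    rw [this, smul_smul, sgn_mul_self, one_smul]
  rw [h2]
  exact (isBd_d _ _).smul _

/-- A morphism of complexes that is bijective on cohomology, in terms of elements. -/
structure IsQI : Prop where
  surj : ∀ (i j : ℤ) (h : i + m = j) (y : L.X j), L.IsCyc y →
    ∃ x : K.X i, K.IsCyc x ∧ L.IsBd (f.f i j h x - y)
  inj : ∀ (i j : ℤ) (h : i + m = j) (x : K.X i), K.IsCyc x → L.IsBd (f.f i j h x) → K.IsBd x

/-- The map induced on cohomology. -/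
def mapH (i j : ℤ) (h : i + m = j) : K.H i →ₗ[ℂ] L.H j :=
  Submodule.mapQ (K.B i) (L.B j) ((f.f i j h).restrict (p := K.Z i) (q := L.Z j)
    fun _ hx => f.isCyc h hx) fun _ hx => f.isBd h hx

lemma mapH_mk (i j : ℤ) (h : i + m = j) (z : K.Z i) :
    f.mapH i j h (Submodule.Quotient.mk z)
      = Submodule.Quotient.mk ⟨f.f i j h z.1, f.isCyc h z.2⟩ := rfl

variable {f}

lemma mapH_injective (hf : ∀ (i j : ℤ) (h : i + m = j) (x : K.X i), K.IsCyc x →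
    L.IsBd (f.f i j h x) → K.IsBd x) (i j : ℤ) (h : i + m = j) :
    Function.Injective (f.mapH i j h) := by
  rw [injective_iff_map_eq_zero]
  intro x hx
  obtain ⟨z, rfl⟩ := Submodule.Quotient.mk_surjective _ x
  rw [mapH_mk, mk_eq_zero] at hx
  exact (mk_eq_zero z).2 (hf i j h z.1 z.2 hx)

lemma IsQI.bijective (hf : f.IsQI) (i j : ℤ) (h : i + m = j) :
    Function.Bijective (f.mapH i j h) := by
  refine ⟨mapH_injective hf.inj i j h, fun y => ?_⟩
  obtain ⟨z, rfl⟩ := Submodule.Quotient.mk_surjective _ y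
  obtain ⟨x, hx, hb⟩ := hf.surj i j h z.1 z.2
  exact ⟨Submodule.Quotient.mk ⟨x, hx⟩, (mk_eq_mk _ _).2 hb⟩

lemma isQI_of_bijective (hf : ∀ i j h, Function.Bijective (f.mapH i j h)) : f.IsQI where
  surj i j h y hy := by
    obtain ⟨x, hx⟩ := (hf i j h).2 (Submodule.Quotient.mk ⟨y, hy⟩)
    obtain ⟨z, rfl⟩ := Submodule.Quotient.mk_surjective _ x
    exact ⟨z.1, z.2, (mk_eq_mk _ _).1 hx⟩
  inj i j h x hx hb := by
    have := (injective_iff_map_eq_zero _).1 (hf i j h).1 (Submodule.Quotient.mk ⟨x, hx⟩)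
      ((mk_eq_zero _).2 hb)
    exact (mk_eq_zero _).1 this

end GMap

/-- The cone of a morphism of complexes of degree `0`. -/
abbrev coneC (f : GMap K L 0) : Cpx where
  X i := K.X (i + 1) × L.X i
  d i j h := LinearMap.prod
    (-(K.d (i + 1) (j + 1) (by omega) ∘ₗ LinearMap.fst ℂ _ _))
    (f.f (i + 1) j (by omega) ∘ₗ LinearMap.fst ℂ _ _ + L.d i j h ∘ₗ LinearMap.snd ℂ _ _)
  d_d := by
    intro i j k h h' x
    have := f.comm (i + 1) j (j + 1) k (by omega) (by omega) h' x.1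
    rw [sgn_zero, one_smul] at this
    simp [K.d_d, L.d_d, this]

lemma coneC_d (f : GMap K L 0) (i j : ℤ) (h : i + 1 = j) (x : (coneC f).X i) :
    (coneC f).d i j h x = (-(K.d (i + 1) (j + 1) (by omega) x.1),
      f.f (i + 1) j (by omega) x.1 + L.d i j h x.2) := rfl

lemma coneC_isAcyclic_iff (f : GMap K L 0) : (coneC f).IsAcyclic ↔ f.IsQI := by
  rw [isAcyclic_iff]
  constructor
  · intro H
    constructor
    · intro i j h y hy
      obtain ⟨⟨w, w'⟩, hw⟩ := (H j (0, y) (isCyc_of (j + 1) rfl (by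
        rw [coneC_d]; simp [hy.d]))).exists (j - 1) (by omega)
      rw [coneC_d, Prod.mk.injEq] at hw
      obtain ⟨h1, h2⟩ := hw
      obtain rfl : i = j - 1 + 1 := by omega
      refine ⟨w, isCyc_of _ (by omega) (neg_eq_zero.1 h1), ?_⟩
      rw [← h2, sub_add_cancel_left]
      exact (isBd_d _ _).neg
    · intro i j h x hx hb
      obtain ⟨y, hy⟩ := hb.exists (i - 1) (by omega)
      obtain rfl : j = i := by omega
      obtain ⟨i, rfl⟩ : ∃ k, j = k + 1 := ⟨j - 1, by omega⟩
      obtain ⟨y, hy⟩ := hb.exists i (by omega)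
      obtain ⟨⟨w, w'⟩, hw⟩ := (H i (x, -y) (isCyc_of (i + 1) rfl (by
        rw [coneC_d]; simp [hx.d, hy]))).exists (i - 1) (by omega)
      rw [coneC_d, Prod.mk.injEq] at hw
      rw [← hw.1]
      exact (isBd_d _ _).neg
  · rintro hf i ⟨x, y⟩ hxy
    have h := hxy.d (i + 1) rfl
    rw [coneC_d, Prod.mk_eq_zero, neg_eq_zero] at h
    obtain ⟨h1, h2⟩ := h
    have hx : K.IsCyc x := isCyc_of _ _ h1
    have hb : L.IsBd (f.f (i + 1) (i + 1) (by omega) x) := by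
      rw [eq_neg_of_add_eq_zero_left h2]
      exact (isBd_d _ _).neg
    obtain ⟨w, hw⟩ := (hf.inj _ _ _ _ hx hb).exists (i - 1 + 1) (by omega)
    have hcyc : L.IsCyc (y + f.f (i - 1 + 1) i (by omega) w) := by
      refine isCyc_of (i + 1) rfl ?_
      rw [map_add, f.comm (i - 1 + 1) i (i + 1) (i + 1) _ (by omega) rfl, sgn_zero, one_smul, hw]
      exact (add_comm _ _).trans h2
    obtain ⟨a, ha, b, hb'⟩ := hf.surj (i - 1 + 1) i (by omega) _ hcyc
    refine ⟨(a - w, -b), ?_⟩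
    rw [coneC_d, map_sub, map_sub, ha.d, hw, map_neg, hb']
    refine Prod.ext ?_ ?_
    · simp
    · simp

/-- A morphism of complexes over a field that is zero on cohomology is null-homotopic. -/
lemma exists_homotopy (g : GMap K L 0) (hg : ∀ (i : ℤ) (x : K.X i), K.IsCyc x →
    L.IsBd (g.f i i (add_zero i) x)) :
    ∃ s : ∀ i j : ℤ, j + 1 = i → K.X i →ₗ[ℂ] L.X j,
      ∀ (i j k : ℤ) (h : j + 1 = i) (h' : i + 1 = k) (x : K.X i),
        g.f i i (add_zero i) x = L.d j i h (s i j h x) + s k i h' (K.d i k h' x) := by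
  have h1 : ∀ i, ∃ τ : K.X (i + 1) →ₗ[ℂ] K.X i, ∀ x : K.X i,
      K.d i (i + 1) rfl (τ (K.d i (i + 1) rfl x)) = K.d i (i + 1) rfl x := by
    intro i
    obtain ⟨τ, hτ⟩ := LinearMap.exists_extend (LinearMap.exists_rightInverse_of_surjective
      (K.d i (i + 1) rfl).rangeRestrict (LinearMap.range_rangeRestrict _)).choose
    have hspec := (LinearMap.exists_rightInverse_of_surjective
      (K.d i (i + 1) rfl).rangeRestrict (LinearMap.range_rangeRestrict _)).choose_spec
    refine ⟨τ, fun x => ?_⟩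
    have e1 := LinearMap.congr_fun hτ ⟨K.d i (i + 1) rfl x, ⟨x, rfl⟩⟩
    have e2 := LinearMap.congr_fun hspec ⟨K.d i (i + 1) rfl x, ⟨x, rfl⟩⟩
    simp only [LinearMap.comp_apply, Submodule.subtype_apply] at e1
    rw [e1]
    exact congrArg Subtype.val e2
  have h2 : ∀ i, ∃ σ : L.X (i + 1) →ₗ[ℂ] L.X i, ∀ x : L.X (i + 1), L.IsBd x →
      L.d i (i + 1) rfl (σ x) = x := by
    intro i
    obtain ⟨τ, hτ⟩ := LinearMap.exists_extend (LinearMap.exists_rightInverse_of_surjective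
      (L.d i (i + 1) rfl).rangeRestrict (LinearMap.range_rangeRestrict _)).choose
    have hspec := (LinearMap.exists_rightInverse_of_surjective
      (L.d i (i + 1) rfl).rangeRestrict (LinearMap.range_rangeRestrict _)).choose_spec
    refine ⟨τ, fun x hx => ?_⟩
    obtain ⟨y, rfl⟩ := hx.exists i rfl
    have e1 := LinearMap.congr_fun hτ ⟨L.d i (i + 1) rfl y, ⟨y, rfl⟩⟩
    have e2 := LinearMap.congr_fun hspec ⟨L.d i (i + 1) rfl y, ⟨y, rfl⟩⟩
    simp only [LinearMap.comp_apply, Submodule.subtype_apply] at e1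
    rw [e1]
    exact congrArg Subtype.val e2
  choose τ hτ using h1
  choose σ hσ using h2
  let s : ∀ j : ℤ, K.X (j + 1) →ₗ[ℂ] L.X j := fun j =>
    σ j ∘ₗ g.f (j + 1) (j + 1) (add_zero _) ∘ₗ
      (LinearMap.id - τ (j + 1) ∘ₗ K.d (j + 1) (j + 1 + 1) rfl) ∘ₗ
      (LinearMap.id - K.d j (j + 1) rfl ∘ₗ τ j) + g.f j j (add_zero _) ∘ₗ τ j
  refine ⟨fun i j h => s j ∘ₗ (LinearEquiv.cast (R := ℂ) (M := K.X) h.symm).toLinearMap, ?_⟩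
  intro i j k h h' x
  subst h h'
  have hg0 : ∀ (i : ℤ) (x : K.X i), L.d i (i + 1) rfl (g.f i i (add_zero i) x)
      = g.f (i + 1) (i + 1) (add_zero _) (K.d i (i + 1) rfl x) := by
    intro i x
    rw [g.comm i i (i + 1) (i + 1) _ rfl rfl, sgn_zero, one_smul]
  have e1 : s (j + 1) (K.d (j + 1) (j + 1 + 1) rfl x)
      = g.f _ _ (add_zero _) (τ (j + 1) (K.d (j + 1) (j + 1 + 1) rfl x)) := by
    have : K.d (j + 1) (j + 1 + 1) rfl x - K.d (j + 1) (j + 1 + 1) rfl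
        (τ (j + 1) (K.d (j + 1) (j + 1 + 1) rfl x)) = 0 := by rw [hτ, sub_self]
    simp only [s, LinearMap.add_apply, LinearMap.comp_apply, LinearMap.sub_apply,
      LinearMap.id_apply, this, map_zero, zero_add]
  have e2 : L.d j (j + 1) rfl (s j x) = g.f _ _ (add_zero _) x
      - g.f _ _ (add_zero _) (τ (j + 1) (K.d (j + 1) (j + 1 + 1) rfl x)) := by
    simp only [s, LinearMap.add_apply, LinearMap.comp_apply, LinearMap.sub_apply,
      LinearMap.id_apply, map_add]
    rw [hσ, hg0]
    · simp only [map_sub, K.d_d, sub_zero]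
      abel
    · apply hg
      refine isCyc_of _ rfl ?_
      rw [map_sub, hτ, sub_self]
  simp only [LinearMap.comp_apply, LinearEquiv.coe_coe, LinearEquiv.cast_apply, cast_eq]
  rw [e1, e2]
  abel

/-- The dual complex, shifted: `(Dₙ K)ⁱ = Hom(Kⁿ⁻ⁱ, ℂ)`. -/
noncomputable abbrev dualC (K : Cpx.{u}) (n : ℤ) : Cpx.{u} where
  X i := Module.Dual ℂ (K.X (n - i))
  d i j h := -(sgn i) • LinearMap.lcomp ℂ ℂ (K.d (n - j) (n - i) (by omega))
  d_d := by
    intro i j k h h' x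
    ext m
    simp [K.d_d]

lemma dualC_d (K : Cpx.{u}) (n i j : ℤ) (h : i + 1 = j) (φ : (K.dualC n).X i) (x : K.X (n - j)) :
    ((K.dualC n).d i j h φ : Module.Dual ℂ (K.X (n - j))) x
      = -(sgn i) * (φ : Module.Dual ℂ (K.X (n - i))) (K.d (n - j) (n - i) (by omega) x) := rfl

/-- The value of an element of the dual complex. -/
def ev {n i : ℤ} (φ : (K.dualC n).X i) : Module.Dual ℂ (K.X (n - i)) := φ

lemma sgn_ne_zero (n : ℤ) : sgn n ≠ 0 := fun h => by
  have := sgn_mul_self n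
  rw [h, mul_zero] at this
  exact zero_ne_one this

lemma dualC_isCyc {n i : ℤ} {φ : (K.dualC n).X i} :
    (K.dualC n).IsCyc φ ↔ ∀ x : K.X (n - i), K.IsBd x → ev φ x = 0 := by
  constructor
  · intro h x hx
    obtain ⟨y, rfl⟩ := hx.exists (n - (i + 1)) (by omega)
    have := LinearMap.congr_fun (h.d (i + 1) rfl : _ = (0 : Module.Dual ℂ _)) y
    rw [dualC_d] at this
    exact (mul_eq_zero.1 this).resolve_left (neg_ne_zero.2 (sgn_ne_zero i))
  · intro h
    refine isCyc_of (i + 1) rfl (LinearMap.ext fun x => ?_)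
    rw [dualC_d]
    exact mul_eq_zero_of_right _ (h _ (isBd_d _ _))

lemma dualC_isBd {n i : ℤ} {φ : (K.dualC n).X i} :
    (K.dualC n).IsBd φ ↔ ∀ x : K.X (n - i), K.IsCyc x → ev φ x = 0 := by
  constructor
  · rintro ⟨ψ, rfl⟩ x hx
    change ((K.dualC n).d _ _ _ ψ : Module.Dual ℂ _) x = 0
    rw [dualC_d, hx.d, map_zero, mul_zero]
  · intro h
    have hle : LinearMap.ker (K.d (n - i) (n - (i - 1)) (by omega)) ≤ LinearMap.ker (ev φ) :=
      fun x hx => h x (isCyc_of _ _ hx)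
    obtain ⟨ψ, hψ⟩ := LinearMap.exists_extend
      (((LinearMap.ker (K.d (n - i) (n - (i - 1)) (by omega))).liftQ (ev φ) hle) ∘ₗ
        (K.d (n - i) (n - (i - 1)) (by omega)).quotKerEquivRange.symm.toLinearMap)
    refine ⟨-(sgn (i - 1)) • ψ, LinearMap.ext fun x => ?_⟩
    rw [dualC_d]
    have e := LinearMap.congr_fun hψ ⟨K.d (n - i) (n - (i - 1)) (by omega) x, ⟨x, rfl⟩⟩
    have e2 : (K.d (n - i) (n - (i - 1)) (by omega)).quotKerEquivRange.symm
        ⟨K.d (n - i) (n - (i - 1)) (by omega) x, ⟨x, rfl⟩⟩ = Submodule.Quotient.mk x := by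
      rw [LinearEquiv.symm_apply_eq]; rfl
    simp only [LinearMap.comp_apply, Submodule.subtype_apply, LinearEquiv.coe_coe, e2] at e
    have e3 : ψ (K.d (n - i) (n - (i - 1)) (by omega) x) = ev φ x := e
    change -(sgn (i - 1)) * (-(sgn (i - 1)) * ψ _) = ev φ x
    rw [e3, ← mul_assoc, neg_mul_neg, sgn_mul_self, one_mul]

/-- Every linear form on cohomology comes from a cocycle of the dual complex. -/
lemma exists_dualC_cyc {n i : ℤ} (l : Module.Dual ℂ (K.H (n - i))) :
    ∃ φ : (K.dualC n).X i, (K.dualC n).IsCyc φ ∧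
      ∀ z : K.Z (n - i), ev φ z.1 = l (Submodule.Quotient.mk z) := by
  obtain ⟨φ, hφ⟩ := LinearMap.exists_extend (l ∘ₗ (K.B (n - i)).mkQ)
  have hz : ∀ z : K.Z (n - i), φ z.1 = l (Submodule.Quotient.mk z) := fun z =>
    LinearMap.congr_fun hφ z
  refine ⟨φ, dualC_isCyc.2 fun x hx => ?_, hz⟩
  change φ x = 0
  rw [hz ⟨x, hx.isCyc⟩, (mk_eq_zero _).2 hx, map_zero]

/-- The pairing of the cohomology of the dual complex with the cohomology. -/
noncomputable def dualPair (K : Cpx.{u}) (n i : ℤ) :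
    (K.dualC n).H i →ₗ[ℂ] Module.Dual ℂ (K.H (n - i)) :=
  Submodule.liftQ _
    { toFun := fun φ => Submodule.liftQ _ (ev φ.1 ∘ₗ (K.Z (n - i)).subtype)
        fun x hx => dualC_isCyc.1 φ.2 x.1 hx
      map_add' := fun φ ψ => by ext; rfl
      map_smul' := fun c φ => by ext; rfl } (by
    intro φ hφ
    ext x
    exact dualC_isBd.1 hφ x.1 x.2)

lemma dualPair_bijective (n i : ℤ) : Function.Bijective (K.dualPair n i) := by
  constructor
  · rw [injective_iff_map_eq_zero]
    intro x hx
    obtain ⟨φ, rfl⟩ := Submodule.Quotient.mk_surjective _ x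
    refine (mk_eq_zero _).2 (dualC_isBd.2 fun x h => ?_)
    exact LinearMap.congr_fun hx (Submodule.Quotient.mk ⟨x, h⟩)
  · intro l
    obtain ⟨φ, hφ, h⟩ := exists_dualC_cyc l
    refine ⟨Submodule.Quotient.mk ⟨φ, hφ⟩, LinearMap.ext fun x => ?_⟩
    obtain ⟨z, rfl⟩ := Submodule.Quotient.mk_surjective _ x
    exact h z

end Cpx

end HodgeCY

namespace HodgeCY

open Cpx

namespace DGBimod

variable {A : DGAlg.{u}} {B : DGAlg.{v}}

lemma homId_d (M : DGBimod.{u, v, w} A B) (i j k : ℤ) (e : j = k) (h : i + 1 = j) (h' : j + 0 = k)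
    (m : M.X i) : (homId M).1 ⟨j, k, h'⟩ (M.d i j h m) = M.d i k (by omega) m := by
  subst e; rfl

/-! ### The structure maps of shifts and cones -/

/-- The tautological isomorphism `M[n] → M` of degree `n`. -/
def shiftOut (M : DGBimod.{u, v, w} A B) (n : ℤ) : homX (M.shift n) M n :=
  ⟨fun t => (homId M).1 ⟨t.p + n, t.q, by have := t.hpq; omega⟩, by
    constructor
    · intro l i j i' j' h hi hj a m
      subst hi hj
      simp only [LinearMap.smul_apply, map_smul]
      rfl
    · intro i l j i' j' h hi hj m b
      subst hi hj
      rfl⟩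

/-- The tautological isomorphism `M → M[n]` of degree `-n`. -/
def shiftIn (M : DGBimod.{u, v, w} A B) (n : ℤ) : homX M (M.shift n) (-n) :=
  ⟨fun t => (homId M).1 ⟨t.p, t.q + n, by have := t.hpq; omega⟩, by
    constructor
    · intro l i j i' j' h hi hj a m
      obtain rfl : i = i' + n := by omega
      obtain rfl : j = j' + n := by omega
      change _ = sgn (-n * l) • sgn (n * l) • M.lact l (i' + n) (j' + n) h a m
      rw [smul_smul, neg_mul, sgn_neg, sgn_mul_self, one_smul]
      rfl
    · intro i l j i' j' h hi hj m b
      obtain rfl : i = i' + n := by omega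
      obtain rfl : j = j' + n := by omega
      rfl⟩

lemma isCyc_shiftOut (M : DGBimod.{u, v, w} A B) (n : ℤ) :
    (hom (M.shift n) M).IsCyc (shiftOut M n) := by
  refine homX_ext fun i j hj m => ?_
  rw [homD_apply _ _ n (n + 1) rfl _ i j (i + 1) (i + n) hj rfl rfl]
  obtain rfl : j = i + 1 + n := by omega
  change M.d (i + n) (i + 1 + n) _ m - sgn n • (sgn n • M.d (i + n) (i + 1 + n) _ m) = 0
  rw [smul_smul, sgn_mul_self, one_smul, sub_self]

lemma isCyc_shiftIn (M : DGBimod.{u, v, w} A B) (n : ℤ) :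
    (hom M (M.shift n)).IsCyc (shiftIn M n) := by
  refine homX_ext fun i j hj m => ?_
  rw [homD_apply _ _ (-n) (-n + 1) rfl _ i j (i + 1) (i - n) hj rfl rfl]
  obtain ⟨i, rfl⟩ : ∃ k, i = k + n := ⟨i - n, by omega⟩
  obtain rfl : j = i + 1 := by omega
  have e : i + n - n = i := by omega
  have key : ∀ (q : ℤ) (hq : q = i) (h1 : q + 1 = i + 1) (h2 : i + n + -n = q)
      (h3 : i + n + 1 + -n = i + 1), (M.shift n).d q (i + 1) h1 ((shiftIn M n).1 ⟨i + n, q, h2⟩ m)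
      - sgn (-n) • (shiftIn M n).1 ⟨i + n + 1, i + 1, h3⟩ (M.d (i + n) (i + n + 1) rfl m) = 0 := by
    rintro q rfl h1 h2 h3
    have e3 : q + n + 1 = q + 1 + n := by omega
    have : (shiftIn M n).1 ⟨q + n + 1, q + 1, h3⟩ (M.d (q + n) (q + n + 1) rfl m)
      = M.d (q + n) (q + 1 + n) (by omega) m := by
      exact homId_d M _ _ _ e3 rfl (by omega) m
    rw [this, sgn_neg]
    exact sub_self _
  exact key _ e _ _ _

lemma shiftOut_shiftIn (M : DGBimod.{u, v, w} A B) (n : ℤ) (h : -n + n = 0) :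
    homComp h (shiftOut M n) (shiftIn M n) = homId M := by
  refine homX_ext fun i j hj m => ?_
  obtain ⟨i, rfl⟩ : ∃ k, i = k + n := ⟨i - n, by omega⟩
  obtain rfl : j = i + n := by omega
  rw [homComp_apply h _ _ (i + n) i (i + n) (by omega)]
  rfl

lemma shiftIn_shiftOut (M : DGBimod.{u, v, w} A B) (n : ℤ) (h : n + -n = 0) :
    homComp h (shiftIn M n) (shiftOut M n) = homId (M.shift n) := by
  refine homX_ext fun i j hj m => ?_
  obtain rfl : j = i := by omega
  rw [homComp_apply h _ _ j (j + n) j rfl]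
  rfl

section Cone

variable {M N : DGBimod.{u, v, w} A B} (f : (hom M N).Z 0)

/-- The inclusion `N → cone f`. -/
noncomputable def coneIn : homX N (cone f) 0 :=
  ⟨fun t => LinearMap.prod 0 ((homId N).1 t), by
    constructor
    · intro l i j i' j' h hi hj a m
      obtain rfl : i = i' := by omega
      obtain rfl : j = j' := by omega
      refine Prod.ext ?_ ?_
      · simp
      · simp only [sgn_zero, zero_mul, one_smul]; rfl
    · intro i l j i' j' h hi hj m b
      obtain rfl : i = i' := by omega
      obtain rfl : j = j' := by omega
      refine Prod.ext ?_ ?_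
      · simp
      · rfl⟩

/-- The projection `cone f → M`, of degree `1`. -/
noncomputable def coneOut : homX (cone f) M 1 :=
  ⟨fun t => (homId M).1 ⟨t.p + 1, t.q, by have := t.hpq; omega⟩ ∘ₗ LinearMap.fst ℂ _ _, by
    constructor
    · intro l i j i' j' h hi hj a m
      subst hi hj
      simp only [LinearMap.comp_apply, LinearMap.mk₂_apply, LinearMap.fst_apply, one_mul, map_smul]
      rfl
    · intro i l j i' j' h hi hj m b
      subst hi hj
      rfl⟩

/-- The graded retraction of `coneIn`. -/
noncomputable def coneRet : homX (cone f) N 0 :=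
  ⟨fun t => (homId N).1 t ∘ₗ LinearMap.snd ℂ _ _, by
    constructor
    · intro l i j i' j' h hi hj a m
      obtain rfl : i = i' := by omega
      obtain rfl : j = j' := by omega
      simp only [sgn_zero, zero_mul, one_smul]; rfl
    · intro i l j i' j' h hi hj m b
      obtain rfl : i = i' := by omega
      obtain rfl : j = j' := by omega
      rfl⟩

/-- The graded section of `coneOut`. -/
noncomputable def coneSec : homX M (cone f) (-1) :=
  ⟨fun t => LinearMap.prod ((homId M).1 ⟨t.p, t.q + 1, by have := t.hpq; omega⟩) 0, by
    constructor
    · intro l i j i' j' h hi hj a m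
      obtain rfl : i = i' + 1 := by omega
      obtain rfl : j = j' + 1 := by omega
      refine Prod.ext ?_ ?_
      · change M.lact l (i' + 1) (j' + 1) h a m
          = sgn (-1 * l) • sgn l • M.lact l (i' + 1) (j' + 1) h a m
        rw [smul_smul, neg_one_mul, sgn_neg, sgn_mul_self, one_smul]
      · simp
    · intro i l j i' j' h hi hj m b
      obtain rfl : i = i' + 1 := by omega
      obtain rfl : j = j' + 1 := by omega
      refine Prod.ext ?_ ?_
      · rfl
      · simp⟩

lemma isCyc_coneIn : (hom N (cone f)).IsCyc (coneIn f) := by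
  refine homX_ext fun i j hj m => ?_
  obtain rfl : j = i + 1 := by omega
  rw [homD_apply _ _ 0 (0 + 1) rfl _ i (i + 1) (i + 1) i hj rfl (add_zero i), sgn_zero, one_smul]
  refine Prod.ext ?_ ?_
  · simp [coneIn]
  · simp only [coneIn, LinearMap.prod_apply, Function.prod, LinearMap.zero_apply, map_zero,
      LinearMap.add_apply, LinearMap.comp_apply, LinearMap.fst_apply, LinearMap.snd_apply, zero_add,
      Prod.snd_sub]
    exact sub_self (N.d i (i + 1) rfl m)

lemma isCyc_coneOut : (hom (cone f) M).IsCyc (coneOut f) := by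
  refine homX_ext fun i j hj m => ?_
  obtain rfl : j = i + 1 + 1 := by omega
  rw [homD_apply _ _ 1 (1 + 1) rfl _ i (i + 1 + 1) (i + 1) (i + 1) hj rfl rfl, sgn_one]
  change M.d (i + 1) (i + 1 + 1) rfl m.1 - (-1 : ℂ) • (-(M.d (i + 1) (i + 1 + 1) _ m.1)) = 0
  simp

lemma homD_coneRet (k : ℤ) (hk : (0 : ℤ) + 1 = k) :
    homD (cone f) N 0 k hk (coneRet f) = -(homComp (by omega) f.1 (coneOut f)) := by
  subst hk
  refine homX_ext fun i j hj m => ?_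
  obtain rfl : j = i + 1 := by omega
  rw [homD_apply _ _ 0 (0 + 1) rfl _ i (i + 1) (i + 1) i hj rfl (add_zero i), sgn_zero, one_smul]
  change N.d i (i + 1) rfl m.2 - (f.1.1 ⟨i + 1, i + 1, _⟩ m.1 + N.d i (i + 1) rfl m.2)
    = -(homComp _ f.1 (coneOut f)).1 ⟨i, i + 1, hj⟩ m
  rw [homComp_apply _ _ _ i (i + 1) (i + 1) rfl]
  change _ = -(f.1.1 ⟨i + 1, i + 1, _⟩ m.1)
  abel

lemma homD_coneSec (k : ℤ) (hk : (-1 : ℤ) + 1 = k) :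
    homD M (cone f) (-1) k hk (coneSec f) = homComp (by omega) (coneIn f) f.1 := by
  obtain rfl : k = 0 := by omega
  refine homX_ext fun i j hj m => ?_
  obtain ⟨i, rfl⟩ : ∃ l, i = l + 1 := ⟨i - 1, by omega⟩
  obtain rfl : j = i + 1 := by omega
  rw [homD_apply _ _ (-1) 0 hk _ (i + 1) (i + 1) (i + 1 + 1) i hj rfl (by omega),
    homComp_apply _ _ _ (i + 1) (i + 1) (i + 1) (by omega), sgn_neg, sgn_one]
  refine Prod.ext ?_ ?_
  · change -(M.d (i + 1) (i + 1 + 1) _ m) - (-1 : ℂ) • M.d (i + 1) (i + 1 + 1) _ m = 0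
    simp
  · change (f.1.1 ⟨i + 1, i + 1, _⟩ m + N.d i (i + 1) rfl 0) - (-1 : ℂ) • (0 : N.X (i + 1))
      = f.1.1 ⟨i + 1, i + 1, _⟩ m
    simp

lemma coneOut_coneSec (h : (-1 : ℤ) + 1 = 0) : homComp h (coneOut f) (coneSec f) = homId M := by
  refine homX_ext fun i j hj m => ?_
  obtain rfl : i = j := by omega
  obtain ⟨i, rfl⟩ : ∃ l, i = l + 1 := ⟨i - 1, by omega⟩
  rw [homComp_apply h _ _ (i + 1) i (i + 1) (by omega)]
  rfl

lemma coneRet_coneIn (h : (0 : ℤ) + 0 = 0) : homComp h (coneRet f) (coneIn f) = homId N := by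
  refine homX_ext fun i j hj m => ?_
  obtain rfl : i = j := by omega
  rw [homComp_apply h _ _ i i i (by omega)]
  rfl

lemma coneOut_coneIn {k : ℤ} (h : (0 : ℤ) + 1 = k) : homComp h (coneOut f) (coneIn f) = 0 := by
  subst h
  refine homX_ext fun i j hj m => ?_
  obtain rfl : i + 1 = j := by omega
  rw [homComp_apply _ _ _ i i (i + 1) (by omega)]
  rfl

lemma cone_decomp (h : (1 : ℤ) + -1 = 0) : homComp h (coneSec f) (coneOut f)
    + homComp (add_zero 0) (coneIn f) (coneRet f) = homId (cone f) := by
  refine homX_ext fun i j hj m => ?_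
  obtain rfl : i = j := by omega
  change (homComp h (coneSec f) (coneOut f)).1 ⟨i, i, hj⟩ m
    + (homComp (add_zero 0) (coneIn f) (coneRet f)).1 ⟨i, i, hj⟩ m = m
  rw [homComp_apply _ _ _ i (i + 1) i rfl, homComp_apply _ _ _ i i i (by omega)]
  change ((m.1, 0) : (cone f).X i) + (0, m.2) = m
  simp

end Cone

/-- The underlying morphism of complexes of a closed morphism. -/
def toGMap {M N : DGBimod.{u, v, w} A B} {k : ℤ} (f : (hom M N).Z k) :
    GMap M.toCpx N.toCpx k where
  f i j h := f.1.1 ⟨i, j, h⟩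
  comm := by
    intro i j i' j' h hi hj x
    have hf : homD M N k (k + 1) rfl f.1 = 0 := f.2
    have := homD_apply M N k (k + 1) rfl f.1 i j' i' j (by omega) hi h x
    rw [hf] at this
    exact sub_eq_zero.1 this.symm

lemma isQuasiIso_iff {M N : DGBimod.{u, v, w} A B} (f : (hom M N).Z 0) :
    IsQuasiIso f ↔ (toGMap f).IsQI := by
  constructor
  · intro h
    refine GMap.isQI_of_bijective fun i j hij => ?_
    obtain rfl : i = j := by omega
    exact h i
  · intro h k
    exact h.bijective k k (add_zero k)

lemma cone_isAcyclic_iff {M N : DGBimod.{u, v, w} A B} (f : (hom M N).Z 0) :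
    (cone f).IsAcyclic ↔ IsQuasiIso f := by
  rw [isQuasiIso_iff, ← coneC_isAcyclic_iff]
  exact Iff.rfl

end DGBimod

end HodgeCY

namespace HodgeCY

open Cpx DGBimod

/-- Contravariant DG functors from DG bimodules to complexes, i.e. right DG modules over the DG
category of DG bimodules. -/
structure DGFun (A : DGAlg.{u}) (B : DGAlg.{v}) where
  obj : DGBimod.{u, v, w} A B → Cpx.{t}
  act : ∀ {M N : DGBimod.{u, v, w} A B} (i k j : ℤ), i + k = j →
    (obj N).X i →ₗ[ℂ] homX M N k →ₗ[ℂ] (obj M).X j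
  act_id : ∀ {M : DGBimod.{u, v, w} A B} (i : ℤ) (h : i + 0 = i) (z : (obj M).X i),
    act i 0 i h z (homId M) = z
  act_comp : ∀ {M N K : DGBimod.{u, v, w} A B} (i k l n il j : ℤ) (h : k + l = n) (h₁ : i + n = j)
    (h₂ : i + l = il) (h₃ : il + k = j) (z : (obj K).X i) (g : homX N K l) (f : homX M N k),
    act i n j h₁ z (homComp h g f) = act il k j h₃ (act i l il h₂ z g) f
  d_act : ∀ {M N : DGBimod.{u, v, w} A B} (i k j i' k' j' : ℤ) (h : i + k = j) (hi : i + 1 = i')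
    (hk : k + 1 = k') (hj : j + 1 = j') (z : (obj N).X i) (f : homX M N k),
    (obj M).d j j' hj (act i k j h z f) = act i' k j' (by omega) ((obj N).d i i' hi z) f
      + sgn i • act i k' j' (by omega) z (homD M N k k' hk f)

namespace DGFun

variable {A : DGAlg.{u}} {B : DGAlg.{v}} (E : DGFun.{u, v, w, t} A B)
  {M N K : DGBimod.{u, v, w} A B}

/-- The morphism of complexes induced by a closed morphism. -/
noncomputable def pull {k : ℤ} (f : homX M N k) (hf : (hom M N).IsCyc f) :
    GMap (E.obj N) (E.obj M) k where
  f i j h := sgn (k * i) • (E.act i k j h).flip f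
  comm := by
    intro i j i' j' h hi hj x
    subst hi
    simp only [LinearMap.smul_apply, LinearMap.flip_apply, map_smul]
    rw [E.d_act i k j (i + 1) (k + 1) j' h rfl rfl hj]
    have : homD M N k (k + 1) rfl f = 0 := hf
    rw [this, map_zero, smul_zero, add_zero, mul_add, sgn_add, mul_one, smul_smul,
      mul_comm (sgn k), mul_assoc, sgn_mul_self, mul_one]

lemma act_isBd_left {i k j : ℤ} (h : i + k = j) {z : (E.obj N).X i} (hz : (E.obj N).IsBd z)
    {f : homX M N k} (hf : (hom M N).IsCyc f) : (E.obj M).IsBd (E.act i k j h z f) := by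
  obtain ⟨y, rfl⟩ := hz
  have := E.d_act (i - 1) k (j - 1) i (k + 1) j (by omega) (by omega) rfl (by omega) y f
  rw [show homD M N k (k + 1) rfl f = 0 from hf, map_zero, smul_zero, add_zero] at this
  rw [← this]
  exact isBd_d _ _

lemma act_isBd_right {i k j : ℤ} (h : i + k = j) {z : (E.obj N).X i} (hz : (E.obj N).IsCyc z)
    {f : homX M N k} (hf : (hom M N).IsBd f) : (E.obj M).IsBd (E.act i k j h z f) := by
  obtain ⟨y, rfl⟩ := hf
  have := E.d_act i (k - 1) (j - 1) (i + 1) k j (by omega) (by omega) (by omega) (by omega) z y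
  rw [hz.d, map_zero, LinearMap.zero_apply, zero_add] at this
  have h2 : E.act i k j h z (homD M N (k - 1) k (by omega) y)
      = sgn i • (E.obj M).d (j - 1) j (by omega) (E.act i (k - 1) (j - 1) (by omega) z y) := by
    rw [this, smul_smul, sgn_mul_self, one_smul]
  change (E.obj M).IsBd (E.act i k j h z (homD M N (k - 1) k (by omega) y))
  rw [h2]
  exact (isBd_d _ _).smul _

lemma isBd_of_retract {i : ℤ} {f : homX M N 0} (hf : (hom M N).IsCyc f) {g : homX N M 0}
    (hgf : (hom M M).IsBd (homComp (add_zero 0) g f - homId M)) {x : (E.obj M).X i}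
    (hx : (E.obj M).IsCyc x) (hb : (E.obj N).IsBd (E.act i 0 i (add_zero i) x g)) :
    (E.obj M).IsBd x := by
  have h1 := E.act_isBd_left (add_zero i) hb hf
  rw [← E.act_comp i 0 0 0 i i (add_zero 0) (add_zero i) (add_zero i) (add_zero i)] at h1
  have h2 := E.act_isBd_right (add_zero i) hx hgf
  rw [map_sub, E.act_id] at h2
  have := h1.sub h2
  rwa [sub_sub_cancel] at this

/-- The long exact sequence of a cone, at the cohomology of the cone. -/
lemma cone_exact (f : (hom M N).Z 0) {i j : ℤ} (hj : j + 1 = i) {z : (E.obj (cone f)).X i}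
    (hz : (E.obj (cone f)).IsCyc z)
    (hb : (E.obj N).IsBd (E.act i 0 i (add_zero i) z (coneIn f))) :
    ∃ x : (E.obj M).X j, (E.obj M).IsCyc x ∧
      (E.obj (cone f)).IsBd (z - E.act j 1 i hj x (coneOut f)) := by
  obtain ⟨y, hy⟩ := hb.exists j hj
  set u : (E.obj M).X j := E.act i (-1) j (by omega) z (coneSec f)
    + sgn j • E.act j 0 j (add_zero j) y f.1 with hu
  have key : z - E.act j 1 i hj u (coneOut f)
      = (E.obj (cone f)).d j i hj (E.act j 0 j (add_zero j) y (coneRet f)) := by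
    rw [E.d_act j 0 j i 1 i (add_zero j) hj rfl hj, hy, homD_coneRet, map_neg, smul_neg,
      hu, map_add, LinearMap.add_apply, map_smul, LinearMap.smul_apply,
      ← E.act_comp i 1 (-1) 0 j i (by omega) (add_zero i) (by omega) hj,
      ← E.act_comp j 1 0 1 j i (by omega) hj (add_zero j) hj,
      ← E.act_comp i 0 0 0 i i (add_zero 0) (add_zero i) (add_zero i) (add_zero i)]
    have := E.act_id i (add_zero i) z
    rw [← cone_decomp f (by omega), map_add] at this
    nth_rewrite 1 [← this]
    abel
  have hzu : (E.obj (cone f)).IsCyc (E.act j 1 i hj u (coneOut f)) := by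
    have h1 : (E.obj (cone f)).IsCyc (z - E.act j 1 i hj u (coneOut f)) := by
      rw [key]; exact (isBd_d _ _).isCyc
    have := hz.sub h1
    rwa [sub_sub_cancel] at this
  refine ⟨u, ?_, ?_⟩
  · refine isCyc_of i hj ?_
    have h1 := E.d_act j 1 i i (1 + 1) (i + 1) hj hj rfl rfl u (coneOut f)
    rw [hzu.d, show homD _ M 1 (1 + 1) rfl (coneOut f) = 0 from isCyc_coneOut f, map_zero,
      smul_zero, add_zero] at h1
    have h2 := E.act_comp i (-1) 1 0 (i + 1) i (by omega) (add_zero i) rfl (by omega)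
      ((E.obj M).d j i hj u) (coneOut f) (coneSec f)
    rw [coneOut_coneSec, E.act_id, ← h1, map_zero, LinearMap.zero_apply] at h2
    exact h2
  · rw [key]
    exact isBd_d _ _

/-- Dévissage: a property of vector spaces that passes to the middle term of exact sequences holds
for the cohomology of a DG functor at all perfect bimodules if it does at the free one. -/
theorem devissage (E : DGFun.{u, v, max u v, t} A B)
    (Pr : ∀ (V : Type t) [AddCommGroup V] [Module ℂ V], Prop)
    (hex : ∀ (U V W : Type t) [AddCommGroup U] [Module ℂ U] [AddCommGroup V] [Module ℂ V]
      [AddCommGroup W] [Module ℂ W] (f : U →ₗ[ℂ] V) (g : V →ₗ[ℂ] W),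
      (∀ v, g v = 0 → ∃ u, f u = v) → Pr U → Pr W → Pr V)
    (hfree : ∀ k, Pr ((E.obj (DGBimod.free A B)).H k)) (M : DGBimod.{u, v, max u v} A B)
    (hM : M.IsPerfect) : ∀ k, Pr ((E.obj M).H k) := by
  have hinj : ∀ (V W : Type t) [AddCommGroup V] [Module ℂ V] [AddCommGroup W] [Module ℂ W]
      (g : V →ₗ[ℂ] W), Function.Injective g → Pr W → Pr V := by
    intro V W _ _ _ _ g hg hW
    refine hex W V W 0 g (fun v hv => ⟨0, ?_⟩) hW hW
    exact hg (by rw [hv, map_zero, map_zero])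
  induction hM with
  | free => exact hfree
  | shift M n _ ih =>
    intro k
    refine hinj _ _ ((E.pull (shiftIn M n) (isCyc_shiftIn M n)).mapH k (k + -n) rfl)
      (GMap.mapH_injective ?_ _ _ _) (ih _)
    intro i j h x hx hb
    have hb' : (E.obj M).IsBd (E.act i (-n) j h x (shiftIn M n)) := by
      have := hb.smul (sgn (-n * i))
      change (E.obj M).IsBd (sgn (-n * i) • sgn (-n * i) • E.act i (-n) j h x (shiftIn M n)) at this
      rwa [smul_smul, sgn_mul_self, one_smul] at this
    have := E.act_isBd_left (k := n) (j := i) (by omega) hb' (isCyc_shiftOut M n)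
    rwa [← E.act_comp i n (-n) 0 j i (by omega) (add_zero i) h (by omega), shiftIn_shiftOut,
      E.act_id] at this
  | @cone M N f _ _ ihM ihN =>
    intro k
    refine hex _ _ _ ((E.pull (coneOut f) (isCyc_coneOut f)).mapH (k - 1) k (by omega))
      ((E.pull (coneIn f) (isCyc_coneIn f)).mapH k k (by omega)) ?_ (ihM _) (ihN _)
    intro z hz
    obtain ⟨z, rfl⟩ := Submodule.Quotient.mk_surjective _ z
    rw [GMap.mapH_mk, mk_eq_zero] at hz
    have hz' : (E.obj N).IsBd (E.act k 0 k (add_zero k) z.1 (coneIn f)) := by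
      have h2 : (E.obj N).IsBd (sgn (0 * k) • E.act k 0 k (add_zero k) z.1 (coneIn f)) := hz
      rwa [zero_mul, sgn_zero, one_smul] at h2
    obtain ⟨x, hx, hb⟩ := E.cone_exact f (j := k - 1) (by omega) z.2 hz'
    refine ⟨Submodule.Quotient.mk ⟨sgn (1 * (k - 1)) • x, hx.smul _⟩, ?_⟩
    rw [GMap.mapH_mk, mk_eq_mk]
    change (E.obj (DGBimod.cone f)).IsBd (sgn (1 * (k - 1)) •
      E.act (k - 1) 1 k _ (sgn (1 * (k - 1)) • x) (coneOut f) - z.1)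
    rw [map_smul, LinearMap.smul_apply, smul_smul, sgn_mul_self, one_smul, ← neg_sub]
    exact hb.neg
  | @retract M N i r hri _ ih =>
    intro k
    obtain ⟨i, rfl⟩ := Submodule.Quotient.mk_surjective _ i
    obtain ⟨r, rfl⟩ := Submodule.Quotient.mk_surjective _ r
    rw [comp_mk] at hri
    have hri' := (mk_eq_mk _ _).1 hri
    refine hinj _ _ ((E.pull r.1 r.2).mapH k k (by omega)) (GMap.mapH_injective ?_ _ _ _) (ih _)
    intro a b h x hx hb
    obtain rfl : a = b := by omega
    refine E.isBd_of_retract i.2 hri' hx ?_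
    have h2 : (E.obj N).IsBd (sgn (0 * a) • E.act a 0 a (add_zero a) x r.1) := hb
    rwa [zero_mul, sgn_zero, one_smul] at h2

theorem acyclic_devissage (E : DGFun.{u, v, max u v, t} A B)
    (hfree : (E.obj (DGBimod.free A B)).IsAcyclic) (M : DGBimod.{u, v, max u v} A B)
    (hM : M.IsPerfect) : (E.obj M).IsAcyclic := by
  refine E.devissage (fun V _ _ => Subsingleton V) ?_ hfree M hM
  intro U V W _ _ _ _ _ _ f g h hU hW
  refine subsingleton_of_forall_eq 0 fun v => ?_
  obtain ⟨u, rfl⟩ := h v (Subsingleton.elim _ _)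
  rw [Subsingleton.elim u 0, map_zero]

theorem finite_devissage (E : DGFun.{u, v, max u v, t} A B)
    (hfree : ∀ k, FiniteDimensional ℂ ((E.obj (DGBimod.free A B)).H k))
    (M : DGBimod.{u, v, max u v} A B) (hM : M.IsPerfect) :
    ∀ k, FiniteDimensional ℂ ((E.obj M).H k) := by
  refine E.devissage (fun V _ _ => FiniteDimensional ℂ V) ?_ hfree M hM
  intro U V W _ _ _ _ _ _ f g h hU hW
  have h1 : LinearMap.ker g ≤ LinearMap.range f := fun v hv => h v hv
  have : FiniteDimensional ℂ (LinearMap.ker g) := Submodule.finiteDimensional_of_le h1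
  have h2 : (⊤ : Submodule ℂ V).FG := by
    refine Submodule.fg_of_fg_map_of_fg_inf_ker g ?_ ?_
    · exact IsNoetherian.noetherian _
    · rw [top_inf_eq]
      exact (Submodule.fg_top _).1 (Module.Finite.fg_top)
  exact ⟨h2⟩

/-- Natural transformations of degree `0` between DG functors. -/
structure NatTrans (E : DGFun.{u, v, w, t} A B) (E' : DGFun.{u, v, w, t'} A B) where
  app : ∀ M, GMap (E.obj M) (E'.obj M) 0
  nat : ∀ {M N : DGBimod.{u, v, w} A B} (i k j : ℤ) (h : i + k = j) (z : (E.obj N).X i)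
    (f : homX M N k), (app M).f j j (add_zero j) (E.act i k j h z f)
      = E'.act i k j h ((app N).f i i (add_zero i) z) f

/-- The cone of a natural transformation. -/
def coneF {E : DGFun.{u, v, w, t} A B} {E' : DGFun.{u, v, w, t'} A B} (η : NatTrans E E') :
    DGFun.{u, v, w, max t t'} A B where
  obj M := coneC (η.app M)
  act i k j h := LinearMap.mk₂ ℂ
    (fun z f => (E.act (i + 1) k (j + 1) (by omega) z.1 f, E'.act i k j h z.2 f))
    (by intros; simp) (by intros; simp) (by intros; simp) (by intros; simp)
  act_id i h z := by
    simp only [LinearMap.mk₂_apply, E'.act_id]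
    rw [E.act_id (i + 1) (by omega)]
  act_comp i k l n il j h h₁ h₂ h₃ z g f := by
    simp only [LinearMap.mk₂_apply]
    rw [E.act_comp (i + 1) k l n (il + 1) (j + 1), E'.act_comp i k l n il j]
  d_act i k j i' k' j' h hi hk hj z f := by
    subst hi hj
    refine Prod.ext ?_ ?_
    · change -(E.obj _).d (j + 1) (j + 1 + 1) _ (E.act (i + 1) k (j + 1) _ z.1 f)
        = E.act (i + 1 + 1) k (j + 1 + 1) _ (-(E.obj _).d (i + 1) (i + 1 + 1) _ z.1) f
          + sgn i • E.act (i + 1) k' (j + 1 + 1) _ z.1 (homD _ _ k k' hk f)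
      rw [E.d_act (i + 1) k (j + 1) (i + 1 + 1) k' (j + 1 + 1) (by omega) rfl hk rfl, sgn_add,
        sgn_one, map_neg, LinearMap.neg_apply]
      module
    · change (η.app _).f (j + 1) (j + 1) _ (E.act (i + 1) k (j + 1) _ z.1 f)
          + (E'.obj _).d j (j + 1) _ (E'.act i k j h z.2 f)
        = E'.act (i + 1) k (j + 1) _ ((η.app _).f (i + 1) (i + 1) _ z.1
          + (E'.obj _).d i (i + 1) _ z.2) f
          + sgn i • E'.act i k' (j + 1) _ z.2 (homD _ _ k k' hk f)
      rw [E'.d_act i k j (i + 1) k' (j + 1) h rfl hk rfl, η.nat, map_add, LinearMap.add_apply]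
      abel

/-- Dévissage for natural transformations. -/
theorem NatTrans.isQI_devissage {E : DGFun.{u, v, max u v, t} A B}
    {E' : DGFun.{u, v, max u v, t'} A B} (η : NatTrans E E')
    (hfree : (η.app (DGBimod.free A B)).IsQI) (M : DGBimod.{u, v, max u v} A B)
    (hM : M.IsPerfect) : (η.app M).IsQI :=
  (coneC_isAcyclic_iff _).1
    (acyclic_devissage (coneF η) ((coneC_isAcyclic_iff (η.app (DGBimod.free A B))).2 hfree) M hM)

end DGFun

end HodgeCY

namespace HodgeCY

open Cpx DGBimod

/-- The functor `M ↦ Hom(M, N)`. -/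
noncomputable def homF {A : DGAlg.{u}} {B : DGAlg.{v}} (N : DGBimod.{u, v, w} A B) :
    DGFun.{u, v, w, w} A B where
  obj M := hom M N
  act i k j h := LinearMap.mk₂ ℂ (fun z f => homComp (by omega) z f)
    (fun _ _ _ => homComp_add_left _ _ _ _) (fun _ _ _ => homComp_smul_left _ _ _ _)
    (fun _ _ _ => homComp_add_right _ _ _ _) (fun _ _ _ => homComp_smul_right _ _ _ _)
  act_id i h z := homComp_id (by omega) z
  act_comp i k l n il j h h₁ h₂ h₃ z g f := homComp_assoc h (by omega) (by omega) (by omega) z g f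
  d_act i k j i' k' j' h hi hk hj z f := homD_comp (by omega) hk hi hj z f

/-- The functor `M ↦ Dₙ M`. -/
noncomputable def dualF (A : DGAlg.{u}) (B : DGAlg.{v}) (n : ℤ) : DGFun.{u, v, w, w} A B where
  obj M := M.toCpx.dualC n
  act {M N} i k j h := LinearMap.mk₂ ℂ
    (fun z f => (z : Module.Dual ℂ (N.X (n - i))) ∘ₗ f.1 ⟨n - j, n - i, by omega⟩)
    (fun _ _ _ => rfl) (fun _ _ _ => rfl)
    (fun _ _ _ => LinearMap.ext fun _ => by simp) (fun _ _ _ => LinearMap.ext fun _ => by simp)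
  act_id i h z := rfl
  act_comp {M N K} i k l n' il j h h₁ h₂ h₃ z g f := by
    refine LinearMap.ext fun x => ?_
    change ev z ((homComp h g f).1 ⟨n - j, n - i, _⟩ x) = ev z (g.1 ⟨_, _, _⟩ (f.1 ⟨_, _, _⟩ x))
    rw [homComp_apply h g f (n - j) (n - il) (n - i) (by omega)]
  d_act {M N} i k j i' k' j' h hi hk hj z f := by
    refine LinearMap.ext fun x => ?_
    change -(sgn j) * ev z (f.1 ⟨n - j, n - i, _⟩ (M.d (n - j') (n - j) _ x))
      = (-(sgn i) * ev z (N.d (n - i') (n - i) _ (f.1 ⟨n - j', n - i', _⟩ x)))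
        + sgn i * ev z ((homD M N k k' hk f).1 ⟨n - j', n - i, _⟩ x)
    rw [homD_apply M N k k' hk f (n - j') (n - i) (n - j) (n - i') (by omega) (by omega) (by omega)]
    simp only [map_sub, map_smul, smul_eq_mul]
    rw [show sgn j = sgn i * sgn k by rw [← sgn_add, h]]
    ring

/-- The functor `G ↦ Hom(F, G)*`. -/
noncomputable def homDualF {A : DGAlg.{u}} {B : DGAlg.{v}} (F : DGBimod.{u, v, w} A B) :
    DGFun.{u, v, w, w} A B where
  obj M := (hom F M).dualC 0
  act {M N} i k j h := LinearMap.mk₂ ℂ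
    (fun z f => (z : Module.Dual ℂ (homX F N (0 - i))) ∘ₗ
      { toFun := fun x => homComp (by omega) f x
        map_add' := fun _ _ => homComp_add_right _ _ _ _
        map_smul' := fun _ _ => homComp_smul_right _ _ _ _ })
    (fun _ _ _ => rfl) (fun _ _ _ => rfl)
    (fun z f g => LinearMap.ext fun x => by simp [homComp_add_left])
    (fun c z f => LinearMap.ext fun x => by simp [homComp_smul_left])
  act_id i h z := LinearMap.ext fun x => congrArg (ev z) (id_homComp (by omega) _)
  act_comp {M N K} i k l n' il j h h₁ h₂ h₃ z g f := LinearMap.ext fun x =>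
    congrArg (ev z)
      (homComp_assoc (by omega) (by omega) (by omega) (by omega) g f x).symm
  d_act {M N} i k j i' k' j' h hi hk hj z f := by
    refine LinearMap.ext fun x => ?_
    change -(sgn j) * ev z (homComp (by omega) f (homD F M (0 - j') (0 - j) (by omega) x))
      = (-(sgn i) * ev z (homD F N (0 - i') (0 - i) (by omega)
          (homComp (k := 0 - j') (by omega) f x)))
        + sgn i * ev z (homComp (k := 0 - j') (by omega) (homD M N k k' hk f) x)
    rw [homD_comp (k' := 0 - j) (l' := k') (by omega) (by omega) hk (by omega)]
    simp only [map_add, map_smul, smul_eq_mul]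
    rw [show sgn j = sgn i * sgn k by rw [← sgn_add, h]]
    ring

namespace DGBimod

variable {A : DGAlg.{u}} {B : DGAlg.{v}}

/-- The morphism `A ⊗ B → G` of degree `k` with `1 ⊗ 1 ↦ y`. -/
noncomputable def hat {G : DGBimod.{u, v, max u v} A B} {k : ℤ} (y : G.X k) :
    homX (free A B) G k :=
  ⟨fun t => freeLift A B t.p fun i j h => LinearMap.mk₂ ℂ
    (fun a b => sgn (k * i) •
      G.ract (i + k) j t.q (by have := t.hpq; omega) (G.lact i k (i + k) rfl a y) b)
    (by intros; simp) (by intros; simp [smul_comm (sgn _)]) (by intros; simp)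
    (by intros; simp [smul_comm (sgn _)]), by
    constructor
    · intro l i j i' j' h hi hj c x
      induction x using free_induction with
      | h0 => simp
      | hadd x y hx hy => simp only [map_add, smul_add, hx, hy]
      | H p q hpq a b =>
        simp only [LinearMap.coe_mk, AddHom.coe_mk, freeLift_mk, LinearMap.comp_apply,
          LinearMap.mk₂_apply, map_smul]
        rw [G.mul_lact l p k (l + p) (p + k) (l + p + k) rfl rfl rfl (by omega),
          G.lact_ract l (p + k) q (l + p + k) i' j' (by omega) (by omega) (by omega) (by omega),
          mul_add, sgn_add, smul_smul]
    · intro i l j i' j' h hi hj x c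
      induction x using free_induction with
      | h0 => simp
      | hadd x y hx hy => simp only [map_add, LinearMap.add_apply, hx, hy]
      | H p q hpq a b =>
        simp only [LinearMap.coe_mk, AddHom.coe_mk, freeLift_mk, LinearMap.flip_apply,
          LinearMap.compl₂_apply, LinearMap.mk₂_apply, map_smul, LinearMap.smul_apply]
        rw [G.ract_mul (p + k) q l i' (q + l) j' (by omega) (by omega) rfl (by omega)]⟩

lemma hat_apply {G : DGBimod.{u, v, max u v} A B} {k : ℤ} (y : G.X k) (i j n m i' : ℤ)
    (h : i + j = n) (h' : n + k = m) (hi' : i + k = i') (a : A.X i) (b : B.X j) :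
    (hat y).1 ⟨n, m, h'⟩ (freeMk A B i j n h a b)
      = sgn (k * i) • G.ract i' j m (by omega) (G.lact i k i' hi' a y) b := by
  subst hi'
  simp [hat, freeLift_mk]

/-- The generator `1 ⊗ 1`. -/
noncomputable def gen (A : DGAlg.{u}) (B : DGAlg.{v}) : (free A B).X 0 :=
  freeMk A B 0 0 0 rfl A.one B.one

lemma hat_gen {G : DGBimod.{u, v, max u v} A B} {k : ℤ} (y : G.X k) (h : 0 + k = k) :
    (hat y).1 ⟨0, k, h⟩ (gen A B) = y := by
  rw [gen, hat_apply y 0 0 0 k k rfl h h, G.one_lact, G.ract_one, mul_zero, sgn_zero, one_smul]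

lemma freeMk_eq_act (i j n : ℤ) (h : i + j = n) (a : A.X i) (b : B.X j) :
    freeMk A B i j n h a b
      = (free A B).ract i j n h ((free A B).lact i 0 i (add_zero i) a (gen A B)) b := by
  have h1 : (free A B).lact i 0 i (add_zero i) a (gen A B) = freeMk A B i 0 i (add_zero i) a B.one := by
    simp only [gen, LinearMap.coe_mk, AddHom.coe_mk, freeLift_mk, LinearMap.comp_apply]
    rw [freeMk_left A B i 0 i 0 i (add_zero i), A.mul_one]
  rw [h1]
  simp only [LinearMap.coe_mk, AddHom.coe_mk, freeLift_mk, LinearMap.flip_apply,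
    LinearMap.compl₂_apply]
  rw [freeMk_right A B i 0 j j n (zero_add j), B.one_mul]

/-- Morphisms out of the free bimodule agree if they agree at the generator. -/
lemma free_hom_ext {G : DGBimod.{u, v, max u v} A B} {k : ℤ} {f g : homX (free A B) G k}
    (h : f.1 ⟨0, k, zero_add k⟩ (gen A B) = g.1 ⟨0, k, zero_add k⟩ (gen A B)) : f = g := by
  refine homX_ext fun n m hm x => ?_
  refine LinearMap.congr_fun (f := f.1 ⟨n, m, hm⟩) (g := g.1 ⟨n, m, hm⟩) (free_ext ?_) x
  intro i j (hij : i + j = n) a b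
  change f.1 ⟨n, m, hm⟩ (freeMk A B i j n hij a b) = g.1 ⟨n, m, hm⟩ (freeMk A B i j n hij a b)
  rw [freeMk_eq_act]
  have key : ∀ f : homX (free A B) G k, f.1 ⟨n, m, hm⟩
      ((free A B).ract i j n hij ((free A B).lact i 0 i (add_zero i) a (gen A B)) b)
      = G.ract (i + k) j m (by omega) (sgn (k * i) • G.lact i k (i + k) rfl a
        (f.1 ⟨0, k, zero_add k⟩ (gen A B))) b := by
    intro f
    rw [f.2.2 i j n (i + k) m hij rfl hm, f.2.1 i 0 i k (i + k) (add_zero i) (zero_add k) rfl]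
  rw [key, key, h]

lemma hat_eq {G : DGBimod.{u, v, max u v} A B} {k : ℤ} (f : homX (free A B) G k) :
    hat (f.1 ⟨0, k, zero_add k⟩ (gen A B)) = f :=
  free_hom_ext (hat_gen _ _)

lemma d_gen : (free A B).d 0 1 rfl (gen A B) = 0 := by
  have hA : A.d 0 1 rfl A.one = 0 := by
    have := A.d_mul 0 0 0 1 1 1 rfl rfl rfl rfl A.one A.one
    rw [A.one_mul, A.mul_one, A.one_mul, sgn_zero, one_smul] at this
    exact left_eq_add.1 this
  have hB : B.d 0 1 rfl B.one = 0 := by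
    have := B.d_mul 0 0 0 1 1 1 rfl rfl rfl rfl B.one B.one
    rw [B.one_mul, B.mul_one, B.one_mul, sgn_zero, one_smul] at this
    exact left_eq_add.1 this
  simp only [gen, freeLift_mk, LinearMap.add_apply, LinearMap.comp_apply, LinearMap.smul_apply,
    LinearMap.compl₂_apply]
  change freeMk A B 1 0 1 _ (A.d 0 1 rfl A.one) B.one
    + sgn 0 • freeMk A B 0 1 1 _ A.one (B.d 0 1 rfl B.one) = 0
  rw [hA, hB, map_zero, map_zero, LinearMap.zero_apply, smul_zero, add_zero]

lemma homD_hat {G : DGBimod.{u, v, max u v} A B} {k k' : ℤ} (hk : k + 1 = k') (y : G.X k) :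
    homD (free A B) G k k' hk (hat y) = hat (G.d k k' hk y) := by
  refine free_hom_ext ?_
  rw [homD_apply _ _ k k' hk _ 0 k' 1 k (zero_add k') rfl (zero_add k), d_gen, map_zero, smul_zero,
    sub_zero, hat_gen, hat_gen]

/-- Evaluation at the generator. -/
noncomputable def evGen (G : DGBimod.{u, v, max u v} A B) : GMap (hom (free A B) G) G.toCpx 0 where
  f i j h :=
    { toFun := fun f => f.1 ⟨0, j, by omega⟩ (gen A B)
      map_add' := fun _ _ => rfl
      map_smul' := fun _ _ => rfl }
  comm := by
    intro i j i' j' h hi hj f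
    obtain rfl : i = j := by omega
    obtain rfl : i' = j' := by omega
    rw [sgn_zero, one_smul]
    change G.d i i' hj (f.1 ⟨0, i, zero_add i⟩ (gen A B))
      = (homD _ _ i i' hi f).1 ⟨0, i', zero_add i'⟩ (gen A B)
    rw [homD_apply _ _ i i' hi f 0 i' 1 i (zero_add i') rfl (zero_add i), d_gen, map_zero,
      smul_zero, sub_zero]

lemma evGen_apply (G : DGBimod.{u, v, max u v} A B) (i : ℤ) (h : i + 0 = i)
    (f : homX (free A B) G i) : (evGen G).f i i h f = f.1 ⟨0, i, zero_add i⟩ (gen A B) := rfl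

lemma evGen_isQI (G : DGBimod.{u, v, max u v} A B) : (evGen G).IsQI where
  surj i j h y hy := by
    obtain rfl : i = j := by omega
    refine ⟨hat y, isCyc_of (i + 1) rfl ?_, ?_⟩
    · change homD _ _ i (i + 1) rfl (hat y) = 0
      rw [homD_hat, hy.d]
      refine free_hom_ext ?_
      rw [hat_gen]; rfl
    · rw [evGen_apply, hat_gen, sub_self]
      exact isBd_zero
  inj i j h f hf hb := by
    obtain rfl : i = j := by omega
    obtain ⟨y, hy⟩ := hb
    refine ⟨hat y, ?_⟩
    change homD _ _ (i - 1) i (by omega) (hat y) = f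
    rw [homD_hat, hy, evGen_apply, hat_eq]

theorem IsPerfect.isKProjective {P : DGBimod.{u, v, max u v} A B} (hP : P.IsPerfect) :
    P.IsKProjective := by
  intro N hN
  refine DGFun.acyclic_devissage (homF N) ?_ P hP
  rw [isAcyclic_iff] at hN ⊢
  intro i x hx
  exact (evGen_isQI N).inj i i (add_zero i) x hx (hN i _ (GMap.isCyc _ _ hx))

section KProj

variable {P M N : DGBimod.{u, v, w} A B}

lemma homComp_isCyc {k l n : ℤ} (h : k + l = n) {g : homX N M l} (hg : (hom N M).IsCyc g)
    {f : homX P N k} (hf : (hom P N).IsCyc f) : (hom P M).IsCyc (homComp h g f) :=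
  comp_mem_Z h ⟨g, hg⟩ ⟨f, hf⟩

lemma homComp_isBd_right {k l n : ℤ} (h : k + l = n) {g : homX N M l} (hg : (hom N M).IsCyc g)
    {f : homX P N k} (hf : (hom P N).IsBd f) : (hom P M).IsBd (homComp h g f) :=
  compZ_mem_right h ⟨g, hg⟩ ⟨f, hf.isCyc⟩ hf

lemma homComp_isBd_left {k l n : ℤ} (h : k + l = n) {g : homX N M l} (hg : (hom N M).IsBd g)
    {f : homX P N k} (hf : (hom P N).IsCyc f) : (hom P M).IsBd (homComp h g f) :=
  compZ_mem_left h ⟨g, hg.isCyc⟩ hg ⟨f, hf⟩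

/-- Composition with a closed morphism `f`, as a morphism of complexes. -/
noncomputable def postC (P : DGBimod.{u, v, w} A B) {m : ℤ} (f : (hom M N).Z m) :
    GMap (hom P M) (hom P N) m where
  f i j h :=
    { toFun := fun g => homComp h f.1 g
      map_add' := fun _ _ => homComp_add_right _ _ _ _
      map_smul' := fun _ _ => homComp_smul_right _ _ _ _ }
  comm := by
    intro i j i' j' h hi hj x
    change homD P N j j' hj (homComp h f.1 x) = sgn m • homComp (by omega) f.1 (homD P M i i' hi x)
    rw [homD_comp h hi rfl hj, show homD M N m (m + 1) rfl f.1 = 0 from f.2]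
    exact zero_add _

lemma postC_apply {m : ℤ} (f : (hom M N).Z m) (i j : ℤ) (h : i + m = j) (g : homX P M i) :
    (postC P f).f i j h g = homComp h f.1 g := rfl

lemma homD_homComp_right {k l n k' n' : ℤ} (h : k + l = n) (hk : k + 1 = k') (hn : n + 1 = n')
    {g : homX N M l} (hg : (hom N M).IsCyc g) (f : homX P N k) :
    homD P M n n' hn (homComp h g f) = sgn l • homComp (by omega) g (homD P N k k' hk f) := by
  have := (postC P ⟨g, hg⟩).comm k n k' n' h hk hn f
  exact this

lemma homComp_neg_left {k l n : ℤ} (h : k + l = n) (g : homX N M l) (f : homX P N k) :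
    homComp h (-g) f = -homComp h g f := rfl

lemma homComp_zero_left {k l n : ℤ} (h : k + l = n) (f : homX P N k) :
    homComp h (0 : homX N M l) f = 0 := rfl

lemma homComp_zero_right {k l n : ℤ} (h : k + l = n) (g : homX N M l) :
    homComp h g (0 : homX P N k) = 0 := homX_ext fun _ _ _ _ => by simp [homComp]

lemma homComp_sub_right {k l n : ℤ} (h : k + l = n) (g : homX N M l) (f f' : homX P N k) :
    homComp h g (f - f') = homComp h g f - homComp h g f' :=
  homX_ext fun _ _ _ _ => by simp [homComp]

lemma IsKProjective.postC_isQI_zero (hP : P.IsKProjective) (f : (hom M N).Z 0)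
    (hf : IsQuasiIso f) : (postC P f).IsQI := by
  have hac := isAcyclic_iff.1 (hP (cone f) ((cone_isAcyclic_iff f).2 hf))
  constructor
  · intro i j h z hz
    obtain rfl : i = j := by omega
    obtain ⟨y, hy⟩ := (hac i _ (homComp_isCyc (add_zero i) (isCyc_coneIn f) hz)).exists (i - 1)
      (by omega)
    change homD P (cone f) (i - 1) i (by omega) y = _ at hy
    have hx : homD P M i (i + 1) rfl (homComp (by omega) (coneOut f) y) = 0 := by
      rw [homD_homComp_right (k := i - 1) (k' := i) (by omega) (by omega) rfl (isCyc_coneOut f), hy,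
        homComp_assoc (add_zero i) rfl (zero_add 1) rfl, coneOut_coneIn, homComp_zero_left,
        smul_zero]
    refine ⟨homComp (by omega) (coneOut f) y, hx, ?_⟩
    have : homD P N (i - 1) i (by omega) (homComp (by omega) (coneRet f) y)
        = -(homComp (by omega) f.1 (homComp (by omega) (coneOut f) y)) + z := by
      rw [homD_comp (k' := i) (l' := 1) (by omega) (by omega) (by omega) (by omega), homD_coneRet,
        sgn_zero, one_smul, hy, homComp_neg_left,
        homComp_assoc (add_zero i) (add_zero i) (add_zero 0) (add_zero i), coneRet_coneIn,
        id_homComp, homComp_assoc (kl := i) (lm := 1) (n := i) (by omega) (by omega) (by omega)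
          (by omega)]
    rw [postC_apply]
    have h2 := (isBd_d (K := hom P N) (sub_add_cancel i 1)
      (homComp (by omega) (coneRet f) y)).neg
    change (hom P N).IsBd (-(homD P N (i - 1) i (by omega) _)) at h2
    rw [this, neg_add, neg_neg, ← sub_eq_add_neg] at h2
    exact h2
  · intro i j h x hx hb
    obtain rfl : i = j := by omega
    obtain ⟨y, hy⟩ := hb.exists (i - 1) (by omega)
    change homD P N (i - 1) i (by omega) y = homComp h f.1 x at hy
    have hx' : homD P M i (i + 1) rfl x = 0 := hx
    have hc : homD P (cone f) (i - 1) i (by omega) (homComp (by omega) (coneSec f) x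
        - homComp (by omega) (coneIn f) y) = 0 := by
      rw [map_sub, homD_comp (k' := i + 1) (l' := 0) (by omega) rfl (by omega) (by omega), hx',
        homComp_zero_right, smul_zero, add_zero, homD_coneSec,
        homD_homComp_right (k := i - 1) (k' := i) (by omega) (by omega) (by omega)
          (isCyc_coneIn f), hy, sgn_zero, one_smul,
        homComp_assoc (h) (add_zero i) (add_zero 0) (add_zero i), sub_self]
    obtain ⟨w, hw⟩ := (hac (i - 1) _ (isCyc_of i (by omega) hc)).exists (i - 2) (by omega)
    change homD P (cone f) (i - 2) (i - 1) (by omega) w = _ at hw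
    refine ⟨-(homComp (by omega) (coneOut f) w), ?_⟩
    change homD P M (i - 1) i (by omega) (-_) = x
    rw [map_neg, homD_homComp_right (k := i - 2) (k' := i - 1) (by omega) (by omega) (by omega)
      (isCyc_coneOut f), hw, sgn_one]
    have e1 : homComp (sub_add_cancel i 1) (coneOut f) (homComp (k := i) (by omega) (coneSec f) x
        - homComp (add_zero (i - 1)) (coneIn f) y) = x := by
      rw [homComp_sub_right,
        homComp_assoc (lm := 0) (n := i) (by omega) (by omega) (by omega) (by omega),
        coneOut_coneSec, id_homComp,
        homComp_assoc (lm := 1) (n := i) (by omega) (by omega) (by omega) (by omega),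
        coneOut_coneIn, homComp_zero_left, sub_zero]
    rw [e1]
    exact neg_eq_iff_eq_neg.2 (neg_one_smul ℂ x)

/-- Composition with a quasi-isomorphism of any degree is bijective on homotopy classes of
morphisms out of a K-projective bimodule. -/
lemma IsKProjective.postC_isQI (hP : P.IsKProjective) {m : ℤ} (f : (hom M N).Z m)
    (hf : (toGMap f).IsQI) : (postC P f).IsQI := by
  let f' : (hom M (N.shift m)).Z 0 :=
    ⟨homComp (by omega) (shiftIn N m) f.1, homComp_isCyc _ (isCyc_shiftIn N m) f.2⟩
  have hval : ∀ (i : ℤ) (h : i + m = i + m) (x : M.X i),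
      (toGMap f').f i i (add_zero i) x = (toGMap f).f i (i + m) h x := by
    intro i h x
    change (homComp (by omega) (shiftIn N m) f.1).1 ⟨i, i, by omega⟩ x = _
    rw [homComp_apply _ _ _ i (i + m) i rfl]
    rfl
  have hf' : IsQuasiIso f' := by
    rw [isQuasiIso_iff]
    have hcyc : ∀ (i : ℤ) (x : N.X (i + m)), (N.shift m).toCpx.IsCyc (i := i) x
        ↔ N.toCpx.IsCyc x := by
      intro i x
      have e : i + m + 1 = i + 1 + m := by omega
      constructor
      · intro h
        refine isCyc_of (i + 1 + m) e ?_
        have h1 : sgn m • N.d (i + m) (i + 1 + m) e x = 0 := h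
        exact (smul_eq_zero.1 h1).resolve_left (sgn_ne_zero m)
      · intro h
        change sgn m • N.d (i + m) (i + 1 + m) e x = 0
        rw [h.d, smul_zero]
    have hbd : ∀ (i : ℤ) (x : N.X (i + m)), (N.shift m).toCpx.IsBd (i := i) x
        ↔ N.toCpx.IsBd x := by
      intro i x
      constructor
      · rintro ⟨y, rfl⟩
        exact (isBd_d (K := N.toCpx) (i := i - 1 + m) (j := i + m) (by omega) y).smul (sgn m)
      · intro h
        obtain ⟨y, rfl⟩ := h.exists (i - 1 + m) (by omega)
        have := (isBd_d (K := (N.shift m).toCpx) (i := i - 1) (j := i) (by omega) y).smul (sgn m)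
        change (N.shift m).toCpx.IsBd (i := i) (sgn m • sgn m • N.d (i - 1 + m) (i + m) _ y) at this
        rwa [smul_smul, sgn_mul_self, one_smul] at this
    constructor
    · intro i j h y hy
      obtain rfl : i = j := by omega
      obtain ⟨x, hx, hb⟩ := hf.surj i (i + m) rfl y ((hcyc i y).1 hy)
      refine ⟨x, hx, ?_⟩
      rw [hval i rfl]
      exact (hbd i _).2 hb
    · intro i j h x hx hb
      obtain rfl : i = j := by omega
      rw [hval i rfl] at hb
      exact hf.inj i (i + m) rfl x hx ((hbd i _).1 hb)
  have hq := hP.postC_isQI_zero f' hf'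
  have hback : ∀ (i j : ℤ) (h : i + m = j) (x : homX P M i),
      homComp (k := i) (l := m) (n := j) (by omega) (shiftOut N m) (homComp (add_zero i) f'.1 x)
        = homComp h f.1 x := by
    intro i j h x
    rw [homComp_assoc (lm := m) (n := j) (by omega) (by omega) (by omega) (by omega)]
    congr 1
    rw [homComp_assoc (lm := 0) (n := m) (by omega) (by omega) (by omega) (by omega),
      shiftOut_shiftIn, id_homComp]
  constructor
  · intro i j h y hy
    obtain ⟨x, hx, hb⟩ := hq.surj i i (add_zero i)
      (homComp (by omega) (shiftIn N m) y) (homComp_isCyc _ (isCyc_shiftIn N m) hy)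
    refine ⟨x, hx, ?_⟩
    have := homComp_isBd_right h (isCyc_shiftOut N m) hb
    rw [postC_apply, homComp_sub_right, hback,
      homComp_assoc (lm := 0) (n := j) (by omega) (by omega) (by omega) (by omega),
      shiftOut_shiftIn, id_homComp] at this
    exact this
  · intro i j h x hx hb
    refine hq.inj i i (add_zero i) x hx ?_
    have := homComp_isBd_right (n := i) (by omega) (isCyc_shiftIn N m) hb
    rw [postC_apply, homComp_assoc (lm := 0) (n := i) (by omega) (by omega) (by omega)
      (by omega)] at this
    exact this

lemma IsKProjective.comp_bijective (hP : P.IsKProjective) {m : ℤ} (f : (hom M N).Z m)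
    (hf : (toGMap f).IsQI) (i j : ℤ) (h : i + m = j) :
    Function.Bijective (comp h (Submodule.Quotient.mk f : GHom M N m) : GHom P M i →ₗ[ℂ] GHom P N j) := by
  have := (hP.postC_isQI f hf).bijective i j h
  convert this using 1
  funext x
  obtain ⟨z, rfl⟩ := Submodule.Quotient.mk_surjective _ x
  rfl

end KProj

end DGBimod

end HodgeCY

namespace HodgeCY

open Cpx DGBimod

/-! ### Tensor products over the base field -/

/-- The component of degree `n` of the tensor product of two complexes. -/
abbrev TX (K : Cpx.{u}) (L : Cpx.{v}) (n : ℤ) : Type (max u v) :=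
  ⨁ p : {p : ℤ × ℤ // p.1 + p.2 = n}, (K.X p.1.1 ⊗[ℂ] L.X p.1.2)

/-- The element `a ⊗ b`. -/
noncomputable def tmk (K : Cpx.{u}) (L : Cpx.{v}) (i j n : ℤ) (h : i + j = n) :
    K.X i →ₗ[ℂ] L.X j →ₗ[ℂ] TX K L n :=
  (TensorProduct.mk ℂ (K.X i) (L.X j)).compr₂
    (DirectSum.lof ℂ {p : ℤ × ℤ // p.1 + p.2 = n} (fun p => K.X p.1.1 ⊗[ℂ] L.X p.1.2)
      ⟨(i, j), h⟩)

/-- The linear map with prescribed bilinear values on the `a ⊗ b`. -/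
noncomputable def tlift (K : Cpx.{u}) (L : Cpx.{v}) (n : ℤ) {V : Type w} [AddCommGroup V]
    [Module ℂ V] (f : ∀ i j : ℤ, i + j = n → K.X i →ₗ[ℂ] L.X j →ₗ[ℂ] V) :
    TX K L n →ₗ[ℂ] V :=
  DirectSum.toModule ℂ _ _ (fun p => TensorProduct.lift (f p.1.1 p.1.2 p.2))

lemma tlift_mk (K : Cpx.{u}) (L : Cpx.{v}) (n : ℤ) {V : Type w} [AddCommGroup V]
    [Module ℂ V] (f : ∀ i j : ℤ, i + j = n → K.X i →ₗ[ℂ] L.X j →ₗ[ℂ] V)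
    (i j : ℤ) (h : i + j = n) (a : K.X i) (b : L.X j) :
    tlift K L n f (tmk K L i j n h a b) = f i j h a b := by
  simp [tlift, tmk]

lemma t_ext {K : Cpx.{u}} {L : Cpx.{v}} {n : ℤ} {V : Type w} [AddCommGroup V]
    [Module ℂ V] {f g : TX K L n →ₗ[ℂ] V}
    (H : ∀ i j h a b, f (tmk K L i j n h a b) = g (tmk K L i j n h a b)) : f = g := by
  refine DirectSum.linearMap_ext _ fun p => TensorProduct.ext' fun a b => ?_
  exact H p.1.1 p.1.2 p.2 a b

lemma t_induction {K : Cpx.{u}} {L : Cpx.{v}} {n : ℤ} {P : TX K L n → Prop}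
    (h0 : P 0) (hadd : ∀ x y, P x → P y → P (x + y))
    (H : ∀ i j h a b, P (tmk K L i j n h a b)) (x : TX K L n) : P x := by
  induction x using DirectSum.induction_on with
  | zero => exact h0
  | add x y hx hy => exact hadd x y hx hy
  | of p t =>
    induction t using TensorProduct.induction_on with
    | zero => rw [map_zero]; exact h0
    | add x y hx hy => rw [map_add]; exact hadd _ _ hx hy
    | tmul a b => exact H p.1.1 p.1.2 p.2 a b

/-- The tensor product of complexes. -/
noncomputable abbrev tensC (K : Cpx.{u}) (L : Cpx.{v}) : Cpx.{max u v} where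
  X n := TX K L n
  d n m hnm := tlift K L n fun i j h =>
    tmk K L (i + 1) j m (by omega) ∘ₗ K.d i (i + 1) rfl +
      sgn i • (tmk K L i (j + 1) m (by omega)).compl₂ (L.d j (j + 1) rfl)
  d_d := by
    intro n m l hm hl x
    induction x using t_induction with
    | h0 => simp
    | hadd x y hx hy => simp only [map_add, hx, hy, add_zero]
    | H i j h a b => simp [tlift_mk, K.d_d, L.d_d, sgn_add, sgn_one]

lemma tensC_d (K : Cpx.{u}) (L : Cpx.{v}) (i j n m i' j' : ℤ) (h : i + j = n) (hm : n + 1 = m)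
    (hi : i + 1 = i') (hj : j + 1 = j') (a : K.X i) (b : L.X j) :
    (tensC K L).d n m hm (tmk K L i j n h a b)
      = tmk K L i' j m (by omega) (K.d i i' hi a) b
        + sgn i • tmk K L i j' m (by omega) a (L.d j j' hj b) := by
  subst hi hj
  simp only [tlift_mk, LinearMap.add_apply, LinearMap.comp_apply, LinearMap.smul_apply,
    LinearMap.compl₂_apply]

section Tens

variable {A A' : DGAlg.{u}} {B B' : DGAlg.{v}} (M : DGBimod.{u, u, u} A A')
  (N : DGBimod.{v, v, v} B' B)

lemma tmk_lact (l i i' j n : ℤ) (hi : l + i = i')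
    (h : l + i + j = n) (a : A.X l) (x : M.X i) (b : N.X j) :
    tmk M.toCpx N.toCpx (l + i) j n h (M.lact l i (l + i) rfl a x) b
      = tmk M.toCpx N.toCpx i' j n (by omega) (M.lact l i i' hi a x) b := by
  subst hi; rfl

lemma tmk_ract (i j l j' n : ℤ) (hj : j + l = j')
    (h : i + (j + l) = n) (a : M.X i) (x : N.X j) (b : B.X l) :
    tmk M.toCpx N.toCpx i (j + l) n h a (N.ract j l (j + l) rfl x b)
      = tmk M.toCpx N.toCpx i j' n (by omega) a (N.ract j l j' hj x b) := by
  subst hj; rfl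

/-- The tensor product of an `A`-`A'`-bimodule and a `B'`-`B`-bimodule over the base field, with
its outer bimodule structure. -/
noncomputable abbrev tens : DGBimod.{u, v, max u v} A B where
  toCpx := tensC M.toCpx N.toCpx
  lact l n m h :=
    { toFun := fun c => tlift M.toCpx N.toCpx n fun i j hij =>
        tmk M.toCpx N.toCpx (l + i) j m (by omega) ∘ₗ M.lact l i (l + i) rfl c
      map_add' := fun c c' => t_ext fun i j h a b => by simp [tlift_mk]
      map_smul' := fun r c => t_ext fun i j h a b => by simp [tlift_mk] }
  ract n l m h := LinearMap.flip
    { toFun := fun c => tlift M.toCpx N.toCpx n fun i j hij =>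
        (tmk M.toCpx N.toCpx i (j + l) m (by omega)).compl₂ ((N.ract j l (j + l) rfl).flip c)
      map_add' := fun c c' => t_ext fun i j h a b => by simp [tlift_mk]
      map_smul' := fun r c => t_ext fun i j h a b => by simp [tlift_mk] }
  one_lact := by
    intro n h x
    induction x using t_induction with
    | h0 => simp
    | hadd x y hx hy => simp only [map_add, hx, hy]
    | H i j h a b =>
      simp only [LinearMap.coe_mk, AddHom.coe_mk, tlift_mk, LinearMap.comp_apply]
      rw [tmk_lact M N 0 i i j n (by omega), M.one_lact]
  ract_one := by
    intro n h x
    induction x using t_induction with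
    | h0 => simp
    | hadd x y hx hy => simp only [map_add, LinearMap.add_apply, hx, hy]
    | H i j h a b =>
      simp only [LinearMap.coe_mk, AddHom.coe_mk, tlift_mk, LinearMap.flip_apply,
        LinearMap.compl₂_apply]
      rw [tmk_ract M N i j 0 j n (by omega), N.ract_one]
  mul_lact := by
    intro l l' n ll' n' m h₁ h₂ h₃ h₄ c c' x
    induction x using t_induction with
    | h0 => simp
    | hadd x y hx hy => simp only [map_add, hx, hy]
    | H i j h a b =>
      simp only [LinearMap.coe_mk, AddHom.coe_mk, tlift_mk, LinearMap.comp_apply]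
      rw [tmk_lact M N ll' i (l + (l' + i)) j m (by omega),
        M.mul_lact l l' i ll' (l' + i) (l + (l' + i)) h₁ (by omega) rfl rfl]
  ract_mul := by
    intro n l l' nl ll' m h₁ h₂ h₃ h₄ x c c'
    induction x using t_induction with
    | h0 => simp
    | hadd x y hx hy => simp only [map_add, LinearMap.add_apply, hx, hy]
    | H i j h a b =>
      simp only [LinearMap.coe_mk, AddHom.coe_mk, tlift_mk, LinearMap.flip_apply,
        LinearMap.compl₂_apply]
      rw [tmk_ract M N i j ll' (j + l + l') m (by omega),
        N.ract_mul j l l' (j + l) ll' (j + l + l') rfl rfl h₃ (by omega)]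
  lact_ract := by
    intro l n l' ln nl m h₁ h₂ h₃ h₄ c x c'
    induction x using t_induction with
    | h0 => simp
    | hadd x y hx hy => simp only [map_add, LinearMap.add_apply, hx, hy]
    | H i j h a b =>
      simp only [LinearMap.coe_mk, AddHom.coe_mk, tlift_mk, LinearMap.flip_apply,
        LinearMap.compl₂_apply, LinearMap.comp_apply]
  d_lact := by
    intro l n m l' n' m' h hl hn hm c x
    induction x using t_induction with
    | h0 => simp
    | hadd x y hx hy => simp only [map_add, smul_add, hx, hy]; abel
    | H i j h a b =>
      simp only [LinearMap.coe_mk, AddHom.coe_mk, tlift_mk, LinearMap.comp_apply,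
        LinearMap.add_apply, LinearMap.smul_apply, LinearMap.compl₂_apply, map_add, map_smul]
      rw [M.d_lact l i (l + i) l' (i + 1) (l + i + 1) rfl hl rfl rfl,
        tmk_lact M N l' i (l + i + 1) j m' (by omega),
        tmk_lact M N l (i + 1) (l + i + 1) j m' (by omega)]
      simp only [map_add, map_smul, LinearMap.add_apply, LinearMap.smul_apply, sgn_add, smul_add,
        smul_smul]
      abel
  d_ract := by
    intro n l m n' l' m' h hn hl hm x c
    induction x using t_induction with
    | h0 => simp
    | hadd x y hx hy => simp only [map_add, LinearMap.add_apply, smul_add, hx, hy]; abel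
    | H i j hij a b =>
      have hs : sgn n = sgn i * sgn j := by rw [← hij, sgn_add]
      rw [hs]
      simp only [LinearMap.coe_mk, AddHom.coe_mk, tlift_mk, LinearMap.comp_apply,
        LinearMap.flip_apply,
        LinearMap.add_apply, LinearMap.smul_apply, LinearMap.compl₂_apply, map_add, map_smul]
      rw [N.d_ract j l (j + l) (j + 1) l' (j + l + 1) rfl rfl hl rfl,
        tmk_ract M N i (j + 1) l (j + l + 1) m' (by omega),
        tmk_ract M N i j l' (j + l + 1) m' (by omega)]
      simp only [map_add, map_smul, smul_add, smul_smul]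
      abel

lemma tens_lact (l i j n m i' : ℤ) (h : i + j = n) (h' : l + n = m) (hi : l + i = i')
    (c : A.X l) (a : M.X i) (b : N.X j) :
    (tens M N).lact l n m h' c (tmk M.toCpx N.toCpx i j n h a b)
      = tmk M.toCpx N.toCpx i' j m (by omega) (M.lact l i i' hi c a) b := by
  subst hi
  simp only [LinearMap.coe_mk, AddHom.coe_mk, tlift_mk, LinearMap.comp_apply]

lemma tens_ract (l i j n m j' : ℤ) (h : i + j = n) (h' : n + l = m) (hj : j + l = j')
    (c : B.X l) (a : M.X i) (b : N.X j) :
    (tens M N).ract n l m h' (tmk M.toCpx N.toCpx i j n h a b) c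
      = tmk M.toCpx N.toCpx i j' m (by omega) a (N.ract j l j' hj b c) := by
  subst hj
  simp only [LinearMap.coe_mk, AddHom.coe_mk, tlift_mk, LinearMap.flip_apply,
    LinearMap.compl₂_apply]

/-- The left inner action on the tensor product. -/
noncomputable def inL (l n m : ℤ) (h : l + n = m) :
    B'.X l →ₗ[ℂ] TX M.toCpx N.toCpx n →ₗ[ℂ] TX M.toCpx N.toCpx m :=
  { toFun := fun c => tlift M.toCpx N.toCpx n fun i j hij =>
      sgn (l * i) • (tmk M.toCpx N.toCpx i (l + j) m (by omega)).compl₂ (N.lact l j (l + j) rfl c)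
    map_add' := fun c c' => t_ext fun i j h a b => by simp [tlift_mk]
    map_smul' := fun r c => t_ext fun i j h a b => by simp [tlift_mk, smul_comm (sgn _)] }

/-- The right inner action on the tensor product. -/
noncomputable def inR (n l m : ℤ) (h : n + l = m) :
    TX M.toCpx N.toCpx n →ₗ[ℂ] A'.X l →ₗ[ℂ] TX M.toCpx N.toCpx m := LinearMap.flip
  { toFun := fun c => tlift M.toCpx N.toCpx n fun i j hij =>
      sgn (l * j) • tmk M.toCpx N.toCpx (i + l) j m (by omega) ∘ₗ (M.ract i l (i + l) rfl).flip c
    map_add' := fun c c' => t_ext fun i j h a b => by simp [tlift_mk]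
    map_smul' := fun r c => t_ext fun i j h a b => by simp [tlift_mk, smul_comm (sgn _)] }

lemma inL_mk (l i j n m j' : ℤ) (h : i + j = n) (h' : l + n = m) (hj : l + j = j')
    (c : B'.X l) (a : M.X i) (b : N.X j) :
    inL M N l n m h' c (tmk M.toCpx N.toCpx i j n h a b)
      = sgn (l * i) • tmk M.toCpx N.toCpx i j' m (by omega) a (N.lact l j j' hj c b) := by
  subst hj
  simp only [inL, LinearMap.coe_mk, AddHom.coe_mk, tlift_mk, LinearMap.smul_apply,
    LinearMap.compl₂_apply]

lemma inR_mk (l i j n m i' : ℤ) (h : i + j = n) (h' : n + l = m) (hi : i + l = i')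
    (c : A'.X l) (a : M.X i) (b : N.X j) :
    inR M N n l m h' (tmk M.toCpx N.toCpx i j n h a b) c
      = sgn (l * j) • tmk M.toCpx N.toCpx i' j m (by omega) (M.ract i l i' hi a c) b := by
  subst hi
  simp only [inR, LinearMap.coe_mk, AddHom.coe_mk, tlift_mk, LinearMap.smul_apply,
    LinearMap.flip_apply, LinearMap.comp_apply]

lemma inL_one (n : ℤ) (h : 0 + n = n) (x : TX M.toCpx N.toCpx n) :
    inL M N 0 n n h B'.one x = x := by
  induction x using t_induction with
  | h0 => simp
  | hadd x y hx hy => simp only [map_add, hx, hy]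
  | H i j hij a b => rw [inL_mk M N 0 i j n n j hij h (by omega), N.one_lact, zero_mul, sgn_zero,
      one_smul]

lemma inR_one (n : ℤ) (h : n + 0 = n) (x : TX M.toCpx N.toCpx n) :
    inR M N n 0 n h x A'.one = x := by
  induction x using t_induction with
  | h0 => simp
  | hadd x y hx hy => simp only [map_add, LinearMap.add_apply, hx, hy]
  | H i j hij a b => rw [inR_mk M N 0 i j n n i hij h (by omega), M.ract_one, zero_mul, sgn_zero,
      one_smul]

lemma inL_mul (l l' n ll' n' m : ℤ) (h₁ : l + l' = ll') (h₂ : ll' + n = m) (h₃ : l' + n = n')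
    (h₄ : l + n' = m) (c : B'.X l) (c' : B'.X l') (x : TX M.toCpx N.toCpx n) :
    inL M N ll' n m h₂ (B'.mul l l' ll' h₁ c c') x
      = inL M N l n' m h₄ c (inL M N l' n n' h₃ c' x) := by
  induction x using t_induction with
  | h0 => simp
  | hadd x y hx hy => simp only [map_add, hx, hy]
  | H i j hij a b =>
    rw [inL_mk M N l' i j n n' (l' + j) hij h₃ rfl, map_smul,
      inL_mk M N l i (l' + j) n' m (ll' + j) (by omega) h₄ (by omega),
      inL_mk M N ll' i j n m (ll' + j) hij h₂ rfl,
      N.mul_lact l l' j ll' (l' + j) (ll' + j) h₁ rfl rfl (by omega), smul_smul, ← sgn_add]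
    congr 1
    exact congrArg sgn (by rw [← h₁]; ring)

lemma inR_mul (n l l' nl ll' m : ℤ) (h₁ : n + l = nl) (h₂ : nl + l' = m) (h₃ : l + l' = ll')
    (h₄ : n + ll' = m) (x : TX M.toCpx N.toCpx n) (c : A'.X l) (c' : A'.X l') :
    inR M N nl l' m h₂ (inR M N n l nl h₁ x c) c'
      = inR M N n ll' m h₄ x (A'.mul l l' ll' h₃ c c') := by
  induction x using t_induction with
  | h0 => simp
  | hadd x y hx hy => simp only [map_add, LinearMap.add_apply, hx, hy]
  | H i j hij a b =>
    rw [inR_mk M N l i j n nl (i + l) hij h₁ rfl, map_smul, LinearMap.smul_apply,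
      inR_mk M N l' (i + l) j nl m (i + ll') (by omega) h₂ (by omega),
      inR_mk M N ll' i j n m (i + ll') hij h₄ rfl,
      M.ract_mul i l l' (i + l) ll' (i + ll') rfl (by omega) h₃ rfl, smul_smul, ← sgn_add]
    congr 1
    exact congrArg sgn (by rw [← h₃]; ring)

lemma inL_inR (l n l' ln nl m : ℤ) (h₁ : l + n = ln) (h₂ : ln + l' = m) (h₃ : n + l' = nl)
    (h₄ : l + nl = m) (c : B'.X l) (x : TX M.toCpx N.toCpx n) (c' : A'.X l') :
    inR M N ln l' m h₂ (inL M N l n ln h₁ c x) c'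
      = inL M N l nl m h₄ c (inR M N n l' nl h₃ x c') := by
  induction x using t_induction with
  | h0 => simp
  | hadd x y hx hy => simp only [map_add, LinearMap.add_apply, hx, hy]
  | H i j hij a b =>
    rw [inL_mk M N l i j n ln (l + j) hij h₁ rfl, map_smul, LinearMap.smul_apply,
      inR_mk M N l' i (l + j) ln m (i + l') (by omega) h₂ rfl,
      inR_mk M N l' i j n nl (i + l') hij h₃ rfl, map_smul,
      inL_mk M N l (i + l') j nl m (l + j) (by omega) h₄ rfl, smul_smul, smul_smul, ← sgn_add,
      ← sgn_add]
    have : sgn (l' * l) * sgn (l' * l) = 1 := sgn_mul_self _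
    congr 1
    rw [show l * i + l' * (l + j) = l' * l + (l * i + l' * j) by ring,
      show l' * j + l * (i + l') = l' * l + (l * i + l' * j) by ring]

lemma d_inL (l n m l' n' m' : ℤ) (h : l + n = m) (hl : l + 1 = l') (hn : n + 1 = n')
    (hm : m + 1 = m') (c : B'.X l) (x : TX M.toCpx N.toCpx n) :
    (tensC M.toCpx N.toCpx).d m m' hm (inL M N l n m h c x)
      = inL M N l' n m' (by omega) (B'.d l l' hl c) x
        + sgn l • inL M N l n' m' (by omega) c ((tensC M.toCpx N.toCpx).d n n' hn x) := by
  induction x using t_induction with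
  | h0 => simp
  | hadd x y hx hy => simp only [map_add, smul_add, hx, hy]; abel
  | H i j hij a b =>
    subst hl
    rw [inL_mk M N l i j n m (l + j) hij h rfl, map_smul,
      tensC_d _ _ i (l + j) m m' (i + 1) (l + 1 + j) (by omega) hm rfl (by omega),
      tensC_d _ _ i j n n' (i + 1) (j + 1) hij hn rfl rfl, map_add, map_smul,
      N.d_lact l j (l + j) (l + 1) (j + 1) (l + 1 + j) rfl rfl rfl (by omega),
      inL_mk M N (l + 1) i j n m' (l + 1 + j) hij (by omega) rfl,
      inL_mk M N l (i + 1) j n' m' (l + j) (by omega) (by omega) rfl,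
      inL_mk M N l i (j + 1) n' m' (l + 1 + j) (by omega) (by omega) (by omega)]
    simp only [map_add, map_smul, smul_add, smul_smul, mul_add, add_mul, sgn_add, mul_one, one_mul]
    have h1 := sgn_mul_self l
    have h2 := sgn_mul_self i
    match_scalars
    · linear_combination (-sgn (l * i)) * h1
    · ring
    · ring

lemma d_inR (n l m n' l' m' : ℤ) (h : n + l = m) (hn : n + 1 = n') (hl : l + 1 = l')
    (hm : m + 1 = m') (x : TX M.toCpx N.toCpx n) (c : A'.X l) :
    (tensC M.toCpx N.toCpx).d m m' hm (inR M N n l m h x c)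
      = inR M N n' l m' (by omega) ((tensC M.toCpx N.toCpx).d n n' hn x) c
        + sgn n • inR M N n l' m' (by omega) x (A'.d l l' hl c) := by
  induction x using t_induction with
  | h0 => simp
  | hadd x y hx hy => simp only [map_add, LinearMap.add_apply, smul_add, hx, hy]; abel
  | H i j hij a b =>
    have hs : sgn n = sgn i * sgn j := by rw [← hij, sgn_add]
    subst hl
    rw [hs, inR_mk M N l i j n m (i + l) hij h rfl, map_smul,
      tensC_d _ _ (i + l) j m m' (i + (l + 1)) (j + 1) (by omega) hm (by omega) rfl,
      tensC_d _ _ i j n n' (i + 1) (j + 1) hij hn rfl rfl, map_add, map_smul,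
      M.d_ract i l (i + l) (i + 1) (l + 1) (i + (l + 1)) rfl rfl rfl (by omega),
      inR_mk M N (l + 1) i j n m' (i + (l + 1)) hij (by omega) rfl, LinearMap.add_apply,
      LinearMap.smul_apply,
      inR_mk M N l (i + 1) j n' m' (i + (l + 1)) (by omega) (by omega) (by omega),
      inR_mk M N l i (j + 1) n' m' (i + l) (by omega) (by omega) rfl]
    simp only [map_add, map_smul, LinearMap.add_apply, LinearMap.smul_apply, smul_add, smul_smul,
      mul_add, add_mul, sgn_add, mul_one, one_mul]
    have h1 := sgn_mul_self l
    have h2 := sgn_mul_self j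
    match_scalars
    · ring
    · linear_combination (-sgn i * sgn (l * j)) * h2
    · ring

lemma inL_lact (l c n cn ln m : ℤ) (h₁ : c + n = cn) (h₂ : l + cn = m) (h₃ : l + n = ln)
    (h₄ : c + ln = m) (b : B'.X l) (a : A.X c) (x : TX M.toCpx N.toCpx n) :
    inL M N l cn m h₂ b ((tens M N).lact c n cn h₁ a x)
      = sgn (l * c) • (tens M N).lact c ln m h₄ a (inL M N l n ln h₃ b x) := by
  induction x using t_induction with
  | h0 => simp
  | hadd x y hx hy => simp only [map_add, smul_add, hx, hy]
  | H i j hij p q =>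
    rw [tens_lact M N c i j n cn (c + i) hij h₁ rfl,
      inL_mk M N l (c + i) j cn m (l + j) (by omega) h₂ rfl,
      inL_mk M N l i j n ln (l + j) hij h₃ rfl, map_smul,
      tens_lact M N c i (l + j) ln m (c + i) (by omega) h₄ rfl, smul_smul, ← sgn_add, mul_add]

lemma inL_ract (l n c nc ln m : ℤ) (h₁ : n + c = nc) (h₂ : l + nc = m) (h₃ : l + n = ln)
    (h₄ : ln + c = m) (b : B'.X l) (x : TX M.toCpx N.toCpx n) (b' : B.X c) :
    inL M N l nc m h₂ b ((tens M N).ract n c nc h₁ x b')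
      = (tens M N).ract ln c m h₄ (inL M N l n ln h₃ b x) b' := by
  induction x using t_induction with
  | h0 => simp
  | hadd x y hx hy => simp only [map_add, LinearMap.add_apply, hx, hy]
  | H i j hij p q =>
    rw [tens_ract M N c i j n nc (j + c) hij h₁ rfl,
      inL_mk M N l i (j + c) nc m (l + (j + c)) (by omega) h₂ rfl,
      inL_mk M N l i j n ln (l + j) hij h₃ rfl, map_smul, LinearMap.smul_apply,
      tens_ract M N c i (l + j) ln m (l + (j + c)) (by omega) h₄ (by omega),
      N.lact_ract l j c (l + j) (j + c) (l + (j + c)) rfl (by omega) rfl rfl]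

lemma inR_lact (l c n cn nl m : ℤ) (h₁ : c + n = cn) (h₂ : cn + l = m) (h₃ : n + l = nl)
    (h₄ : c + nl = m) (a : A.X c) (x : TX M.toCpx N.toCpx n) (a' : A'.X l) :
    inR M N cn l m h₂ ((tens M N).lact c n cn h₁ a x) a'
      = (tens M N).lact c nl m h₄ a (inR M N n l nl h₃ x a') := by
  induction x using t_induction with
  | h0 => simp
  | hadd x y hx hy => simp only [map_add, LinearMap.add_apply, hx, hy]
  | H i j hij p q =>
    rw [tens_lact M N c i j n cn (c + i) hij h₁ rfl,
      inR_mk M N l (c + i) j cn m (c + (i + l)) (by omega) h₂ (by omega),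
      inR_mk M N l i j n nl (i + l) hij h₃ rfl, map_smul,
      tens_lact M N c (i + l) j nl m (c + (i + l)) (by omega) h₄ rfl,
      M.lact_ract c i l (c + i) (i + l) (c + (i + l)) rfl (by omega) rfl rfl]

lemma inR_ract (n c l nc nl m : ℤ) (h₁ : n + c = nc) (h₂ : nc + l = m) (h₃ : n + l = nl)
    (h₄ : nl + c = m) (x : TX M.toCpx N.toCpx n) (b : B.X c) (a : A'.X l) :
    inR M N nc l m h₂ ((tens M N).ract n c nc h₁ x b) a
      = sgn (l * c) • (tens M N).ract nl c m h₄ (inR M N n l nl h₃ x a) b := by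
  induction x using t_induction with
  | h0 => simp
  | hadd x y hx hy => simp only [map_add, LinearMap.add_apply, smul_add, hx, hy]
  | H i j hij p q =>
    rw [tens_ract M N c i j n nc (j + c) hij h₁ rfl,
      inR_mk M N l i (j + c) nc m (i + l) (by omega) h₂ rfl,
      inR_mk M N l i j n nl (i + l) hij h₃ rfl, map_smul, LinearMap.smul_apply,
      tens_ract M N c (i + l) j nl m (j + c) (by omega) h₄ rfl, smul_smul, ← sgn_add, mul_add,
      add_comm]

end Tens

end HodgeCY

namespace HodgeCY

open Cpx DGBimod

section InnerHom

variable {A A' : DGAlg.{u}} {B B' : DGAlg.{v}} (M : DGBimod.{u, u, u} A A')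
  (N : DGBimod.{v, v, v} B' B) (F : DGBimod.{u, v, max u v} A B)

/-- The left action on `Hom(F, M ⊗ N)` through the inner action on `M ⊗ N`. -/
noncomputable def ihL (l k m : ℤ) (h : l + k = m) (b : B'.X l) (ψ : homX F (tens M N) k) :
    homX F (tens M N) m :=
  ⟨fun t => inL M N l (t.p + k) t.q (by have := t.hpq; omega) b ∘ₗ ψ.1 ⟨t.p, t.p + k, rfl⟩, by
    constructor
    · intro c i j i' j' h₁ hi hj a x
      simp only [LinearMap.comp_apply]
      rw [ψ.2.1 c i j (i + k) (j + k) h₁ rfl rfl, map_smul,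
        inL_lact M N l c (i + k) (j + k) i' j' (by omega) (by omega) (by omega) (by omega),
        smul_smul, ← sgn_add, ← add_mul, add_comm k l, h]
    · intro i c j i' j' h₁ hi hj x b'
      simp only [LinearMap.comp_apply]
      rw [ψ.2.2 i c j (i + k) (j + k) h₁ rfl rfl,
        inL_ract M N l (i + k) c (j + k) i' j' (by omega) (by omega) (by omega) (by omega)]⟩

lemma ihL_apply (l k m : ℤ) (h : l + k = m) (b : B'.X l) (ψ : homX F (tens M N) k)
    (i q j : ℤ) (hq : i + k = q) (hj : i + m = j) (x : F.X i) :
    (ihL M N F l k m h b ψ).1 ⟨i, j, hj⟩ x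
      = inL M N l q j (by omega) b (ψ.1 ⟨i, q, hq⟩ x) := by
  subst hq; rfl

/-- The right action on `Hom(F, M ⊗ N)` through the inner action on `M ⊗ N`. -/
noncomputable def ihR (k l m : ℤ) (h : k + l = m) (ψ : homX F (tens M N) k) (a : A'.X l) :
    homX F (tens M N) m :=
  ⟨fun t => sgn (l * t.p) • (inR M N (t.p + k) l t.q (by have := t.hpq; omega)).flip a
      ∘ₗ ψ.1 ⟨t.p, t.p + k, rfl⟩, by
    constructor
    · intro c i j i' j' h₁ hi hj a' x
      simp only [LinearMap.comp_apply, LinearMap.smul_apply, LinearMap.flip_apply]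
      rw [ψ.2.1 c i j (i + k) (j + k) h₁ rfl rfl, map_smul, LinearMap.smul_apply, map_smul,
        inR_lact M N l c (i + k) (j + k) i' j' (by omega) (by omega) (by omega) (by omega),
        smul_smul, smul_smul, ← sgn_add, ← sgn_add]
      congr 1
      exact congrArg sgn (by rw [← h₁, ← h]; ring)
    · intro i c j i' j' h₁ hi hj x b'
      change sgn (l * j) • inR M N (j + k) l j' (by omega) (ψ.1 ⟨j, j + k, rfl⟩ (F.ract i c j h₁ x b')) a
        = (tens M N).ract i' c j' (by omega)
          (sgn (l * i) • inR M N (i + k) l i' (by omega) (ψ.1 ⟨i, i + k, rfl⟩ x) a) b'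
      have e : sgn (l * j) * sgn (l * c) = sgn (l * i) := by
        rw [← h₁, mul_add, sgn_add, mul_assoc, sgn_mul_self, mul_one]
      rw [map_smul, LinearMap.smul_apply, ψ.2.2 i c j (i + k) (j + k) h₁ rfl rfl,
        inR_ract M N (i + k) c l (j + k) i' j' (by omega) (by omega) (by omega) (by omega),
        smul_smul, e]⟩

lemma ihR_apply (k l m : ℤ) (h : k + l = m) (ψ : homX F (tens M N) k) (a : A'.X l)
    (i q j : ℤ) (hq : i + k = q) (hj : i + m = j) (x : F.X i) :
    (ihR M N F k l m h ψ a).1 ⟨i, j, hj⟩ x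
      = sgn (l * i) • inR M N q l j (by omega) (ψ.1 ⟨i, q, hq⟩ x) a := by
  subst hq; rfl

/-- The map `ihL`, as a bilinear map. -/
noncomputable def ihLBilin (l k m : ℤ) (h : l + k = m) :
    B'.X l →ₗ[ℂ] homX F (tens M N) k →ₗ[ℂ] homX F (tens M N) m :=
  LinearMap.mk₂ ℂ (ihL M N F l k m h)
    (fun _ _ _ => homX_ext fun i j hj x => by simp [ihL])
    (fun _ _ _ => homX_ext fun i j hj x => by simp [ihL])
    (fun _ _ _ => homX_ext fun i j hj x => by simp [ihL])
    (fun _ _ _ => homX_ext fun i j hj x => by simp [ihL])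

/-- The map `ihR`, as a bilinear map. -/
noncomputable def ihRBilin (k l m : ℤ) (h : k + l = m) :
    homX F (tens M N) k →ₗ[ℂ] A'.X l →ₗ[ℂ] homX F (tens M N) m :=
  LinearMap.mk₂ ℂ (ihR M N F k l m h)
    (fun _ _ _ => homX_ext fun i j hj x => by simp [ihR])
    (fun _ _ _ => homX_ext fun i j hj x => by simp [ihR, smul_comm (sgn _)])
    (fun _ _ _ => homX_ext fun i j hj x => by simp [ihR])
    (fun _ _ _ => homX_ext fun i j hj x => by simp [ihR, smul_comm (sgn _)])

lemma homD_ihL (l k m l' k' m' : ℤ) (h : l + k = m) (hl : l + 1 = l') (hk : k + 1 = k')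
    (hm : m + 1 = m') (b : B'.X l) (ψ : homX F (tens M N) k) :
    homD F (tens M N) m m' hm (ihL M N F l k m h b ψ)
      = ihL M N F l' k m' (by omega) (B'.d l l' hl b) ψ
        + sgn l • ihL M N F l k' m' (by omega) b (homD F (tens M N) k k' hk ψ) :=
  homX_ext fun i j hj x => by
    change _ = (ihL M N F l' k m' (by omega) (B'.d l l' hl b) ψ).1 ⟨i, j, hj⟩ x
      + sgn l • (ihL M N F l k' m' (by omega) b (homD F (tens M N) k k' hk ψ)).1 ⟨i, j, hj⟩ x
    rw [homD_apply _ _ m m' hm _ i j (i + 1) (i + m) hj rfl rfl,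
      ihL_apply M N F l k m h _ _ i (i + k) (i + m) rfl rfl,
      ihL_apply M N F l k m h _ _ (i + 1) (i + k') j (by omega) (by omega),
      ihL_apply M N F l' k m' (by omega) _ _ i (i + k) j rfl hj,
      ihL_apply M N F l k' m' (by omega) _ _ i (i + k') j rfl hj,
      homD_apply _ _ k k' hk _ i (i + k') (i + 1) (i + k) rfl rfl rfl,
      d_inL M N l (i + k) (i + m) l' (i + k') j (by omega) hl (by omega) (by omega),
      show sgn m = sgn l * sgn k by rw [← sgn_add, h]]
    simp only [map_sub, map_smul]
    module

lemma homD_ihR (k l m k' l' m' : ℤ) (h : k + l = m) (hk : k + 1 = k') (hl : l + 1 = l')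
    (hm : m + 1 = m') (ψ : homX F (tens M N) k) (a : A'.X l) :
    homD F (tens M N) m m' hm (ihR M N F k l m h ψ a)
      = ihR M N F k' l m' (by omega) (homD F (tens M N) k k' hk ψ) a
        + sgn k • ihR M N F k l' m' (by omega) ψ (A'.d l l' hl a) :=
  homX_ext fun i j hj x => by
    change _ = (ihR M N F k' l m' (by omega) (homD F (tens M N) k k' hk ψ) a).1 ⟨i, j, hj⟩ x
      + sgn k • (ihR M N F k l' m' (by omega) ψ (A'.d l l' hl a)).1 ⟨i, j, hj⟩ x
    rw [homD_apply _ _ m m' hm _ i j (i + 1) (i + m) hj rfl rfl,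
      ihR_apply M N F k l m h _ _ i (i + k) (i + m) rfl rfl,
      ihR_apply M N F k l m h _ _ (i + 1) (i + k') j (by omega) (by omega),
      ihR_apply M N F k' l m' (by omega) _ _ i (i + k') j rfl hj,
      ihR_apply M N F k l' m' (by omega) _ _ i (i + k) j rfl hj,
      homD_apply _ _ k k' hk _ i (i + k') (i + 1) (i + k) rfl rfl rfl, map_smul,
      d_inR M N (i + k) l (i + m) (i + k') l' j (by omega) (by omega) hl (by omega),
      show sgn m = sgn k * sgn l by rw [← sgn_add, h]]
    simp only [map_sub, map_smul, LinearMap.sub_apply, LinearMap.smul_apply]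
    have e1 : sgn (l' * i) = sgn (l * i) * sgn i := by rw [← sgn_add, ← hl]; ring_nf
    have e2 : sgn (l * (i + 1)) = sgn (l * i) * sgn l := by rw [← sgn_add]; ring_nf
    have h1 := sgn_mul_self l
    rw [e1, e2, sgn_add]
    match_scalars
    · ring
    · ring
    · linear_combination (-sgn k * sgn (l * i)) * h1

/-- The `B'`-`A'`-bimodule `Hom(F, M ⊗ N)`. -/
noncomputable abbrev innerHom : DGBimod.{v, u, max u v} B' A' where
  toCpx := hom F (tens M N)
  lact := ihLBilin M N F
  ract := ihRBilin M N F
  one_lact k h ψ := homX_ext fun i j hj x => by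
    refine (ihL_apply M N F 0 k k h _ _ i j j hj hj x).trans ?_
    rw [inL_one]
  ract_one k h ψ := homX_ext fun i j hj x => by
    refine (ihR_apply M N F k 0 k h _ _ i j j hj hj x).trans ?_
    rw [inR_one, zero_mul, sgn_zero, one_smul]
  mul_lact l l' k ll' l'k n h₁ h₂ h₃ h₄ b b' ψ := homX_ext fun i j hj x => by
    refine (ihL_apply M N F ll' k n h₂ _ _ i (i + k) j rfl hj x).trans
      (Eq.trans ?_ (ihL_apply M N F l l'k n h₄ _ _ i (i + l'k) j rfl hj x).symm)
    rw [inL_mul M N l l' (i + k) ll' (i + l'k) j h₁ (by omega) (by omega) (by omega)]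
    exact congrArg _ (ihL_apply M N F l' k l'k h₃ _ _ i (i + k) (i + l'k) rfl rfl x).symm
  ract_mul k l l' kl ll' n h₁ h₂ h₃ h₄ ψ a a' := homX_ext fun i j hj x => by
    change (ihR M N F kl l' n h₂ (ihR M N F k l kl h₁ ψ a) a').1 ⟨i, j, hj⟩ x
      = (ihR M N F k ll' n h₄ ψ (A'.mul l l' ll' h₃ a a')).1 ⟨i, j, hj⟩ x
    rw [ihR_apply M N F kl l' n h₂ _ _ i (i + kl) j rfl hj,
      ihR_apply M N F k l kl h₁ _ _ i (i + k) (i + kl) rfl rfl,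
      ihR_apply M N F k ll' n h₄ _ _ i (i + k) j rfl hj, map_smul, LinearMap.smul_apply,
      inR_mul M N (i + k) l l' (i + kl) ll' j (by omega) (by omega) h₃ (by omega), smul_smul,
      ← sgn_add]
    congr 1
    exact congrArg sgn (by rw [← h₃]; ring)
  lact_ract l k l' lk kl n h₁ h₂ h₃ h₄ b ψ a := homX_ext fun i j hj x => by
    change (ihR M N F lk l' n h₂ (ihL M N F l k lk h₁ b ψ) a).1 ⟨i, j, hj⟩ x
      = (ihL M N F l kl n h₄ b (ihR M N F k l' kl h₃ ψ a)).1 ⟨i, j, hj⟩ x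
    rw [ihR_apply M N F lk l' n h₂ _ _ i (i + lk) j rfl hj,
      ihL_apply M N F l k lk h₁ _ _ i (i + k) (i + lk) rfl rfl,
      ihL_apply M N F l kl n h₄ _ _ i (i + kl) j rfl hj,
      ihR_apply M N F k l' kl h₃ _ _ i (i + k) (i + kl) rfl rfl, map_smul,
      inL_inR M N l (i + k) l' (i + lk) (i + kl) j (by omega) (by omega) (by omega) (by omega)]
  d_lact l k m l' k' m' h hl hk hm b ψ := homD_ihL M N F l k m l' k' m' h hl hk hm b ψ
  d_ract k l m k' l' m' h hk hl hm ψ a := homD_ihR M N F k l m k' l' m' h hk hl hm ψ a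

end InnerHom

end HodgeCY

namespace HodgeCY

open Cpx DGBimod

/-! ### The Künneth formula -/

section Kunneth

variable {K K' K'' : Cpx.{u}} {L L' L'' : Cpx.{v}}

namespace Cpx

lemma GMap.comm_zero (f : GMap K L 0) (i j : ℤ) (h : i + 1 = j) (x : K.X i) :
    L.d i j h (f.f i i (add_zero i) x) = f.f j j (add_zero j) (K.d i j h x) := by
  rw [f.comm i i j j (add_zero i) h h, sgn_zero, one_smul]

/-- The composition of morphisms of complexes of degree `0`. -/
def GMap.comp (g : GMap K' K'' 0) (f : GMap K K' 0) : GMap K K'' 0 where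
  f i j h := g.f j j (add_zero j) ∘ₗ f.f i j h
  comm := by
    intro i j i' j' h hi hj x
    obtain rfl : i = j := by omega
    obtain rfl : i' = j' := by omega
    rw [sgn_zero, one_smul, LinearMap.comp_apply, LinearMap.comp_apply, g.comm_zero, f.comm_zero]

/-- Every graded linear map between the cohomologies is induced by a morphism of complexes. -/
lemma exists_gmap (φ : ∀ i, L.H i →ₗ[ℂ] K.H i) :
    ∃ h : GMap L K 0, ∀ (i : ℤ) (z : L.Z i), ∃ hz : K.IsCyc (h.f i i (add_zero i) z.1),
      (Submodule.Quotient.mk ⟨_, hz⟩ : K.H i) = φ i (Submodule.Quotient.mk z) := by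
  have h1 : ∀ i, ∃ σ : K.H i →ₗ[ℂ] K.Z i, (K.B i).mkQ ∘ₗ σ = LinearMap.id := fun i =>
    LinearMap.exists_rightInverse_of_surjective _ (Submodule.range_mkQ _)
  have h2 : ∀ i, ∃ π : L.X i →ₗ[ℂ] L.H i, π ∘ₗ (L.Z i).subtype = (L.B i).mkQ := fun i =>
    LinearMap.exists_extend _
  choose σ hσ using h1
  choose π hπ using h2
  have hπ' : ∀ i (z : L.Z i), π i z.1 = Submodule.Quotient.mk z := fun i z =>
    LinearMap.congr_fun (hπ i) z
  refine ⟨⟨fun i j h => (K.Z j).subtype ∘ₗ σ j ∘ₗ φ j ∘ₗ π j ∘ₗ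
      (LinearEquiv.cast (R := ℂ) (M := L.X) (show i = j by omega)).toLinearMap, ?_⟩, ?_⟩
  · intro i j i' j' h hi hj x
    obtain rfl : i = j := by omega
    obtain rfl : i' = j' := by omega
    have e1 : π i' (L.d i i' hi x) = 0 := by
      rw [hπ' i' ⟨_, (isBd_d hi x).isCyc⟩]
      exact (mk_eq_zero _).2 (isBd_d hi x)
    simp only [LinearMap.comp_apply, LinearEquiv.coe_coe, LinearEquiv.cast_apply, cast_eq, e1,
      map_zero, smul_zero]
    exact IsCyc.d (σ i (φ i (π i x))).2 i' hi
  · intro i z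
    refine ⟨(σ i (φ i (π i z.1))).2, ?_⟩
    exact (LinearMap.congr_fun (hσ i) (φ i (π i z.1))).trans (congrArg (φ i) (hπ' i z))

lemma GMap.IsQI.exists_quasiInverse {f : GMap K L 0} (hf : f.IsQI) :
    ∃ h : GMap L K 0,
      (∀ (i : ℤ) (x : K.X i), K.IsCyc x →
        K.IsBd (h.f i i (add_zero i) (f.f i i (add_zero i) x) - x)) ∧
      ∀ (i : ℤ) (y : L.X i), L.IsCyc y →
        L.IsBd (f.f i i (add_zero i) (h.f i i (add_zero i) y) - y) := by
  let e := fun i => LinearEquiv.ofBijective _ (hf.bijective i i (add_zero i))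
  obtain ⟨h, hh⟩ := exists_gmap fun i => (e i).symm.toLinearMap
  refine ⟨h, fun i x hx => ?_, fun i y hy => ?_⟩
  · obtain ⟨hz, e1⟩ := hh i ⟨f.f i i (add_zero i) x, f.isCyc _ hx⟩
    have e2 : (e i).symm (Submodule.Quotient.mk ⟨f.f i i (add_zero i) x, f.isCyc _ hx⟩)
        = Submodule.Quotient.mk ⟨x, hx⟩ := by
      rw [LinearEquiv.symm_apply_eq]; rfl
    exact (mk_eq_mk _ _).1 (e1.trans e2)
  · obtain ⟨hz, e1⟩ := hh i ⟨y, hy⟩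
    exact (mk_eq_mk (⟨f.f i i (add_zero i) (h.f i i (add_zero i) y), f.isCyc _ hz⟩ : L.Z i)
      ⟨y, hy⟩).1 (((e i).eq_symm_apply.1 e1))

end Cpx

/-- The tensor product of two morphisms of complexes. -/
noncomputable def tensG (f : GMap K K' 0) (f' : GMap L L' 0) :
    GMap (tensC K L) (tensC K' L') 0 where
  f n m h := tlift K L n fun i j hij => (tmk K' L' i j m (by omega)).compl₁₂
    (f.f i i (add_zero i)) (f'.f j j (add_zero j))
  comm := by
    intro n m n' m' h hn hm x
    obtain rfl : n = m := by omega
    obtain rfl : n' = m' := by omega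
    rw [sgn_zero, one_smul]
    induction x using t_induction with
    | h0 => simp only [map_zero]
    | hadd x y hx hy => simp only [map_add, hx, hy]
    | H i j hij a b =>
      rw [tlift_mk, LinearMap.compl₁₂_apply, tensC_d _ _ i j n n' (i + 1) (j + 1) hij hm rfl rfl,
        tensC_d _ _ i j n n' (i + 1) (j + 1) hij hn rfl rfl, map_add, map_smul, tlift_mk, tlift_mk,
        LinearMap.compl₁₂_apply, LinearMap.compl₁₂_apply, f.comm_zero, f'.comm_zero]

lemma tensG_mk (f : GMap K K' 0) (f' : GMap L L' 0) (i j n : ℤ) (hij : i + j = n) (h : n + 0 = n)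
    (a : K.X i) (b : L.X j) : (tensG f f').f n n h (tmk K L i j n hij a b)
      = tmk K' L' i j n hij (f.f i i (add_zero i) a) (f'.f j j (add_zero j) b) := by
  simp only [tensG, tlift_mk, LinearMap.compl₁₂_apply]

lemma tensG_comp (g : GMap K' K'' 0) (f : GMap K K' 0) (g' : GMap L' L'' 0) (f' : GMap L L' 0)
    (n : ℤ) (x : TX K L n) :
    (tensG g g').f n n (add_zero n) ((tensG f f').f n n (add_zero n) x)
      = (tensG (g.comp f) (g'.comp f')).f n n (add_zero n) x := by
  induction x using t_induction with
  | h0 => simp only [map_zero]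
  | hadd x y hx hy => simp only [map_add, hx, hy]
  | H i j hij a b => rw [tensG_mk, tensG_mk, tensG_mk]; rfl

/-- The difference of an endomorphism and the identity. -/
def Cpx.GMap.subId (g : GMap K K 0) : GMap K K 0 where
  f i j h := g.f i j h - (LinearEquiv.cast (R := ℂ) (M := K.X) (show i = j by omega)).toLinearMap
  comm := by
    intro i j i' j' h hi hj x
    obtain rfl : i = j := by omega
    obtain rfl : i' = j' := by omega
    rw [sgn_zero, one_smul, LinearMap.sub_apply, LinearMap.sub_apply, map_sub, g.comm_zero]
    rfl

lemma tensG_sub_isBd {g : GMap K K 0} {g' : GMap L L 0}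
    (hg : ∀ (i : ℤ) (x : K.X i), K.IsCyc x → K.IsBd (g.f i i (add_zero i) x - x))
    (hg' : ∀ (i : ℤ) (x : L.X i), L.IsCyc x → L.IsBd (g'.f i i (add_zero i) x - x))
    (n : ℤ) (z : TX K L n) (hz : (tensC K L).IsCyc z) :
    (tensC K L).IsBd ((tensG g g').f n n (add_zero n) z - z) := by
  obtain ⟨s, hs⟩ := exists_homotopy g.subId hg
  obtain ⟨s', hs'⟩ := exists_homotopy g'.subId hg'
  have hs2 : ∀ (i : ℤ) (x : K.X i), g.f i i (add_zero i) x = x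
      + K.d (i - 1) i (by omega) (s i (i - 1) (by omega) x)
      + s (i + 1) i rfl (K.d i (i + 1) rfl x) := fun i x => by
    rw [add_assoc, ← hs i (i - 1) (i + 1) (by omega) rfl x]
    exact (add_sub_cancel x _).symm
  have hs3 : ∀ (i : ℤ) (x : L.X i), g'.f i i (add_zero i) x = x
      + L.d (i - 1) i (by omega) (s' i (i - 1) (by omega) x)
      + s' (i + 1) i rfl (L.d i (i + 1) rfl x) := fun i x => by
    rw [add_assoc, ← hs' i (i - 1) (i + 1) (by omega) rfl x]
    exact (add_sub_cancel x _).symm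
  let S : ∀ n m : ℤ, m + 1 = n → TX K L n →ₗ[ℂ] TX K L m := fun n m h =>
    tlift K L n fun i j hij =>
      (tmk K L (i - 1) j m (by omega)).compl₁₂ (s i (i - 1) (by omega)) (g'.f j j (add_zero j))
      + sgn i • (tmk K L i (j - 1) m (by omega)).compl₂ (s' j (j - 1) (by omega))
  have hS : ∀ (n m i j i' j' : ℤ) (h : m + 1 = n) (hij : i + j = n) (hi : i' + 1 = i)
      (hj : j' + 1 = j) (a : K.X i) (b : L.X j), S n m h (tmk K L i j n hij a b)
      = tmk K L i' j m (by omega) (s i i' hi a) (g'.f j j (add_zero j) b)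
        + sgn i • tmk K L i j' m (by omega) a (s' j j' hj b) := by
    intro n m i j i' j' h hij hi hj a b
    obtain rfl : i' = i - 1 := by omega
    obtain rfl : j' = j - 1 := by omega
    simp only [S, tlift_mk, LinearMap.add_apply, LinearMap.smul_apply, LinearMap.compl₂_apply,
      LinearMap.compl₁₂_apply]
  have key : ∀ x : TX K L n, (tensG g g').f n n (add_zero n) x - x
      = (tensC K L).d (n - 1) n (by omega) (S n (n - 1) (by omega) x)
        + S (n + 1) n rfl ((tensC K L).d n (n + 1) rfl x) := by
    intro x
    induction x using t_induction with
    | h0 => simp only [map_zero, sub_zero, add_zero]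
    | hadd x y hx hy =>
      simp only [map_add]
      rw [add_sub_add_comm, hx, hy]
      abel
    | H i j hij a b =>
      rw [tensG_mk, hS n (n - 1) i j (i - 1) (j - 1) (by omega) hij (by omega) (by omega), map_add,
        map_smul,
        tensC_d _ _ (i - 1) j (n - 1) n i (j + 1) (by omega) (by omega) (by omega) rfl,
        tensC_d _ _ i (j - 1) (n - 1) n (i + 1) j (by omega) (by omega) rfl (by omega),
        tensC_d _ _ i j n (n + 1) (i + 1) (j + 1) hij rfl rfl rfl, map_add, map_smul,
        hS (n + 1) n (i + 1) j i (j - 1) rfl (by omega) rfl (by omega),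
        hS (n + 1) n i (j + 1) (i - 1) j rfl (by omega) (by omega) rfl, hs2 i a,
        g'.comm_zero, sgn_add, sgn_one, show sgn (i - 1) = -sgn i by
          rw [sub_eq_add_neg, sgn_add, sgn_neg, sgn_one]; ring]
      have h1 := sgn_mul_self i
      have h2 : tmk K L i j n hij a (g'.f j j (add_zero j) b) = tmk K L i j n hij a b
          + tmk K L i j n hij a (L.d (j - 1) j (by omega) (s' j (j - 1) (by omega) b))
          + tmk K L i j n hij a (s' (j + 1) j rfl (L.d j (j + 1) rfl b)) := by
        rw [← map_add, ← map_add, ← hs3]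
      simp only [map_add, LinearMap.add_apply]
      rw [h2]
      simp only [smul_add, smul_smul, h1, one_smul]
      module
  rw [key z, hz.d, map_zero, add_zero]
  exact isBd_d _ _

theorem tensG_isQI {f : GMap K K' 0} {f' : GMap L L' 0} (hf : f.IsQI) (hf' : f'.IsQI) :
    (tensG f f').IsQI := by
  obtain ⟨h, h1, h2⟩ := hf.exists_quasiInverse
  obtain ⟨h', h1', h2'⟩ := hf'.exists_quasiInverse
  constructor
  · intro i j e y hy
    obtain rfl : i = j := by omega
    refine ⟨(tensG h h').f i i (add_zero i) y, (tensG h h').isCyc _ hy, ?_⟩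
    rw [tensG_comp]
    exact tensG_sub_isBd h2 h2' i y hy
  · intro i j e x hx hb
    obtain rfl : i = j := by omega
    have e1 := (tensG h h').isBd (add_zero i) hb
    rw [tensG_comp] at e1
    have e2 := e1.sub (tensG_sub_isBd (g := h.comp f) (g' := h'.comp f') h1 h1' i x hx)
    rwa [sub_sub_cancel] at e2

/-- The functional on the tensor product given by functionals on the factors. -/
noncomputable def tfun (K : Cpx.{u}) (L : Cpx.{v}) (i j n : ℤ) (h : i + j = n)
    (α : Module.Dual ℂ (K.X i)) (β : Module.Dual ℂ (L.X j)) : Module.Dual ℂ (TX K L n) :=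
  (LinearMap.mul' ℂ ℂ ∘ₗ TensorProduct.map α β) ∘ₗ
    DirectSum.component ℂ {p : ℤ × ℤ // p.1 + p.2 = n} (fun p => K.X p.1.1 ⊗[ℂ] L.X p.1.2)
      ⟨(i, j), h⟩

lemma tfun_mk (i j n : ℤ) (h : i + j = n) (α : Module.Dual ℂ (K.X i)) (β : Module.Dual ℂ (L.X j))
    (a : K.X i) (b : L.X j) : tfun K L i j n h α β (tmk K L i j n h a b) = α a * β b := by
  simp [tfun, tmk, DirectSum.component.lof_self]

lemma tfun_mk_of_ne {i j i' j' n : ℤ} (h : i + j = n) (h' : i' + j' = n) (hi : i ≠ i')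
    (α : Module.Dual ℂ (K.X i)) (β : Module.Dual ℂ (L.X j)) (a : K.X i') (b : L.X j') :
    tfun K L i j n h α β (tmk K L i' j' n h' a b) = 0 := by
  have : (⟨(i', j'), h'⟩ : {p : ℤ × ℤ // p.1 + p.2 = n}) ≠ ⟨(i, j), h⟩ := fun e =>
    hi (congrArg (fun p => p.1.1) e).symm
  simp [tfun, tmk, DirectSum.component.of, this]

/-- The projection to a finite family of cocycles. -/
def finProj (m : ℤ → ℕ) (k : ∀ i, Fin (m i) → K.X i) (α : ∀ i, Fin (m i) → Module.Dual ℂ (K.X i))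
    (hk : ∀ i t, K.IsCyc (k i t)) (hα : ∀ i t x, K.IsBd x → α i t x = 0) : GMap K K 0 where
  f i j h := (∑ t, (α j t).smulRight (k j t)) ∘ₗ
    (LinearEquiv.cast (R := ℂ) (M := K.X) (show i = j by omega)).toLinearMap
  comm := by
    intro i j i' j' h hi hj x
    obtain rfl : i = j := by omega
    obtain rfl : i' = j' := by omega
    simp [(hk i _).d i' hj, hα i' _ _ (isBd_d hi x)]

lemma finProj_apply (m : ℤ → ℕ) (k : ∀ i, Fin (m i) → K.X i)
    (α : ∀ i, Fin (m i) → Module.Dual ℂ (K.X i)) (hk : ∀ i t, K.IsCyc (k i t))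
    (hα : ∀ i t x, K.IsBd x → α i t x = 0) (i : ℤ) (x : K.X i) :
    (finProj m k α hk hα).f i i (add_zero i) x = ∑ t, α i t x • k i t := by
  simp [finProj]

/-- A finite family of cocycles and functionals that represents the identity on cohomology. -/
structure Casimir (K : Cpx.{u}) (m : ℤ → ℕ) where
  k : ∀ i, Fin (m i) → K.X i
  α : ∀ i, Fin (m i) → Module.Dual ℂ (K.X i)
  cyc : ∀ i t, K.IsCyc (k i t)
  bd : ∀ i t x, K.IsBd x → α i t x = 0
  sum : ∀ i x, K.IsCyc x → K.IsBd ((∑ t, α i t x • k i t) - x)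

theorem tensC_isBd_of_tfun {m m' : ℤ → ℕ} (c : Casimir K m) (c' : Casimir L m') {n : ℤ}
    {z : TX K L n} (hz : (tensC K L).IsCyc z)
    (h0 : ∀ i j h t s, tfun K L i j n h (c.α i t) (c'.α j s) z = 0) : (tensC K L).IsBd z := by
  have key := tensG_sub_isBd (g := finProj m c.k c.α c.cyc c.bd)
    (g' := finProj m' c'.k c'.α c'.cyc c'.bd)
    (fun i x hx => by rw [finProj_apply]; exact c.sum i x hx)
    (fun i x hx => by rw [finProj_apply]; exact c'.sum i x hx) n z hz
  have e0 : (tensG (finProj m c.k c.α c.cyc c.bd) (finProj m' c'.k c'.α c'.cyc c'.bd)).f n n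
      (add_zero n) z = 0 := by
    classical
    have hsum := DirectSum.sum_support_of z
    rw [← hsum, map_sum]
    refine Finset.sum_eq_zero fun p _ => ?_
    have e1 : ∀ y : K.X p.1.1 ⊗[ℂ] L.X p.1.2,
        (tensG (finProj m c.k c.α c.cyc c.bd) (finProj m' c'.k c'.α c'.cyc c'.bd)).f n n
          (add_zero n) (DirectSum.of (fun p : {p : ℤ × ℤ // p.1 + p.2 = n} =>
            K.X p.1.1 ⊗[ℂ] L.X p.1.2) p y)
        = ∑ t, ∑ s, (LinearMap.mul' ℂ ℂ (TensorProduct.map (c.α p.1.1 t) (c'.α p.1.2 s) y)) •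
            tmk K L p.1.1 p.1.2 n p.2 (c.k p.1.1 t) (c'.k p.1.2 s) := by
      intro y
      induction y using TensorProduct.induction_on with
      | zero => simp only [map_zero, zero_smul, Finset.sum_const_zero]
      | add x y hx hy =>
        simp only [map_add, hx, hy, add_smul, Finset.sum_add_distrib]
      | tmul a b =>
        refine (tensG_mk _ _ p.1.1 p.1.2 n p.2 (add_zero n) a b).trans ?_
        rw [finProj_apply, finProj_apply]
        simp only [map_sum, LinearMap.sum_apply, map_smul, LinearMap.smul_apply,
          TensorProduct.map_tmul, LinearMap.mul'_apply, Finset.smul_sum, smul_smul]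
        rw [Finset.sum_comm]
        simp only [mul_comm]
    rw [e1]
    refine Finset.sum_eq_zero fun t _ => Finset.sum_eq_zero fun s _ => ?_
    have := h0 p.1.1 p.1.2 p.2 t s
    have e2 : LinearMap.mul' ℂ ℂ (TensorProduct.map (c.α p.1.1 t) (c'.α p.1.2 s) (z p)) = 0 := this
    rw [e2, zero_smul]
  rw [e0, zero_sub] at key
  have := key.neg
  rwa [neg_neg] at this

theorem tensC_finiteDimensional {m m' : ℤ → ℕ} (c : Casimir K m) (c' : Casimir L m')
    (hm : {i | m i ≠ 0}.Finite) (n : ℤ) : FiniteDimensional ℂ ((tensC K L).H n) := by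
  have : Finite {i | m i ≠ 0} := hm
  let Φ : (tensC K L).Z n →ₗ[ℂ]
      ((Σ i : {i | m i ≠ 0}, Fin (m i) × Fin (m' (n - i))) → ℂ) :=
    LinearMap.pi fun x => tfun K L x.1.1 (n - x.1.1) n (by omega) (c.α _ x.2.1) (c'.α _ x.2.2) ∘ₗ
      ((tensC K L).Z n).subtype
  have hle : LinearMap.ker Φ ≤ (tensC K L).B n := by
    intro z hz
    refine tensC_isBd_of_tfun c c' z.2 fun i j h t s => ?_
    obtain rfl : j = n - i := by omega
    exact congrFun (LinearMap.mem_ker.1 hz) ⟨⟨i, fun h => (Fin.cast h t).elim0⟩, (t, s)⟩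
  have : FiniteDimensional ℂ ((tensC K L).Z n ⧸ LinearMap.ker Φ) :=
    LinearEquiv.finiteDimensional Φ.quotKerEquivRange.symm
  exact Module.Finite.of_surjective _ (Submodule.factor_surjective hle)

/-- A separating family of functionals on the cohomology yields a representation of the
identity. -/
lemma exists_casimir_of_separating {i : ℤ} [FiniteDimensional ℂ (K.H i)] {V : Type w}
    [AddCommGroup V] [Module ℂ V] (Φ : V →ₗ[ℂ] Module.Dual ℂ (K.X i))
    (hbd : ∀ v x, K.IsBd x → Φ v x = 0)
    (hsep : ∀ x, K.IsCyc x → (∀ v, Φ v x = 0) → K.IsBd x) :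
    ∃ (k : Fin (Module.finrank ℂ (K.H i)) → K.X i) (a : Fin (Module.finrank ℂ (K.H i)) → V),
      (∀ t, K.IsCyc (k t)) ∧ ∀ x, K.IsCyc x → K.IsBd ((∑ t, Φ (a t) x • k t) - x) := by
  let Ψ : V →ₗ[ℂ] Module.Dual ℂ (K.H i) :=
    { toFun := fun v => Submodule.liftQ _ (Φ v ∘ₗ (K.Z i).subtype) fun x hx => hbd v x.1 hx
      map_add' := fun v v' => Submodule.linearMap_qext _ (LinearMap.ext fun x =>
        LinearMap.congr_fun (map_add Φ v v') x.1)
      map_smul' := fun c v => Submodule.linearMap_qext _ (LinearMap.ext fun x =>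
        LinearMap.congr_fun (map_smul Φ c v) x.1) }
  have hinj : Function.Injective Ψ.flip := by
    rw [injective_iff_map_eq_zero]
    intro x hx
    obtain ⟨z, rfl⟩ := Submodule.Quotient.mk_surjective _ x
    exact (mk_eq_zero z).2 (hsep z.1 z.2 fun v => LinearMap.congr_fun hx v)
  have hsurj : Function.Surjective Ψ := LinearMap.flip_injective_iff₂.1 hinj
  let b := Module.finBasis ℂ (K.H i)
  choose a ha using fun t => hsurj (b.coord t)
  choose k hk using fun t => Submodule.Quotient.mk_surjective _ (b t)
  refine ⟨fun t => (k t).1, a, fun t => (k t).2, fun x hx => ?_⟩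
  have h1 := b.sum_repr (Submodule.Quotient.mk ⟨x, hx⟩)
  have h2 : ∀ t, b.repr (Submodule.Quotient.mk ⟨x, hx⟩) t = Φ (a t) x := fun t => by
    have := LinearMap.congr_fun (ha t) (Submodule.Quotient.mk ⟨x, hx⟩)
    exact this.symm
  simp only [h2, ← hk] at h1
  have h3 : (Submodule.Quotient.mk (∑ t, Φ (a t) x • k t) : K.H i)
      = Submodule.Quotient.mk ⟨x, hx⟩ := by
    rw [← h1]
    exact map_sum (K.B i).mkQ _ _
  have h4 := (mk_eq_mk _ _).1 h3
  convert h4 using 2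
  simp

lemma isBd_of_forall_dual {i : ℤ} {x : K.X i}
    (h : ∀ α : Module.Dual ℂ (K.X i), (∀ y, K.IsBd y → α y = 0) → α x = 0) : K.IsBd x := by
  rw [← mem_bd, ← Subspace.dualAnnihilator_dualCoannihilator_eq (W := K.bd i),
    Submodule.mem_dualCoannihilator]
  exact fun α hα => h α fun y hy => (Submodule.mem_dualAnnihilator α).1 hα y hy

lemma exists_casimir (hK : ∀ i, FiniteDimensional ℂ (K.H i)) :
    Nonempty (Casimir K fun i => Module.finrank ℂ (K.H i)) := by
  have h := fun i => exists_casimir_of_separating (K := K) (i := i)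
    (K.bd i).dualAnnihilator.subtype
    (fun α x hx => (Submodule.mem_dualAnnihilator _).1 α.2 x hx)
    (fun x _ h => isBd_of_forall_dual fun α hα =>
      h ⟨α, (Submodule.mem_dualAnnihilator α).2 hα⟩)
  choose k a h1 h2 using h
  exact ⟨⟨k, fun i t => (a i t).1, h1,
    fun i t x hx => (Submodule.mem_dualAnnihilator _).1 (a i t).2 x hx, h2⟩⟩

end Kunneth

end HodgeCY

namespace HodgeCY

open Cpx DGBimod

/-- A bimodule resolution `P` of the diagonal together with a closed graded trace `P → ℂ[-n]` that
induces a perfect pairing between the cohomologies of `A` and of `P`. -/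
structure TraceData (A : DGAlg.{u}) (n : ℤ) where
  P : DGBimod.{u, u, u} A A
  ε : (hom P (diag A)).Z 0
  qi : IsQuasiIso ε
  Θ : Module.Dual ℂ (P.X n)
  Θ_d : ∀ (m : ℤ) (h : m + 1 = n) (x : P.X m), Θ (P.d m n h x) = 0
  Θ_comm : ∀ (i j : ℤ) (h : i + j = n) (a : A.X i) (p : P.X j),
    Θ (P.lact i j n h a p) = sgn (i * j) * Θ (P.ract j i n (by omega) p a)
  sep_left : ∀ (i j : ℤ) (h : j + i = n) (p : P.X i), P.IsCyc p →
    (∀ a : A.X j, A.IsCyc a → Θ (P.lact j i n h a p) = 0) → P.IsBd p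
  sep_right : ∀ (i j : ℤ) (h : j + i = n) (a : A.X j), A.IsCyc a →
    (∀ p : P.X i, P.IsCyc p → Θ (P.lact j i n h a p) = 0) → A.IsBd a

section Actions

variable {A : DGAlg.{u}} {B : DGAlg.{v}} (M : DGBimod.{u, v, w} A B)

lemma DGBimod.isBd_lact_right {i j k : ℤ} (h : i + j = k) {a : A.X i} (ha : A.IsCyc a)
    {x : M.X j} (hx : M.IsBd x) : M.IsBd (M.lact i j k h a x) := by
  obtain ⟨y, rfl⟩ := hx
  have := M.d_lact i (j - 1) (k - 1) (i + 1) j k (by omega) rfl (by omega) (by omega) a y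
  rw [ha.d, map_zero, LinearMap.zero_apply, zero_add] at this
  have h2 : M.lact i j k h a (M.d (j - 1) j (by omega) y)
      = sgn i • M.d (k - 1) k (by omega) (M.lact i (j - 1) (k - 1) (by omega) a y) := by
    rw [this, smul_smul, sgn_mul_self, one_smul]
  rw [h2]
  exact (isBd_d _ _).smul _

lemma DGBimod.isBd_lact_left {i j k : ℤ} (h : i + j = k) {a : A.X i} (ha : A.IsBd a) {x : M.X j}
    (hx : M.IsCyc x) : M.IsBd (M.lact i j k h a x) := by
  obtain ⟨y, rfl⟩ := ha
  have := M.d_lact (i - 1) j (k - 1) i (j + 1) k (by omega) (by omega) rfl (by omega) y x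
  rw [hx.d, map_zero, smul_zero, add_zero] at this
  rw [← this]
  exact isBd_d _ _

end Actions

namespace TraceData

variable {A : DGAlg.{u}} {B : DGAlg.{v}} {nA nB n : ℤ}

section One

variable (D : TraceData A nA)

lemma Θ_isBd {x : D.P.X nA} (hx : D.P.IsBd x) : D.Θ x = 0 := by
  obtain ⟨y, rfl⟩ := hx
  exact D.Θ_d _ _ y

lemma finite_H (hA : A.IsProper) (i : ℤ) : FiniteDimensional ℂ (D.P.H i) :=
  have := hA.1 i
  LinearEquiv.finiteDimensional (LinearEquiv.ofBijective _ (D.qi i)).symm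

/-- A representation of the identity of `P` by the trace and cocycles of `A`. -/
lemma exists_casimir_P (hA : A.IsProper) : ∃ (m : ℤ → ℕ) (c : Casimir D.P.toCpx m)
    (a : ∀ i, Fin (m i) → A.X (nA - i)), (∀ i t, A.IsCyc (a i t)) ∧
      ∀ i t x, c.α i t x = D.Θ (D.P.lact (nA - i) i nA (by omega) (a i t) x) := by
  have := D.finite_H hA
  have h := fun i => exists_casimir_of_separating (K := D.P.toCpx) (i := i)
    (((D.P.lact (nA - i) i nA (by omega)).compr₂ D.Θ).domRestrict (A.Z (nA - i)))
    (fun a x hx => D.Θ_isBd (D.P.isBd_lact_right _ a.2 hx))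
    (fun x hx h => D.sep_left i (nA - i) (by omega) x hx fun a ha => h ⟨a, ha⟩)
  choose k a h1 h2 using h
  exact ⟨_, ⟨k, fun i t => D.Θ ∘ₗ D.P.lact (nA - i) i nA (by omega) (a i t).1, h1,
    fun i t x hx => D.Θ_isBd (D.P.isBd_lact_right _ (a i t).2 hx), h2⟩,
    fun i t => (a i t).1, fun i t => (a i t).2, fun _ _ _ => rfl⟩

/-- A representation of the identity of `A` by the trace and cocycles of `P`. -/
lemma exists_casimir_A (hA : A.IsProper) : ∃ (m : ℤ → ℕ) (c : Casimir A.toCpx m)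
    (p : ∀ i, Fin (m i) → D.P.X (nA - i)), (∀ i t, D.P.IsCyc (p i t)) ∧
      ∀ i t x, c.α i t x = D.Θ (D.P.lact i (nA - i) nA (by omega) x (p i t)) := by
  have := hA.1
  have h := fun i => exists_casimir_of_separating (K := A.toCpx) (i := i)
    (((D.P.lact i (nA - i) nA (by omega)).compr₂ D.Θ).flip.domRestrict (D.P.Z (nA - i)))
    (fun p x hx => D.Θ_isBd (D.P.isBd_lact_left _ hx p.2))
    (fun x hx h => D.sep_right (nA - i) i (by omega) x hx fun a ha => h ⟨a, ha⟩)
  choose k a h1 h2 using h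
  exact ⟨_, ⟨k, fun i t => D.Θ ∘ₗ (D.P.lact i (nA - i) nA (by omega)).flip (a i t).1, h1,
    fun i t x hx => D.Θ_isBd (D.P.isBd_lact_left _ hx (a i t).2), h2⟩,
    fun i t => (a i t).1, fun i t => (a i t).2, fun _ _ _ => rfl⟩

end One

lemma finrank_support (hA : A.IsProper) : {i | Module.finrank ℂ (A.H i) ≠ 0}.Finite :=
  hA.2.subset fun _ hi => Module.nontrivial_of_finrank_pos (Nat.pos_of_ne_zero hi)

lemma finite_H_free (hA : A.IsProper) (hB : B.IsProper) (i : ℤ) :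
    FiniteDimensional ℂ ((free A B).H i) := by
  obtain ⟨c⟩ := exists_casimir (K := A.toCpx) hA.1
  obtain ⟨c'⟩ := exists_casimir (K := B.toCpx) hB.1
  exact tensC_finiteDimensional c c' (finrank_support hA) i

lemma finite_H_perfect (hA : A.IsProper) (hB : B.IsProper) {F : DGBimod.{u, v, max u v} A B}
    (hF : F.IsPerfect) (i : ℤ) : FiniteDimensional ℂ (F.H i) := by
  have h := DGFun.finite_devissage (dualF A B 0) (fun k => ?_) F hF (0 - i)
  · have h0 : FiniteDimensional ℂ ((F.toCpx.dualC 0).H (0 - i)) := h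
    have h1 := LinearEquiv.finiteDimensional (LinearEquiv.ofBijective _
      (dualPair_bijective (K := F.toCpx) 0 (0 - i)))
    rw [show 0 - (0 - i) = i by ring] at h1
    exact (Module.finite_dual_iff ℂ).1 h1
  · have := finite_H_free hA hB (0 - k)
    exact LinearEquiv.finiteDimensional (LinearEquiv.ofBijective _
      (dualPair_bijective (K := (free A B).toCpx) 0 k)).symm

section Two

variable (D : TraceData A nA) (D' : TraceData B nB) (hn : nA + nB = n)

/-- The graded trace on `P ⊗ P'`. -/
noncomputable def th : Module.Dual ℂ (TX D.P.toCpx D'.P.toCpx n) :=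
  tfun D.P.toCpx D'.P.toCpx nA nB n hn D.Θ D'.Θ

lemma th_mk (p : D.P.X nA) (q : D'.P.X nB) :
    th D D' hn (tmk _ _ nA nB n hn p q) = D.Θ p * D'.Θ q := tfun_mk _ _ _ _ _ _ _ _

lemma th_mk_of_ne {i j : ℤ} (h : i + j = n) (hi : i ≠ nA) (p : D.P.X i) (q : D'.P.X j) :
    th D D' hn (tmk _ _ i j n h p q) = 0 := tfun_mk_of_ne _ _ hi.symm _ _ _ _

lemma th_d (m : ℤ) (hm : m + 1 = n) (x : TX D.P.toCpx D'.P.toCpx m) :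
    th D D' hn ((tens D.P D'.P).d m n hm x) = 0 := by
  induction x using t_induction with
  | h0 => simp only [map_zero]
  | hadd x y hx hy => simp only [map_add, hx, hy, add_zero]
  | H i j hij a b =>
    rw [tensC_d _ _ i j m n (i + 1) (j + 1) hij hm rfl rfl, map_add, map_smul]
    have h1 : th D D' hn (tmk _ _ (i + 1) j n (by omega) (D.P.d i (i + 1) rfl a) b) = 0 := by
      by_cases h : i + 1 = nA
      · subst h
        obtain rfl : j = nB := by omega
        rw [th_mk, D.Θ_d, zero_mul]
      · rw [th_mk_of_ne _ _ _ _ h]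
    have h2 : th D D' hn (tmk _ _ i (j + 1) n (by omega) a (D'.P.d j (j + 1) rfl b)) = 0 := by
      by_cases h : i = nA
      · subst h
        obtain rfl : j + 1 = nB := by omega
        rw [th_mk, D'.Θ_d, mul_zero]
      · rw [th_mk_of_ne _ _ _ _ h]
    rw [h1, h2, smul_zero, add_zero]

lemma th_lact (l m : ℤ) (h : l + m = n) (a : A.X l) (r : TX D.P.toCpx D'.P.toCpx m) :
    th D D' hn ((tens D.P D'.P).lact l m n h a r)
      = sgn (l * m) * th D D' hn (inR D.P D'.P m l n (by omega) r a) := by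
  induction r using t_induction with
  | h0 => simp only [map_zero, LinearMap.zero_apply, mul_zero]
  | hadd x y hx hy => simp only [map_add, LinearMap.add_apply, hx, hy, mul_add]
  | H i j hij p q =>
    rw [tens_lact D.P D'.P l i j m n (l + i) hij h rfl,
      inR_mk D.P D'.P l i j m n (l + i) hij (by omega) (by omega), map_smul]
    by_cases e : l + i = nA
    · obtain rfl : j = nB := by omega
      subst e
      rw [th_mk, th_mk, D.Θ_comm, smul_eq_mul, ← hij, mul_add, sgn_add]
      have := sgn_mul_self (l * j)
      linear_combination (-sgn (l * i) * D.Θ (D.P.ract i l (l + i) (by omega) p a) * D'.Θ q) * this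
    · rw [th_mk_of_ne _ _ _ _ e, th_mk_of_ne _ _ _ _ e, smul_zero, mul_zero]

lemma th_ract (l m : ℤ) (h : m + l = n) (r : TX D.P.toCpx D'.P.toCpx m) (b : B.X l) :
    th D D' hn ((tens D.P D'.P).ract m l n h r b)
      = sgn (l * m) * th D D' hn (inL D.P D'.P l m n (by omega) b r) := by
  induction r using t_induction with
  | h0 => simp only [map_zero, LinearMap.zero_apply, mul_zero]
  | hadd x y hx hy => simp only [map_add, LinearMap.add_apply, hx, hy, mul_add]
  | H i j hij p q =>
    rw [tens_ract D.P D'.P l i j m n (l + j) hij h (by omega),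
      inL_mk D.P D'.P l i j m n (l + j) hij (by omega) rfl, map_smul]
    by_cases e : i = nA
    · subst e
      obtain rfl : l + j = nB := by omega
      rw [th_mk, th_mk, D'.Θ_comm, smul_eq_mul, ← hij, mul_add, sgn_add]
      have h1 := sgn_mul_self (l * i)
      have h2 := sgn_mul_self (l * j)
      linear_combination (-D.Θ p * D'.Θ (D'.P.ract j l (l + j) (by omega) q b)) *
        (sgn (l * i) * sgn (l * i) * h2 + h1)
    · rw [th_mk_of_ne _ _ _ _ e, th_mk_of_ne _ _ _ _ e, smul_zero, mul_zero]

/-- The natural transformation `ψ ↦ Θ ∘ ψ`. -/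
noncomputable def trNat : DGFun.NatTrans (homF (tens D.P D'.P)) (dualF A B n) where
  app M :=
    { f := fun i j h =>
        { toFun := fun ψ => th D D' hn ∘ₗ ψ.1 ⟨n - j, n, by omega⟩
          map_add' := fun ψ ψ' => LinearMap.ext fun x => map_add (th D D' hn) _ _
          map_smul' := fun c ψ => LinearMap.ext fun x => map_smul (th D D' hn) c _ }
      comm := by
        intro i j i' j' h hi hj ψ
        obtain rfl : i = j := by omega
        obtain rfl : i' = j' := by omega
        refine LinearMap.ext fun x => ?_
        rw [sgn_zero, one_smul]
        change -(sgn i) * th D D' hn (ψ.1 ⟨n - i, n, by omega⟩ (M.d (n - i') (n - i) (by omega) x))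
          = th D D' hn ((homD M (tens D.P D'.P) i i' hi ψ).1 ⟨n - i', n, by omega⟩ x)
        rw [homD_apply _ _ i i' hi ψ (n - i') n (n - i) (n - 1) (by omega) (by omega) (by omega),
          map_sub, th_d, map_smul, smul_eq_mul]
        ring }
  nat {M N} i k j h ψ f := by
    refine LinearMap.ext fun x => ?_
    exact congrArg (th D D' hn) (homComp_apply (k := k) (l := i) (n := j) (by omega)
      (ψ : homX N (tens D.P D'.P) i) f (n - j) (n - i) n (by omega) (by omega) x)

lemma th_lact_ract (i l k l' k' m : ℤ) (h : l + k = nA) (h' : k' + l' = nB) (hi : k + k' = i)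
    (hm : l + i = m) (hm' : m + l' = n) (a : A.X l) (b : B.X l') (r : TX D.P.toCpx D'.P.toCpx i) :
    th D D' hn ((tens D.P D'.P).ract m l' n hm' ((tens D.P D'.P).lact l i m hm a r) b)
      = tfun D.P.toCpx D'.P.toCpx k k' i hi (D.Θ ∘ₗ D.P.lact l k nA h a)
        (D'.Θ ∘ₗ (D'.P.ract k' l' nB h').flip b) r := by
  induction r using t_induction with
  | h0 => simp only [map_zero, LinearMap.zero_apply]
  | hadd x y hx hy => simp only [map_add, LinearMap.add_apply, hx, hy]
  | H x y hxy p q =>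
    rw [tens_lact D.P D'.P l x y i m (l + x) hxy hm rfl,
      tens_ract D.P D'.P l' (l + x) y m n (y + l') (by omega) hm' rfl]
    by_cases e : x = k
    · subst e
      obtain rfl : y = k' := by omega
      subst h h'
      rw [th_mk, tfun_mk]; rfl
    · rw [th_mk_of_ne _ _ _ _ (by omega), tfun_mk_of_ne _ _ (Ne.symm e)]

lemma isCyc_hat {G : DGBimod.{u, v, max u v} A B} {k : ℤ} {y : G.X k} (hy : G.IsCyc y) :
    (hom (free A B) G).IsCyc (hat y) := by
  refine isCyc_of (k + 1) rfl ?_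
  change homD _ _ k (k + 1) rfl (hat y) = 0
  rw [homD_hat, hy.d]
  exact free_hom_ext (hat_gen _ _)

lemma isCyc_tmk {K : Cpx.{u}} {L : Cpx.{v}} {i j m : ℤ} (h : i + j = m) {a : K.X i} {b : L.X j}
    (ha : K.IsCyc a) (hb : L.IsCyc b) : (tensC K L).IsCyc (tmk K L i j m h a b) := by
  refine isCyc_of (m + 1) rfl ?_
  rw [tensC_d _ _ i j m (m + 1) (i + 1) (j + 1) h rfl rfl rfl, ha.d, hb.d]
  simp

lemma th_hat (i k k' l l' m : ℤ) (hi : k + k' = i) (h : l + k = nA) (h' : k' + l' = nB)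
    (hm : m + i = n) (p : D.P.X k) (q : D'.P.X k') (x : FreeX A B m) :
    th D D' hn ((hat (G := tens D.P D'.P) (tmk _ _ k k' i hi p q)).1 ⟨m, n, hm⟩ x)
      = sgn (i * l) * tfun A.toCpx B.toCpx l l' m (by omega)
        (D.Θ ∘ₗ (D.P.lact l k nA h).flip p) (D'.Θ ∘ₗ D'.P.ract k' l' nB h' q) x := by
  induction x using free_induction with
  | h0 => simp only [map_zero, mul_zero]
  | hadd x y hx hy => simp only [map_add, hx, hy, mul_add]
  | H s t hst a b =>
    rw [hat_apply _ s t m n (s + i) hst hm (add_comm i s |>.symm ▸ by omega), map_smul,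
      tens_lact D.P D'.P s k k' i (s + i) (s + k) hi (by omega) rfl,
      tens_ract D.P D'.P t (s + k) k' (s + i) n (k' + t) (by omega) (by omega) rfl]
    by_cases e : s = l
    · subst e
      obtain rfl : t = l' := by omega
      subst h h'
      rw [th_mk]
      exact congrArg (sgn (i * s) * ·) (tfun_mk (K := A.toCpx) (L := B.toCpx) s t m hst
        (D.Θ ∘ₗ (D.P.lact s k (s + k) rfl).flip p) (D'.Θ ∘ₗ D'.P.ract k' t (k' + t) rfl q) a b).symm
    · rw [th_mk_of_ne _ _ _ _ (by omega)]
      have := tfun_mk_of_ne (K := A.toCpx) (L := B.toCpx) (n := m) (i := l) (j := l') (by omega) hst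
        (Ne.symm e) (D.Θ ∘ₗ (D.P.lact l k nA h).flip p) (D'.Θ ∘ₗ D'.P.ract k' l' nB h' q) a b
      rw [smul_zero]
      exact ((congrArg (sgn (i * l) * ·) this).trans (mul_zero _)).symm

lemma trNat_free_inj (hA : A.IsProper) (hB : B.IsProper) (i j : ℤ) (h : i + 0 = j)
    (ψ : homX (free A B) (tens D.P D'.P) i) (hψ : (hom (free A B) (tens D.P D'.P)).IsCyc ψ)
    (hb : ∀ x : FreeX A B (n - i), (free A B).IsCyc x →
      th D D' hn (ψ.1 ⟨n - i, n, by omega⟩ x) = 0) :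
    (hom (free A B) (tens D.P D'.P)).IsBd ψ := by
  refine (evGen_isQI _).inj i i (add_zero i) ψ hψ ?_
  obtain ⟨y, rfl⟩ : ∃ y : (tens D.P D'.P).X i, ψ = hat y := ⟨_, (hat_eq ψ).symm⟩
  have hy : (evGen (tens D.P D'.P)).f i i (add_zero i) (hat y) = y := hat_gen y (zero_add i)
  have hyc := (evGen _).isCyc (add_zero i) hψ
  rw [hy] at hyc ⊢
  obtain ⟨m, c, a, ha, hc⟩ := D.exists_casimir_P hA
  obtain ⟨m', c', b, hb', hc'⟩ := D'.exists_casimir_P hB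
  refine tensC_isBd_of_tfun c c' hyc fun k k' hk t s => ?_
  have h1 := hb (tmk A.toCpx B.toCpx (nA - k) (nB - k') (n - i) (by omega) (a k t) (b k' s))
    (isCyc_tmk _ (ha k t) (hb' k' s))
  have h2 := (congrArg (th D D' hn) (hat_apply y (nA - k)
    (nB - k') (n - i) n (nA - k + i) (by omega) (by omega) (by omega) (a k t) (b k' s))).symm.trans h1
  rw [map_smul, smul_eq_mul] at h2
  have h3 := (mul_eq_zero.1 h2).resolve_left (sgn_ne_zero _)
  rw [th_lact_ract D D' hn i (nA - k) k (nB - k') k' (nA - k + i) (by omega) (by omega) hk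
    (by omega) (by omega)] at h3
  have e1 : c.α k t = D.Θ ∘ₗ D.P.lact (nA - k) k nA (by omega) (a k t) := LinearMap.ext (hc k t)
  have e2 : c'.α k' s = sgn ((nB - k') * k') •
      (D'.Θ ∘ₗ (D'.P.ract k' (nB - k') nB (by omega)).flip (b k' s)) := LinearMap.ext fun x => by
    rw [hc', D'.Θ_comm]; rfl
  rw [e1, e2]
  simp only [tfun, TensorProduct.map_smul_right, LinearMap.comp_apply, LinearMap.smul_apply,
    map_smul] at h3 ⊢
  rw [h3, smul_zero]

lemma trNat_free_isQI (hA : A.IsProper) (hB : B.IsProper) :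
    ((trNat D D' hn).app (free A B)).IsQI := by
  refine GMap.isQI_of_bijective fun i j h => ?_
  obtain rfl : i = j := by omega
  have := finite_H_free hA hB (n - i)
  let Ψ := (free A B).toCpx.dualPair n i ∘ₗ ((trNat D D' hn).app (free A B)).mapH i i h
  suffices hΨ : Function.Bijective Ψ by
    exact (Function.Bijective.of_comp_iff' (dualPair_bijective (K := (free A B).toCpx) n i) _).1 hΨ
  constructor
  · rw [injective_iff_map_eq_zero]
    intro x hx
    obtain ⟨z, rfl⟩ := Submodule.Quotient.mk_surjective _ x
    refine (mk_eq_zero z).2 (trNat_free_inj D D' hn hA hB i i h z.1 z.2 fun x hx' => ?_)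
    exact LinearMap.congr_fun hx (Submodule.Quotient.mk ⟨x, hx'⟩)
  · refine LinearMap.flip_injective_iff₂.1 ?_
    rw [injective_iff_map_eq_zero]
    intro x hx
    obtain ⟨z, rfl⟩ := Submodule.Quotient.mk_surjective _ x
    refine (mk_eq_zero z).2 ?_
    obtain ⟨m, c, a, ha, hc⟩ := D.exists_casimir_A hA
    obtain ⟨m', c', b, hb', hc'⟩ := D'.exists_casimir_A hB
    refine tensC_isBd_of_tfun (K := A.toCpx) (L := B.toCpx) c c' z.2 fun k k' hk t s => ?_
    have h1 := LinearMap.congr_fun hx (Submodule.Quotient.mk ⟨hat (G := tens D.P D'.P)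
      (tmk _ _ (nA - k) (nB - k') i (by omega) (a k t) (b k' s)),
      isCyc_hat (G := tens D.P D'.P) (isCyc_tmk _ (ha k t) (hb' k' s))⟩)
    have h2 : th D D' hn ((hat (G := tens D.P D'.P)
      (tmk _ _ (nA - k) (nB - k') i (by omega) (a k t) (b k' s))).1 ⟨n - i, n, by omega⟩ z.1) = 0 := h1
    rw [th_hat D D' hn i (nA - k) (nB - k') k k' (n - i) (by omega) (by omega) (by omega)
      (by omega)] at h2
    have h3 := (mul_eq_zero.1 h2).resolve_left (sgn_ne_zero _)
    have e1 : c.α k t = D.Θ ∘ₗ (D.P.lact k (nA - k) nA (by omega)).flip (a k t) :=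
      LinearMap.ext (hc k t)
    have e2 : c'.α k' s = sgn (k' * (nB - k')) •
        (D'.Θ ∘ₗ D'.P.ract (nB - k') k' nB (by omega) (b k' s)) := LinearMap.ext fun x => by
      rw [hc', D'.Θ_comm]; rfl
    rw [e1, e2]
    simp only [tfun, TensorProduct.map_smul_right, LinearMap.comp_apply, LinearMap.smul_apply,
      map_smul] at h3 ⊢
    rw [h3, smul_zero]

theorem trNat_isQI (hA : A.IsProper) (hB : B.IsProper) {F : DGBimod.{u, v, max u v} A B}
    (hF : F.IsPerfect) : ((trNat D D' hn).app F).IsQI :=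
  (trNat D D' hn).isQI_devissage (trNat_free_isQI D D' hn hA hB) F hF

end Two

end TraceData

end HodgeCY

namespace HodgeCY

open Cpx DGBimod

lemma sgn_congr {m n : ℤ} (k : ℤ) (h : m = n + 2 * k) : sgn m = sgn n := by
  rw [h, sgn_add, two_mul, sgn_add, sgn_mul_self, mul_one]

lemma exists_sq_eq (l : ℤ) : ∃ k, l * l = l + 2 * k := by
  obtain ⟨k, hk⟩ := Int.even_mul_succ_self (l - 1)
  exact ⟨k, by linear_combination hk⟩

section DualValues

variable {K : Cpx.{u}} {A : DGAlg.{u}} {B : DGAlg.{v}} {M : DGBimod.{u, v, w} A B}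

/-- The value of an element of the dual complex, in a flexible degree. -/
def Cpx.dcv {n i : ℤ} (φ : (K.dualC n).X i) (m : ℤ) (h : i + m = n) : Module.Dual ℂ (K.X m) :=
  ev φ ∘ₗ (LinearEquiv.cast (R := ℂ) (M := K.X) (show m = n - i by omega)).toLinearMap

lemma Cpx.dcv_isCyc {n i : ℤ} {φ : (K.dualC n).X i} (m : ℤ) (h : i + m = n) :
    (K.dualC n).IsCyc φ ↔ ∀ x : K.X m, K.IsBd x → dcv φ m h x = 0 := by
  obtain rfl : m = n - i := by omega
  exact dualC_isCyc

lemma Cpx.dcv_isBd {n i : ℤ} {φ : (K.dualC n).X i} (m : ℤ) (h : i + m = n) :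
    (K.dualC n).IsBd φ ↔ ∀ x : K.X m, K.IsCyc x → dcv φ m h x = 0 := by
  obtain rfl : m = n - i := by omega
  exact dualC_isBd

lemma Cpx.exists_dcv {n i : ℤ} (m : ℤ) (h : i + m = n) (f : Module.Dual ℂ (K.X m)) :
    ∃ φ : (K.dualC n).X i, dcv φ m h = f := by
  obtain rfl : m = n - i := by omega
  exact ⟨f, rfl⟩

/-- The value of an element of the dual bimodule, in a flexible degree. -/
def DGBimod.dv {i : ℤ} (φ : M.dual.X i) (m : ℤ) (h : i + m = 0) : Module.Dual ℂ (M.X m) :=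
  (φ : Module.Dual ℂ (M.X (-i))) ∘ₗ
    (LinearEquiv.cast (R := ℂ) (M := M.X) (show m = -i by omega)).toLinearMap

lemma DGBimod.dv_ext {i : ℤ} {φ φ' : M.dual.X i} (m : ℤ) (h : i + m = 0)
    (H : ∀ x, dv φ m h x = dv φ' m h x) : φ = φ' := by
  obtain rfl : m = -i := by omega
  exact LinearMap.ext H

lemma DGBimod.exists_dv {i : ℤ} (m : ℤ) (h : i + m = 0) (f : Module.Dual ℂ (M.X m)) :
    ∃ φ : M.dual.X i, dv φ m h = f := by
  obtain rfl : m = -i := by omega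
  exact ⟨f, rfl⟩

lemma DGBimod.dv_d {i j m m' : ℤ} (hj : i + 1 = j) (h : j + m = 0) (h' : i + m' = 0)
    (φ : M.dual.X i) (x : M.X m) :
    dv (M.dual.d i j hj φ) m h x = -(sgn i) * dv φ m' h' (M.d m m' (by omega) x) := by
  obtain rfl : m = -j := by omega
  obtain rfl : m' = -i := by omega
  rfl

lemma DGBimod.dv_lact {l i j m m' : ℤ} (h : l + i = j) (hm : j + m = 0) (hm' : i + m' = 0)
    (b : B.X l) (φ : M.dual.X i) (x : M.X m) :
    dv (M.dual.lact l i j h b φ) m hm x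
      = sgn l * dv φ m' hm' (M.ract m l m' (by omega) x b) := by
  obtain rfl : m = -j := by omega
  obtain rfl : m' = -i := by omega
  rfl

lemma DGBimod.dv_ract {l i j m m' : ℤ} (h : i + l = j) (hm : j + m = 0) (hm' : i + m' = 0)
    (φ : M.dual.X i) (a : A.X l) (x : M.X m) :
    dv (M.dual.ract i l j h φ a) m hm x = dv φ m' hm' (M.lact l m m' (by omega) a x) := by
  obtain rfl : m = -j := by omega
  obtain rfl : m' = -i := by omega
  rfl

lemma DGBimod.dv_sub {i m : ℤ} (h : i + m = 0) (φ φ' : M.dual.X i) (x : M.X m) :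
    dv (φ - φ') m h x = dv φ m h x - dv φ' m h x := rfl

lemma DGBimod.dv_smul {i m : ℤ} (h : i + m = 0) (c : ℂ) (φ : M.dual.X i) (x : M.X m) :
    dv (c • φ) m h x = c * dv φ m h x := rfl

lemma DGBimod.dv_isCyc {i : ℤ} {φ : M.dual.X i} (m : ℤ) (h : i + m = 0) :
    M.dual.IsCyc φ ↔ ∀ x : M.X m, M.IsBd x → dv φ m h x = 0 := by
  constructor
  · intro hφ x hx
    obtain ⟨y, rfl⟩ := hx
    have h1 := dv_d (M := M) (i := i) (m := m - 1) (m' := m) rfl (by omega) h φ y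
    rw [hφ.d] at h1
    exact (mul_eq_zero.1 (h1.symm.trans rfl)).resolve_left (neg_ne_zero.2 (sgn_ne_zero i))
  · intro H
    refine isCyc_of (i + 1) rfl (dv_ext (m - 1) (by omega) fun x => ?_)
    rw [dv_d (m' := m) rfl (by omega) h, H _ (isBd_d _ _), mul_zero]
    rfl

lemma DGBimod.dv_isBd {i : ℤ} {φ : M.dual.X i} (m : ℤ) (h : i + m = 0) :
    M.dual.IsBd φ ↔ ∀ x : M.X m, M.IsCyc x → dv φ m h x = 0 := by
  constructor
  · rintro ⟨ψ, rfl⟩ x hx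
    rw [dv_d (m' := m + 1) (by omega) h (by omega), hx.d, map_zero, mul_zero]
  · intro H
    obtain ⟨φ', hφ'⟩ := exists_dcv (K := M.toCpx) (n := 0) (i := i) m h (dv φ m h)
    obtain ⟨ψ, hψ⟩ := ((dcv_isBd (φ := φ') m h).2 fun x hx => by rw [hφ']; exact H x hx).exists
      (i - 1) (by omega)
    obtain ⟨ψ', hψ'⟩ := exists_dv (M := M) (i := i - 1) (m + 1) (by omega)
      (dcv ψ (m + 1) (by omega))
    refine ⟨ψ', dv_ext m h fun x => ?_⟩
    rw [dv_d (m' := m + 1) (by omega) h (by omega), hψ', ← hφ', ← hψ]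
    obtain rfl : m = 0 - i := by omega
    have e : ∀ (m' : ℤ) (hm : i - 1 + m' = 0) (hm' : 0 - i + 1 = m'),
        -(sgn (i - 1)) * dcv ψ m' hm (M.d (0 - i) m' hm' x)
          = -(sgn (i - 1)) * dcv ψ (0 - (i - 1)) (by omega) (M.d (0 - i) _ (by omega) x) := by
      intro m' hm hm'
      obtain rfl : m' = 0 - (i - 1) := by omega
      rfl
    rw [e]
    rfl

end DualValues

section Functionals

variable {K : Cpx.{u}} {L : Cpx.{v}}

/-- Functionals on cohomology can be transported along quasi-isomorphisms. -/
lemma Cpx.GMap.IsQI.exists_dual {f : GMap K L 0} (hf : f.IsQI) {m : ℤ}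
    (φ : Module.Dual ℂ (K.X m)) (hφ : ∀ x, K.IsBd x → φ x = 0) :
    ∃ l : Module.Dual ℂ (L.X m), (∀ y, L.IsBd y → l y = 0) ∧
      ∀ x, K.IsCyc x → l (f.f m m (add_zero m) x) = φ x := by
  obtain ⟨h, h1, _⟩ := hf.exists_quasiInverse
  refine ⟨φ ∘ₗ h.f m m (add_zero m), fun y hy => hφ _ (h.isBd _ hy), fun x hx => ?_⟩
  have := hφ _ (h1 m x hx)
  rw [map_sub, sub_eq_zero] at this
  exact this

lemma Cpx.exists_dual_ne_zero {i : ℤ} {x : K.X i} (hx : ¬ K.IsBd x) :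
    ∃ α : Module.Dual ℂ (K.X i), (∀ y, K.IsBd y → α y = 0) ∧ α x ≠ 0 := by
  by_contra! h
  exact hx (isBd_of_forall_dual h)

end Functionals

section TensHom

variable {A A' : DGAlg.{u}} {B B' : DGAlg.{v}} {M M' : DGBimod.{u, u, u} A A'}
  {N N' : DGBimod.{v, v, v} B' B}

/-- The tensor product of two closed morphisms, for the outer bimodule structures. -/
noncomputable def tensHom (f : (hom M M').Z 0) (f' : (hom N N').Z 0) :
    (hom (tens M N : DGBimod.{u, v, max u v} A B) (tens M' N')).Z 0 :=
  ⟨⟨fun t => (tensG (toGMap f) (toGMap f')).f t.p t.q t.hpq, by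
    constructor
    · intro l i j i' j' h hi hj a x
      obtain rfl : i = i' := by omega
      obtain rfl : j = j' := by omega
      rw [zero_mul, sgn_zero, one_smul]
      induction x using t_induction with
      | h0 => simp only [map_zero]
      | hadd x y hx hy => simp only [map_add, hx, hy]
      | H p q hpq x y =>
        rw [tens_lact M N l p q i j (l + p) hpq h rfl, tensG_mk, tensG_mk,
          tens_lact M' N' l p q i j (l + p) hpq h rfl]
        exact congrArg (fun z => tmk _ _ (l + p) q j _ z _) (ap_lact f l p (l + p) rfl a x)
    · intro i l j i' j' h hi hj x b
      obtain rfl : i = i' := by omega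
      obtain rfl : j = j' := by omega
      induction x using t_induction with
      | h0 => simp only [map_zero, LinearMap.zero_apply]
      | hadd x y hx hy => simp only [map_add, LinearMap.add_apply, hx, hy]
      | H p q hpq x y =>
        rw [tens_ract M N l p q i j (q + l) hpq h rfl, tensG_mk, tensG_mk,
          tens_ract M' N' l p q i j (q + l) hpq h rfl]
        exact congrArg (tmk _ _ p (q + l) j _ _) (ap_ract f' q l (q + l) rfl y b)⟩, by
    refine homX_ext fun i j hj x => ?_
    rw [homD_apply _ _ 0 (0 + 1) rfl _ i j j i (by omega) (by omega) (by omega)]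
    exact sub_eq_zero.2 ((tensG (toGMap f) (toGMap f')).comm i i j j (add_zero i) (by omega)
      (by omega) x)⟩

lemma tensHom_mk (f : (hom M M').Z 0) (f' : (hom N N').Z 0) (i j n : ℤ) (hij : i + j = n)
    (h : n + 0 = n) (x : M.X i) (y : N.X j) :
    (tensHom (A := A) (B := B) f f').1.1 ⟨n, n, h⟩ (tmk _ _ i j n hij x y)
      = tmk _ _ i j n hij (ap f i x) (ap f' j y) := tensG_mk _ _ i j n hij h x y

lemma tensHom_isQI {f : (hom M M').Z 0} {f' : (hom N N').Z 0} (hf : IsQuasiIso f)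
    (hf' : IsQuasiIso f') : IsQuasiIso (tensHom (A := A) (B := B) f f') := by
  rw [isQuasiIso_iff] at hf hf' ⊢
  have := tensG_isQI hf hf'
  exact ⟨this.surj, this.inj⟩

lemma tensHom_inL (f : (hom M M').Z 0) (f' : (hom N N').Z 0) (l n m : ℤ) (h : l + n = m)
    (hn : n + 0 = n) (hm : m + 0 = m) (b : B'.X l) (x : TX M.toCpx N.toCpx n) :
    (tensHom (A := A) (B := B) f f').1.1 ⟨m, m, hm⟩ (inL M N l n m h b x)
      = inL M' N' l n m h b ((tensHom (A := A) (B := B) f f').1.1 ⟨n, n, hn⟩ x) := by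
  induction x using t_induction with
  | h0 => simp only [map_zero]
  | hadd x y hx hy => simp only [map_add, hx, hy]
  | H p q hpq x y =>
    rw [tensHom_mk, inL_mk M N l p q n m (l + q) hpq h rfl, map_smul, tensHom_mk,
      inL_mk M' N' l p q n m (l + q) hpq h rfl, ap_lact f' l q (l + q) rfl]

lemma tensHom_inR (f : (hom M M').Z 0) (f' : (hom N N').Z 0) (n l m : ℤ) (h : n + l = m)
    (hn : n + 0 = n) (hm : m + 0 = m) (x : TX M.toCpx N.toCpx n) (a : A'.X l) :
    (tensHom (A := A) (B := B) f f').1.1 ⟨m, m, hm⟩ (inR M N n l m h x a)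
      = inR M' N' n l m h ((tensHom (A := A) (B := B) f f').1.1 ⟨n, n, hn⟩ x) a := by
  induction x using t_induction with
  | h0 => simp only [map_zero, LinearMap.zero_apply]
  | hadd x y hx hy => simp only [map_add, LinearMap.add_apply, hx, hy]
  | H p q hpq x y =>
    rw [tensHom_mk, inR_mk M N l p q n m (p + l) hpq h rfl, map_smul, tensHom_mk,
      inR_mk M' N' l p q n m (p + l) hpq h rfl, ap_ract f p l (p + l) rfl]

end TensHom

section Hat

variable {A : DGAlg.{u}} {B : DGAlg.{v}} {G H : DGBimod.{u, v, max u v} A B}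

lemma hat_add {k : ℤ} (y y' : G.X k) : hat (y + y') = hat y + hat y' := by
  refine free_hom_ext ?_
  rw [hat_gen]
  exact (congrArg₂ (· + ·) (hat_gen y (zero_add k)) (hat_gen y' (zero_add k))).symm

lemma hat_smul {k : ℤ} (c : ℂ) (y : G.X k) : hat (c • y) = c • hat y := by
  refine free_hom_ext ?_
  rw [hat_gen]
  exact (congrArg (c • ·) (hat_gen y (zero_add k))).symm

lemma hat_comp {k l m : ℤ} (h : k + l = m) (f : homX G H l) (y : G.X k) :
    homComp h f (hat y) = hat (f.1 ⟨k, m, h⟩ y) := by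
  refine free_hom_ext ?_
  rw [hat_gen, homComp_apply h f (hat y) 0 k m (zero_add k) (zero_add m), hat_gen]

lemma hat_gen_eq : hat (gen A B) = homId (free A B) := by
  refine free_hom_ext ?_
  rw [hat_gen]; rfl

lemma hat_lact {l k k' m n n' : ℤ} (h : l + k = k') (hm : m + k' = n) (hn' : m + l = n')
    (a : A.X l) (y : G.X k) (r : FreeX A B m) :
    (hat (G.lact l k k' h a y)).1 ⟨m, n, hm⟩ r
      = sgn (l * (m + k)) • (hat y).1 ⟨n', n, by omega⟩ (inR (diag A) (diag B) m l n' hn' r a) := by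
  induction r using t_induction (K := A.toCpx) (L := B.toCpx) with
  | h0 => simp only [map_zero, LinearMap.zero_apply, smul_zero]
  | hadd x y hx hy => simp only [map_add, LinearMap.add_apply, smul_add, hx, hy]
  | H i j hij x b =>
    rw [inR_mk (diag A) (diag B) l i j m n' (i + l) hij hn' rfl, map_smul]
    refine (hat_apply (G.lact l k k' h a y) i j m n (i + k') hij hm rfl x b).trans ?_
    have e := hat_apply y (i + l) j n' n (i + k') (by omega) (by omega) (by omega)
      (A.mul i l (i + l) rfl x a) b
    refine Eq.trans ?_ (congrArg (fun z => sgn (l * (m + k)) • sgn (l * j) • z) e).symm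
    rw [G.mul_lact i l k (i + l) k' (i + k') rfl (by omega) h rfl, smul_smul, smul_smul,
      ← sgn_add, ← sgn_add]
    congr 1
    exact (sgn_congr (l * j + l * k) (by rw [← h, ← hij]; ring)).symm

lemma hat_ract {l k k' m n n' : ℤ} (h : k + l = k') (hm : m + k' = n) (hn' : l + m = n')
    (y : G.X k) (b : B.X l) (r : FreeX A B m) :
    (hat (G.ract k l k' h y b)).1 ⟨m, n, hm⟩ r
      = (hat y).1 ⟨n', n, by omega⟩ (inL (diag A) (diag B) l m n' hn' b r) := by
  induction r using t_induction (K := A.toCpx) (L := B.toCpx) with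
  | h0 => simp only [map_zero]
  | hadd x y hx hy => simp only [map_add, hx, hy]
  | H i j hij x b' =>
    rw [inL_mk (diag A) (diag B) l i j m n' (l + j) hij hn' rfl, map_smul]
    refine (hat_apply (G.ract k l k' h y b) i j m n (i + k') hij hm rfl x b').trans ?_
    have e := hat_apply y i (l + j) n' n (i + k) (by omega) (by omega) (by omega) x
      (B.mul l j (l + j) rfl b b')
    refine Eq.trans ?_ (congrArg (fun z => sgn (l * i) • z) e).symm
    rw [← G.lact_ract i k l (i + k) k' (i + k') rfl (by omega) h rfl,
      G.ract_mul (i + k) l j (i + k') (l + j) n (by omega) (by omega) rfl (by omega), smul_smul,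
      ← sgn_add]
    congr 1
    exact congrArg sgn (by rw [← h]; ring)

end Hat

end HodgeCY

namespace HodgeCY

open Cpx DGBimod

/-! ### Serre duality -/

namespace TraceData

variable {A : DGAlg.{u}} {B : DGAlg.{v}} {nA nB n : ℤ}

section Kappa

variable (D : TraceData A nA) (D' : TraceData B nB) (hn : nA + nB = n)
  (F : DGBimod.{u, v, max u v} A B)

/-- The bimodule `Hom(F, P ⊗ P')`. -/
noncomputable abbrev inv : DGBimod.{v, u, max u v} B A := innerHom D.P D'.P F

/-- The components of `kappaX`. -/
noncomputable def kappaVal (p q : ℤ) (h : p + -n = q) : F.X p →ₗ[ℂ] (inv D D' F).dual.X q :=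
  LinearMap.mk₂ ℂ
    (fun x (ψ : homX F (tens D.P D'.P) (-q)) => sgn (p * (n - 1)) *
      th D D' hn (ψ.1 ⟨p, n, by omega⟩ x))
    (by intros; simp [mul_add]) (by intros; simp [mul_left_comm])
    (by intros; simp [mul_add]) (by intros; simp [mul_left_comm])

variable {F}

lemma th_apply_lact {l i j m m' : ℤ} (h : l + i = j) (hm : j + m = n) (hc : m + l = m')
    (hm' : i + m' = n) (a : A.X l) (x : F.X i) (ψ : homX F (tens D.P D'.P) m) :
    th D D' hn (ψ.1 ⟨j, n, hm⟩ (F.lact l i j h a x)) = sgn (m * l + l * (n - l) + l * i)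
      * th D D' hn ((ihR D.P D'.P F m l m' hc ψ a).1 ⟨i, n, hm'⟩ x) := by
  rw [ψ.2.1 l i j (n - l) n h (by omega) (by omega), map_smul, th_lact,
    ihR_apply D.P D'.P F m l m' hc ψ a i (n - l) n (by omega) (by omega),
    map_smul, smul_eq_mul, smul_eq_mul, ← mul_assoc, ← mul_assoc, ← sgn_add, ← sgn_add]
  congr 1
  exact sgn_congr (-(l * i)) (by ring)

lemma th_apply_ract {l i j m m' : ℤ} (h : i + l = j) (hm : j + m = n) (hc : l + m = m')
    (hm' : i + m' = n) (x : F.X i) (b : B.X l) (ψ : homX F (tens D.P D'.P) m) :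
    th D D' hn (ψ.1 ⟨j, n, hm⟩ (F.ract i l j h x b)) = sgn (l * (n - l))
      * th D D' hn ((ihL D.P D'.P F l m m' hc b ψ).1 ⟨i, n, hm'⟩ x) := by
  rw [ψ.2.2 i l j (n - l) n h (by omega) (by omega), th_ract,
    ihL_apply D.P D'.P F l m m' hc b ψ i (n - l) n (by omega) (by omega)]

variable (F)

/-- The morphism `F → Hom(F, P ⊗ P')*` of degree `-n` given by the trace. -/
noncomputable def kappaX : homX F (inv D D' F).dual (-n) :=
  ⟨fun t => kappaVal D D' hn F t.p t.q t.hpq, by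
    constructor
    · intro l i j i' j' h hi hj a x
      refine dv_ext (M := inv D D' F) (i := j') (-j') (by omega) fun (ψ : homX F (tens D.P D'.P) (-j')) => ?_
      rw [dv_smul, dv_lact (i := i') (j := j') (m' := -i') (by omega) (by omega) (by omega)]
      change sgn (j * (n - 1)) * th D D' hn (ψ.1 ⟨j, n, by omega⟩ (F.lact l i j h a x))
        = sgn (-n * l) * (sgn l * (sgn (i * (n - 1)) * th D D' hn
          ((ihR D.P D'.P F (-j') l (-i') (by omega) ψ a).1 ⟨i, n, by omega⟩ x)))
      rw [th_apply_lact D D' hn (m' := -i') h (by omega) (by omega) (by omega), ← mul_assoc,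
        ← mul_assoc, ← mul_assoc, ← sgn_add, ← sgn_add, ← sgn_add]
      congr 1
      obtain rfl : i' = i + -n := by omega
      obtain rfl : j' = l + i + -n := by omega
      obtain rfl : j = l + i := by omega
      exact sgn_congr (2 * n * l - l - l * l) (by ring)
    · intro i l j i' j' h hi hj x b
      refine dv_ext (M := inv D D' F) (i := j') (-j') (by omega) fun (ψ : homX F (tens D.P D'.P) (-j')) => ?_
      rw [dv_ract (i := i') (j := j') (m' := -i') (by omega) (by omega) (by omega)]
      change sgn (j * (n - 1)) * th D D' hn (ψ.1 ⟨j, n, by omega⟩ (F.ract i l j h x b))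
        = (sgn (i * (n - 1)) * th D D' hn
          ((ihL D.P D'.P F l (-j') (-i') (by omega) b ψ).1 ⟨i, n, by omega⟩ x))
      rw [th_apply_ract D D' hn (m' := -i') h (by omega) (by omega) (by omega), ← mul_assoc,
        ← sgn_add]
      congr 1
      obtain ⟨t, ht⟩ := exists_sq_eq l
      obtain rfl : j = i + l := by omega
      exact sgn_congr (l * n - l - t) (by linear_combination -ht)⟩

lemma dv_kappaX {i q m : ℤ} (hq : i + -n = q) (hm : q + m = 0) (x : F.X i)
    (ψ : homX F (tens D.P D'.P) m) :
    dv (M := inv D D' F) ((kappaX D D' hn F).1 ⟨i, q, hq⟩ x) m hm ψ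
      = sgn (i * (n - 1)) * th D D' hn (ψ.1 ⟨i, n, by omega⟩ x) := by
  obtain rfl : m = -q := by omega
  rfl

lemma isCyc_kappaX : (hom F (inv D D' F).dual).IsCyc (kappaX D D' hn F) := by
  refine homX_ext fun i j hj x => ?_
  refine dv_ext (M := inv D D' F) (i := j) (-j) (by omega) fun (ψ : homX F (tens D.P D'.P) (-j)) => ?_
  rw [homD_apply _ _ (-n) (-n + 1) rfl _ i j (i + 1) (i + -n) hj rfl rfl, dv_sub, dv_smul,
    dv_d (M := inv D D' F) (j := j) (m' := -j + 1) (by omega) (by omega) (by omega), dv_kappaX, dv_kappaX]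
  change -(sgn (i + -n)) * (sgn (i * (n - 1)) * th D D' hn
    ((homD F (tens D.P D'.P) (-j) (-j + 1) rfl ψ).1 ⟨i, n, by omega⟩ x)) - _ = 0
  rw [homD_apply _ _ (-j) (-j + 1) rfl _ i n (i + 1) (n - 1) (by omega) rfl (by omega), map_sub,
    th_d, map_smul, smul_eq_mul, zero_sub]
  have e1 : sgn ((i + 1) * (n - 1)) = sgn (i * (n - 1)) * sgn n * -1 := by
    rw [← sgn_one, ← sgn_add, ← sgn_add]
    exact sgn_congr (-1) (by ring)
  have e2 : sgn (i + -n) * sgn (-j) = -1 := by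
    rw [← sgn_one, ← sgn_add]
    exact sgn_congr (-1) (by omega)
  have e3 := sgn_mul_self n
  rw [e1, sgn_neg n]
  generalize th D D' hn _ = y
  linear_combination (sgn (i * (n - 1)) * y) * e2 + (sgn (i * (n - 1)) * y) * e3

/-- The closed morphism `F → Hom(F, P ⊗ P')*`. -/
noncomputable def kappa : (hom F (inv D D' F).dual).Z (-n) :=
  ⟨kappaX D D' hn F, isCyc_kappaX D D' hn F⟩

theorem kappa_isQI (hA : A.IsProper) (hB : B.IsProper) (hF : F.IsPerfect) :
    (toGMap (kappa D D' hn F)).IsQI := by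
  have hq := trNat_isQI D D' hn hA hB hF
  have hval : ∀ (i q m : ℤ) (hq : i + -n = q) (hm : q + m = 0) (x : F.X i)
      (ψ : homX F (tens D.P D'.P) m), dv (M := inv D D' F)
        ((toGMap (kappa D D' hn F)).f i q hq x) m hm ψ
        = sgn (i * (n - 1)) * th D D' hn (ψ.1 ⟨i, n, by omega⟩ x) :=
    fun i q m hq hm x ψ => dv_kappaX D D' hn F hq hm x ψ
  have htr : ∀ (m i : ℤ) (h : m + i = n) (ψ : homX F (tens D.P D'.P) m) (x : F.X i),
      dcv (K := F.toCpx) (((trNat D D' hn).app F).f m m (add_zero m) ψ) i h x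
        = th D D' hn (ψ.1 ⟨i, n, by omega⟩ x) := by
    intro m i h ψ x
    obtain rfl : i = n - m := by omega
    rfl
  constructor
  · intro i q hiq φ hφ
    have : FiniteDimensional ℂ (F.H i) := finite_H_perfect hA hB hF i
    obtain rfl : i = n - -q := by omega
    let T : (hom F (tens D.P D'.P)).H (-q) →ₗ[ℂ] Module.Dual ℂ (F.H (n - -q)) :=
      F.toCpx.dualPair n (-q) ∘ₗ ((trNat D D' hn).app F).mapH (-q) (-q) (add_zero _)
    have hT : Function.Bijective T :=
      (dualPair_bijective (K := F.toCpx) n (-q)).comp (hq.bijective _ _ _)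
    let e := LinearEquiv.ofBijective T hT
    let φH : Module.Dual ℂ ((hom F (tens D.P D'.P)).H (-q)) :=
      Submodule.liftQ _ (dv (M := inv D D' F) φ (-q) (by omega) ∘ₗ
        ((hom F (tens D.P D'.P)).Z (-q)).subtype)
        fun ψ hψ => (dv_isCyc (M := inv D D' F) (-q) (by omega)).1 hφ ψ.1 hψ
    obtain ⟨x, hx⟩ := (Module.evalEquiv ℂ (F.H (n - -q))).surjective (φH ∘ₗ e.symm.toLinearMap)
    obtain ⟨z, rfl⟩ := Submodule.Quotient.mk_surjective _ x
    refine ⟨sgn ((n - -q) * (n - 1)) • z.1, IsCyc.smul _ z.2, ?_⟩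
    refine (dv_isBd (M := inv D D' F) (-q) (by omega)).2
      fun (ψ : homX F (tens D.P D'.P) (-q)) hψ => ?_
    rw [dv_sub, hval, map_smul, map_smul, smul_eq_mul, ← mul_assoc, sgn_mul_self, one_mul,
      sub_eq_zero]
    have h1 := LinearMap.congr_fun hx (T (Submodule.Quotient.mk ⟨ψ, hψ⟩))
    have h2 : e.symm (T (Submodule.Quotient.mk ⟨ψ, hψ⟩)) = Submodule.Quotient.mk ⟨ψ, hψ⟩ :=
      e.symm_apply_apply _
    simp only [LinearMap.comp_apply, LinearEquiv.coe_coe] at h1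
    rw [h2] at h1
    exact h1
  · intro i q hiq x hx hb
    by_contra hne
    obtain ⟨α, hα, hαx⟩ := exists_dual_ne_zero hne
    obtain ⟨φ, hφ⟩ := exists_dcv (K := F.toCpx) (n := n) (i := -q) i (by omega) α
    obtain ⟨ψ, hψ, hb'⟩ := hq.surj (-q) (-q) (add_zero _) φ
      ((dcv_isCyc i (by omega)).2 (by rw [hφ]; exact hα))
    have h1 := (dcv_isBd (K := F.toCpx) i (by omega)).1 hb' x hx
    have h2 := (dv_isBd (M := inv D D' F) (-q) (by omega)).1 hb ψ hψ
    have h3 := (mul_eq_zero.1 ((hval i q (-q) hiq (by omega) x ψ).symm.trans h2)).resolve_left (sgn_ne_zero _)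
    have h4 : dcv (K := F.toCpx) (((trNat D D' hn).app F).f (-q) (-q) (add_zero _) ψ) i (by omega) x
        - dcv φ i (by omega) x = 0 := h1
    rw [htr (-q) i (by omega) ψ x, h3, hφ, zero_sub, neg_eq_zero] at h4
    exact hαx h4

end Kappa

section Chi

variable (D : TraceData A nA) (D' : TraceData B nB) (F G : DGBimod.{u, v, max u v} A B)

/-- The quasi-isomorphism from `P ⊗ P'` to `A ⊗ B`. -/
noncomputable def res : (hom (tens D.P D'.P) (free A B)).Z 0 := tensHom D.ε D'.ε

lemma res_isQI : IsQuasiIso (res D D') := tensHom_isQI D.qi D'.qi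

variable {F G}

/-- The morphism `F → G` with values `ŷ (ε ⊗ ε') ψ(x)`. -/
noncomputable def through {p m k : ℤ} (h : m + p = k) (y : G.X p)
    (ψ : homX F (tens D.P D'.P) m) : homX F G k :=
  homComp (k := m) (l := p) h (hat y) (homComp (add_zero m) (res D D').1 ψ)

lemma through_apply {p m k : ℤ} (h : m + p = k) (y : G.X p) (ψ : homX F (tens D.P D'.P) m)
    (i q j : ℤ) (hq : i + m = q) (hj : i + k = j) (x : F.X i) :
    (through D D' h y ψ).1 ⟨i, j, hj⟩ x
      = (hat y).1 ⟨q, j, by omega⟩ ((res D D').1.1 ⟨q, q, add_zero q⟩ (ψ.1 ⟨i, q, hq⟩ x)) := by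
  rw [through, homComp_apply h _ _ i q j hq, homComp_apply _ _ _ i q q hq]

lemma homD_through {p m k p' m' k' : ℤ} (h : m + p = k) (hp : p + 1 = p') (hm : m + 1 = m')
    (hk : k + 1 = k') (y : G.X p) (ψ : homX F (tens D.P D'.P) m) :
    homD F G k k' hk (through D D' h y ψ)
      = through D D' (by omega) (G.d p p' hp y) ψ
        + sgn p • through D D' (by omega) y (homD F (tens D.P D'.P) m m' hm ψ) := by
  rw [through, homD_comp h hm hp hk, homD_hat,
    homD_homComp_right (add_zero m) hm hm (res D D').2, sgn_zero, one_smul]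
  rfl

/-- The components of `chiX`. -/
noncomputable def chiVal {i : ℤ} (l : ((hom F G).dualC 0).X i) (p q : ℤ) (h : p + i = q) :
    G.X p →ₗ[ℂ] (inv D D' F).dual.X q :=
  LinearMap.mk₂ ℂ
    (fun y (ψ : homX F (tens D.P D'.P) (-q)) =>
      ev (K := hom F G) l (through D D' (by omega) y ψ))
    (by intros; simp [through, hat_add, homComp_add_left])
    (by intros; simp [through, hat_smul, homComp_smul_left])
    (by intros; simp [through, homComp_add_right])
    (by intros; simp [through, homComp_smul_right])

lemma through_lact {c p p' m m' k : ℤ} (h : c + p = p') (hm : m' + p' = k) (hm' : m + p = k)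
    (hc : m' + c = m) (a : A.X c) (y : G.X p) (ψ : homX F (tens D.P D'.P) m') :
    through D D' hm (G.lact c p p' h a y) ψ
      = sgn (c * (m' + p)) • through D D' hm' y (ihR D.P D'.P F m' c m hc ψ a) := by
  refine homX_ext fun s j hsj x => ?_
  change _ = sgn (c * (m' + p)) • (through D D' _ y _).1 ⟨s, j, hsj⟩ x
  rw [through_apply D D' _ _ _ s (s + m') j rfl, through_apply D D' _ _ _ s (s + m) j rfl,
    hat_lact (n' := s + m) h (by omega) (by omega),
    ihR_apply D.P D'.P F m' c m hc ψ a s (s + m') (s + m) rfl rfl,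
    map_smul, map_smul, res,
    tensHom_inR D.ε D'.ε (s + m') c (s + m) (by omega) (by omega) (by omega), smul_smul,
    ← sgn_add]
  congr 1
  exact congrArg sgn (by ring)

lemma through_ract {c p p' m m' k : ℤ} (h : p + c = p') (hm : m' + p' = k) (hm' : m + p = k)
    (hc : c + m' = m) (y : G.X p) (b : B.X c) (ψ : homX F (tens D.P D'.P) m') :
    through D D' hm (G.ract p c p' h y b) ψ
      = through D D' hm' y (ihL D.P D'.P F c m' m hc b ψ) := by
  refine homX_ext fun s j hsj x => ?_
  rw [through_apply D D' _ _ _ s (s + m') j rfl, through_apply D D' _ _ _ s (s + m) j rfl,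
    hat_ract (n' := s + m) h (by omega) (by omega),
    ihL_apply D.P D'.P F c m' m hc b ψ s (s + m') (s + m) rfl rfl, res,
    tensHom_inL D.ε D'.ε c (s + m') (s + m) (by omega) (by omega) (by omega)]

/-- The natural transformation `Hom(F, G)* → Hom(G, Hom(F, P ⊗ P')*)`, at a single element. -/
noncomputable def chiX {i : ℤ} (l : ((hom F G).dualC 0).X i) : homX G (inv D D' F).dual i :=
  ⟨fun t => chiVal D D' l t.p t.q t.hpq, by
    constructor
    · intro c p p' q q' h hi hj a y
      refine dv_ext (M := inv D D' F) (i := q') (-q') (by omega) fun (ψ : homX F (tens D.P D'.P) (-q')) => ?_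
      rw [dv_smul, dv_lact (i := q) (j := q') (m' := -q) (by omega) (by omega) (by omega)]
      change ev (K := hom F G) l (through D D' (by omega) (G.lact c p p' h a y) ψ)
        = sgn (i * c) * (sgn c * ev (K := hom F G) l (through D D' (by omega) y
          (ihR D.P D'.P F (-q') c (-q) (by omega) ψ a)))
      rw [through_lact D D' (m := -q) (m' := -q') h (by omega) (by omega) (by omega), map_smul, smul_eq_mul,
        ← _root_.mul_assoc, ← sgn_add]
      congr 1
      obtain ⟨t, ht⟩ := exists_sq_eq c
      obtain rfl : q' = c + p + i := by omega
      exact sgn_congr (-c - t - c * i) (by linear_combination -ht)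
    · intro p c p' q q' h hi hj y b
      refine dv_ext (M := inv D D' F) (i := q') (-q') (by omega) fun (ψ : homX F (tens D.P D'.P) (-q')) => ?_
      rw [dv_ract (i := q) (j := q') (m' := -q) (by omega) (by omega) (by omega)]
      exact congrArg (ev (K := hom F G) l) (through_ract D D' h
        (by omega) (by omega) (show c + -q' = -q by omega) y b ψ)⟩

lemma dv_chiX {i p q m k : ℤ} (l : ((hom F G).dualC 0).X i) (hq : p + i = q) (hm : q + m = 0)
    (hk : i + k = 0) (y : G.X p) (ψ : homX F (tens D.P D'.P) m) :
    dv (M := inv D D' F) ((chiX D D' l).1 ⟨p, q, hq⟩ y) m hm ψ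
      = dcv (K := hom F G) l k hk (through D D' (by omega) y ψ) := by
  obtain rfl : m = -q := by omega
  obtain rfl : k = 0 - i := by omega
  rfl

lemma dcv_d {K : Cpx.{u}} {n i j m m' : ℤ} (hj : i + 1 = j) (h : j + m = n) (h' : i + m' = n)
    (φ : (K.dualC n).X i) (x : K.X m) :
    dcv ((K.dualC n).d i j hj φ) m h x = -(sgn i) * dcv φ m' h' (K.d m m' (by omega) x) := by
  obtain rfl : m = n - j := by omega
  obtain rfl : m' = n - i := by omega
  rfl

lemma homD_chiX {i i' : ℤ} (hi : i + 1 = i') (l : ((hom F G).dualC 0).X i) :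
    homD G _ i i' hi (chiX D D' l) = chiX D D' (((hom F G).dualC 0).d i i' hi l) := by
  refine homX_ext fun p q hq y => ?_
  refine dv_ext (M := inv D D' F) (i := q) (-q) (by omega) fun (ψ : homX F (tens D.P D'.P) (-q)) => ?_
  rw [homD_apply _ _ i i' hi _ p q (p + 1) (p + i) hq rfl rfl, dv_sub, dv_smul,
    dv_d (M := inv D D' F) (j := q) (m' := -q + 1) (by omega) (by omega) (by omega),
    dv_chiX (k := -i) D D' l rfl (by omega) (by omega),
    dv_chiX (k := -i) D D' l (by omega) (by omega) (by omega),
    dv_chiX (k := -i') D D' _ (by omega) (by omega) (by omega),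
    dcv_d (m' := -i) hi (by omega) (by omega)]
  change -(sgn (p + i)) * dcv (K := hom F G) l (-i) (by omega) (through D D' (by omega) y
    (homD F (tens D.P D'.P) (-q) (-q + 1) rfl ψ)) - _
    = -(sgn i) * dcv (K := hom F G) l (-i) (by omega)
      (homD F G (-i') (-i) (by omega) (through D D' (by omega) y ψ))
  rw [homD_through (p' := p + 1) (m' := -q + 1) D D' (by omega) rfl rfl (by omega), map_add,
    map_smul, smul_eq_mul, sgn_add]
  ring

lemma chiX_comp {N : DGBimod.{u, v, max u v} A B} {i k j m m' : ℤ} (h : k + i = j)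
    (hm : i + m = 0) (hm' : j + m' = 0) (l : ((hom F G).dualC 0).X i)
    (l' : ((hom F N).dualC 0).X j) (f : homX N G k)
    (hl : ∀ φ : homX F N m', dcv (K := hom F N) l' m' hm' φ
      = dcv (K := hom F G) l m hm (homComp (by omega) f φ)) :
    chiX D D' l' = homComp h (chiX D D' l) f := by
  refine homX_ext fun p q hq y => ?_
  refine dv_ext (M := inv D D' F) (i := q) (-q) (by omega) fun (ψ : homX F (tens D.P D'.P) (-q)) => ?_
  rw [homComp_apply _ _ _ p (p + k) q rfl, dv_chiX (k := m') D D' _ (by omega) (by omega) hm',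
    dv_chiX (k := m) D D' l (by omega) (by omega) hm, hl]
  congr 1
  rw [through, homComp_assoc (lm := p + k) (by omega) (by omega) rfl (by omega), hat_comp]
  rfl

variable (F)

/-- The natural transformation `Hom(F, -)* → Hom(-, Hom(F, P ⊗ P')*)`. -/
noncomputable def chi : DGFun.NatTrans (homDualF F) (homF (inv D D' F).dual) where
  app G :=
    { f := fun i j h =>
        { toFun := fun l => chiX D D' (i := j) (l ∘ₗ (LinearEquiv.cast (R := ℂ)
            (M := fun k => homX F G k) (show 0 - j = 0 - i by omega)).toLinearMap)
          map_add' := fun l l' => rfl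
          map_smul' := fun c l => rfl }
      comm := by
        intro i j i' j' h hi hj l
        obtain rfl : i = j := by omega
        obtain rfl : i' = j' := by omega
        rw [sgn_zero, one_smul]
        exact homD_chiX D D' hi l }
  nat {M N} i k j h l f :=
    chiX_comp D D' (m := 0 - i) (m' := 0 - j) (by omega) (by omega) (by omega) l _ f
      fun φ => rfl

variable {F}

lemma evGen_chi {i m : ℤ} (hm : i + m = 0) (l : ((hom F (free A B)).dualC 0).X i)
    (ψ : homX F (tens D.P D'.P) m) :
    dv (M := inv D D' F) ((evGen (inv D D' F).dual).f i i (add_zero i) (chiX D D' l)) m hm ψ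
      = dcv (K := hom F (free A B)) l m hm (homComp (add_zero m) (res D D').1 ψ) := by
  rw [evGen_apply, dv_chiX (k := m) D D' l _ _ hm, through, hat_gen_eq, id_homComp]

theorem chi_free_isQI (hF : F.IsPerfect) : ((chi D D' F).app (free A B)).IsQI := by
  have hq := hF.isKProjective.postC_isQI_zero (res D D') (res_isQI D D')
  have hev := evGen_isQI (inv D D' F).dual
  constructor
  · intro i j h (f : homX (free A B) (inv D D' F).dual j) hf
    obtain rfl : i = j := by omega
    have hφ := (dv_isCyc (M := inv D D' F) (-i) (by omega)).1
      ((evGen (inv D D' F).dual).isCyc (add_zero i) hf)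
    obtain ⟨l', hl', hl''⟩ := hq.exists_dual _ hφ
    obtain ⟨l, rfl⟩ := exists_dcv (K := hom F (free A B)) (n := 0) (i := i) (-i) (by omega) l'
    have hl : ((hom F (free A B)).dualC 0).IsCyc l :=
      (dcv_isCyc (K := hom F (free A B)) (-i) (by omega)).2 hl'
    have hc : (hom (free A B) (inv D D' F).dual).IsCyc (chiX D D' l) :=
      ((chi D D' F).app (free A B)).isCyc (add_zero i) hl
    refine ⟨l, hl, ?_⟩
    change (hom (free A B) (inv D D' F).dual).IsBd (chiX D D' l - f)
    refine hev.inj i i (add_zero i) _ (hc.sub hf) ?_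
    refine (dv_isBd (M := inv D D' F) (-i) (by omega)).2 fun ψ hψ => ?_
    rw [map_sub, dv_sub, evGen_chi, sub_eq_zero]
    exact hl'' ψ hψ
  · intro i j h l hl hb
    obtain rfl : i = j := by omega
    have hb : (hom (free A B) (inv D D' F).dual).IsBd (chiX D D' l) := hb
    have h1 := (evGen (inv D D' F).dual).isBd (add_zero i) hb
    have h2 := (dv_isBd (M := inv D D' F) (-i) (by omega)).1 h1
    refine (dcv_isBd (K := hom F (free A B)) (-i) (by omega)).2 fun x hx => ?_
    obtain ⟨ψ, hψ, hb'⟩ := hq.surj (-i) (-i) (add_zero _) x hx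
    have h3 := h2 ψ hψ
    rw [evGen_chi D D' (by omega) l ψ] at h3
    have h4 := (dcv_isCyc (K := hom F (free A B)) (-i) (by omega)).1 hl _ hb'
    rw [map_sub, sub_eq_zero] at h4
    exact h4.symm.trans h3

theorem chi_isQI (hF : F.IsPerfect) (hG : G.IsPerfect) : ((chi D D' F).app G).IsQI :=
  (chi D D' F).isQI_devissage (chi_free_isQI D D' hF) G hG

end Chi

end TraceData

end HodgeCY

namespace HodgeCY

open Cpx DGBimod

/-- A space is finite-dimensional if it is the dual of a space whose dual it represents. -/
lemma finiteDimensional_of_dual_dual {V W : Type w} [AddCommGroup V] [Module ℂ V] [AddCommGroup W]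
    [Module ℂ W] (e : V ≃ₗ[ℂ] Module.Dual ℂ W) (e' : W ≃ₗ[ℂ] Module.Dual ℂ V) :
    FiniteDimensional ℂ V := by
  by_contra hV
  have hW : ¬ FiniteDimensional ℂ W := fun hW => hV (LinearEquiv.finiteDimensional e.symm)
  have key : ∀ {X : Type w} [AddCommGroup X] [Module ℂ X], ¬ FiniteDimensional ℂ X →
      Module.rank ℂ X < Module.rank ℂ (Module.Dual ℂ X) := fun hX => by
    have := lift_rank_lt_rank_dual (not_lt.1 fun h => hX (Module.rank_lt_aleph0_iff.1 h))
    rwa [Cardinal.lift_id'.{0, w}] at this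
  have h2 := key hV
  have h3 := key hW
  rw [← e.rank_eq] at h3
  rw [← e'.rank_eq] at h2
  exact lt_asymm h2 h3

namespace TraceData

variable {A : DGAlg.{u}} {B : DGAlg.{v}} {nA nB n : ℤ}

lemma exists_tr_form (D : TraceData A nA) (D' : TraceData B nB) (hn : nA + nB = n)
    {F : DGBimod.{u, v, max u v} A B} (hF : F.IsPerfect) :
    ∃ l : ((hom F F).dualC 0).X (-n), ((hom F F).dualC 0).IsCyc l ∧
      (hom F (inv D D' F).dual).IsBd (chiX D D' l - kappaX D D' hn F) :=
  (chi_isQI D D' hF hF).surj (-n) (-n) (add_zero _) (kappaX D D' hn F) (isCyc_kappaX D D' hn F)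

/-- Serre duality for perfect bimodules. -/
theorem exists_trace (D : TraceData A nA) (D' : TraceData B nB) (hn : nA + nB = n)
    (hA : A.IsProper) (hB : B.IsProper) {F : DGBimod.{u, v, max u v} A B} (hF : F.IsPerfect) :
    ∃ tr : GHom F F n →ₗ[ℂ] ℂ, ∀ G : DGBimod.{u, v, max u v} A B, G.IsPerfect →
      ∀ (k m : ℤ) (h : k + m = n), Function.Bijective
        ((comp h).compr₂ tr : GHom G F m →ₗ[ℂ] GHom F G k →ₗ[ℂ] ℂ) := by
  obtain ⟨l, hl, hlκ⟩ := exists_tr_form D D' hn hF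
  have hlb := (dcv_isCyc (K := hom F F) n (by omega)).1 hl
  refine ⟨Submodule.liftQ _ (dcv (K := hom F F) l n (by omega) ∘ₗ ((hom F F).Z n).subtype)
    fun x hx => hlb x.1 hx, fun G hG k m h => ?_⟩
  have hκ := hG.isKProjective.postC_isQI (kappa D D' hn F) (kappa_isQI D D' hn F hA hB hF)
  have hχ := chi_isQI D D' hF hG
  have key : ∀ g : homX G F m, (hom G F).IsCyc g →
      ∃ lg : ((hom F G).dualC 0).X (m + -n), ((hom F G).dualC 0).IsCyc lg ∧
        (∀ φ : homX F G k, dcv (K := hom F G) lg k (by omega) φ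
          = dcv (K := hom F F) l n (by omega) (homComp h g φ)) ∧
        (hom G (inv D D' F).dual).IsBd
          (chiX D D' lg - homComp (k := m) (l := -n) rfl (kappaX D D' hn F) g) := by
    intro g hg
    obtain ⟨lg, hlg⟩ := exists_dcv (K := hom F G) (n := 0) (i := m + -n) k (by omega)
      (dcv (K := hom F F) l n (by omega) ∘ₗ (postC F ⟨g, hg⟩).f k n h)
    have hval : ∀ φ : homX F G k, dcv (K := hom F G) lg k (by omega) φ
        = dcv (K := hom F F) l n (by omega) (homComp h g φ) := fun φ => LinearMap.congr_fun hlg φ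
    refine ⟨lg, (dcv_isCyc (K := hom F G) k (by omega)).2 fun x hx => ?_, hval, ?_⟩
    · rw [hval]
      exact hlb _ (homComp_isBd_right h hg hx)
    · rw [chiX_comp D D' (k := m) (i := -n) (m := n) (m' := k) rfl (by omega) (by omega) l lg g hval]
      exact homComp_isBd_left rfl hlκ hg
  constructor
  · refine (injective_iff_map_eq_zero _).2 fun x hx => ?_
    obtain ⟨g, rfl⟩ := Submodule.Quotient.mk_surjective _ x
    obtain ⟨lg, hlg, hval, hb⟩ := key g.1 g.2
    have h1 : ((hom F G).dualC 0).IsBd lg := by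
      refine (dcv_isBd (K := hom F G) k (by omega)).2 fun φ hφ => ?_
      rw [hval]
      exact LinearMap.congr_fun hx (Submodule.Quotient.mk ⟨φ, hφ⟩)
    have h2 : (hom G (inv D D' F).dual).IsBd (chiX D D' lg) :=
      ((chi D D' F).app G).isBd (add_zero _) h1
    have h3 := h2.sub hb
    rw [sub_sub_cancel] at h3
    exact (mk_eq_zero _).2 (hκ.inj m (m + -n) rfl g.1 g.2 h3)
  · intro φ
    obtain ⟨φ', hφ'⟩ := LinearMap.exists_extend (φ ∘ₗ ((hom F G).B k).mkQ)
    have hz : ∀ z : (hom F G).Z k, φ' z.1 = φ (Submodule.Quotient.mk z) := fun z =>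
      LinearMap.congr_fun hφ' z
    obtain ⟨lφ, hlφ⟩ := exists_dcv (K := hom F G) (n := 0) (i := m + -n) k (by omega) φ'
    have hc : ((hom F G).dualC 0).IsCyc lφ := by
      refine (dcv_isCyc (K := hom F G) k (by omega)).2 fun x hx => ?_
      rw [hlφ, hz ⟨x, hx.isCyc⟩, (mk_eq_zero _).2 hx, map_zero]
    have hc' : (hom G (inv D D' F).dual).IsCyc (chiX D D' lφ) :=
      ((chi D D' F).app G).isCyc (add_zero _) hc
    obtain ⟨g, hg, hb'⟩ := hκ.surj m (m + -n) rfl _ hc'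
    obtain ⟨lg, hlg, hval, hb⟩ := key g hg
    have h3 : (hom G (inv D D' F).dual).IsBd (chiX D D' (lg - lφ)) := by
      have h4 := hb.add hb'
      rw [postC_apply] at h4
      have h5 : chiX D D' lg - homComp (k := m) (l := -n) rfl (kappaX D D' hn F) g
          + (homComp (k := m) (l := -n) rfl (kappaX D D' hn F) g - chiX D D' lφ)
          = chiX D D' (lg - lφ) := by
        rw [sub_add_sub_cancel]; rfl
      rw [← h5]
      exact h4
    have h6 := hχ.inj (m + -n) (m + -n) (add_zero _) (lg - lφ) (hlg.sub hc) h3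
    have h7 := (dcv_isBd (K := hom F G) k (by omega)).1 h6
    refine ⟨Submodule.Quotient.mk ⟨g, hg⟩, LinearMap.ext fun x => ?_⟩
    obtain ⟨z, rfl⟩ := Submodule.Quotient.mk_surjective _ x
    have h8 : dcv (K := hom F G) lg k (by omega) z.1 - dcv (K := hom F G) lφ k (by omega) z.1 = 0 :=
      h7 z.1 z.2
    rw [hval, hlφ, hz, sub_eq_zero] at h8
    exact h8

/-- Spaces of morphisms between perfect bimodules are finite-dimensional. -/
theorem finite_GHom (D : TraceData A nA) (D' : TraceData B nB)
    (hA : A.IsProper) (hB : B.IsProper) {F G : DGBimod.{u, v, max u v} A B} (hF : F.IsPerfect)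
    (hG : G.IsPerfect) (k : ℤ) : FiniteDimensional ℂ (GHom F G k) := by
  obtain ⟨tr, htr⟩ := exists_trace D D' rfl hA hB hF
  obtain ⟨tr', htr'⟩ := exists_trace D D' rfl hA hB hG
  exact finiteDimensional_of_dual_dual
    (LinearEquiv.ofBijective _ (htr' F hF (nA + nB - k) k (by omega)))
    (LinearEquiv.ofBijective _ (htr G hG k (nA + nB - k) (by omega)))

end TraceData

end HodgeCY

namespace HodgeCY

open Cpx DGBimod

section TwoOfThree

variable {K : Cpx.{u}} {L : Cpx.{v}} {N : Cpx.{w}} {m m' n : ℤ} {f : GMap K L m} {g : GMap L N m'}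
  {e : GMap K N n}

lemma Cpx.GMap.IsQI.of_comp (hn : m + m' = n) (hg : g.IsQI) (he : e.IsQI)
    (h : ∀ (i k j : ℤ) (h₁ : i + m = k) (h₂ : k + m' = j) (h₃ : i + n = j) (x : K.X i),
      K.IsCyc x → N.IsBd (g.f k j h₂ (f.f i k h₁ x) - e.f i j h₃ x)) : f.IsQI where
  surj i k hi y hy := by
    obtain ⟨x, hx, hb⟩ := he.surj i (k + m') (by omega) _ (g.isCyc rfl hy)
    refine ⟨x, hx, hg.inj k (k + m') rfl _ ((f.isCyc hi hx).sub hy) ?_⟩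
    have := (h i k (k + m') hi rfl (by omega) x hx).add hb
    rwa [sub_add_sub_cancel, ← map_sub] at this
  inj i k hi x hx hb := by
    have h1 := (g.isBd rfl hb).sub (h i k (k + m') hi rfl (by omega) x hx)
    rw [sub_sub_cancel] at h1
    exact he.inj i _ (by omega) x hx h1

lemma Cpx.GMap.IsQI.comp_of (hn : m + m' = n) (hf : f.IsQI) (hg : g.IsQI)
    (h : ∀ (i k j : ℤ) (h₁ : i + m = k) (h₂ : k + m' = j) (h₃ : i + n = j) (x : K.X i),
      K.IsCyc x → N.IsBd (g.f k j h₂ (f.f i k h₁ x) - e.f i j h₃ x)) : e.IsQI where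
  surj i j hi y hy := by
    obtain ⟨x', hx', hb'⟩ := hg.surj (i + m) j (by omega) y hy
    obtain ⟨x, hx, hb⟩ := hf.surj i (i + m) rfl x' hx'
    refine ⟨x, hx, ?_⟩
    have h1 := (hb'.add (g.isBd (show i + m + m' = j by omega) hb)).sub
      (h i (i + m) j rfl (by omega) hi x hx)
    rw [map_sub] at h1
    convert h1 using 1
    abel
  inj i j hi x hx hb := by
    have h1 := (h i (i + m) j rfl (by omega) hi x hx).add hb
    rw [sub_add_cancel] at h1
    exact hf.inj i _ rfl x hx (hg.inj _ j (by omega) _ (f.isCyc rfl hx) h1)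

end TwoOfThree

namespace DGBimod

variable {A : DGAlg.{u}} {B : DGAlg.{v}} {M N K : DGBimod.{u, v, w} A B}

lemma isBd_apply {k i j : ℤ} {φ : homX M N k} (hφ : (hom M N).IsBd φ) (h : i + k = j) {x : M.X i}
    (hx : M.IsCyc x) : N.IsBd (φ.1 ⟨i, j, h⟩ x) := by
  obtain ⟨y, hy⟩ := hφ
  change homD M N (k - 1) k (by omega) y = φ at hy
  rw [← hy, homD_apply M N (k - 1) k (by omega) y i j (i + 1) (j - 1) h rfl (by omega), hx.d,
    map_zero, smul_zero, sub_zero]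
  exact isBd_d _ _

lemma isCyc_apply {k i j : ℤ} {φ : homX M N k} (hφ : (hom M N).IsCyc φ) (h : i + k = j) {x : M.X i}
    (hx : M.IsCyc x) : N.IsCyc (φ.1 ⟨i, j, h⟩ x) :=
  (toGMap ⟨φ, hφ⟩).isCyc h hx

/-- Lifting a morphism through a quasi-isomorphism. -/
lemma IsKProjective.exists_lift (hM : M.IsKProjective) {m k n : ℤ} (h : k + m = n)
    (f : (hom N K).Z m) (hf : (toGMap f).IsQI) (e : (hom M K).Z n) :
    ∃ l : (hom M N).Z k, (hom M K).IsBd (homComp h f.1 l.1 - e.1) := by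
  obtain ⟨l, hl, hb⟩ := (hM.postC_isQI f hf).surj k n h e.1 e.2
  exact ⟨⟨l, hl⟩, hb⟩

lemma IsKProjective.eq_of_comp_eq (hM : M.IsKProjective) {m k n : ℤ} (h : k + m = n)
    (f : (hom N K).Z m) (hf : (toGMap f).IsQI) {l l' : (hom M N).Z k}
    (hb : (hom M K).IsBd (homComp h f.1 l.1 - homComp h f.1 l'.1)) :
    (Submodule.Quotient.mk l : GHom M N k) = Submodule.Quotient.mk l' := by
  rw [← homComp_sub_right] at hb
  exact (mk_eq_mk _ _).2 ((hM.postC_isQI f hf).inj k n h _ (IsCyc.sub l.2 l'.2) hb)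

lemma toGMap_isQI_of_comp {k m n : ℤ} (h : k + m = n) (l : (hom M N).Z k) (f : (hom N K).Z m)
    (e : (hom M K).Z n) (hf : (toGMap f).IsQI) (he : (toGMap e).IsQI)
    (hb : (hom M K).IsBd (homComp h f.1 l.1 - e.1)) : (toGMap l).IsQI := by
  refine GMap.IsQI.of_comp h hf he fun i q j h₁ h₂ h₃ x hx => ?_
  have := isBd_apply hb h₃ hx
  change K.IsBd ((homComp h f.1 l.1).1 ⟨i, j, h₃⟩ x - e.1.1 ⟨i, j, h₃⟩ x) at this
  rw [homComp_apply h _ _ i q j h₁] at this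
  exact this

lemma toGMap_isQI_comp {k m n : ℤ} (h : k + m = n) (l : (hom M N).Z k) (f : (hom N K).Z m)
    (hl : (toGMap l).IsQI) (hf : (toGMap f).IsQI) : (toGMap (compZ h f l)).IsQI := by
  refine GMap.IsQI.comp_of h hl hf fun i q j h₁ h₂ h₃ x hx => ?_
  change K.IsBd (f.1.1 ⟨q, j, h₂⟩ (l.1.1 ⟨i, q, h₁⟩ x) - (homComp h f.1 l.1).1 ⟨i, j, h₃⟩ x)
  rw [homComp_apply h _ _ i q j h₁, sub_self]
  exact isBd_zero

lemma shiftIn_isQI (M : DGBimod.{u, v, w} A B) (n : ℤ) :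
    (toGMap ⟨shiftIn M n, isCyc_shiftIn M n⟩ : GMap M.toCpx (M.shift n).toCpx (-n)).IsQI where
  surj i j h y hy := by
    obtain rfl : i = j + n := by omega
    refine ⟨y, ?_, ?_⟩
    · refine isCyc_of (j + 1 + n) (by omega) ?_
      have h1 : sgn n • M.d (j + n) (j + 1 + n) (by omega) y = 0 := hy
      exact (smul_eq_zero.1 h1).resolve_left (sgn_ne_zero n)
    · change (M.shift n).IsBd (y - y)
      rw [sub_self]
      exact isBd_zero
  inj i j h x hx hb := by
    obtain rfl : i = j + n := by omega
    obtain ⟨y, hy⟩ := hb.exists (j - 1) (by omega)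
    change sgn n • M.d (j - 1 + n) (j + n) (by omega) y = x at hy
    rw [← hy]
    exact (isBd_d _ _).smul _

end DGBimod

lemma DGBimod.homComp_sub_left {A : DGAlg.{u}} {B : DGAlg.{v}} {M N K : DGBimod.{u, v, w} A B}
    {k l n : ℤ} (h : k + l = n) (g g' : homX N K l) (f : homX M N k) :
    homComp h (g - g') f = homComp h g f - homComp h g' f := rfl

lemma DGAlg.d_one (A : DGAlg.{u}) : A.d 0 1 rfl A.one = 0 := by
  have h := A.d_mul 0 0 0 1 1 1 rfl rfl rfl rfl A.one A.one
  rw [A.one_mul, A.one_mul, A.mul_one, sgn_zero, one_smul] at h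
  exact left_eq_add.1 h

section Diagonal

variable {A : DGAlg.{u}} {P : DGBimod.{u, u, u} A A} {n : ℤ}

/-- The values of a morphism to the dual of the diagonal. -/
noncomputable def dualVal {m : ℤ} (θ : homX P (diag A).dual m) (i j : ℤ) (h : i + m + j = 0) :
    P.X i →ₗ[ℂ] Module.Dual ℂ (A.X j) where
  toFun p := dv (M := diag A) (i := i + m) (θ.1 ⟨i, i + m, rfl⟩ p) j h
  map_add' p p' := by rw [map_add]; rfl
  map_smul' c p := by rw [map_smul]; rfl

lemma dualVal_apply {m : ℤ} (θ : homX P (diag A).dual m) (i j k : ℤ) (h : i + m + j = 0)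
    (hk : i + m = k) (p : P.X i) :
    dualVal θ i j h p = dv (M := diag A) (i := k) (θ.1 ⟨i, k, hk⟩ p) j (by omega) := by
  subst hk
  rfl

lemma dualVal_lact {m : ℤ} (θ : homX P (diag A).dual m) {i j k l lj : ℤ} (h : j + i = k)
    (hm : k + m + l = 0) (hl : l + j = lj) (a : A.X j) (p : P.X i) (c : A.X l) :
    dualVal θ k l hm (P.lact j i k h a p) c
      = sgn ((m + 1) * j) * dualVal θ i lj (by omega) p (A.mul l j lj hl c a) := by
  rw [dualVal_apply θ k l (k + m) hm rfl, θ.2.1 j i k (i + m) (k + m) h rfl rfl, dv_smul,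
    dv_lact (M := diag A) (m' := lj) (by omega) (by omega) (by omega), ← mul_assoc, ← sgn_add]
  congr 1
  exact congrArg sgn (by ring)

lemma dualVal_ract {m : ℤ} (θ : homX P (diag A).dual m) {i j k l jl : ℤ} (h : i + j = k)
    (hm : k + m + l = 0) (hl : j + l = jl) (a : A.X j) (p : P.X i) (c : A.X l) :
    dualVal θ k l hm (P.ract i j k h p a) c
      = dualVal θ i jl (by omega) p (A.mul j l jl hl a c) := by
  rw [dualVal_apply θ k l (k + m) hm rfl, θ.2.2 i j k (i + m) (k + m) h rfl rfl,
    dv_ract (M := diag A) (m' := jl) (by omega) (by omega) (by omega)]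
  rfl

lemma dualVal_homD {m m' : ℤ} (hm : m + 1 = m') (θ : homX P (diag A).dual m)
    {i i' j j' : ℤ} (hi : i + 1 = i') (hj : j + 1 = j') (h : i + m' + j = 0) (p : P.X i)
    (a : A.X j) :
    dualVal (homD P (diag A).dual m m' hm θ) i j h p a
      = -(sgn (i + m)) * dualVal θ i j' (by omega) p (A.d j j' hj a)
        - sgn m * dualVal θ i' j (by omega) (P.d i i' hi p) a := by
  rw [dualVal_apply _ i j (i + m') h rfl, homD_apply _ _ m m' hm θ i (i + m') i' (i + m) rfl hi rfl,
    dv_sub, dv_smul, dv_d (M := diag A) (m' := j') (by omega) (by omega) (by omega),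
    dualVal_apply θ i' j (i + m') (by omega) (by omega)]
  rfl

lemma dualVal_one_lact {m : ℤ} (θ : homX P (diag A).dual m) {i j k : ℤ} (h : j + i = k)
    (hm : k + m + 0 = 0) (a : A.X j) (p : P.X i) :
    dualVal θ k 0 hm (P.lact j i k h a p) A.one
      = sgn ((m + 1) * j) * dualVal θ i j (by omega) p a := by
  rw [dualVal_lact θ h hm (zero_add j), A.one_mul]

lemma dualVal_one_ract {m : ℤ} (θ : homX P (diag A).dual m) {i j k : ℤ} (h : i + j = k)
    (hm : k + m + 0 = 0) (a : A.X j) (p : P.X i) :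
    dualVal θ k 0 hm (P.ract i j k h p a) A.one = dualVal θ i j (by omega) p a := by
  rw [dualVal_ract θ h hm (add_zero j), A.mul_one]

lemma dualVal_one_comm {m : ℤ} (θ : homX P (diag A).dual m) {i j k : ℤ} (h : j + i = k)
    (hm : k + m + 0 = 0) (a : A.X j) (p : P.X i) :
    dualVal θ k 0 hm (P.lact j i k h a p) A.one
      = sgn (j * i) * dualVal θ k 0 hm (P.ract i j k (by omega) p a) A.one := by
  rw [dualVal_one_lact, dualVal_one_ract]
  congr 1
  obtain ⟨t, ht⟩ := exists_sq_eq j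
  obtain rfl : m = -(j + i) := by omega
  exact sgn_congr (-t - j * i) (by linear_combination -ht)

lemma dualVal_one_homD {m m' : ℤ} (hm : m + 1 = m') (θ : homX P (diag A).dual m)
    {i i' : ℤ} (hi : i + 1 = i') (h : i + m' + 0 = 0) (p : P.X i) :
    dualVal (homD P (diag A).dual m m' hm θ) i 0 h p A.one
      = -(sgn m) * dualVal θ i' 0 (by omega) (P.d i i' hi p) A.one := by
  rw [dualVal_homD hm θ hi (zero_add 1), A.d_one, map_zero, mul_zero, zero_sub, neg_mul]

/-- The trace associated with a quasi-isomorphism from a resolution of the diagonal to the shifted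
dual of the diagonal. -/
noncomputable def TraceData.ofDual (ε : (hom P (diag A)).Z 0) (hε : IsQuasiIso ε)
    (θ : (hom P (diag A).dual).Z (-n)) (hθ : (toGMap θ).IsQI) : TraceData A n where
  P := P
  ε := ε
  qi := hε
  Θ := LinearMap.applyₗ A.one ∘ₗ dualVal θ.1 n 0 (by omega)
  Θ_d := by
    intro m h x
    have h1 := dualVal_one_homD (m := -n) rfl θ.1 h (by omega) x
    rw [show homD P (diag A).dual (-n) (-n + 1) rfl θ.1 = 0 from θ.2] at h1
    exact (mul_eq_zero.1 (h1.symm.trans rfl)).resolve_left (neg_ne_zero.2 (sgn_ne_zero _))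
  Θ_comm i j h a p := dualVal_one_comm θ.1 h (by omega) a p
  sep_left := by
    intro i j h p hp H
    refine hθ.inj i (-j) (by omega) p hp ((dv_isBd (M := diag A) j (by omega)).2 fun a ha => ?_)
    have h1 := (mul_eq_zero.1 ((dualVal_one_lact θ.1 h (by omega) a p).symm.trans
      (H a ha))).resolve_left (sgn_ne_zero _)
    rwa [dualVal_apply θ.1 i j (-j) (by omega) (by omega)] at h1
  sep_right := by
    intro i j h a ha H
    refine isBd_of_forall_dual fun α hα => ?_
    obtain ⟨φ, hφ⟩ := exists_dv (M := diag A) (i := -j) j (by omega) α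
    obtain ⟨p, hp, hb⟩ := hθ.surj i (-j) (by omega) φ
      ((dv_isCyc (M := diag A) j (by omega)).2 (by rw [hφ]; exact hα))
    have h1 := (dv_isBd (M := diag A) j (by omega)).1 hb a ha
    rw [dv_sub, hφ] at h1
    have h2 := (mul_eq_zero.1 ((dualVal_one_lact θ.1 h (by omega) a p).symm.trans
      (H p hp))).resolve_left (sgn_ne_zero _)
    rw [dualVal_apply θ.1 i j (-j) (by omega) (by omega)] at h2
    exact (sub_eq_zero.1 h1).symm.trans h2

end Diagonal

/-- The trace of the base field. -/
noncomputable def TraceData.ofBase : TraceData base 0 :=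
  { P := diag base
    ε := ⟨homId _, homD_id _⟩
    qi := by
      refine (isQuasiIso_iff _).2 ⟨fun i j h y hy => ?_, fun i j h x hx hb => ?_⟩
      · obtain rfl : i = j := by omega
        refine ⟨y, hy, ?_⟩
        change (diag base).IsBd (y - y)
        rw [sub_self]
        exact isBd_zero
      · obtain rfl : i = j := by omega
        exact hb
    Θ := (baseX 0).subtype
    Θ_d := by intros; rfl
    Θ_comm := by
      intro i j h a p
      change a.1 * p.1 = sgn (i * j) * (p.1 * a.1)
      by_cases hi : i = 0
      · have e : sgn (i * j) = 1 := by rw [hi, zero_mul, sgn_zero]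
        rw [e, _root_.one_mul, mul_comm]
      · rw [a.2 hi, zero_mul, mul_zero, mul_zero]
    sep_left := by
      intro i j h p _ H
      have hp : p = 0 := by
        by_cases hi : i = 0
        · obtain rfl : j = 0 := by omega
          subst hi
          have := H base.one (base.d_one)
          exact Subtype.ext ((_root_.one_mul _).symm.trans this)
        · exact Subtype.ext (p.2 hi)
      rw [hp]
      exact isBd_zero
    sep_right := by
      intro i j h a _ H
      have ha : a = 0 := by
        by_cases hj : j = 0
        · obtain rfl : i = 0 := by omega
          subst hj
          have := H base.one (base.d_one)
          exact Subtype.ext ((_root_.mul_one _).symm.trans this)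
        · exact Subtype.ext (a.2 hj)
      rw [ha]
      exact isBd_zero }

lemma base_isProper : base.IsProper := by
  refine ⟨fun k => ?_, (Set.finite_singleton (0 : ℤ)).subset fun k hk => ?_⟩
  · have : FiniteDimensional ℂ (base.X k) := inferInstanceAs (FiniteDimensional ℂ (baseX k))
    infer_instance
  · by_contra h
    refine not_subsingleton_iff_nontrivial.2 hk (subsingleton_H_iff.2 fun x _ => ?_)
    rw [show x = 0 from Subtype.ext (x.2 h)]
    exact isBd_zero

namespace DGAlg.Resolution

variable {C : DGAlg.{u}} (R : C.Resolution)

lemma qi : (toGMap R.ε).IsQI := (isQuasiIso_iff _).1 R.quasiIso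

lemma isPerfect (h : C.IsSmooth) : R.P.IsPerfect := by
  obtain ⟨P, ε, hP, hε⟩ := h
  have hε' := (isQuasiIso_iff _).1 hε
  obtain ⟨i, hi⟩ := R.kproj.exists_lift (add_zero 0) ε hε' R.ε
  obtain ⟨r, hr⟩ := hP.isKProjective.exists_lift (add_zero 0) R.ε R.qi ε
  refine .retract (Submodule.Quotient.mk i) (Submodule.Quotient.mk r) ?_ hP
  rw [comp_mk]
  refine R.kproj.eq_of_comp_eq (add_zero 0) R.ε R.qi ?_
  change (hom R.P (diag C)).IsBd (homComp _ R.ε.1 (homComp (add_zero 0) r.1 i.1)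
    - homComp _ R.ε.1 (homId R.P))
  rw [homComp_assoc (lm := 0) (n := 0) (add_zero 0) (add_zero 0) (add_zero 0) (add_zero 0),
    homComp_id]
  have h1 := (homComp_isBd_left (add_zero 0) hr i.2).add hi
  rw [homComp_sub_left, sub_add_sub_cancel] at h1
  exact h1

/-- A Calabi–Yau structure, as a quasi-isomorphism from the resolution of the diagonal. -/
lemma exists_dual {n : ℤ} (h : C.IsCalabiYau n) :
    ∃ θ : (hom R.P (diag C).dual).Z (-n), (toGMap θ).IsQI := by
  obtain ⟨Q, f, g, hf, hg⟩ := h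
  have hf' := (isQuasiIso_iff _).1 hf
  let e := compZ (zero_add (-n)) ⟨shiftIn (diag C) n, isCyc_shiftIn _ n⟩ R.ε
  have he : (toGMap e).IsQI := toGMap_isQI_comp _ _ _ R.qi (shiftIn_isQI _ n)
  obtain ⟨l, hl⟩ := R.kproj.exists_lift (add_zero (-n)) f hf' e
  exact ⟨compZ (add_zero (-n)) g l, toGMap_isQI_comp _ _ _
    (toGMap_isQI_of_comp _ l f e hf' he hl) ((isQuasiIso_iff _).1 hg)⟩

end DGAlg.Resolution

end HodgeCY

namespace HodgeCY

open Cpx DGBimod DGAlg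

section Coinvariants

variable {A : DGAlg.{u}} {P : DGBimod.{u, u, u} A A}

lemma dualVal_one_commutators {m : ℤ} (θ : homX P (diag A).dual m) {k : ℤ} (hm : k + m + 0 = 0) :
    commutators P k ≤ LinearMap.ker (LinearMap.applyₗ A.one ∘ₗ dualVal θ k 0 hm) := by
  refine Submodule.span_le.2 ?_
  rintro _ ⟨j, i, h, a, p, rfl⟩
  change dualVal θ k 0 hm _ A.one = 0
  rw [map_sub, map_smul, LinearMap.sub_apply, dualVal_one_comm θ h hm, LinearMap.smul_apply,
    smul_eq_mul, sub_self]

/-- Bimodule morphisms to the dual of the diagonal give linear forms on the coinvariants. -/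
noncomputable def coinvDual (P : DGBimod.{u, u, u} A A) :
    GMap (hom P (diag A).dual) ((coinvariants P).dualC 0) 0 where
  f i j h :=
    { toFun := fun θ => Submodule.liftQ (commutators P (0 - j))
        (LinearMap.applyₗ A.one ∘ₗ dualVal θ (0 - j) 0 (by omega)) (dualVal_one_commutators θ _)
      map_add' := fun _ _ => Submodule.linearMap_qext _ rfl
      map_smul' := fun _ _ => Submodule.linearMap_qext _ rfl }
  comm := by
    intro i j i' j' h hi hj θ
    obtain rfl : i = j := by omega
    obtain rfl : i' = j' := by omega
    rw [sgn_zero, one_smul]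
    refine Submodule.linearMap_qext _ (LinearMap.ext fun p => ?_)
    exact (dualVal_one_homD hi θ (i := 0 - i') (i' := 0 - i) (by omega) (by omega) p).symm

lemma coinvDual_injective {i j : ℤ} (h : i + 0 = j) :
    Function.Injective ((coinvDual P).f i j h) := by
  refine (injective_iff_map_eq_zero _).2 fun (θ : homX P (diag A).dual i) hθ => ?_
  refine homX_ext fun k l hl p => dv_ext (M := diag A) (i := l) (-l) (by omega) fun (a : A.X (-l)) => ?_
  have h1 : dualVal θ (0 - j) 0 (by omega) (P.ract k (-l) (0 - j) (by omega) p a) A.one = 0 :=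
    LinearMap.congr_fun hθ (Submodule.Quotient.mk (P.ract k (-l) (0 - j) (by omega) p a))
  rw [dualVal_one_ract, dualVal_apply θ k (-l) l (by omega) hl] at h1
  exact h1

lemma coinvDual_surjective {i j : ℤ} (h : i + 0 = j) :
    Function.Surjective ((coinvDual P).f i j h) := by
  intro φ
  obtain rfl : i = j := by omega
  have hc : ∀ (a b : ℤ) (hab : a + b = 0 - i) (c : A.X a) (p : P.X b),
      φ (Submodule.Quotient.mk (P.lact a b (0 - i) hab c p))
        = sgn (a * b) * φ (Submodule.Quotient.mk (P.ract b a (0 - i) (by omega) p c)) := by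
    intro a b hab c p
    have h1 : (Submodule.Quotient.mk (P.lact a b (0 - i) hab c p) : P.X (0 - i) ⧸ commutators P (0 - i))
        = sgn (a * b) • Submodule.Quotient.mk (P.ract b a (0 - i) (by omega) p c) := by
      rw [← Submodule.Quotient.mk_smul, ← sub_eq_zero, ← Submodule.Quotient.mk_sub,
        Submodule.Quotient.mk_eq_zero]
      exact Submodule.subset_span ⟨a, b, hab, c, p, rfl⟩
    rw [h1]
    exact map_smul φ _ _
  let val : ∀ k l : ℤ, k + l = 0 - i → P.X k →ₗ[ℂ] A.X l →ₗ[ℂ] ℂ := fun k l h =>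
    (P.ract k l (0 - i) h).compr₂ (φ ∘ₗ (commutators P (0 - i)).mkQ)
  have hval : ∀ k l h p a, val k l h p a = φ (Submodule.Quotient.mk (P.ract k l (0 - i) h p a)) :=
    fun _ _ _ _ _ => rfl
  let θ : homX P (diag A).dual i :=
    ⟨fun t => val t.p (-t.q) (by have := t.hpq; omega), by
      constructor
      · intro l k j k' j' h hk hj a p
        refine dv_ext (M := diag A) (i := j') (-j') (by omega) fun (c : A.X (-j')) => ?_
        rw [dv_smul, dv_lact (M := diag A) (i := k') (j := j') (m' := -k') (by omega) (by omega) (by omega)]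
        change val j (-j') (by omega) (P.lact l k j h a p) c
          = sgn (i * l) * (sgn l * val k (-k') (by omega) p (A.mul (-j') l (-k') (by omega) c a))
        rw [hval, hval, P.lact_ract l k (-j') j (k + -j') (0 - i) h (by omega) rfl (by omega),
          hc, P.ract_mul k (-j') l (k + -j') (-k') (0 - i) rfl (by omega) (by omega) (by omega),
          ← _root_.mul_assoc, ← sgn_add]
        congr 1
        obtain ⟨t, ht⟩ := exists_sq_eq l
        obtain rfl : j' = l + k + i := by omega
        exact sgn_congr (-l * i - l - t) (by linear_combination -ht)
      · intro k l j k' j' h hk hj p a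
        refine dv_ext (M := diag A) (i := j') (-j') (by omega) fun (c : A.X (-j')) => ?_
        rw [dv_ract (M := diag A) (i := k') (j := j') (m' := -k') (by omega) (by omega) (by omega)]
        change val j (-j') (by omega) (P.ract k l j h p a) c
          = val k (-k') (by omega) p (A.mul l (-j') (-k') (by omega) a c)
        rw [hval, hval, P.ract_mul k l (-j') j (-k') (0 - i) h (by omega) (by omega) (by omega)]⟩
  refine ⟨θ, Submodule.linearMap_qext _ (LinearMap.ext fun p => ?_)⟩
  change dualVal θ (0 - i) 0 (by omega) p A.one = _
  rw [dualVal_apply θ (0 - i) 0 0 (by omega) (by omega)]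
  change φ (Submodule.Quotient.mk (P.ract (0 - i) 0 (0 - i) _ p A.one)) = _
  rw [P.ract_one]
  rfl

lemma coinvDual_isQI : (coinvDual P).IsQI where
  surj i j h y hy := by
    obtain ⟨x, rfl⟩ := coinvDual_surjective h y
    refine ⟨x, ?_, by rw [sub_self]; exact isBd_zero⟩
    have h1 := (coinvDual P).comm i j (i + 1) (j + 1) h rfl rfl x
    rw [hy.d, sgn_zero, one_smul] at h1
    exact coinvDual_injective (i := i + 1) (j := j + 1) (by omega)
      (h1.symm.trans (map_zero ((coinvDual P).f (i + 1) (j + 1) (by omega))).symm)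
  inj i j h x hx hb := by
    obtain ⟨y, hy⟩ := hb.exists (j - 1) (by omega)
    obtain ⟨z, rfl⟩ := coinvDual_surjective (i := i - 1) (j := j - 1) (by omega) y
    have h1 := (coinvDual P).comm (i - 1) (j - 1) i j (by omega) (by omega) (by omega) z
    rw [hy, sgn_zero, one_smul] at h1
    rw [coinvDual_injective h h1]
    exact isBd_d _ _

end Coinvariants

namespace DGAlg.Resolution

variable {C : DGAlg.{u}} (R : C.Resolution)

/-- The duality between Hochschild cohomology and homology of Calabi–Yau algebras. -/
lemma nonempty_dualEquiv {n : ℤ} (h : C.IsCalabiYau n) (k j : ℤ) (hkj : k + j = n) :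
    Nonempty (HHcoh R k ≃ₗ[ℂ] Module.Dual ℂ (HHhom R j)) := by
  obtain ⟨θ, hθ⟩ := R.exists_dual h
  obtain rfl : j = 0 - (k + -n) := by omega
  let e₁ := LinearEquiv.ofBijective _ (R.kproj.comp_bijective θ hθ k (k + -n) rfl)
  let e₂ := LinearEquiv.ofBijective _ ((coinvDual_isQI (P := R.P)).bijective (k + -n) (k + -n) (add_zero _))
  let e₃ := LinearEquiv.ofBijective _
    (dualPair_bijective (K := coinvariants R.P) 0 (k + -n))
  exact ⟨e₁.trans (e₂.trans e₃)⟩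

lemma exists_traceData (R : C.Resolution) {n : ℤ} (hc : C.IsCalabiYau n) : Nonempty (TraceData C n) := by
  obtain ⟨θ, hθ⟩ := R.exists_dual hc
  exact ⟨.ofDual R.ε R.quasiIso θ hθ⟩

lemma finite_HHcoh (hs : C.IsSmooth) (hp : C.IsProper) {n : ℤ} (hc : C.IsCalabiYau n) (k : ℤ) : FiniteDimensional ℂ (HHcoh R k) := by
  obtain ⟨D⟩ := R.exists_traceData hc
  exact TraceData.finite_GHom D D hp hp (R.isPerfect hs) (R.isPerfect hs) k

lemma finite_HHhom (hs : C.IsSmooth) (hp : C.IsProper) {n : ℤ} (hc : C.IsCalabiYau n)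
    (j : ℤ) : FiniteDimensional ℂ (HHhom R j) := by
  obtain ⟨e⟩ := R.nonempty_dualEquiv hc (n - j) j (by omega)
  have := R.finite_HHcoh hs hp hc (n - j)
  exact (Module.finite_dual_iff ℂ).1 (LinearEquiv.finiteDimensional e)

lemma finrank_HHhom {n : ℤ} (hc : C.IsCalabiYau n) (j k : ℤ) (h : k + j = n) :
    Module.finrank ℂ (HHhom R j) = Module.finrank ℂ (HHcoh R k) := by
  obtain ⟨e⟩ := R.nonempty_dualEquiv hc k j h
  rw [e.finrank_eq, Subspace.dual_finrank_eq]

lemma exists_nondegenerate (hs : C.IsSmooth) (hp : C.IsProper) {n : ℤ} (hc : C.IsCalabiYau n) :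
    ∃ tr : HHcoh R (n + n) →ₗ[ℂ] ℂ,
    ∀ (k l : ℤ) (h : k + l = n + n), (tracePairing R h tr).Nondegenerate := by
  obtain ⟨D⟩ := R.exists_traceData hc
  obtain ⟨tr, htr⟩ := TraceData.exists_trace D D rfl hp hp (R.isPerfect hs)
  refine ⟨tr, fun k l h => ⟨fun x hx => ?_, fun y hy => ?_⟩⟩
  · exact (injective_iff_map_eq_zero _).1 (htr R.P (R.isPerfect hs) k l h).1 x (LinearMap.ext hx)
  · refine (Module.forall_dual_apply_eq_zero_iff ℂ y).1 fun φ => ?_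
    obtain ⟨x, rfl⟩ := (htr R.P (R.isPerfect hs) k l h).2 φ
    exact hy x

lemma finrank_HHcoh_symm (hs : C.IsSmooth) (hp : C.IsProper) {n : ℤ} (hc : C.IsCalabiYau n)
    (k l : ℤ) (h : k + l = n + n) :
    Module.finrank ℂ (HHcoh R k) = Module.finrank ℂ (HHcoh R l) := by
  obtain ⟨D⟩ := R.exists_traceData hc
  obtain ⟨tr, htr⟩ := TraceData.exists_trace D D rfl hp hp (R.isPerfect hs)
  have := (LinearEquiv.ofBijective _ (htr R.P (R.isPerfect hs) k l h)).finrank_eq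
  rw [Subspace.dual_finrank_eq] at this
  exact this.symm

end DGAlg.Resolution

/-- Duality for perfect right modules over a Calabi–Yau algebra. -/
lemma finite_GHom_base {C : DGAlg.{u}} (hp : C.IsProper) {n : ℤ} (D : TraceData C n)
    {F G : DGBimod.{0, u, u} base C} (hF : F.IsPerfect) (hG : G.IsPerfect) (k : ℤ) :
    FiniteDimensional ℂ (GHom F G k) :=
  TraceData.finite_GHom TraceData.ofBase D base_isProper hp hF hG k

lemma finrank_GHom_base {C : DGAlg.{u}} (hp : C.IsProper) {n : ℤ} (D : TraceData C n)
    {F G : DGBimod.{0, u, u} base C} (hF : F.IsPerfect) (hG : G.IsPerfect) (k l : ℤ)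
    (h : k + l = n) : Module.finrank ℂ (GHom F G k) = Module.finrank ℂ (GHom G F l) := by
  obtain ⟨tr, htr⟩ := TraceData.exists_trace TraceData.ofBase D (zero_add n) base_isProper hp hF
  have := (LinearEquiv.ofBijective _ (htr G hG k l h)).finrank_eq
  rw [Subspace.dual_finrank_eq] at this
  exact this.symm

end HodgeCY

namespace HodgeCY

open Cpx DGBimod

/-! ### Right modules underlying bimodules -/

/-- The identification of components of equal degree, extended by zero. -/
noncomputable def Cpx.trn (K : Cpx.{u}) (i j : ℤ) : K.X i →ₗ[ℂ] K.X j :=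
  if h : i = j then (LinearEquiv.cast (R := ℂ) (M := K.X) h).toLinearMap else 0

@[simp] lemma Cpx.trn_self (K : Cpx.{u}) (i : ℤ) (x : K.X i) : K.trn i i x = x := by
  simp [trn]

lemma base_eq (c : base.X 0) : c = c.1 • base.one := Subtype.ext (mul_one c.1).symm

lemma base_eq_zero {i : ℤ} (hi : i ≠ 0) (c : base.X i) : c = 0 := Subtype.ext (c.2 hi)

namespace DGBimod

variable {A A' : DGAlg.{u}} {B : DGAlg.{v}}

/-- The right module underlying a bimodule. -/
noncomputable abbrev res (M : DGBimod.{u, v, w} A B) : DGBimod.{0, v, w} base B where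
  X := M.X
  d := M.d
  d_d := M.d_d
  lact i j k h := LinearMap.mk₂ ℂ (fun c x => (c : baseX i).1 • M.trn j k x)
    (by intros; simp [add_smul]) (by intros; simp [mul_smul])
    (by intros; simp) (by intros; rw [map_smul]; exact smul_comm _ _ _)
  ract := M.ract
  one_lact i h x := by simp
  ract_one := M.ract_one
  mul_lact i j k ij jk n h₁ h₂ h₃ h₄ a a' x := by
    by_cases hi : i = 0
    · by_cases hj : j = 0
      · subst hi hj
        obtain rfl : k = jk := by omega
        obtain rfl : k = n := by omega
        simp only [LinearMap.mk₂_apply, map_smul, trn_self]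
        exact (mul_smul (a : baseX 0).1 (a' : baseX 0).1 x).trans (smul_comm _ _ _)
      · rw [base_eq_zero hj a']; simp
    · rw [base_eq_zero hi a]; simp
  ract_mul := M.ract_mul
  lact_ract i j k ij jk n h₁ h₂ h₃ h₄ a x b := by
    by_cases hi : i = 0
    · subst hi
      obtain rfl : j = ij := by omega
      obtain rfl : jk = n := by omega
      simp
    · rw [base_eq_zero hi a]; simp
  d_lact i j k i' j' k' h hi hj hk a x := by
    by_cases h0 : i = 0
    · subst h0
      obtain rfl : j = k := by omega
      obtain rfl : j' = k' := by omega
      simp [sgn_zero]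
    · rw [base_eq_zero h0 a]; simp
  d_ract := M.d_ract

/-- Linearity over the base field is automatic. -/
def ofRight {M N : DGBimod.{0, v, w} base B} {k : ℤ}
    (f : ∀ t : CochainComplex.HomComplex.Triplet k, M.X t.p →ₗ[ℂ] N.X t.q)
    (hf : ∀ (i l j i' j' : ℤ) (h : i + l = j) (hi : i + k = i') (hj : j + k = j') (m : M.X i)
      (b : B.X l), f ⟨j, j', hj⟩ (M.ract i l j h m b)
        = N.ract i' l j' (by omega) (f ⟨i, i', hi⟩ m) b) : homX M N k :=
  ⟨f, by
    intro l i j i' j' h hi hj a m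
    by_cases hl : l = 0
    · subst hl
      obtain rfl : i = j := by omega
      obtain rfl : i' = j' := by omega
      rw [base_eq a]
      simp only [map_smul, LinearMap.smul_apply]
      rw [M.one_lact, N.one_lact, mul_zero, sgn_zero, one_smul]
    · rw [base_eq_zero hl a]; simp, hf⟩

/-- The morphism of right modules underlying a morphism of bimodules. -/
noncomputable def resX {M N : DGBimod.{u, v, w} A B} {k : ℤ} (f : homX M N k) : homX (res M) (res N) k :=
  ofRight f.1 f.2.2

lemma resX_apply {M N : DGBimod.{u, v, w} A B} {k i j : ℤ} (f : homX M N k) (h : i + k = j)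
    (x : M.X i) : (resX f).1 ⟨i, j, h⟩ x = f.1 ⟨i, j, h⟩ x := rfl

lemma homD_resX {M N : DGBimod.{u, v, w} A B} {k k' : ℤ} (hk : k + 1 = k') (f : homX M N k) :
    homD (res M) (res N) k k' hk (resX f) = resX (homD M N k k' hk f) := rfl

lemma isCyc_resX {M N : DGBimod.{u, v, w} A B} {k : ℤ} {f : homX M N k}
    (hf : (hom M N).IsCyc f) : (hom (res M) (res N)).IsCyc (resX f) := by
  change homD (res M) (res N) k (k + 1) rfl (resX f) = 0
  rw [homD_resX, show homD M N k (k + 1) rfl f = 0 from hf]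
  rfl

/-- The functor `M ↦ Hom(M, N)` for a right module `N`. -/
noncomputable def resHomF (A : DGAlg.{u}) (N : DGBimod.{0, v, w} base B) :
    DGFun.{u, v, w, w} A B where
  obj M := hom (res M) N
  act i k j h := LinearMap.mk₂ ℂ (fun z f => homComp (k := k) (l := i) (by omega) z (resX f))
    (fun z z' f => homComp_add_left _ z z' (resX f)) (fun c z f => homComp_smul_left _ c z (resX f))
    (fun z f f' => homComp_add_right _ z (resX f) (resX f'))
    (fun c z f => homComp_smul_right _ c z (resX f))
  act_id i h z := homComp_id (by omega) z
  act_comp i k l n il j h h₁ h₂ h₃ z g f :=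
    homComp_assoc h (by omega) (by omega) (by omega) z (resX g) (resX f)
  d_act i k j i' k' j' h hi hk hj z f := homD_comp (by omega) hk hi hj z (resX f)

lemma Cpx.exists_contraction {K : Cpx.{u}} (hK : K.IsAcyclic) :
    ∃ s : ∀ i j : ℤ, j + 1 = i → K.X i →ₗ[ℂ] K.X j,
      ∀ (i j k : ℤ) (h : j + 1 = i) (h' : i + 1 = k) (x : K.X i),
        x = K.d j i h (s i j h x) + s k i h' (K.d i k h' x) := by
  let g : GMap K K 0 :=
    { f := fun i j h => K.trn i j
      comm := by
        intro i j i' j' h hi hj x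
        obtain rfl : i = j := by omega
        obtain rfl : i' = j' := by omega
        rw [sgn_zero, one_smul, trn_self, trn_self] }
  have hg : ∀ i x, g.f i i (add_zero i) x = x := fun i x => K.trn_self i x
  obtain ⟨s, hs⟩ := exists_homotopy g fun i x hx => by
    rw [hg]
    exact isAcyclic_iff.1 hK i x hx
  exact ⟨s, fun i j k h h' x => (hg i x).symm.trans (hs i j k h h' x)⟩

lemma freeMk_eq_ract (i j n : ℤ) (h : i + j = n) (a : A.X i) (b : B.X j) :
    freeMk A B i j n h a b = (free A B).ract i j n h (freeMk A B i 0 i (add_zero i) a B.one) b := by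
  rw [LinearMap.flip_apply]
  simp only [LinearMap.coe_mk, AddHom.coe_mk, freeLift_mk, LinearMap.compl₂_apply,
    LinearMap.flip_apply]
  rw [freeMk_right A B i 0 j j n (zero_add j), B.one_mul]

lemma d_freeMk_one (i i' : ℤ) (hi : i + 1 = i') (a : A.X i) :
    (free A B).d i i' hi (freeMk A B i 0 i (add_zero i) a B.one)
      = freeMk A B i' 0 i' (add_zero i') (A.d i i' hi a) B.one := by
  subst hi
  simp only [freeLift_mk, LinearMap.add_apply, LinearMap.comp_apply, LinearMap.smul_apply,
    LinearMap.compl₂_apply]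
  change _ + sgn i • freeMk A B i 1 (i + 1) _ a (B.d 0 1 rfl B.one) = _
  rw [B.d_one, map_zero, smul_zero, add_zero]

lemma res_free_acyclic (N : DGBimod.{0, v, max u v} base B) (hN : N.IsAcyclic) :
    (hom (res (free A B)) N).IsAcyclic := by
  obtain ⟨s, hs⟩ := Cpx.exists_contraction hN
  refine isAcyclic_iff.2 fun k (φ : homX (res (free A B)) N k) hφ => ?_
  let G : ∀ i n : ℤ, i + k = n → A.X i →ₗ[ℂ] N.X n := fun i n h =>
    φ.1 ⟨i, n, h⟩ ∘ₗ (freeMk A B i 0 i (add_zero i)).flip B.one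
  have hG : ∀ i j n m q h hm hq a b, φ.1 ⟨n, m, hm⟩ (freeMk A B i j n h a b)
      = N.ract q j m (by omega) (G i q hq a) b := by
    intro i j n m q h hm hq a b
    rw [freeMk_eq_ract]
    exact φ.2.2 i j n q m h hq hm _ b
  have hdG : ∀ i n i' n' h (hi : i + 1 = i') (hn : n + 1 = n') a, N.d n n' hn (G i n h a)
      = sgn k • G i' n' (by omega) (A.d i i' hi a) := by
    intro i n i' n' h hi hn a
    have h1 := (toGMap ⟨φ, hφ⟩).comm i n i' n' h hi hn (freeMk A B i 0 i (add_zero i) a B.one)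
    refine h1.trans ?_
    change sgn k • φ.1 ⟨i', n', _⟩ ((free A B).d i i' hi (freeMk A B i 0 i (add_zero i) a B.one)) = _
    rw [d_freeMk_one]
    rfl
  obtain ⟨S, hS⟩ : ∃ S : homX (res (free A B)) N (k - 1), ∀ i j n m q r (h : i + j = n)
      (hm : n + (k - 1) = m) (hq : i + k = q) (hr : r + 1 = q) a b,
      S.1 ⟨n, m, hm⟩ (freeMk A B i j n h a b)
        = N.ract r j m (by omega) (s q r hr (G i q hq a)) b := by
    let g : ∀ n m : ℤ, n + (k - 1) = m → ∀ i j : ℤ, i + j = n → A.X i →ₗ[ℂ] B.X j →ₗ[ℂ] N.X m :=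
      fun n m hm i j h => N.ract (i + k - 1) j m (by omega) ∘ₗ s (i + k) (i + k - 1) (by omega)
        ∘ₗ G i (i + k) rfl
    have hg : ∀ i j n m q r (h : i + j = n) (hm : n + (k - 1) = m) (hq : i + k = q)
        (hr : r + 1 = q) a b, g n m hm i j h a b
          = N.ract r j m (by omega) (s q r hr (G i q hq a)) b := by
      intro i j n m q r h hm hq hr a b
      subst hq
      obtain rfl : r = i + k - 1 := by omega
      rfl
    clear_value g
    let S : homX (res (free A B)) N (k - 1) := ofRight
      (fun t => freeLift A B t.p (g t.p t.q t.hpq)) (by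
      intro n l n' m m' h hm hm' (x : FreeX A B n) c
      induction x using free_induction with
      | h0 => simp
      | hadd x y hx hy => simp only [map_add, LinearMap.add_apply, hx, hy]
      | H i j hij a b =>
        simp only [LinearMap.coe_mk, AddHom.coe_mk, freeLift_mk, LinearMap.flip_apply,
          LinearMap.compl₂_apply]
        rw [hg i j n m (i + k) (i + k - 1) hij hm rfl (by omega),
          hg i (j + l) n' m' (i + k) (i + k - 1) (by omega) hm' rfl (by omega),
          N.ract_mul (i + k - 1) j l m (j + l) m' (by omega) (by omega) rfl (by omega)])
    refine ⟨S, fun i j n m q r h hm hq hr a b => ?_⟩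
    exact (freeLift_mk A B n (g n m hm) i j h a b).trans (hg i j n m q r h hm hq hr a b)
  clear_value G
  refine ⟨S, homX_ext fun n m hm (x : FreeX A B n) => ?_⟩
  change (homD (res (free A B)) N (k - 1) k (by omega) S).1 ⟨n, m, hm⟩ x = _
  rw [homD_apply _ _ (k - 1) k (by omega) S n m (n + 1) (m - 1) hm rfl (by omega)]
  induction x using free_induction with
  | h0 => simp
  | hadd x y hx hy =>
    simp only [map_add, smul_add, ← hx, ← hy]
    abel
  | H i j h a b =>
    have hd : (res (free A B)).d n (n + 1) rfl (freeMk A B i j n h a b)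
        = freeMk A B (i + 1) j (n + 1) (by omega) (A.d i (i + 1) rfl a) b
          + sgn i • freeMk A B i (j + 1) (n + 1) (by omega) a (B.d j (j + 1) rfl b) := by
      simp only [freeLift_mk, LinearMap.add_apply, LinearMap.comp_apply, LinearMap.smul_apply,
        LinearMap.compl₂_apply]
    rw [hd, map_add, map_smul, hG i j n m (i + k) h hm rfl,
      hS i j n (m - 1) (i + k) (i + k - 1) h _ rfl (by omega),
      hS (i + 1) j (n + 1) m (i + k + 1) (i + k) (by omega) _ (by omega) rfl,
      hS i (j + 1) (n + 1) m (i + k) (i + k - 1) (by omega) _ rfl (by omega),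
      N.d_ract (i + k - 1) j (m - 1) (i + k) (j + 1) m (by omega) (by omega) rfl (by omega)]
    have h1 := hs (i + k) (i + k - 1) (i + k + 1) (by omega) rfl (G i (i + k) rfl a)
    rw [hdG i (i + k) (i + 1) (i + k + 1) rfl rfl rfl, map_smul] at h1
    have h2 := congrArg (fun y => N.ract (i + k) j m (by omega) y b) h1
    simp only [map_add, map_smul, LinearMap.add_apply, LinearMap.smul_apply] at h2
    rw [h2, show sgn (i + k - 1) = -(sgn i * sgn k) by
        rw [sub_eq_add_neg, sgn_add, sgn_add, sgn_neg, sgn_one]; ring,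
      show sgn (k - 1) = - sgn k by rw [sub_eq_add_neg, sgn_add, sgn_neg, sgn_one]; ring]
    module

theorem IsPerfect.res_isKProjective {P : DGBimod.{u, v, max u v} A B} (hP : P.IsPerfect) :
    (res P).IsKProjective := fun N hN =>
  (resHomF A N).acyclic_devissage (res_free_acyclic N hN) P hP

end DGBimod

end HodgeCY

namespace HodgeCY

open Cpx DGBimod

/-! ### Morphisms of right modules between bimodules -/

namespace DGBimod

section Mul

variable {A : DGAlg.{u}} {B : DGAlg.{v}} (N : DGBimod.{u, v, w} A B)

/-- Left multiplication by an element, as a morphism of right modules. -/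
noncomputable def lmulX (l : ℤ) : A.X l →ₗ[ℂ] homX (res N) (res N) l where
  toFun a := ofRight (fun t => N.lact l t.p t.q (by have := t.hpq; omega) a) (by
    intro i c j i' j' h hi hj x b
    exact (N.lact_ract l i c i' j j' (by omega) (by omega) (by omega) (by omega) a x b).symm)
  map_add' a a' := homX_ext fun i j hj x =>
    LinearMap.congr_fun (map_add (N.lact l i j (by omega)) a a') x
  map_smul' c a := homX_ext fun i j hj x =>
    LinearMap.congr_fun (map_smul (N.lact l i j (by omega)) c a) x

lemma lmulX_one : lmulX N 0 A.one = homId (res N) :=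
  homX_ext fun i j hj (x : N.X i) => by
    obtain rfl : i = j := by omega
    exact N.one_lact i _ x

lemma lmulX_mul {i j k : ℤ} (h : i + j = k) (h' : j + i = k) (a : A.X i) (a' : A.X j) :
    lmulX N k (A.mul i j k h a a') = homComp h' (lmulX N i a) (lmulX N j a') :=
  homX_ext fun p q hq (x : N.X p) => by
    rw [homComp_apply _ _ _ p (p + j) q rfl]
    exact N.mul_lact i j p k (p + j) q h (by omega) (by omega) (by omega) a a' x

lemma homD_lmulX {l l' : ℤ} (h : l + 1 = l') (a : A.X l) :
    homD (res N) (res N) l l' h (lmulX N l a) = lmulX N l' (A.d l l' h a) :=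
  homX_ext fun i j hj (x : N.X i) => by
    rw [homD_apply _ _ l l' h _ i j (i + 1) (i + l) hj rfl rfl]
    change N.d (i + l) j _ (N.lact l i (i + l) _ a x) - sgn l • N.lact l (i + 1) j _ a (N.d i (i + 1) rfl x)
      = N.lact l' i j _ (A.d l l' h a) x
    rw [N.d_lact l i (i + l) l' (i + 1) j (by omega) h rfl (by omega), add_sub_cancel_right]

variable {N}

lemma resX_lmulX {N' : DGBimod.{u, v, w} A B} {k l n : ℤ} (h : l + k = n) (h' : k + l = n)
    (g : homX N N' k) (a : A.X l) :
    homComp h (resX g) (lmulX N l a) = sgn (k * l) • homComp h' (lmulX N' l a) (resX g) :=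
  homX_ext fun i j hj (x : N.X i) => by
    change _ = sgn (k * l) • (homComp h' (lmulX N' l a) (resX g)).1 ⟨i, j, hj⟩ x
    rw [homComp_apply _ _ _ i (i + l) j rfl, homComp_apply _ _ _ i (i + k) j rfl]
    exact g.2.1 l i (i + l) (i + k) j (by omega) rfl (by omega) a x

end Mul

section RightMul

variable {A : DGAlg.{t}} {A' : DGAlg.{t'}} {B : DGAlg.{v}} {N : DGBimod.{t, v, v} A B}

/-- Multiplication of an element by elements of the algebra, as a morphism of right modules. -/
noncomputable def rmulX (N : DGBimod.{t, v, v} A B) (i : ℤ) :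
    N.X i →ₗ[ℂ] homX (res (diag B)) (res N) i where
  toFun y := ofRight (fun t => N.ract i t.p t.q (by have := t.hpq; omega) y) (by
    intro p c q p' q' h hp hq x b
    exact (N.ract_mul i p c p' q q' (by omega) (by omega) (by omega) (by omega) y x b).symm)
  map_add' a a' := homX_ext fun p q hq x =>
    LinearMap.congr_fun (map_add (N.ract i p q (by omega)) a a') x
  map_smul' c a := homX_ext fun p q hq x =>
    LinearMap.congr_fun (map_smul (N.ract i p q (by omega)) c a) x

lemma homD_rmulX {i i' : ℤ} (h : i + 1 = i') (y : N.X i) :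
    homD (res (diag B)) (res N) i i' h (rmulX N i y) = rmulX N i' (N.d i i' h y) :=
  homX_ext fun p q hq (b : B.X p) => by
    rw [homD_apply _ _ i i' h _ p q (p + 1) (p + i) hq rfl rfl]
    change N.d (p + i) q _ (N.ract i p (p + i) _ y b) - sgn i • N.ract i (p + 1) q _ y (B.d p (p + 1) rfl b)
      = N.ract i' p q _ (N.d i i' h y) b
    rw [N.d_ract i p (p + i) i' (p + 1) q (by omega) h rfl (by omega), add_sub_cancel_right]

lemma rmulX_lact {l i j : ℤ} (h : l + i = j) (h' : i + l = j) (a : A.X l) (y : N.X i) :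
    rmulX N j (N.lact l i j h a y) = homComp h' (lmulX N l a) (rmulX N i y) :=
  homX_ext fun p q hq (b : B.X p) => by
    rw [homComp_apply _ _ _ p (p + i) q rfl]
    exact N.lact_ract l i p j (p + i) q h (by omega) (by omega) (by omega) a y b

lemma rmulX_ract {l i j : ℤ} (h : i + l = j) (h' : l + i = j) (y : N.X i) (b : B.X l) :
    rmulX N j (N.ract i l j h y b) = homComp h' (rmulX N i y) (lmulX (diag B) l b) :=
  homX_ext fun p q hq (c : B.X p) => by
    rw [homComp_apply _ _ _ p (p + l) q rfl]
    exact N.ract_mul i l p j (p + l) q h (by omega) (by omega) (by omega) y b c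

lemma comp_rmulX {M : DGBimod.{t', v, v} A' B} {i k j : ℤ} (h : i + k = j)
    (ψ : homX (res N) (res M) k) (y : N.X i) :
    homComp h ψ (rmulX N i y) = rmulX M j (ψ.1 ⟨i, j, h⟩ y) :=
  homX_ext fun p q hq (b : B.X p) => by
    rw [homComp_apply _ _ _ p (p + i) q rfl]
    exact ψ.2.2 i p (p + i) j q (by omega) h (by omega) y b

end RightMul

/-! ### The bimodule of morphisms of right modules -/

section HomRight

variable {A : DGAlg.{u}} {A' : DGAlg.{t}} {B : DGAlg.{v}}

/-- The bimodule of morphisms of right modules. -/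
noncomputable abbrev homR (P : DGBimod.{u, v, w} A B) (N : DGBimod.{t, v, w} A' B) :
    DGBimod.{t, u, w} A' A where
  toCpx := hom (res P) (res N)
  lact l k m h := LinearMap.mk₂ ℂ
    (fun a ψ => homComp (k := k) (l := l) (n := m) (by omega) (lmulX N l a) ψ)
    (fun a a' ψ => by rw [map_add]; rfl) (fun c a ψ => by rw [map_smul]; rfl)
    (fun a ψ ψ' => homComp_add_right _ _ _ _) (fun c a ψ => homComp_smul_right _ _ _ _)
  ract k l m h := LinearMap.mk₂ ℂ
    (fun ψ a => homComp (k := l) (l := k) (n := m) (by omega) ψ (lmulX P l a))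
    (fun _ _ _ => rfl) (fun _ _ _ => rfl)
    (fun ψ a a' => by rw [map_add]; exact homComp_add_right _ _ _ _)
    (fun c ψ a => by rw [map_smul]; exact homComp_smul_right _ _ _ _)
  one_lact k h ψ := by
    change homComp (by omega) (lmulX N 0 A'.one) ψ = ψ
    rw [lmulX_one, id_homComp]
  ract_one k h ψ := by
    change homComp (by omega) ψ (lmulX P 0 A.one) = ψ
    rw [lmulX_one, homComp_id]
  mul_lact i j k ij jk n h₁ h₂ h₃ h₄ a a' ψ := by
    change homComp (k := k) (l := ij) (n := n) (by omega) (lmulX N ij (A'.mul i j ij h₁ a a')) ψ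
      = homComp (k := jk) (l := i) (n := n) (by omega) (lmulX N i a)
        (homComp (k := k) (l := j) (n := jk) (by omega) (lmulX N j a') ψ)
    rw [lmulX_mul N h₁ (by omega)]
    exact (homComp_assoc _ _ _ _ _ _ _).symm
  ract_mul k i j ki ij n h₁ h₂ h₃ h₄ ψ a a' := by
    change homComp (k := j) (l := ki) (n := n) (by omega) (homComp (k := i) (l := k) (n := ki) (by omega) ψ (lmulX P i a))
      (lmulX P j a') = homComp (k := ij) (l := k) (n := n) (by omega) ψ (lmulX P ij (A.mul i j ij h₃ a a'))
    rw [lmulX_mul P h₃ (by omega)]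
    exact (homComp_assoc _ _ _ _ _ _ _).symm
  lact_ract i k j ik kj n h₁ h₂ h₃ h₄ a ψ a' := by
    change homComp (k := j) (l := ik) (n := n) (by omega) (homComp (k := k) (l := i) (n := ik) (by omega) (lmulX N i a) ψ)
      (lmulX P j a') = homComp (k := kj) (l := i) (n := n) (by omega) (lmulX N i a)
        (homComp (k := j) (l := k) (n := kj) (by omega) ψ (lmulX P j a'))
    exact (homComp_assoc _ _ _ _ _ _ _).symm
  d_lact l k m l' k' m' h hl hk hm a ψ := by
    change homD (res P) (res N) m m' hm (homComp (k := k) (l := l) (n := m) (by omega) (lmulX N l a) ψ)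
      = homComp (k := k) (l := l') (n := m') (by omega) (lmulX N l' (A'.d l l' hl a)) ψ
        + sgn l • homComp (k := k') (l := l) (n := m') (by omega) (lmulX N l a) (homD (res P) (res N) k k' hk ψ)
    rw [← homD_lmulX]
    exact homD_comp _ hk hl hm _ _
  d_ract k l m k' l' m' h hk hl hm ψ a := by
    change homD (res P) (res N) m m' hm (homComp (k := l) (l := k) (n := m) (by omega) ψ (lmulX P l a))
      = homComp (k := l) (l := k') (n := m') (by omega) (homD (res P) (res N) k k' hk ψ) (lmulX P l a)
        + sgn k • homComp (k := l') (l := k) (n := m') (by omega) ψ (lmulX P l' (A.d l l' hl a))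
    rw [← homD_lmulX]
    exact homD_comp _ hl hk hm _ _

variable {P : DGBimod.{u, v, w} A B} {N N' : DGBimod.{t, v, w} A' B}

/-- Composition with a morphism of bimodules in the second argument. -/
noncomputable def postR (P : DGBimod.{u, v, w} A B) {k : ℤ} (g : homX N N' k) :
    homX (homR P N) (homR P N') k :=
  ⟨fun s =>
    { toFun := fun ψ => homComp (k := s.p) (l := k) (n := s.q) s.hpq (resX g) ψ
      map_add' := fun _ _ => homComp_add_right _ _ _ _
      map_smul' := fun _ _ => homComp_smul_right _ _ _ _ }, by
    constructor
    · intro l i j i' j' h hi hj a ψ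
      change homComp (k := j) (l := k) (n := j') (by omega) (resX g)
          (homComp (k := i) (l := l) (n := j) (by omega) (lmulX N l a) ψ)
        = sgn (k * l) • homComp (k := i') (l := l) (n := j') (by omega) (lmulX N' l a)
          (homComp (k := i) (l := k) (n := i') (by omega) (resX g) ψ)
      rw [homComp_assoc (lm := l + k) (by omega) hj rfl (by omega), resX_lmulX rfl (by omega),
        homComp_smul_left,
        homComp_assoc (kl := i') (lm := l + k) (n := j') (by omega) (by omega) (by omega) (by omega)]
    · intro i l j i' j' h hi hj ψ a
      exact homComp_assoc (kl := j) (lm := i') (n := j') (by omega) (by omega) (by omega) (by omega)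
        _ _ _⟩

lemma postR_apply {k i j : ℤ} (h : i + k = j) (g : homX N N' k) (ψ : homX (res P) (res N) i) :
    (postR P g).1 ⟨i, j, h⟩ ψ = homComp h (resX g) ψ := rfl

lemma homD_postR {k k' : ℤ} (hk : k + 1 = k') (g : homX N N' k) :
    homD (homR P N) (homR P N') k k' hk (postR P g) = postR P (homD N N' k k' hk g) :=
  homX_ext fun i j hj (ψ : homX (res P) (res N) i) => by
    rw [homD_apply _ _ k k' hk _ i j (i + 1) (i + k) hj rfl rfl]
    change homD (res P) (res N') (i + k) j (by omega) (homComp (k := i) (l := k) (n := i + k) rfl (resX g) ψ)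
      - sgn k • homComp (k := i + 1) (l := k) (n := j) (by omega) (resX g) (homD (res P) (res N) i (i + 1) rfl ψ)
      = homComp (k := i) (l := k') (n := j) (by omega) (resX (homD N N' k k' hk g)) ψ
    rw [homD_comp rfl rfl hk (by omega), add_sub_cancel_right, homD_resX]

/-- Composition with a morphism of bimodules in the first argument. -/
noncomputable def preR (N : DGBimod.{t, v, w} A' B) {l : ℤ} (f : homX P P l) :
    homX (homR P N) (homR P N) l :=
  ⟨fun s =>
    { toFun := fun ψ => sgn (l * s.p) • homComp (k := l) (l := s.p) (n := s.q)
        (by have := s.hpq; omega) ψ (resX f)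
      map_add' := fun ψ ψ' => by rw [homComp_add_left, smul_add]
      map_smul' := fun c ψ => by rw [homComp_smul_left, smul_comm]; rfl }, by
    constructor
    · intro c i j i' j' h hi hj a ψ
      change sgn (l * j) • homComp (k := l) (l := j) (n := j') (by omega)
          (homComp (k := i) (l := c) (n := j) (by omega) (lmulX N c a) ψ) (resX f)
        = sgn (l * c) • homComp (k := i') (l := c) (n := j') (by omega) (lmulX N c a)
          (sgn (l * i) • homComp (k := l) (l := i) (n := i') (by omega) ψ (resX f))
      rw [homComp_smul_right, smul_smul, ← sgn_add, ← mul_add, h,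
        homComp_assoc (kl := i') (lm := j) (n := j') (by omega) (by omega) (by omega) (by omega)]
    · intro i c j i' j' h hi hj ψ a
      change sgn (l * j) • homComp (k := l) (l := j) (n := j') (by omega)
          (homComp (k := c) (l := i) (n := j) (by omega) ψ (lmulX P c a)) (resX f)
        = homComp (k := c) (l := i') (n := j') (by omega)
          (sgn (l * i) • homComp (k := l) (l := i) (n := i') (by omega) ψ (resX f)) (lmulX P c a)
      rw [homComp_smul_left,
        ← homComp_assoc (kl := c + l) (lm := i') (n := j') (by omega) (by omega) (by omega) (by omega),
        resX_lmulX rfl (by omega),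
        ← homComp_assoc (kl := c + l) (lm := j) (n := j') (by omega) (by omega) (by omega) (by omega),
        homComp_smul_right, smul_smul, ← sgn_add]
      congr 1
      exact congrArg sgn (by rw [← h]; ring)⟩

lemma preR_apply {l i j : ℤ} (h : i + l = j) (h' : l + i = j) (f : homX P P l)
    (ψ : homX (res P) (res N) i) :
    (preR N f).1 ⟨i, j, h⟩ ψ = sgn (l * i) • homComp h' ψ (resX f) := rfl

lemma homD_preR {l l' : ℤ} (hl : l + 1 = l') (f : homX P P l) :
    homD (homR P N) (homR P N) l l' hl (preR N f) = preR N (homD P P l l' hl f) :=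
  homX_ext fun i j hj (ψ : homX (res P) (res N) i) => by
    rw [homD_apply _ _ l l' hl _ i j (i + 1) (i + l) hj rfl rfl]
    change homD (res P) (res N) (i + l) j (by omega)
        (sgn (l * i) • homComp (k := l) (l := i) (n := i + l) (by omega) ψ (resX f))
      - sgn l • sgn (l * (i + 1)) • homComp (k := l) (l := i + 1) (n := j) (by omega)
        (homD (res P) (res N) i (i + 1) rfl ψ) (resX f)
      = sgn (l' * i) • homComp (k := l') (l := i) (n := j) (by omega) ψ (resX (homD P P l l' hl f))
    rw [map_smul, homD_comp (by omega) hl rfl (by omega), homD_resX]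
    subst hl
    simp only [smul_add, smul_smul, mul_add, add_mul, sgn_add, mul_one, one_mul]
    rw [show sgn l * (sgn (l * i) * sgn l) = sgn (l * i) by
      linear_combination sgn (l * i) * sgn_mul_self l, add_sub_cancel_left]

lemma preR_postR {k l n : ℤ} (h : k + l = n) (h' : l + k = n) (g : homX N N' k) (f : homX P P l) :
    homComp h' (postR P g) (preR N f) = sgn (k * l) • homComp h (preR N' f) (postR P g) :=
  homX_ext fun i j hj (ψ : homX (res P) (res N) i) => by
    change _ = sgn (k * l) • (homComp h (preR N' f) (postR P g)).1 ⟨i, j, hj⟩ ψ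
    rw [homComp_apply _ _ _ i (i + l) j rfl, homComp_apply _ _ _ i (i + k) j rfl]
    change homComp (k := i + l) (l := k) (n := j) (by omega) (resX g)
        (sgn (l * i) • homComp (k := l) (l := i) (n := i + l) (by omega) ψ (resX f))
      = sgn (k * l) • sgn (l * (i + k)) • homComp (k := l) (l := i + k) (n := j) (by omega)
        (homComp (k := i) (l := k) (n := i + k) rfl (resX g) ψ) (resX f)
    rw [homComp_smul_right, smul_smul, ← sgn_add,
      homComp_assoc (kl := i + l) (lm := i + k) (n := j) (by omega) (by omega) rfl (by omega)]
    congr 1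
    exact sgn_congr (-(k * l)) (by ring)

end HomRight

end DGBimod

end HodgeCY

namespace HodgeCY

open Cpx DGBimod DGAlg

/-! ### The action of Hochschild cohomology -/

namespace DGBimod

variable {A : DGAlg.{t}} {B : DGAlg.{v}} {P : DGBimod.{v, v, v} B B} (ε : (hom P (diag B)).Z 0)
  (N : DGBimod.{t, v, v} A B)

lemma homD_comp_ε {M : DGBimod.{0, v, v} base B} {k k' : ℤ} (hk : k + 1 = k')
    (f : homX (res (diag B)) M k) :
    homD (res P) M k k' hk (homComp (zero_add k) f (resX ε.1))
      = homComp (zero_add k') (homD (res (diag B)) M k k' hk f) (resX ε.1) := by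
  rw [homD_comp (k' := 1) (zero_add k) (zero_add 1) hk hk, homD_resX,
    show homD P (diag B) 0 1 rfl ε.1 = 0 from ε.2]
  have e : resX (0 : homX P (diag B) 1) = 0 := rfl
  rw [e, homComp_zero_right, smul_zero, add_zero]

/-- The morphism `N → Hom(P, N)` that sends `y` to `q ↦ y ε(q)`. -/
noncomputable def nuX : homX N (homR P N) 0 :=
  ⟨fun s =>
    { toFun := fun y => homComp (k := 0) (l := s.p) (n := s.q) (by have := s.hpq; omega)
        (rmulX N s.p y) (resX ε.1)
      map_add' := fun y y' => by rw [map_add, homComp_add_left]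
      map_smul' := fun c y => by rw [map_smul, homComp_smul_left]; rfl }, by
    constructor
    · intro l i j i' j' h hi hj a y
      obtain rfl : i = i' := by omega
      obtain rfl : j = j' := by omega
      change homComp (k := 0) (l := j) (n := j) (by omega) (rmulX N j (N.lact l i j h a y)) (resX ε.1)
        = sgn (0 * l) • homComp (k := i) (l := l) (n := j) (by omega) (lmulX N l a)
          (homComp (k := 0) (l := i) (n := i) (by omega) (rmulX N i y) (resX ε.1))
      rw [zero_mul, sgn_zero, one_smul, rmulX_lact h (by omega),
        homComp_assoc (kl := i) (lm := j) (n := j) (by omega) (by omega) (by omega) (by omega)]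
    · intro i l j i' j' h hi hj y b
      obtain rfl : i = i' := by omega
      obtain rfl : j = j' := by omega
      change homComp (k := 0) (l := j) (n := j) (by omega) (rmulX N j (N.ract i l j h y b)) (resX ε.1)
        = homComp (k := l) (l := i) (n := j) (by omega)
          (homComp (k := 0) (l := i) (n := i) (by omega) (rmulX N i y) (resX ε.1)) (lmulX P l b)
      rw [rmulX_ract h (by omega),
        ← homComp_assoc (kl := l) (lm := i) (n := j) (by omega) (by omega) (by omega) (by omega),
        resX_lmulX (n := l) (by omega) (by omega), zero_mul, sgn_zero, one_smul,
        homComp_assoc (kl := l) (lm := j) (n := j) (by omega) (by omega) (by omega) (by omega)]⟩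

variable {N}

lemma nuX_apply {i j : ℤ} (h : i + 0 = j) (h' : 0 + i = j) (y : N.X i) :
    (nuX ε N).1 ⟨i, j, h⟩ y = homComp h' (rmulX N i y) (resX ε.1) := rfl

lemma isCyc_nuX : (hom N (homR P N)).IsCyc (nuX ε N) := by
  refine homX_ext fun i j hj y => ?_
  rw [homD_apply _ _ 0 (0 + 1) rfl _ i j j i hj (by omega) (add_zero i), sgn_zero, one_smul]
  change homD (res P) (res N) i j (by omega) (homComp (zero_add i) (rmulX N i y) (resX ε.1))
    - homComp (zero_add j) (rmulX N j (N.d i j (by omega) y)) (resX ε.1) = 0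
  rw [homD_comp_ε, homD_rmulX, sub_self]

variable (N)

/-- The closed morphism `N → Hom(P, N)`. -/
noncomputable def nu : (hom N (homR P N)).Z 0 := ⟨nuX ε N, isCyc_nuX ε⟩

variable {N} {ε}

lemma exists_lift_one (hε : IsQuasiIso ε) : ∃ p : P.X 0, P.IsCyc p ∧
    ∃ c : B.X (-1), B.d (-1) 0 rfl c = ap ε 0 p - B.one := by
  obtain ⟨p, hp, hb⟩ := ((isQuasiIso_iff ε).1 hε).surj 0 0 (add_zero 0) B.one B.d_one
  exact ⟨p, hp, hb.exists (-1) rfl⟩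

/-- The composition `P → B → P` is homotopic to the identity of the right module `P`. -/
lemma exists_section (hε : IsQuasiIso ε) (hP : (res P).IsKProjective) :
    ∃ p : P.X 0, P.IsCyc p ∧ (∃ c : B.X (-1), B.d (-1) 0 rfl c = ap ε 0 p - B.one) ∧
      (hom (res P) (res P)).IsBd
        (homComp (add_zero 0) (rmulX P 0 p) (resX ε.1) - homId (res P)) := by
  obtain ⟨p, hp, c, hc⟩ := exists_lift_one hε
  refine ⟨p, hp, ⟨c, hc⟩, ?_⟩
  have hcyc : (hom (res P) (res P)).IsCyc (homComp (add_zero 0) (rmulX P 0 p) (resX ε.1)) := by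
    refine homComp_isCyc _ ?_ (isCyc_resX ε.2)
    change homD (res (diag B)) (res P) 0 1 rfl (rmulX P 0 p) = 0
    rw [homD_rmulX, hp.d, map_zero]
  let ε' : (hom (res P) (res (diag B))).Z 0 := ⟨resX ε.1, isCyc_resX ε.2⟩
  have hε' : (toGMap ε').IsQI := by
    have h := (isQuasiIso_iff ε).1 hε
    exact ⟨h.surj, h.inj⟩
  refine (mk_eq_mk ⟨_, hcyc⟩ ⟨_, homD_id (res P)⟩).1
    (hP.eq_of_comp_eq (add_zero 0) ε' hε' ?_)
  change (hom (res P) (res (diag B))).IsBd (homComp (add_zero 0) (resX ε.1)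
    (homComp (add_zero 0) (rmulX P 0 p) (resX ε.1)) - homComp (add_zero 0) (resX ε.1) (homId (res P)))
  rw [homComp_assoc (lm := 0) (n := 0) (add_zero 0) (add_zero 0) (add_zero 0) (add_zero 0),
    homComp_id, comp_rmulX]
  have e1 : rmulX (diag B) 0 ((resX ε.1).1 ⟨0, 0, add_zero 0⟩ p)
      = lmulX (diag B) 0 (B.d (-1) 0 rfl c) + homId (res (diag B)) := by
    rw [hc, map_sub, ← lmulX_one, sub_add_cancel]
    rfl
  rw [e1, homComp_add_left, id_homComp, add_sub_cancel_right, ← homD_lmulX, ← homD_comp_ε]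
  exact isBd_d (K := hom (res P) (res (diag B))) rfl _

lemma nu_isQI (hε : IsQuasiIso ε) (hP : (res P).IsKProjective) : (toGMap (nu ε N)).IsQI := by
  obtain ⟨p, hp, ⟨c, hc⟩, hb⟩ := exists_section hε hP
  constructor
  · intro i j h (ψ : homX (res P) (res N) j) hψ
    obtain rfl : i = j := by omega
    refine ⟨ψ.1 ⟨0, i, zero_add i⟩ p, isCyc_apply hψ _ hp, ?_⟩
    have h1 := homComp_isBd_right (zero_add i) hψ hb
    rw [homComp_sub_right, homComp_id,
      homComp_assoc (lm := i) (n := i) (add_zero 0) (zero_add i) (zero_add i) (zero_add i),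
      comp_rmulX] at h1
    exact h1
  · intro i j h y hy hb'
    obtain rfl : i = j := by omega
    have h1 := isBd_apply (M := res P) (N := res N) hb' (zero_add i) hp
    change N.IsBd (N.ract i 0 i _ y (ap ε 0 p)) at h1
    have h2 : ap ε 0 p = B.d (-1) 0 rfl c + B.one := by rw [hc, sub_add_cancel]
    have h3 : N.IsBd (N.ract i 0 i (add_zero i) y (B.d (-1) 0 rfl c)) := by
      have h4 := N.d_ract i (-1) (i - 1) (i + 1) 0 i (by omega) rfl rfl (by omega) y c
      rw [hy.d, map_zero, LinearMap.zero_apply, zero_add] at h4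
      have h5 := (isBd_d (K := N.toCpx) (show i - 1 + 1 = i by omega)
        (N.ract i (-1) (i - 1) (by omega) y c)).smul (sgn i)
      rw [h4, smul_smul, sgn_mul_self, one_smul] at h5
      exact h5
    rw [h2, map_add, N.ract_one] at h1
    have h6 := h1.sub h3
    rwa [add_sub_cancel_left] at h6

lemma postR_nu {N' : DGBimod.{t, v, v} A B} {k : ℤ} (g : homX N N' k) :
    homComp (zero_add k) (postR P g) (nuX ε N) = homComp (add_zero k) (nuX ε N') g :=
  homX_ext fun i j hj y => by
    refine (homComp_apply _ _ _ i i j (add_zero i) hj y).trans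
      (Eq.trans ?_ (homComp_apply _ _ _ i j j hj hj y).symm)
    rw [nuX_apply ε (add_zero i) (zero_add i), nuX_apply ε (add_zero j) (zero_add j), postR_apply,
      homComp_assoc (kl := i) (lm := j) (n := j) (by omega) (by omega) (by omega) (by omega),
      comp_rmulX]
    rfl

/-- The morphism `P → Hom(P, P)` that sends `p` to `q ↦ ε(p) q`. -/
noncomputable def muX (ε : (hom P (diag B)).Z 0) : homX P (homR P P) 0 :=
  ⟨fun s => lmulX P s.q ∘ₗ ε.1.1 s, by
    constructor
    · intro l i j i' j' h hi hj a p
      obtain rfl : i = i' := by omega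
      obtain rfl : j = j' := by omega
      have h1 : ε.1.1 ⟨j, j, hj⟩ (P.lact l i j h a p) = B.mul l i j h a (ap ε i p) :=
        ap_lact ε l i j h a p
      change lmulX P j (ε.1.1 ⟨j, j, hj⟩ (P.lact l i j h a p)) = sgn (0 * l) •
        homComp (k := i) (l := l) (n := j) (by omega) (lmulX P l a) (lmulX P i (ap ε i p))
      rw [h1, lmulX_mul P h (by omega), zero_mul, sgn_zero, one_smul]
    · intro i l j i' j' h hi hj p a
      obtain rfl : i = i' := by omega
      obtain rfl : j = j' := by omega
      have h1 : ε.1.1 ⟨j, j, hj⟩ (P.ract i l j h p a) = B.mul i l j h (ap ε i p) a :=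
        ap_ract ε i l j h p a
      change lmulX P j (ε.1.1 ⟨j, j, hj⟩ (P.ract i l j h p a)) =
        homComp (k := l) (l := i) (n := j) (by omega) (lmulX P i (ap ε i p)) (lmulX P l a)
      rw [h1, lmulX_mul P h (by omega)]⟩

lemma muX_apply {i : ℤ} (h : i + 0 = i) (p : P.X i) :
    (muX ε).1 ⟨i, i, h⟩ p = lmulX P i (ap ε i p) := rfl

lemma isCyc_muX : (hom P (homR P P)).IsCyc (muX ε) := by
  refine homX_ext fun i j hj p => ?_
  rw [homD_apply _ _ 0 (0 + 1) rfl _ i j j i hj (by omega) (add_zero i), sgn_zero, one_smul]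
  change homD (res P) (res P) i j (by omega) (lmulX P i (ap ε i p))
    - lmulX P j (ap ε j (P.d i j (by omega) p)) = 0
  rw [homD_lmulX, ← ap_d]
  exact sub_self _

lemma postR_mu {l : ℤ} (g : homX P P l) :
    homComp (zero_add l) (postR P g) (muX ε) = homComp (zero_add l) (preR P g) (muX ε) :=
  homX_ext fun i j hj p => by
    refine (homComp_apply _ _ _ i i j (add_zero i) hj p).trans
      (Eq.trans ?_ (homComp_apply _ _ _ i i j (add_zero i) hj p).symm)
    exact resX_lmulX hj (by omega) g (ap ε i p)

/-- The two multiplications `ε(p) q` and `p ε(q)` are homotopic. -/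
lemma mu_nu_isBd (hε : IsQuasiIso ε) (hP : (res P).IsKProjective) (hP' : P.IsKProjective) :
    (hom P (homR P P)).IsBd (muX ε - nuX ε P) := by
  have hc : (hom (homR P P) (homR P (diag B))).IsCyc (postR P ε.1) := by
    change homD (homR P P) (homR P (diag B)) 0 1 rfl (postR P ε.1) = 0
    rw [homD_postR, show homD P (diag B) 0 1 rfl ε.1 = 0 from ε.2]
    exact homX_ext fun i j hj ψ => homX_ext fun _ _ _ _ => rfl
  have hq : (toGMap ⟨postR P ε.1, hc⟩ : GMap (homR P P).toCpx (homR P (diag B)).toCpx 0).IsQI := by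
    have hε' : IsQuasiIso (⟨resX ε.1, isCyc_resX ε.2⟩ : (hom (res P) (res (diag B))).Z 0) := by
      have h := (isQuasiIso_iff ε).1 hε
      exact (isQuasiIso_iff _).2 ⟨h.surj, h.inj⟩
    have h := hP.postC_isQI_zero _ hε'
    exact ⟨h.surj, h.inj⟩
  refine (mk_eq_mk ⟨_, isCyc_muX⟩ ⟨_, isCyc_nuX ε⟩).1 (hP'.eq_of_comp_eq (add_zero 0) _ hq ?_)
  have e : homComp (add_zero 0) (postR P ε.1) (muX ε) = homComp (add_zero 0) (postR P ε.1) (nuX ε P) := by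
    refine homX_ext fun i j hj p => ?_
    obtain rfl : i = j := by omega
    rw [homComp_apply _ _ _ i i i (add_zero i), homComp_apply _ _ _ i i i (add_zero i), muX_apply,
      nuX_apply ε (add_zero i) (zero_add i), postR_apply, postR_apply,
      resX_lmulX (add_zero i) (zero_add i), zero_mul, sgn_zero, one_smul,
      homComp_assoc (kl := i) (lm := i) (n := i) (by omega) (by omega) (by omega) (by omega),
      comp_rmulX]
    rfl
  change (hom P (homR P (diag B))).IsBd (homComp (add_zero 0) (postR P ε.1) (muX ε)
    - homComp (add_zero 0) (postR P ε.1) (nuX ε P))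
  rw [e, sub_self]
  exact isBd_zero

lemma isCyc_postR {N' : DGBimod.{t, v, v} A B} {k : ℤ} {g : homX N N' k}
    (hg : (hom N N').IsCyc g) : (hom (homR P N) (homR P N')).IsCyc (postR P g) := by
  change homD (homR P N) (homR P N') k (k + 1) rfl (postR P g) = 0
  rw [homD_postR, show homD N N' k (k + 1) rfl g = 0 from hg]
  exact homX_ext fun i j hj ψ => homX_ext fun _ _ _ _ => rfl

lemma preR_zero {l : ℤ} : preR (P := P) N (0 : homX P P l) = 0 :=
  homX_ext fun i j hj (ψ : homX (res P) (res N) i) => by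
    rw [preR_apply (h' := by omega)]
    have e : resX (0 : homX P P l) = 0 := rfl
    rw [e, homComp_zero_right, smul_zero]
    rfl

lemma isCyc_preR {l : ℤ} {f : homX P P l} (hf : (hom P P).IsCyc f) :
    (hom (homR P N) (homR P N)).IsCyc (preR N f) := by
  change homD (homR P N) (homR P N) l (l + 1) rfl (preR N f) = 0
  rw [homD_preR, show homD P P l (l + 1) rfl f = 0 from hf, preR_zero]

lemma isBd_preR {l : ℤ} {f : homX P P l} (hf : (hom P P).IsBd f) :
    (hom (homR P N) (homR P N)).IsBd (preR N f) := by
  obtain ⟨y, rfl⟩ := hf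
  have := homD_preR (N := N) (sub_add_cancel l 1) y
  change (hom (homR P N) (homR P N)).IsBd (preR N (homD P P (l - 1) l (sub_add_cancel l 1) y))
  rw [← this]
  exact isBd_d (K := hom (homR P N) (homR P N)) (sub_add_cancel l 1) _

lemma preR_nu_isBd (hε : IsQuasiIso ε) (hP : (res P).IsKProjective) (hP' : P.IsKProjective)
    {m : ℤ} {x : homX P P m} (hx : (hom P P).IsCyc x) : (hom P (homR P P)).IsBd
      (homComp (zero_add m) (preR P x) (nuX ε P) - homComp (add_zero m) (nuX ε P) x) := by
  have hmn := mu_nu_isBd hε hP hP'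
  have h1 := homComp_isBd_right (zero_add m) (isCyc_preR (N := P) hx) hmn
  have h2 := homComp_isBd_right (zero_add m) (isCyc_postR (P := P) hx) hmn
  rw [homComp_sub_right] at h1 h2
  rw [postR_mu, postR_nu] at h2
  have h3 := h2.sub h1
  rwa [sub_sub_sub_cancel_left] at h3

lemma nuX_comp {N' N'' : DGBimod.{t, v, v} A B} {k l n : ℤ} (h : l + k = n) (x : homX N' N'' k)
    (y : homX N N' l) : homComp (add_zero n) (nuX ε N'') (homComp h x y)
      = homComp h (postR P x) (homComp (add_zero l) (nuX ε N') y) := by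
  rw [homComp_assoc (lm := k) (n := n) h (add_zero n) (add_zero k) h, ← postR_nu,
    ← homComp_assoc (kl := l) (lm := k) (n := n) (add_zero l) h (zero_add k) h]

lemma postR_preR_nu {N' : DGBimod.{t, v, v} A B} {k l n : ℤ} (h : k + l = n) (h' : l + k = n)
    (x : homX N N' k) (y : homX P P l) :
    homComp h' (postR P x) (homComp (zero_add l) (preR N y) (nuX ε N))
      = sgn (k * l) • homComp h (homComp (zero_add l) (preR N' y) (nuX ε N')) x := by
  rw [homComp_assoc (kl := l) (lm := n) (n := n) (zero_add l) h' h' (zero_add n), preR_postR h h',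
    homComp_smul_left, ← homComp_assoc (kl := k) (lm := n) (n := n) (zero_add k) h h (zero_add n),
    postR_nu, homComp_assoc (kl := k) (lm := l) (n := n) (add_zero k) h (zero_add l) h]

lemma nuX_comm_isBd (hε : IsQuasiIso ε) (hP : (res P).IsKProjective) (hP' : P.IsKProjective)
    {k l n : ℤ} (h : k + l = n) (h' : l + k = n) {z : homX P P k} {z' : homX P P l}
    (hz : (hom P P).IsCyc z) (hz' : (hom P P).IsCyc z') :
    (hom P (homR P P)).IsBd (homComp (add_zero n) (nuX ε P)
      (homComp h' z z' - sgn (k * l) • homComp h z' z)) := by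
  have star := preR_nu_isBd hε hP hP' hz'
  have h1 := homComp_isBd_right h' (isCyc_postR (P := P) hz) star
  have h2 := (homComp_isBd_left h star hz).smul (sgn (k * l))
  rw [homComp_sub_right, postR_preR_nu h h', ← nuX_comp h'] at h1
  rw [homComp_sub_left, ← homComp_assoc (lm := l) (n := n) h (add_zero n) (add_zero l) h,
    smul_sub] at h2
  rw [homComp_sub_right, homComp_smul_right]
  have h3 := h2.sub h1
  rwa [sub_sub_sub_cancel_left] at h3

/-- The bimodule endomorphisms of a resolution of the diagonal commute up to homotopy. -/
theorem gradedComm (hε : IsQuasiIso ε) (hP : (res P).IsKProjective) (hP' : P.IsKProjective)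
    {k l n : ℤ} (h : k + l = n) (h' : l + k = n) {z : homX P P k} {z' : homX P P l}
    (hz : (hom P P).IsCyc z) (hz' : (hom P P).IsCyc z') :
    (hom P P).IsBd (homComp h' z z' - sgn (k * l) • homComp h z' z) :=
  (hP'.postC_isQI (nu ε P) (nu_isQI hε hP)).inj n n (add_zero n) _
    ((homComp_isCyc _ hz hz').sub ((homComp_isCyc _ hz' hz).smul _))
    (nuX_comm_isBd hε hP hP' h h' hz hz')

end DGBimod

end HodgeCY

namespace HodgeCY

open Cpx DGBimod DGAlg

variable {C : DGAlg.{u}} {R : C.Resolution} {F : DGBimod.{0, u, u} base C}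

/-! ### The natural transformations given by Hochschild classes -/

/-- The morphism of right modules obtained by fixing the first variable of a balanced map. -/
noncomputable def balancedRight {P : DGBimod.{u, u, u} C C} {k : ℤ}
    (s : ∀ i j l : ℤ, i + j + k = l → F.X i →ₗ[ℂ] P.X j →ₗ[ℂ] F.X l)
    (hs : ∀ (i j c jc l l' : ℤ) (h₁ : j + c = jc) (h : i + j + k = l) (h' : l + c = l')
      (x : F.X i) (p : P.X j) (a : C.X c),
      s i jc l' (by omega) x (P.ract j c jc h₁ p a) = F.ract l c l' h' (s i j l h x p) a)
    (i j : ℤ) (h : i + k = j) : F.X i →ₗ[ℂ] homX (res P) (res F) j where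
  toFun x := ofRight (fun t => s i t.p t.q (by have := t.hpq; omega) x)
    fun p c q p' q' h₁ hp hq m b => hs i p c q p' q' h₁ (by omega) (by omega) x m b
  map_add' x x' := homX_ext fun p q hq m =>
    LinearMap.congr_fun (map_add (s i p q (by omega)) x x') m
  map_smul' c x := homX_ext fun p q hq m =>
    LinearMap.congr_fun (map_smul (s i p q (by omega)) c x) m

/-- A balanced bilinear map, as a morphism to the bimodule of morphisms. -/
noncomputable def balancedX {P : DGBimod.{u, u, u} C C} {k : ℤ}
    (s : ∀ i j l : ℤ, i + j + k = l → F.X i →ₗ[ℂ] P.X j →ₗ[ℂ] F.X l)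
    (hb : ∀ (i c j ic cj l : ℤ) (h₁ : i + c = ic) (h₂ : c + j = cj) (h : i + c + j + k = l)
      (x : F.X i) (a : C.X c) (p : P.X j),
      s ic j l (by omega) (F.ract i c ic h₁ x a) p = s i cj l (by omega) x (P.lact c j cj h₂ a p))
    (hs : ∀ (i j c jc l l' : ℤ) (h₁ : j + c = jc) (h : i + j + k = l) (h' : l + c = l')
      (x : F.X i) (p : P.X j) (a : C.X c),
      s i jc l' (by omega) x (P.ract j c jc h₁ p a) = F.ract l c l' h' (s i j l h x p) a) :
    homX F (homR P F) k :=
  ofRight (N := homR P F) (fun t => balancedRight s hs t.p t.q t.hpq)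
    fun i l j i' j' h hi hj x a => homX_ext fun (p q : ℤ) (hq : p + j' = q) (m : P.X p) => by
      change s j p q (by omega) (F.ract i l j h x a) m
        = (homComp (k := l) (l := i') (n := j') (by omega) (balancedRight s hs i i' hi x)
          (lmulX P l a)).1 ⟨p, q, hq⟩ m
      rw [homComp_apply _ _ _ p (p + l) q rfl]
      exact hb i l p j (p + l) q h (by omega) (by omega) x a m

lemma nuX_val {P : DGBimod.{u, u, u} C C} (ε : (hom P (diag C)).Z 0) {i p q : ℤ} (h : p + i = q)
    (x : F.X i) (m : P.X p) :
    (homComp (zero_add i) (rmulX F i x) (resX ε.1)).1 ⟨p, q, h⟩ m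
      = F.ract i p q (by omega) x (ap ε p m) := by
  rw [homComp_apply _ _ _ p p q (add_zero p)]
  rfl

theorem ActsAs.exists_isBd {k : ℤ} {ζ : HHcoh R k} {g : GHom F F k} (H : ActsAs R F ζ g) :
    ∃ (z : (hom R.P R.P).Z k) (γ : (hom F F).Z k), Submodule.Quotient.mk z = ζ ∧
      Submodule.Quotient.mk γ = g ∧ (hom F (homR R.P F)).IsBd
        (homComp (add_zero k) (nuX R.ε F) γ.1 - homComp (zero_add k) (preR F z.1) (nuX R.ε F)) := by
  obtain ⟨z, γ, s, hz, hγ, hb, hs, h⟩ := H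
  refine ⟨z, γ, hz, hγ, ?_⟩
  have key : homD F (homR R.P F) (k - 1) k (by omega) (balancedX s hb hs)
      = homComp (add_zero k) (nuX R.ε F) γ.1 - homComp (zero_add k) (preR F z.1) (nuX R.ε F) := by
    refine homX_ext fun i j hj x => homX_ext fun (p q : ℤ) (hq : p + j = q) (m : R.P.X p) => ?_
    rw [homD_apply _ _ (k - 1) k _ _ i j (i + 1) (j - 1) hj rfl (by omega)]
    change (homD (res R.P) (res F) (j - 1) j (by omega) (balancedRight s hs i (j - 1) (by omega) x)
        - sgn (k - 1) • balancedRight s hs (i + 1) j (by omega) (F.d i (i + 1) rfl x)).1 ⟨p, q, hq⟩ m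
      = ((homComp (add_zero k) (nuX R.ε F) γ.1).1 ⟨i, j, hj⟩ x
        - (homComp (zero_add k) (preR F z.1) (nuX R.ε F)).1 ⟨i, j, hj⟩ x).1 ⟨p, q, hq⟩ m
    rw [homComp_apply _ _ _ i j j hj, homComp_apply _ _ _ i i j (add_zero i),
      nuX_apply R.ε (add_zero i) (zero_add i), nuX_apply R.ε (add_zero j) (zero_add j),
      preR_apply (h' := by omega)]
    change (homD (res R.P) (res F) (j - 1) j (by omega) (balancedRight s hs i (j - 1) (by omega) x)).1
          ⟨p, q, hq⟩ m - sgn (k - 1) • s (i + 1) p q (by omega) (F.d i (i + 1) rfl x) m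
      = (homComp (zero_add j) (rmulX F j (γ.1.1 ⟨i, j, hj⟩ x)) (resX R.ε.1)).1 ⟨p, q, hq⟩ m
        - sgn (k * i) • (homComp (k := k) (l := i) (n := j) (by omega)
          (homComp (zero_add i) (rmulX F i x) (resX R.ε.1)) (resX z.1)).1 ⟨p, q, hq⟩ m
    rw [homComp_apply (k := k) (l := i) _ _ _ p (p + k) q rfl, nuX_val R.ε, nuX_val R.ε, resX_apply]
    rw [homD_apply _ _ (j - 1) j _ _ p q (p + 1) (q - 1) hq rfl (by omega)]
    change F.d (q - 1) q _ (s i p (q - 1) _ x m)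
        - sgn (j - 1) • s i (p + 1) q _ x (R.P.d p (p + 1) rfl m) - _ = _
    have h1 := h i p (i + p) q (p + k) rfl rfl (by omega) x m
    have h2 : γ.1.1 ⟨i + p, q, by omega⟩ (F.ract i p (i + p) rfl x (ap R.ε p m))
        = F.ract j p q (by omega) (γ.1.1 ⟨i, j, hj⟩ x) (ap R.ε p m) :=
      γ.1.2.2 i p (i + p) j q rfl hj (by omega) x (ap R.ε p m)
    rw [h2] at h1
    rw [h1, show sgn (j - 1) = -(sgn i * sgn k) by
        rw [sub_eq_add_neg, ← hj, sgn_add, sgn_add, sgn_neg, sgn_one]; ring,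
      show sgn (k - 1) = - sgn k by rw [sub_eq_add_neg, sgn_add, sgn_neg, sgn_one]; ring]
    module
  rw [← key]
  exact isBd_d (K := hom F (homR R.P F)) (by omega) _

variable (R F)

variable {R F} in
lemma preR_add {k : ℤ} (f f' : homX R.P R.P k) : preR F (f + f') = preR F f + preR F f' :=
  homX_ext fun i j hj (ψ : homX (res R.P) (res F) i) => by
    change _ = (preR F f).1 ⟨i, j, hj⟩ ψ + (preR F f').1 ⟨i, j, hj⟩ ψ
    rw [preR_apply (h' := by omega), preR_apply (h' := by omega), preR_apply (h' := by omega),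
      ← smul_add, ← homComp_add_right]
    rfl

variable {R F} in
lemma preR_smul {k : ℤ} (c : ℂ) (f : homX R.P R.P k) : preR F (c • f) = c • preR F f :=
  homX_ext fun i j hj (ψ : homX (res R.P) (res F) i) => by
    change _ = c • (preR F f).1 ⟨i, j, hj⟩ ψ
    rw [preR_apply (h' := by omega), preR_apply (h' := by omega),
      show resX (c • f) = c • resX f from rfl, homComp_smul_right]
    exact smul_comm _ _ _

/-- The cocycles `F → Hom(P, F)` defined by Hochschild cocycles. -/
noncomputable def hochZ (k : ℤ) : (hom R.P R.P).Z k →ₗ[ℂ] (hom F (homR R.P F)).Z k where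
  toFun z := ⟨homComp (zero_add k) (preR F z.1) (nuX R.ε F),
    homComp_isCyc _ (isCyc_preR z.2) (isCyc_nuX R.ε)⟩
  map_add' z z' := Subtype.ext (by
    change homComp (zero_add k) (preR F (z.1 + z'.1)) (nuX R.ε F) = homComp (zero_add k) (preR F z.1)
      (nuX R.ε F) + homComp (zero_add k) (preR F z'.1) (nuX R.ε F)
    rw [← homComp_add_left, preR_add])
  map_smul' c z := Subtype.ext (by
    change homComp (zero_add k) (preR F (c • z.1)) (nuX R.ε F)
      = c • homComp (zero_add k) (preR F z.1) (nuX R.ε F)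
    rw [← homComp_smul_left, preR_smul])

/-- The classes `F → Hom(P, F)` defined by Hochschild classes. -/
noncomputable def hochMap (k : ℤ) : HHcoh R k →ₗ[ℂ] GHom F (homR R.P F) k :=
  Submodule.mapQ _ _ (hochZ R F k) (by
    intro z hz
    have h : (hom R.P R.P).IsBd z.1 := hz
    exact homComp_isBd_left (zero_add k) (isBd_preR h) (isCyc_nuX R.ε))

variable {R F}

/-- Composition with a quasi-isomorphism, as an isomorphism of spaces of morphisms. -/
noncomputable def DGBimod.IsKProjective.compEquiv {A : DGAlg.{u}} {B : DGAlg.{v}}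
    {P M N : DGBimod.{u, v, w} A B} (hP : P.IsKProjective) (f : (hom M N).Z 0)
    (hf : (toGMap f).IsQI) (k : ℤ) : GHom P M k ≃ₗ[ℂ] GHom P N k :=
  LinearEquiv.ofBijective _ (hP.comp_bijective f hf k k (add_zero k))

lemma DGBimod.IsKProjective.compEquiv_symm_mk {A : DGAlg.{u}} {B : DGAlg.{v}}
    {P M N : DGBimod.{u, v, w} A B} (hP : P.IsKProjective) (f : (hom M N).Z 0)
    (hf : (toGMap f).IsQI) {k : ℤ} (γ : (hom P M).Z k) (y : (hom P N).Z k)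
    (h : (hom P N).IsBd (homComp (add_zero k) f.1 γ.1 - y.1)) :
    (hP.compEquiv f hf k).symm (Submodule.Quotient.mk y) = Submodule.Quotient.mk γ :=
  (LinearEquiv.symm_apply_eq _).2 ((mk_eq_mk (compZ (add_zero k) f γ) y).2 h).symm

/-- The evaluation at `F` of the natural transformations given by Hochschild classes. -/
noncomputable def hochEval (R : C.Resolution) (hs : C.IsSmooth) (hF : F.IsPerfect) (k : ℤ) :
    HHcoh R k →ₗ[ℂ] GHom F F k :=
  (hF.isKProjective.compEquiv (nu R.ε F)
    (nu_isQI R.quasiIso (R.isPerfect hs).res_isKProjective) k).symm.toLinearMap ∘ₗ hochMap R F k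

lemma hochEval_mk (hs : C.IsSmooth) (hF : F.IsPerfect) {k : ℤ} (z : (hom R.P R.P).Z k)
    (γ : (hom F F).Z k) (h : (hom F (homR R.P F)).IsBd
      (homComp (add_zero k) (nuX R.ε F) γ.1 - homComp (zero_add k) (preR F z.1) (nuX R.ε F))) :
    hochEval R hs hF k (Submodule.Quotient.mk z) = Submodule.Quotient.mk γ :=
  hF.isKProjective.compEquiv_symm_mk (nu R.ε F)
    (nu_isQI R.quasiIso (R.isPerfect hs).res_isKProjective) γ (hochZ R F k z) h

lemma preR_id : preR F (homId R.P) = homId (homR R.P F) :=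
  homX_ext fun i j hj (ψ : homX (res R.P) (res F) i) => by
    obtain rfl : i = j := by omega
    rw [preR_apply (h' := by omega), zero_mul, sgn_zero, one_smul]
    exact homComp_id (by omega) ψ

lemma hochEval_id (hs : C.IsSmooth) (hF : F.IsPerfect) :
    hochEval R hs hF 0 (idE R.P) = idE F := by
  refine hochEval_mk hs hF _ _ ?_
  change (hom F (homR R.P F)).IsBd (homComp (add_zero 0) (nuX R.ε F) (homId F)
    - homComp (zero_add 0) (preR F (homId R.P)) (nuX R.ε F))
  rw [preR_id, id_homComp, homComp_id, sub_self]
  exact isBd_zero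

theorem ActsAs.eq_hochEval (hs : C.IsSmooth) (hF : F.IsPerfect) {k : ℤ} {ζ : HHcoh R k}
    {g : GHom F F k} (H : ActsAs R F ζ g) : g = hochEval R hs hF k ζ := by
  obtain ⟨z, γ, rfl, rfl, hb⟩ := H.exists_isBd
  exact (hochEval_mk hs hF z γ hb).symm

end HodgeCY

namespace HodgeCY

open Cpx DGBimod DGAlg

/-! ### Alternating forms -/

lemma even_finrank_of_isAlt {V : Type u} [AddCommGroup V] [Module ℂ V] [FiniteDimensional ℂ V]
    (b : V →ₗ[ℂ] V →ₗ[ℂ] ℂ) (hb : b.Nondegenerate) (ha : b.IsAlt) :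
    Even (Module.finrank ℂ V) := by
  let e := Module.finBasis ℂ V
  have hdet : (LinearMap.toMatrix₂ e e b).det ≠ 0 :=
    (LinearMap.separatingLeft_iff_det_ne_zero e).1 hb.1
  have hT : (LinearMap.toMatrix₂ e e b).transpose = -LinearMap.toMatrix₂ e e b := by
    ext i j
    rw [Matrix.transpose_apply, Matrix.neg_apply, LinearMap.toMatrix₂_apply,
      LinearMap.toMatrix₂_apply, ha.neg]
  have h := congrArg Matrix.det hT
  rw [Matrix.det_transpose, Matrix.det_neg, Fintype.card_fin] at h
  by_contra hodd
  rw [(Nat.not_even_iff_odd.1 hodd).neg_one_pow] at h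
  exact hdet (by linear_combination h / 2)

lemma Cpx.IsBd.of_sub_smul {K : Cpx.{u}} {i : ℤ} {x : K.X i} {c : ℂ} (h : K.IsBd (x - c • x))
    (hc : c ≠ 1) : K.IsBd x := by
  have h1 := h.smul (1 - c)⁻¹
  rwa [show x - c • x = (1 - c) • x by module, smul_smul,
    inv_mul_cancel₀ (sub_ne_zero.2 hc.symm), one_smul] at h1

lemma tracePairing_isAlt {C : DGAlg.{u}} (R : C.Resolution) (hs : C.IsSmooth) {k n : ℤ}
    (hk : Odd k) (h : k + k = n) (tr : HHcoh R n →ₗ[ℂ] ℂ) : (tracePairing R h tr).IsAlt := by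
  intro x
  obtain ⟨z, rfl⟩ := Submodule.Quotient.mk_surjective _ x
  have h1 := gradedComm R.quasiIso (R.isPerfect hs).res_isKProjective R.kproj h h z.2 z.2
  have h2 : sgn (k * k) = -1 := (hk.mul hk).neg_one_zpow
  have h3 := h1.of_sub_smul (by rw [h2]; norm_num)
  have h4 : comp h (Submodule.Quotient.mk z : HHcoh R k) (Submodule.Quotient.mk z : HHcoh R k)
      = (0 : HHcoh R n) := (mk_eq_zero (compZ h z z)).2 h3
  change tr (comp h (Submodule.Quotient.mk z : HHcoh R k) (Submodule.Quotient.mk z : HHcoh R k)) = 0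
  rw [h4, map_zero]

/-! ### Rank functions and unit properties -/

lemma subsingleton_GHom_of_idE {A : DGAlg.{u}} {B : DGAlg.{v}} {M N : DGBimod.{u, v, w} A B}
    (h : idE M = 0) (k : ℤ) : Subsingleton (GHom M N k) :=
  subsingleton_of_forall_eq 0 fun f => by
    rw [← comp_id (zero_add k) f, h, map_zero]

variable {C : DGAlg.{u}}

lemma IsRankFunction.eq_zero {rk : Perf C → ℤ} (hrk : IsRankFunction rk) (F : Perf C)
    (hF : idE F.1 = 0) : rk F = 0 := by
  let f : (hom F.1 F.1).Z 0 := ⟨homId F.1, homD_id F.1⟩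
  have hq : IsQuasiIso f := by
    refine (isQuasiIso_iff f).2 ⟨fun i j h y hy => ⟨?_, ?_, ?_⟩, fun i j h x hx hb => ?_⟩
    all_goals obtain rfl : i = j := by omega
    · exact y
    · exact hy
    · change F.1.IsBd (y - y)
      rw [sub_self]
      exact isBd_zero
    · exact hb
  have hc : Subsingleton (GHom (cone f) (cone f) 0) :=
    (F.2.cone f F.2).isKProjective _ ((cone_isAcyclic_iff f).2 hq) 0
  have := hrk.additive F F F f ⟨0, 0, by rw [map_zero, hF], Subsingleton.elim _ _⟩
  omega

section Unit

variable {R : C.Resolution} {rk : Perf C → ℤ} {T : GrAlg.{v}}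

/-- The structure map at an object of non-zero rank is injective and its values are evaluations
of Hochschild classes. -/
lemma HasUnitProperty.exists_embedding (hT : HasUnitProperty R rk T) (hs : C.IsSmooth)
    (F : Perf C) (hF : rk F ≠ 0) : ∃ i : GrAlgHom T (endAlg F.1),
      (∀ k, Function.Injective (i.app k)) ∧
      ∀ k a, ∃ ζ : HHcoh R k, i.app k a = hochEval R hs F.2 k ζ := by
  obtain ⟨i, -, hi, ht⟩ := hT
  obtain ⟨t, ht⟩ := ht F
  refine ⟨i F, fun k => (injective_iff_map_eq_zero _).2 fun a ha => ?_, fun k a => ?_⟩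
  · have h := ht k a
    rw [ha, map_zero] at h
    have h' : ((rk F : ℤ) : ℂ) • a = 0 := by rw [Int.cast_smul_eq_zsmul, ← h]
    exact (smul_eq_zero.1 h').resolve_left (Int.cast_ne_zero.2 hF)
  · obtain ⟨ζ, hζ⟩ := hi k a
    exact ⟨ζ, (hζ F).eq_hochEval hs F.2⟩

lemma HasUnitProperty.finite_finrank_le (hT : HasUnitProperty R rk T) (hs : C.IsSmooth)
    {F : Perf C} (hF : rk F ≠ 0) (k : ℤ) [FiniteDimensional ℂ (HHcoh R k)] :
    FiniteDimensional ℂ (T.X k) ∧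
      Module.finrank ℂ (T.X k) ≤ Module.finrank ℂ (HHcoh R k) := by
  obtain ⟨i, hi, hr⟩ := hT.exists_embedding hs F hF
  let Ψ := hochEval R hs F.2 k
  have hmem : ∀ a, i.app k a ∈ LinearMap.range Ψ := fun a => by
    obtain ⟨ζ, hζ⟩ := hr k a
    exact ⟨ζ, hζ.symm⟩
  have hinj : Function.Injective ((i.app k).codRestrict (LinearMap.range Ψ) hmem) :=
    fun a b h => hi k (congrArg Subtype.val h)
  refine ⟨FiniteDimensional.of_injective _ hinj, ?_⟩
  exact (LinearMap.finrank_le_finrank_of_injective hinj).trans (LinearMap.finrank_range_le Ψ)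

lemma HasUnitProperty.one_ne_zero (hT : HasUnitProperty R rk T) (hs : C.IsSmooth)
    (hrk : IsRankFunction rk) {F : Perf C} (hF : rk F ≠ 0) : T.one ≠ 0 := by
  obtain ⟨i, -, -⟩ := hT.exists_embedding hs F hF
  intro h
  have h1 := i.map_one
  rw [h, map_zero] at h1
  exact hF (hrk.eq_zero F h1.symm)

lemma HasUnitProperty.eq_smul_one (hT : HasUnitProperty R rk T) (hs : C.IsSmooth)
    {F : Perf C} (hF : rk F ≠ 0) (hR : Module.finrank ℂ (HHcoh R 0) = 1) (a : T.X 0) :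
    ∃ c : ℂ, a = c • T.one := by
  obtain ⟨i, hi, hr⟩ := hT.exists_embedding hs F hF
  obtain ⟨ζ, hζ⟩ := hr 0 a
  have hid : idE R.P ≠ 0 := fun h => by
    have := subsingleton_GHom_of_idE (N := R.P) h 0
    have h0 : Module.finrank ℂ (HHcoh R 0) = 0 := Module.finrank_zero_of_subsingleton
    omega
  obtain ⟨c, hc⟩ := (finrank_eq_one_iff_of_nonzero' (idE R.P) hid).1 hR ζ
  refine ⟨c, hi 0 ?_⟩
  rw [hζ, ← hc, map_smul, hochEval_id, map_smul, i.map_one]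

lemma HasUnitProperty.finrank_zero (hT : HasUnitProperty R rk T) (hs : C.IsSmooth)
    (hrk : IsRankFunction rk) {F : Perf C} (hF : rk F ≠ 0)
    (hR : Module.finrank ℂ (HHcoh R 0) = 1) : Module.finrank ℂ (T.X 0) = 1 :=
  (finrank_eq_one_iff_of_nonzero' T.one (hT.one_ne_zero hs hrk hF)).2 fun a => by
    obtain ⟨c, hc⟩ := hT.eq_smul_one hs hF hR a
    exact ⟨c, hc.symm⟩

end Unit

/-- A graded algebra that is isomorphic, as a ring, to one with scalars in degree `0`. -/
lemma GrRingIso.finrank_zero {S : GrAlg.{u}} {T : GrAlg.{v}} (h : GrRingIso S T)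
    [FiniteDimensional ℂ (S.X 0)] (h1 : T.one ≠ 0) (hT : ∀ a : T.X 0, ∃ c : ℂ, a = c • T.one) :
    Module.finrank ℂ (S.X 0) = 1 := by
  obtain ⟨e, he, hm⟩ := h
  have hS : S.one ≠ 0 := fun h0 => h1 (by rw [← he, h0, map_zero])
  have : Nontrivial (S.X 0) := ⟨⟨_, _, hS⟩⟩
  refine (finrank_eq_one_iff_of_nonzero' S.one hS).2 fun x => ?_
  obtain ⟨μ, hμ⟩ := Module.End.exists_eigenvalue (S.mul 0 0 0 (add_zero 0) x : S.X 0 →ₗ[ℂ] S.X 0)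
  obtain ⟨y, hy⟩ := hμ.exists_hasEigenvector
  refine ⟨μ, ?_⟩
  have h0 : S.mul 0 0 0 (add_zero 0) (x - μ • S.one) y = 0 := by
    rw [map_sub, map_smul, LinearMap.sub_apply, LinearMap.smul_apply, S.one_mul,
      hy.apply_eq_smul, sub_self]
  obtain ⟨a, ha⟩ := hT (e 0 (x - μ • S.one))
  obtain ⟨b, hb⟩ := hT (e 0 y)
  have h2 := hm 0 0 0 (add_zero 0) (x - μ • S.one) y
  rw [h0, map_zero, ha, hb, map_smul, map_smul, LinearMap.smul_apply, T.one_mul, smul_smul] at h2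
  rcases mul_eq_zero.1 ((smul_eq_zero.1 h2.symm).resolve_right h1) with hz | hz
  · rw [hz, zero_smul, ← map_zero (e 0)] at hb
    exact absurd ((e 0).injective hb) hy.2
  · rw [hz, zero_smul, ← map_zero (e 0)] at ha
    exact (sub_eq_zero.1 ((e 0).injective ha)).symm

lemma GrRingIso.finrank_one {S : GrAlg.{u}} {T : GrAlg.{v}} (h : GrRingIso S T)
    (hT : ∀ a : T.X 0, ∃ c : ℂ, a = c • T.one) {k : ℤ} (hS : Module.finrank ℂ (S.X k) = 1) :
    Module.finrank ℂ (T.X k) = 1 := by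
  obtain ⟨e, he, hm⟩ := h
  obtain ⟨w, hw, hspan⟩ := finrank_eq_one_iff'.1 hS
  have hw' : e k w ≠ 0 := fun h0 => hw ((e k).injective (h0.trans (map_zero _).symm))
  refine (finrank_eq_one_iff_of_nonzero' (e k w) hw').2 fun x => ?_
  obtain ⟨c, hc⟩ := hspan ((e k).symm x)
  obtain ⟨a, ha⟩ := hT (e 0 (c • S.one))
  refine ⟨a, ?_⟩
  have h2 := hm 0 k k (zero_add k) (c • S.one) w
  rw [map_smul, LinearMap.smul_apply, S.one_mul, hc, AddEquiv.apply_symm_apply, ha, map_smul,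
    LinearMap.smul_apply, T.one_mul] at h2
  exact h2.symm

end HodgeCY

theorem mainTheorem5 (C : DGAlg.{u}) (hsmooth : C.IsSmooth) (hproper : C.IsProper)
    (hCY : C.IsCalabiYau 3) (R : C.Resolution) (hconn : Nonempty (DGAlg.HHhom R (-3) ≃ₗ[ℂ] ℂ))
    (rk : Perf C → ℤ) (hrk : IsRankFunction rk) (hrk0 : ∃ F, rk F ≠ 0)
    (T : GrAlg.{v}) (hT : IsHomologicalUnit R rk T)
    (hunit : ∃ F : Perf C, GrRingIso (endAlg F.1) T) :
    (∀ k, FiniteDimensional ℂ (T.X k)) ∧ (∀ j, FiniteDimensional ℂ (DGAlg.HHhom R j)) ∧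
    (∀ p q : ℕ, p ≤ 3 → q ≤ 3 → (p, q) ≠ (2, 1) → (p, q) ≠ (1, 2) →
      ∃ n : ℕ, hodgeNumber R T p q = n) ∧
    hodgeNumber R T 0 0 = 1 ∧ hodgeNumber R T 3 0 = 1 ∧
    Even (Module.finrank ℂ (DGAlg.HHhom R 0)) ∧
    (∀ k, FiniteDimensional ℂ (DGAlg.HHcoh R k)) ∧
    ∃ tr : DGAlg.HHcoh R 6 →ₗ[ℂ] ℂ,
      (∀ (k l : ℤ) (h : k + l = 6), (tracePairing R h tr).Nondegenerate) ∧
      (tracePairing R (show (3 : ℤ) + 3 = 6 by norm_num) tr).IsAlt := by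
  have hcoh : ∀ k, FiniteDimensional ℂ (DGAlg.HHcoh R k) := R.finite_HHcoh hsmooth hproper hCY
  obtain ⟨F₀, hF₀⟩ := hrk0
  obtain ⟨e₃⟩ := hconn
  have hHH0 : Module.finrank ℂ (DGAlg.HHcoh R 0) = 1 := by
    rw [R.finrank_HHcoh_symm hsmooth hproper hCY 0 6 (by norm_num),
      ← R.finrank_HHhom hCY (-3) 6 (by norm_num), e₃.finrank_eq, Module.finrank_self]
  have hone := hT.1.one_ne_zero hsmooth hrk hF₀
  have hscal := hT.1.eq_smul_one hsmooth hF₀ hHH0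
  have hT0 : Module.finrank ℂ (T.X 0) = 1 := hT.1.finrank_zero hsmooth hrk hF₀ hHH0
  have hT3 : Module.finrank ℂ (T.X 3) = 1 := by
    obtain ⟨F, hF⟩ := hunit
    obtain ⟨D⟩ := R.exists_traceData hCY
    have hfin : FiniteDimensional ℂ ((endAlg F.1).X 0) := finite_GHom_base hproper D F.2 F.2 0
    have h0 : Module.finrank ℂ (DGBimod.GHom F.1 F.1 0) = 1 := hF.finrank_zero hone hscal
    have h3 : Module.finrank ℂ ((endAlg F.1).X 3) = 1 :=
      (finrank_GHom_base hproper D F.2 F.2 0 3 (zero_add 3)).symm.trans h0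
    exact hF.finrank_one hscal h3
  obtain ⟨tr, htr⟩ : ∃ tr : DGAlg.HHcoh R 6 →ₗ[ℂ] ℂ,
      ∀ (k l : ℤ) (h : k + l = 6), (tracePairing R h tr).Nondegenerate :=
    R.exists_nondegenerate hsmooth hproper hCY
  have halt := tracePairing_isAlt R hsmooth (k := 3) (by decide)
    (show (3 : ℤ) + 3 = 6 by norm_num) tr
  have h00 : Module.finrank ℂ (DGAlg.HHhom R 0) = Module.finrank ℂ (DGAlg.HHcoh R 3) :=
    R.finrank_HHhom hCY 0 3 (by norm_num)
  have heven : Even (Module.finrank ℂ (DGAlg.HHhom R 0)) := by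
    rw [h00]
    exact even_finrank_of_isAlt _ (htr 3 3 (by norm_num)) halt
  have h31 : ∃ n : ℕ, (Module.finrank ℂ (DGAlg.HHhom R (-2)) - Module.finrank ℂ (T.X 1) : ℚ) = n := by
    have h1 := (hT.1.finite_finrank_le hsmooth hF₀ 1).2
    rw [← R.finrank_HHcoh_symm hsmooth hproper hCY 5 1 (by norm_num),
      ← R.finrank_HHhom hCY (-2) 5 (by norm_num)] at h1
    exact ⟨_, (Nat.cast_sub h1).symm⟩
  have h11 : ∃ n : ℕ, ((Module.finrank ℂ (DGAlg.HHhom R 0) - Module.finrank ℂ (T.X 3)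
      - Module.finrank ℂ (T.X 3)) / 2 : ℚ) = n := by
    have h1 := (hT.1.finite_finrank_le hsmooth hF₀ 3).2
    rw [← h00] at h1
    obtain ⟨m, hm⟩ := heven
    refine ⟨m - 1, ?_⟩
    rw [Nat.cast_sub (by omega), hm, hT3]
    push_cast
    ring
  refine ⟨fun k => (hT.1.finite_finrank_le hsmooth hF₀ k).1, R.finite_HHhom hsmooth hproper hCY,
    fun p q hp hq hpq hpq' => ?_, by simp [hodgeNumber, hT3], by simp [hodgeNumber, hT0], heven,
    hcoh, tr, htr, halt⟩
  interval_cases p <;> interval_cases q <;>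
    first
      | exact ⟨_, rfl⟩
      | exact h31
      | exact h11
      | exact absurd rfl hpq
      | exact absurd rfl hpq'
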